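/- Let $X$ be a smooth scheme of pure dimension $n$ over $\mathbb C$ (for instance a smooth irreducible projective variety) and let $\mathfrak E=(E,\phi)$ be a Higgs bundle of rank $r$ on $X$: $E$ is locally free of rank $r$ and $\phi\colon E\to E\otimes\Omega^1_X$ is $\mathcal O_X$-linear with $\phi\wedge\phi=0$. Let $\rho_1\colon \mathrm{HGrass}_1(\mathfrak E)\to X$ be the scheme representing the functor that sends $y\colon Y\to X$ to the set of rank one Higgs subbundles of $y^*\mathfrak E$ (rank one locally free $M\subset y^*E$ with locally free quotient such that $(y^*\phi)(M)\subset M\otimes y^*\Omega^1_X$), and let $S_1\subset\rho_1^*E$ be the universal Higgs subbundle. Let $T$ be the total space of $\Omega^1_X$, and let $p\colon S_{\mathfrak E}\to X$ be the spectral cover, i.e. the closed subscheme of $T$ given by the equation $\lambda^r+a_1\lambda^{r-1}+\dots+a_r=0$ in the pullback of $\operatorname{Sym}^r\Omega^1_X$, where $\lambda$ is the tautological section of the pullback of $\Omega^1_X$ and $a_i\in H^0(X,\operatorname{Sym}^i\Omega^1_X)$ are the coefficients of the characteristic polynomial of $\phi$. Then $\mathrm{HGrass}_1(\mathfrak E)$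 and $S_{\mathfrak E}$ exist, and there is a surjective morphism $g\colon \mathrm{HGrass}_1(\mathfrak E)\to S_{\mathfrak E}$ over $X$ which sends an eigenline to its eigenvalue, in the scheme-theoretic sense that $\rho_1^*\phi$ acts on $S_1$ as multiplication by the section $g^*\lambda$ of $\rho_1^*\Omega^1_X$. Suppose moreover that $n\ge 1$, and let $W\subset S_{\mathfrak E}$ be any open subscheme that is smooth over $\mathbb C$ (for instance the smooth locus of $S_{\mathfrak E}$, or all of $S_{\mathfrak E}$ when $X$ is a curve with smooth spectral curve). Then the kernel $L$ of $\Psi=\mathrm{id}\otimes\lambda-p^*\phi\colon p^*E|_W\to p^*(E\otimes\Omega^1_X)|_W$ is a line bundle and a subbundle of $p^*E|_W$, and there is a morphism $f\colon W\to \mathrm{HGrass}_1(\mathfrak E)$ with $\rho_1\circ f=p|_W$, with $f^*S_1=L$ as subbundles of $p^*E|_W$ (so that $\phi$ acts on it as $\lambda$), and such that $g\circ f$ is the inclusion $W\hookrightarrow S_{\mathfrak E}$; in particular $g\circ f=\mathrm{id}_{S_{\mathfrak E}}$ if $S_{\mathfrak E}$ is smooth. -/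

import Mathlib

open AlgebraicGeometry CategoryTheory TensorProduct

noncomputable section

namespace Higgs

/-- The base scheme `Spec ℂ`. -/
abbrev SpecC : Scheme.{0} := Spec (.of ℂ)

/-- The sections of the structure sheaf of a complex scheme form a `ℂ`-algebra. -/
instance sectionsAlgebra (X : Scheme.{0}) [X.Over SpecC] (U : X.Opens) : Algebra ℂ Γ(X, U) :=
  ((Scheme.ΓSpecIso (.of ℂ)).inv ≫ (X ↘ SpecC).appTop ≫
    X.presheaf.map (homOfLE le_top).op).hom.toAlgebra

section Restriction

variable {X : Scheme.{0}} {U V : X.Opens}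

/-- Restriction of functions. -/
abbrev resRing (h : V ≤ U) : Γ(X, U) →+* Γ(X, V) :=
  (X.presheaf.map (homOfLE h).op).hom

/-- Restriction of sections of a sheaf of modules. -/
def resMod (E : X.Modules) (h : V ≤ U) : Γ(E, U) →ₛₗ[resRing h] Γ(E, V) where
  toFun s := E.presheaf.map (homOfLE h).op s
  map_add' s t := map_add _ s t
  map_smul' a s := Scheme.Modules.map_smul E (homOfLE h) a s

lemma resRing_algebraMap [X.Over SpecC] (h : V ≤ U) (c : ℂ) :
    resRing h (algebraMap ℂ Γ(X, U) c) = algebraMap ℂ Γ(X, V) c := by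
  change (X.presheaf.map (homOfLE h).op) ((X.presheaf.map (homOfLE le_top).op) _) = _
  rw [← CategoryTheory.comp_apply, ← Functor.map_comp]
  rfl

/-- Restriction of differential `1`-forms from `U` to `V`; on affine opens `Ω[Γ(X, U)⁄ℂ]` is the
module of sections of the cotangent sheaf. It is the semilinear map with `df ↦ d(f|_V)`. -/
def resForm [X.Over SpecC] (h : V ≤ U) :
    Ω[Γ(X, U)⁄ℂ] →ₛₗ[resRing h] Ω[Γ(X, V)⁄ℂ] :=
  letI : Algebra Γ(X, U) Γ(X, V) := (resRing h).toAlgebra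
  haveI : IsScalarTower ℂ Γ(X, U) Γ(X, V) :=
    IsScalarTower.of_algebraMap_eq fun c => (resRing_algebraMap h c).symm
  { toFun := KaehlerDifferential.map ℂ ℂ Γ(X, U) Γ(X, V)
    map_add' := fun s t => map_add _ s t
    map_smul' := fun a s => by
      rw [map_smul, ← algebraMap_smul Γ(X, V) a (KaehlerDifferential.map ℂ ℂ Γ(X, U) Γ(X, V) s)]
      rfl }

end Restriction

section LinearAlgebra

variable (A : Type*) [CommRing A] (M N : Type*) [AddCommGroup M] [Module A M]
  [AddCommGroup N] [Module A N]

/-- The wedge product `N ⊗ N → ⋀² N`. -/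
def wedge : N ⊗[A] N →ₗ[A] ⋀[A]^2 N :=
  have h0 : ∀ x y z : N, ![z, y] = Function.update ![x, y] 0 z := fun x y z => by
    ext i; fin_cases i <;> simp
  have h1 : ∀ x y z : N, ![x, z] = Function.update ![x, y] 1 z := fun x y z => by
    ext i; fin_cases i <;> simp
  TensorProduct.lift <| LinearMap.mk₂ A (fun x y => exteriorPower.ιMulti A 2 ![x, y])
    (fun x x' y => by
      rw [h0 0 y (x + x'), h0 0 y x, h0 0 y x', AlternatingMap.map_update_add])
    (fun c x y => by
      rw [h0 0 y (c • x), h0 0 y x, AlternatingMap.map_update_smul])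
    (fun x y y' => by
      rw [h1 x 0 (y + y'), h1 x 0 y, h1 x 0 y', AlternatingMap.map_update_add])
    (fun c x y => by
      rw [h1 x 0 (c • y), h1 x 0 y, AlternatingMap.map_update_smul])

variable {A M N}

/-- The composition `M → M ⊗ N → M ⊗ N ⊗ N → M ⊗ ⋀² N` attached to `φ : M → M ⊗ N`. -/
def wedgeSquare (φ : M →ₗ[A] M ⊗[A] N) : M →ₗ[A] M ⊗[A] ⋀[A]^2 N :=
  (wedge A N).lTensor M ∘ₗ (TensorProduct.assoc A M N N).toLinearMap ∘ₗ φ.rTensor N ∘ₗ φ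

/-- The extension of `φ : M → M ⊗ N` to an endomorphism of `Sym N ⊗ M`. In bases, it is
the matrix of `φ`, whose entries lie in `N ⊆ Sym N`. -/
def symEnd (φ : M →ₗ[A] M ⊗[A] N) :
    SymmetricAlgebra A N ⊗[A] M →ₗ[SymmetricAlgebra A N] SymmetricAlgebra A N ⊗[A] M :=
  LinearMap.liftBaseChange (SymmetricAlgebra A N)
    ((SymmetricAlgebra.ι A N).rTensor M ∘ₗ (TensorProduct.comm A M N).toLinearMap ∘ₗ φ)

/-- The base change of `φ : M → M ⊗ N` along `A → B`. -/
def baseChangeTwisted (B : Type*) [CommRing B] [Algebra A B] (φ : M →ₗ[A] M ⊗[A] N) :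
    B ⊗[A] M →ₗ[B] (B ⊗[A] M) ⊗[B] (B ⊗[A] N) :=
  (AlgebraTensorModule.distribBaseChange A B M N).toLinearMap ∘ₗ φ.baseChange B

/-- For `Φ : P → P ⊗ Q` and `θ ∈ Q`, the map `id ⊗ θ - Φ : P → P ⊗ Q`. -/
def subEigen {B P Q : Type*} [CommRing B] [AddCommGroup P] [Module B P] [AddCommGroup Q]
    [Module B Q] (Φ : P →ₗ[B] P ⊗[B] Q) (θ : Q) : P →ₗ[B] P ⊗[B] Q :=
  (TensorProduct.mk B P Q).flip θ - Φ

/-- The value at `λ = θ` of the characteristic polynomial `λ^r + a₁ λ^(r-1) + ⋯ + a_r` of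
`φ : M → M ⊗ N`, whose coefficients `aᵢ` lie in `Symⁱ N`. -/
def charValue [Module.Free A M] [Module.Finite A M] (B : Type*) [CommRing B] [Algebra A B]
    (φ : M →ₗ[A] M ⊗[A] N) (θ : B ⊗[A] N) : B ⊗[A] SymmetricAlgebra A N :=
  (symEnd φ).charpoly.eval₂
    (Algebra.TensorProduct.includeRight : SymmetricAlgebra A N →ₐ[A] _).toRingHom
    ((SymmetricAlgebra.ι A N).baseChange B θ)

/-- A submodule `L` of `P` is a subbundle of rank `d`: it is finitely generated, the quotient is
projective (so that `L` is a direct summand), and `L` has constant rank `d`. -/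
structure IsSubbundle {B P : Type*} [CommRing B] [AddCommGroup P] [Module B P] (d : ℕ)
    (L : Submodule B P) : Prop where
  finite : Module.Finite B L
  projective_quotient : Module.Projective B (P ⧸ L)
  rank_eq : ∀ x : PrimeSpectrum B, Module.rankAtStalk (R := B) L x = d

/-- `L` is invariant under `Φ : P → P ⊗ Q`, that is `Φ(L) ⊆ L ⊗ Q`. -/
def IsInvariant {B P Q : Type*} [CommRing B] [AddCommGroup P] [Module B P] [AddCommGroup Q]
    [Module B Q] (Φ : P →ₗ[B] P ⊗[B] Q) (L : Submodule B P) : Prop :=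
  ∀ l ∈ L, Φ l ∈ LinearMap.range (L.subtype.rTensor Q)

end LinearAlgebra

/-- A Higgs bundle of rank `r` on the complex scheme `X`: a sheaf of modules `E` which is
locally free of rank `r`, and a Higgs field `φ : E → E ⊗ Ω¹` with `φ ∧ φ = 0`. As `E ⊗ Ω¹` is
quasi-coherent, the morphism `φ` is given by its values on the affine open subsets, compatible with
restriction. -/
structure HiggsBundle (X : Scheme.{0}) [X.Over SpecC] (r : ℕ) where
  E : X.Modules
  /-- Locally, there is a frame `e₁, …, e_r`, i.e. an isomorphism `𝒪^r ≅ E` of sheaves. -/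
  locallyFree : ∀ x : X, ∃ U : X.Opens, x ∈ U ∧ ∃ e : Fin r → Γ(E, U),
    ∀ (V : X.Opens) (h : V ≤ U),
      Function.Bijective fun c : Fin r → Γ(X, V) => ∑ i, c i • resMod E h (e i)
  φ : ∀ U : X.affineOpens, Γ(E, U.1) →ₗ[Γ(X, U.1)] Γ(E, U.1) ⊗[Γ(X, U.1)] Ω[Γ(X, U.1)⁄ℂ]
  φ_res : ∀ (U V : X.affineOpens) (h : V.1 ≤ U.1) (s : Γ(E, U.1)),
    φ V (resMod E h s) = TensorProduct.map (resMod E h) (resForm h) (φ U s)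
  φ_wedge : ∀ U : X.affineOpens, wedgeSquare (φ U) = 0

section Points

variable {X : Scheme.{0}}

/-- The morphism `Spec B → U ⊆ X` given by an algebra `B` over the functions on an
affine open subset `U`. -/
def pt (U : X.affineOpens) (B : Type) [CommRing B] [Algebra Γ(X, U.1) B] :
    Spec (.of B) ⟶ X :=
  Spec.map (CommRingCat.ofHom (algebraMap Γ(X, U.1) B)) ≫ U.2.fromSpec

/-- A ring map `f : B → B'` covering the restriction of functions from `U` to `V`, regarded as a
semilinear map. -/
def semilinear {U V : X.affineOpens} (h : V.1 ≤ U.1) {B B' : Type} [CommRing B] [CommRing B']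
    [Algebra Γ(X, U.1) B] [Algebra Γ(X, V.1) B'] (f : B →+* B')
    (hf : f.comp (algebraMap Γ(X, U.1) B) = (algebraMap Γ(X, V.1) B').comp (resRing h)) :
    B →ₛₗ[resRing h] B' where
  toFun := f
  map_add' := map_add f
  map_smul' a b := by
    rw [Algebra.smul_def, map_mul, Algebra.smul_def]
    exact congrArg (· * f b) (RingHom.congr_fun hf a)

end Points

namespace HiggsBundle

variable {X : Scheme.{0}} [X.Over SpecC] {r : ℕ} (𝓔 : HiggsBundle X r)

/-- For `y : Spec B → U ⊆ X`, the module of global sections of `y^* E`. -/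
abbrev Fib (U : X.affineOpens) (B : Type) [CommRing B] [Algebra Γ(X, U.1) B] : Type :=
  B ⊗[Γ(X, U.1)] Γ(𝓔.E, U.1)

/-- For `y : Spec B → U ⊆ X`, the module of global sections of `y^* Ω¹`. These are the morphisms
`Spec B → T` over `y`, where `T` is the total space of the cotangent bundle. -/
abbrev Forms (U : X.affineOpens) (B : Type) [CommRing B] [Algebra Γ(X, U.1) B] : Type :=
  B ⊗[Γ(X, U.1)] Ω[Γ(X, U.1)⁄ℂ]

/-- The pulled back Higgs field `y^* φ : y^* E → y^* E ⊗ y^* Ω¹`. -/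
abbrev pullbackφ (U : X.affineOpens) (B : Type) [CommRing B] [Algebra Γ(X, U.1) B] :
    𝓔.Fib U B →ₗ[B] 𝓔.Fib U B ⊗[B] Forms U B :=
  baseChangeTwisted B (𝓔.φ U)

/-- The kernel of `Ψ = id ⊗ θ - y^* φ : y^* E → y^* E ⊗ y^* Ω¹`. -/
def kerΨ (U : X.affineOpens) (B : Type) [CommRing B] [Algebra Γ(X, U.1) B]
    (θ : Forms U B) : Submodule B (𝓔.Fib U B) :=
  LinearMap.ker (subEigen (𝓔.pullbackφ U B) θ)

/-- Rank `d` Higgs subbundles of `y^* (E, φ)`, for `y : Spec B → U ⊆ X`. -/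
def IsHiggsSubbundle (d : ℕ) (U : X.affineOpens) (B : Type) [CommRing B] [Algebra Γ(X, U.1) B]
    (L : Submodule B (𝓔.Fib U B)) : Prop :=
  IsSubbundle d L ∧ IsInvariant (𝓔.pullbackφ U B) L

/-- The affine open subsets over which `E` is free; they form a basis of the topology of `X`. -/
def IsTrivializing (U : X.affineOpens) : Prop :=
  Module.Free Γ(X, U.1) Γ(𝓔.E, U.1) ∧ Module.Finite Γ(X, U.1) Γ(𝓔.E, U.1)

/-- The equation `θ^r + a₁ θ^(r-1) + ⋯ + a_r = 0` in `y^* Sym^r Ω¹`, where `aᵢ` is the `i`-th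
coefficient of the characteristic polynomial of `φ`. -/
def SpectralEquation {U : X.affineOpens} (hU : 𝓔.IsTrivializing U) (B : Type) [CommRing B]
    [Algebra Γ(X, U.1) B] (θ : Forms U B) : Prop :=
  haveI := hU.1
  haveI := hU.2
  charValue B (𝓔.φ U) θ = 0

end HiggsBundle

/-- The Higgs Grassmannian of rank `d` Higgs subbundles of `(E, φ)`: the scheme over `X` that
represents the functor of rank `d` Higgs subbundles of pullbacks of `(E, φ)`, i.e. the closed
subscheme of the Grassmann bundle where `S_d → E → E ⊗ Ω¹ → Q_d ⊗ Ω¹` vanishes. A scheme over `X` is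
determined by its points with values in affine schemes that map into a trivializing affine open. -/
structure HiggsGrassmannian {X : Scheme.{0}} [X.Over SpecC] {r : ℕ} (𝓔 : HiggsBundle X r)
    (d : ℕ) where
  carrier : Scheme.{0}
  /-- the projection to `X` -/
  ρ : carrier ⟶ X
  /-- the pullback of the universal subbundle `S_d ⊆ ρ^* E` along `h : Spec B → carrier` -/
  sub : ∀ (U : X.affineOpens) (_ : 𝓔.IsTrivializing U) (B : Type) [CommRing B]
    [Algebra Γ(X, U.1) B] (h : Spec (.of B) ⟶ carrier) (_ : h ≫ ρ = pt U B),
    Submodule B (𝓔.Fib U B)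
  isHiggsSubbundle_sub : ∀ (U : X.affineOpens) (hU : 𝓔.IsTrivializing U) (B : Type) [CommRing B]
    [Algebra Γ(X, U.1) B] (h : Spec (.of B) ⟶ carrier) (hh : h ≫ ρ = pt U B),
    𝓔.IsHiggsSubbundle d U B (sub U hU B h hh)
  sub_natural : ∀ (U V : X.affineOpens) (hU : 𝓔.IsTrivializing U) (hV : 𝓔.IsTrivializing V)
    (hVU : V.1 ≤ U.1) (B B' : Type) [CommRing B] [CommRing B']
    [Algebra Γ(X, U.1) B] [Algebra Γ(X, V.1) B'] (f : B →+* B')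
    (hf : f.comp (algebraMap Γ(X, U.1) B) = (algebraMap Γ(X, V.1) B').comp (resRing hVU))
    (h : Spec (.of B) ⟶ carrier) (hh : h ≫ ρ = pt U B)
    (hh' : (Spec.map (CommRingCat.ofHom f) ≫ h) ≫ ρ = pt V B'),
    sub V hV B' (Spec.map (CommRingCat.ofHom f) ≫ h) hh' =
      Submodule.span B' (TensorProduct.map (semilinear hVU f hf) (resMod 𝓔.E hVU) ''
        (sub U hU B h hh : Set (𝓔.Fib U B)))
  existsUnique_sub_eq : ∀ (U : X.affineOpens) (hU : 𝓔.IsTrivializing U) (B : Type) [CommRing B]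
    [Algebra Γ(X, U.1) B] (L : Submodule B (𝓔.Fib U B)), 𝓔.IsHiggsSubbundle d U B L →
    ∃! h : Spec (.of B) ⟶ carrier, ∃ hh : h ≫ ρ = pt U B, sub U hU B h hh = L

/-- The spectral cover of `(E, φ)`: the closed subscheme of the total space `T` of the cotangent
bundle of `X` described by the equation `λ^r + a₁ λ^(r-1) + ⋯ + a_r = 0`, where `λ` is the
tautological section of `p^* Ω¹`. By the universal properties of `T` and of
zero schemes, it is the scheme over `X` whose points `Spec B → S_E` over `y : Spec B → U ⊆ X` are the
sections `θ` of `y^* Ω¹` that satisfy the equation. -/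
structure SpectralCover {X : Scheme.{0}} [X.Over SpecC] {r : ℕ} (𝓔 : HiggsBundle X r) where
  carrier : Scheme.{0}
  /-- the projection to `X` -/
  p : carrier ⟶ X
  /-- the pullback of the tautological section `λ` along `h : Spec B → carrier` -/
  eig : ∀ (U : X.affineOpens) (_ : 𝓔.IsTrivializing U) (B : Type) [CommRing B]
    [Algebra Γ(X, U.1) B] (h : Spec (.of B) ⟶ carrier) (_ : h ≫ p = pt U B),
    HiggsBundle.Forms U B
  spectralEquation_eig : ∀ (U : X.affineOpens) (hU : 𝓔.IsTrivializing U) (B : Type) [CommRing B]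
    [Algebra Γ(X, U.1) B] (h : Spec (.of B) ⟶ carrier) (hh : h ≫ p = pt U B),
    𝓔.SpectralEquation hU B (eig U hU B h hh)
  eig_natural : ∀ (U V : X.affineOpens) (hU : 𝓔.IsTrivializing U) (hV : 𝓔.IsTrivializing V)
    (hVU : V.1 ≤ U.1) (B B' : Type) [CommRing B] [CommRing B']
    [Algebra Γ(X, U.1) B] [Algebra Γ(X, V.1) B'] (f : B →+* B')
    (hf : f.comp (algebraMap Γ(X, U.1) B) = (algebraMap Γ(X, V.1) B').comp (resRing hVU))
    (h : Spec (.of B) ⟶ carrier) (hh : h ≫ p = pt U B)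
    (hh' : (Spec.map (CommRingCat.ofHom f) ≫ h) ≫ p = pt V B'),
    eig V hV B' (Spec.map (CommRingCat.ofHom f) ≫ h) hh' =
      TensorProduct.map (semilinear hVU f hf) (resForm hVU) (eig U hU B h hh)
  existsUnique_eig_eq : ∀ (U : X.affineOpens) (hU : 𝓔.IsTrivializing U) (B : Type) [CommRing B]
    [Algebra Γ(X, U.1) B] (θ : HiggsBundle.Forms U B), 𝓔.SpectralEquation hU B θ →
    ∃! h : Spec (.of B) ⟶ carrier, ∃ hh : h ≫ p = pt U B, eig U hU B h hh = θ

end Higgs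

end

/-!
Everything happens on points `Spec B ⟶ X` that factor through a trivializing affine open subset `U`
of `X`. With `A = Γ(X, U)` the bundle is there a finite free `A`-module `M`, the forms are the
projective module `N = Ω[A⁄ℂ]`, and the Higgs field is a map `φ : M → M ⊗ N`. A linear form
`c : N → B` contracts `φ` to a matrix over `B`, and `φ ∧ φ = 0` says that these matrices commute.
Given a section `θ` of `B ⊗ N`, the *characteristic matrices* are `charMatrix c = c(θ) - c(φ)`. The
spectral equation for `θ` says that all of them, also those over larger algebras, are singular; the
eigenvectors with eigenvalue `θ` are their common null vectors.

*Existence.* Both schemes are glued from affine charts that represent their functors of points. For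
the spectral cover there is one chart over each trivializing open subset, given by equations for the
coordinates of `θ` (`exists_spectralAlgebra`). For the Higgs Grassmannian there is one for each
coordinate that may be nonzero on the line (`exists_lineAlgebra`). That Zariski sheaves with affine
charts are representable is proved for functors that are given on the points over a basis of `X`
only (`PointFunctor.Charts.existsUnique_toElt_eq`). Line subbundles are handled through
`IsLine`, which is equivalent to the notion of subbundle of rank one in terms of projective modules.

*The morphism `g`.* An invariant line `L` has an eigenvalue `θ`, as `Hom(L, L ⊗ N) ≅ B ⊗ N`
(`IsLine.exists_eigenvalue`), and `θ` satisfies the spectral equation by Cramer's rule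
(`charValue_eq_zero_of_isLine`). At a point with values in a field `K`, a solution `θ` of the
spectral equation makes the characteristic matrices a linear space of commuting singular matrices.
It is covered by the finitely many maximal ideals of the algebra that it generates, so it lies in one
of them, and has a common null vector (`exists_common_null_vector`). Hence `g` is surjective.

*The morphism `f`.* Let `W` be a smooth open part of the spectral cover. The coordinates of `θ` are
integral over `A`, so that the tangent spaces of `W` have dimension at most `n`
(`finrank_hom_kaehler_le`). Consider a point of `W` with values in a field and a tangent vector
`δ ≠ 0` of `X` at its image. If every lift of `θ` over `k[ε]` along `δ` satisfied the spectral
equation, then the tangent space of `W` would contain the `n`-dimensional space of vertical vectors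
as well as a vector over `δ`; so some lift violates it (`exists_charValue_ne_zero`). As
`det (M + ε M') = det M + ε tr (adj M * M')`, some characteristic matrix `X` has a nonzero adjugate at
the point. If `n = 1`, all characteristic matrices are locally proportional to `X`, so that the
columns of `adj X` are eigenvectors, and by Cramer's rule they span the eigenspace. If `n ≥ 2`, one
can choose `X` such that even `tr (adj X) ≠ 0` (`exists_trace_adjugate_charMatrix_ne_zero`):
otherwise the vertical direction drops out of the first order equations, which reduce to a single
linear condition on `δ`, and some `δ ≠ 0` satisfies it. The columns of `tr (adj X) • adj X` are then
eigenvectors, by an identity for commuting matrices (`trace_adjugate_smul_mul_adjugate`). In both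
cases the kernel of `Ψ` is a line near the point (`isLine_ker_subEigen`), and it defines `f`. As the
eigenvalue of this line is `θ`, the composition `g ∘ f` is the inclusion.
-/


noncomputable section

namespace Higgs

/-! ### Adjugates of singular matrices -/

section Adjugate

open Matrix

variable {ι B : Type*} [Fintype ι] [DecidableEq ι] [CommRing B]

lemma adjugate_apply_eq_det_updateCol (M : Matrix ι ι B) (i j : ι) :
    M.adjugate i j = (M.updateCol i (Pi.single j 1)).det := by
  rw [← Matrix.cramer_apply, Matrix.cramer_eq_adjugate_mulVec]
  simp

/-- Cramer's rule for a vector `m` in the kernel of `M`: the columns of the adjugate are, up to the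
coordinates of `m`, multiples of `m`. -/
lemma adjugate_apply_mul_of_mulVec_eq_zero {M : Matrix ι ι B} {m : ι → B} (h : M *ᵥ m = 0)
    (i j k : ι) : m i * M.adjugate k j = m k * M.adjugate i j := by
  -- `Z` is the identity matrix with column `i` replaced by `m`, so column `i` of `M * Z` vanishes.
  set Z : Matrix ι ι B := (1 : Matrix ι ι B).updateCol i m with hZ
  have hMZ : M * Z = M.updateCol i 0 := by
    ext a b
    rw [Matrix.mul_apply]
    by_cases hb : b = i
    · subst hb
      simpa [hZ, Matrix.mulVec, dotProduct] using congrFun h a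
    · simp [hZ, Matrix.updateCol_ne hb, Matrix.one_apply]
  have hdet : Z.det = m i := by
    rw [hZ, ← Matrix.cramer_apply, Matrix.cramer_one]; rfl
  have key : Z * (M.updateCol i 0).adjugate = m i • M.adjugate := by
    rw [← hMZ, Matrix.adjugate_mul_distrib, ← Matrix.mul_assoc, Matrix.mul_adjugate, hdet]
    simp
  have hrow : ∀ a, (M.updateCol i 0).adjugate a j = if a = i then M.adjugate i j else 0 := by
    intro a
    split_ifs with ha
    · subst ha
      rw [adjugate_apply_eq_det_updateCol, adjugate_apply_eq_det_updateCol]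
      congr 1
      ext x y
      by_cases hy : y = a
      · subst hy; simp
      · simp [Matrix.updateCol_ne hy]
    · rw [adjugate_apply_eq_det_updateCol]
      apply Matrix.det_eq_zero_of_column_eq_zero i
      intro x
      simp [Matrix.updateCol_ne (Ne.symm ha)]
  have := congrFun (congrFun key k) j
  rw [Matrix.mul_apply] at this
  simp only [hrow, mul_ite, mul_zero, Finset.sum_ite_eq', Finset.mem_univ, if_true,
    Matrix.smul_apply, smul_eq_mul] at this
  rw [← this, hZ]
  simp

/-- The first-order expansion of a determinant. -/
lemma snd_det_dualNumber (M : Matrix ι ι (DualNumber B)) :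
    M.det.snd =
      ((M.map TrivSqZeroExt.fst).adjugate * M.map TrivSqZeroExt.snd).trace := by
  have hprod : ∀ (s : Finset ι) (x : ι → DualNumber B),
      (∏ i ∈ s, x i).snd = ∑ i ∈ s, (∏ j ∈ s.erase i, (x j).fst) * (x i).snd := by
    intro s x
    induction s using Finset.induction_on with
    | empty => simp
    | insert a s ha ih =>
      have hfst : (∏ i ∈ s, x i).fst = ∏ i ∈ s, (x i).fst :=
        map_prod (TrivSqZeroExt.fstHom B B B) x s
      rw [Finset.prod_insert ha, TrivSqZeroExt.snd_mul, ih, Finset.sum_insert ha,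
        Finset.erase_insert ha, hfst, add_comm]
      simp only [smul_eq_mul, MulOpposite.smul_eq_mul_unop, MulOpposite.unop_op]
      rw [Finset.mul_sum, mul_comm]
      congr 1
      refine Finset.sum_congr rfl fun i hi => ?_
      have hia : a ≠ i := fun h => ha (h ▸ hi)
      rw [Finset.erase_insert_of_ne hia, Finset.prod_insert (by simp [ha]), mul_assoc]
  have hsgn : ∀ (z : ℤˣ) (x : DualNumber B), (z • x).snd = z • x.snd := by
    intro z x; rcases Int.units_eq_one_or z with rfl | rfl <;> simp
  have hsum : ∀ (s : Finset (Equiv.Perm ι)) (f : Equiv.Perm ι → DualNumber B),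
      (∑ i ∈ s, f i).snd = ∑ i ∈ s, (f i).snd := fun s f =>
    map_sum (TrivSqZeroExt.sndHom B B) f s
  rw [Matrix.det_apply, hsum]
  simp only [hsgn, hprod, Finset.smul_sum]
  rw [Finset.sum_comm, Matrix.trace]
  refine Finset.sum_congr rfl fun i _ => ?_
  have : ((M.map TrivSqZeroExt.fst).adjugate * M.map TrivSqZeroExt.snd).diag i =
      (M.map TrivSqZeroExt.fst).cramer (fun k => (M k i).snd) i := by
    rw [Matrix.cramer_eq_adjugate_mulVec, Matrix.diag_apply, Matrix.mul_apply]
    rfl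
  rw [this, Matrix.cramer_apply, Matrix.det_apply]
  refine Finset.sum_congr rfl fun σ _ => ?_
  congr 1
  rw [← Finset.prod_erase_mul _ _ (Finset.mem_univ i)]
  congr 1
  · refine Finset.prod_congr rfl fun j hj => ?_
    rw [Matrix.updateCol_ne (Finset.ne_of_mem_erase hj)]
    rfl
  · rw [Matrix.updateCol_self]

/-- If `M'` commutes with a singular matrix `M` and `det (M + ε M')` vanishes to first order, then
the columns of `tr (adj M) • adj M` are annihilated by `M'`, too. -/
lemma trace_adjugate_smul_mul_adjugate {M M' : Matrix ι ι B} (hM : M.det = 0)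
    (hc : Commute M M') (ht : (M.adjugate * M').trace = 0) :
    M.adjugate.trace • (M' * M.adjugate) = 0 := by
  have hMN : M * M.adjugate = 0 := by rw [Matrix.mul_adjugate, hM, zero_smul]
  -- The columns of `M' * adj M` lie in the kernel of `M`.
  have hker : ∀ l, M *ᵥ (fun k => (M' * M.adjugate) k l) = 0 := by
    intro l
    have : M * (M' * M.adjugate) = 0 := by
      rw [← Matrix.mul_assoc, hc.eq, Matrix.mul_assoc, hMN, Matrix.mul_zero]
    ext a
    exact congrFun (congrFun this a) l
  have key : ∀ i j k l, (M' * M.adjugate) i l * M.adjugate k j =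
      (M' * M.adjugate) k l * M.adjugate i j := fun i j k l =>
    adjugate_apply_mul_of_mulVec_eq_zero (hker l) i j k
  have h1 : M.adjugate * M.adjugate = M.adjugate.trace • M.adjugate := by
    ext k l
    simp only [Matrix.mul_apply, Matrix.smul_apply, Matrix.trace, Matrix.diag_apply, smul_eq_mul,
      Finset.sum_mul]
    refine Finset.sum_congr rfl fun i _ => ?_
    have := adjugate_apply_mul_of_mulVec_eq_zero (M := M) (m := fun k => M.adjugate k l)
      (by ext a; exact congrFun (congrFun hMN a) l) i i k
    rw [mul_comm, this, mul_comm]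
  have h2 : M' * M.adjugate * M.adjugate = 0 := by
    ext i j
    rw [Matrix.mul_apply]
    calc ∑ k, (M' * M.adjugate) i k * M.adjugate k j
        = ∑ k, (M' * M.adjugate) k k * M.adjugate i j := Finset.sum_congr rfl fun k _ => key i j k k
      _ = (M' * M.adjugate).trace * M.adjugate i j := by rw [← Finset.sum_mul]; rfl
      _ = 0 := by rw [Matrix.trace_mul_comm, ht, zero_mul]
  rw [← Matrix.mul_smul, ← h1, ← Matrix.mul_assoc, h2]

section Field

variable {K : Type*} [Field K]

lemma exists_smul_eq_of_mulVec_eq_zero {M : Matrix ι ι K} {i j : ι}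
    (h : M.adjugate i j ≠ 0) {m : ι → K} (hm : M *ᵥ m = 0) :
    m = (m i / M.adjugate i j) • fun k => M.adjugate k j := by
  ext k
  have := adjugate_apply_mul_of_mulVec_eq_zero hm i j k
  simp only [Pi.smul_apply, smul_eq_mul]
  field_simp
  exact this.symm

/-- A vector orthogonal to a nonzero row of the adjugate of `M` lies in the range of `M`. -/
lemma exists_mulVec_eq_of_adjugate_dotProduct {M : Matrix ι ι K} {i j : ι}
    (h : M.adjugate i j ≠ 0) {x : ι → K} (hx : M.adjugate i ⬝ᵥ x = 0) : ∃ y, M *ᵥ y = x := by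
  have hdet : (M.updateCol i x).det = 0 := by
    rw [← Matrix.cramer_apply, Matrix.cramer_eq_adjugate_mulVec]; exact hx
  obtain ⟨z, hz0, hz⟩ := Matrix.exists_mulVec_eq_zero_iff.mpr hdet
  have hexp : M *ᵥ (Function.update z i 0) + z i • x = 0 := by
    rw [← hz]
    ext a
    simp only [Matrix.mulVec, dotProduct, Pi.add_apply, Pi.smul_apply, smul_eq_mul]
    rw [← Finset.add_sum_erase _ _ (Finset.mem_univ i),
      ← Finset.add_sum_erase _ (fun b => M.updateCol i x a b * z b) (Finset.mem_univ i)]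
    simp only [Function.update_self, mul_zero, zero_add, Matrix.updateCol_self]
    rw [add_comm, mul_comm]
    congr 1
    refine Finset.sum_congr rfl fun b hb => ?_
    rw [Function.update_of_ne (Finset.ne_of_mem_erase hb),
      Matrix.updateCol_ne (Finset.ne_of_mem_erase hb)]
  -- otherwise `z` is a null vector of `M` with `i`-th coordinate `0`, hence zero by Cramer
  have hzi : z i ≠ 0 := by
    intro h0
    have hz' : Function.update z i 0 = z := by rw [← h0, Function.update_eq_self]
    rw [h0, zero_smul, add_zero, hz'] at hexp
    have := exists_smul_eq_of_mulVec_eq_zero h hexp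
    rw [h0, zero_div, zero_smul] at this
    exact hz0 this
  refine ⟨-(z i)⁻¹ • Function.update z i 0, ?_⟩
  rw [Matrix.mulVec_smul, eq_neg_of_add_eq_zero_left hexp, smul_neg, neg_smul, neg_neg, smul_smul,
    inv_mul_cancel₀ hzi, one_smul]

/-- If `v` and `u` are a right and a left null vector of `M`, then `adj M` is a multiple of
`v uᵀ`. -/
lemma adjugate_eq_smul_vecMulVec {M : Matrix ι ι K} {v u : ι → K} (hv0 : v ≠ 0) (hu0 : u ≠ 0)
    (hv : M *ᵥ v = 0) (hu : u ᵥ* M = 0) : ∃ κ : K, M.adjugate = κ • Matrix.vecMulVec v u := by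
  obtain ⟨a, ha⟩ := Function.ne_iff.mp hv0
  obtain ⟨b, hb⟩ := Function.ne_iff.mp hu0
  simp only [Pi.zero_apply] at ha hb
  have hu' : Mᵀ *ᵥ u = 0 := by rw [Matrix.mulVec_transpose, hu]
  refine ⟨M.adjugate a b / (v a * u b), ?_⟩
  ext k l
  have h1 := adjugate_apply_mul_of_mulVec_eq_zero hv a l k
  have h2 := adjugate_apply_mul_of_mulVec_eq_zero hu' b a l
  rw [← Matrix.adjugate_transpose] at h2
  simp only [Matrix.transpose_apply] at h2
  simp only [Matrix.smul_apply, Matrix.vecMulVec_apply, smul_eq_mul]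
  field_simp
  linear_combination u b * h1 + v k * h2

end Field

end Adjugate

/-! ### Common null vectors -/

/-- A linear space of commuting endomorphisms, none of which is invertible, has a common null
vector. The space is covered by the finitely many maximal ideals of the algebra it generates, hence
lies in one of them, and every maximal ideal of an Artinian ring is an associated prime of every
faithful module. -/
lemma exists_common_null_vector {K V : Type*} [Field K] [Infinite K] [AddCommGroup V] [Module K V]
    [Module.Finite K V] (S : Submodule K (Module.End K V))
    (hc : ∀ f ∈ S, ∀ g ∈ S, f * g = g * f) (hs : ∀ f ∈ S, ¬ IsUnit f) :
    ∃ v : V, v ≠ 0 ∧ ∀ f ∈ S, f v = 0 := by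
  let 𝒜 := Algebra.adjoin K (S : Set (Module.End K V))
  have hcomm := Algebra.isMulCommutative_adjoin K hc
  let _ : CommRing 𝒜 := { (inferInstance : Ring 𝒜) with mul_comm := fun a b => hcomm.1.1 a b }
  have : Module.Finite K 𝒜 := inferInstanceAs (Module.Finite K (Subalgebra.toSubmodule 𝒜))
  have : IsArtinianRing 𝒜 := IsArtinianRing.of_finite K 𝒜
  have : Module.Finite 𝒜 V := Module.Finite.of_restrictScalars_finite K 𝒜 V
  have hS : ∀ f : S, (f : Module.End K V) ∈ 𝒜 := fun f => Algebra.subset_adjoin f.2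
  let j : S →ₗ[K] 𝒜 :=
    { toFun := fun f => ⟨f, hS f⟩, map_add' := fun _ _ => rfl, map_smul' := fun _ _ => rfl }
  -- The subspace of `S` that is contained in the maximal ideal `m`.
  let p : MaximalSpectrum 𝒜 → Subspace K S := fun m => (m.asIdeal.restrictScalars K).comap j
  -- a non-unit of the algebra lies in a maximal ideal
  have hcov : ⋃ m, (p m : Set S) = Set.univ := by
    rw [Set.eq_univ_iff_forall]
    intro f
    have : j f ∈ nonunits 𝒜 := by
      intro h
      exact hs f f.2 (h.map 𝒜.val)
    obtain ⟨m, hm, hfm⟩ := exists_max_ideal_of_mem_nonunits this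
    exact Set.mem_iUnion.mpr ⟨⟨m, hm⟩, hfm⟩
  obtain ⟨m, hm⟩ := Subspace.exists_eq_top_of_iUnion_eq_univ hcov
  -- `m` is a minimal prime over the annihilator `0`, hence an associated prime: the annihilator of
  -- some vector `v`
  have hann : Module.annihilator 𝒜 V = ⊥ := by
    rw [eq_bot_iff]
    intro a ha
    rw [Module.mem_annihilator] at ha
    exact Subtype.ext (LinearMap.ext fun v => ha v)
  have hmin : m.asIdeal ∈ (Module.annihilator 𝒜 V).minimalPrimes := by
    rw [hann]
    refine ⟨⟨m.isMaximal.isPrime, bot_le⟩, fun q hq hqm => ?_⟩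
    have := hq.1
    have : q.IsMaximal := inferInstance
    exact (this.eq_of_le m.isMaximal.ne_top hqm).ge
  have hass := Module.associatedPrimes.minimalPrimes_annihilator_subset_associatedPrimes 𝒜 V hmin
  obtain ⟨_, v, hv⟩ := isAssociatedPrime_iff.mp hass
  refine ⟨v, ?_, fun f hf => ?_⟩
  · rintro rfl
    apply m.isMaximal.ne_top
    rw [hv, Ideal.eq_top_iff_one, Submodule.mem_colon_singleton]
    simp
  · have h1 : (⟨f, hf⟩ : S) ∈ p m := hm ▸ Submodule.mem_top
    have h2 : j ⟨f, hf⟩ ∈ m.asIdeal := h1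
    rw [hv, Submodule.mem_colon_singleton, Submodule.mem_bot] at h2
    exact h2

/-! ### Line subbundles -/

section Line

variable {B P : Type*} [CommRing B] [AddCommGroup P] [Module B P]

/-- A submodule `L` of `P` with finitely many elements `v k` and linear forms `ℓ k` on `P` such that
`∑ ℓ k (v k) = 1` and, on the locus where `ℓ k (v k)` is invertible, `L` is generated by `v k`. This
is a form of the notion of rank one subbundle that can be handled without localization. -/
def IsLine (L : Submodule B P) : Prop :=
  ∃ (n : ℕ) (v : Fin n → P) (ℓ : Fin n → P →ₗ[B] B), (∀ k, v k ∈ L) ∧ ∑ k, ℓ k (v k) = 1 ∧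
    ∀ m ∈ L, ∀ k, ℓ k (v k) • m = ℓ k m • v k

lemma eq_zero_of_forall_smul_eq_zero {s : Set B} (hs : Ideal.span s = ⊤) (n : ℕ) {x : P}
    (h : ∀ b ∈ s, b ^ n • x = 0) : x = 0 := by
  have h1 : Ideal.span ((· ^ n) '' s) ≤ (LinearMap.toSpanSingleton B P x).ker := by
    rw [Ideal.span_le]
    rintro _ ⟨b, hb, rfl⟩
    exact h b hb
  rw [Ideal.span_pow_eq_top s hs n] at h1
  have := h1 (Submodule.mem_top (x := (1 : B)))
  simpa using this

lemma span_range_eq_top_of_sum_eq_one {n : ℕ} {b : Fin n → B} (h : ∑ k, b k = 1) :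
    Ideal.span (Set.range b) = ⊤ := by
  rw [Ideal.eq_top_iff_one, ← h]
  exact Ideal.sum_mem _ fun k _ => Ideal.subset_span ⟨k, rfl⟩

/-- On a line, `f(l) l' = f(l') l`. -/
lemma IsLine.apply_smul_comm {L : Submodule B P} (h : IsLine L) (f : P →ₗ[B] B) {l l' : P}
    (hl : l ∈ L) (hl' : l' ∈ L) : f l • l' = f l' • l := by
  obtain ⟨n, v, ℓ, hv, h1, hL⟩ := h
  rw [← sub_eq_zero]
  refine eq_zero_of_forall_smul_eq_zero (span_range_eq_top_of_sum_eq_one h1) 2 ?_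
  rintro _ ⟨k, rfl⟩
  have e1 := hL l hl k
  have e2 := hL l' hl' k
  have e3 := congrArg f e1
  have e4 := congrArg f e2
  simp only [map_smul, smul_eq_mul] at e3 e4
  rw [pow_two, smul_sub, sub_eq_zero]
  calc (ℓ k (v k) * ℓ k (v k)) • f l • l' = (ℓ k (v k) * f l) • ℓ k (v k) • l' := by
        simp only [smul_smul]; congr 1; ring
    _ = (ℓ k (v k) * f l') • ℓ k (v k) • l := by
        rw [e1, e2, e3, e4, smul_smul, smul_smul]; congr 1; ring
    _ = _ := by simp only [smul_smul]; congr 1; ring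

lemma IsLine.of_span_eq_top {L : Submodule B P}
    (h : Ideal.span {b : B | ∃ v ∈ L, ∃ ℓ : P →ₗ[B] B, ℓ v = b ∧ ∀ m ∈ L, b • m = ℓ m • v} = ⊤) :
    IsLine L := by
  obtain ⟨n, c, g, hg⟩ := Submodule.mem_span_set'.mp ((Ideal.eq_top_iff_one _).mp h)
  choose v hv ℓ hℓ hL using fun k => (g k).2
  refine ⟨n, v, fun k => c k • ℓ k, hv, ?_, fun m hm k => ?_⟩
  · rw [← hg]
    exact Finset.sum_congr rfl fun k _ => by simp [hℓ]
  · simp only [LinearMap.smul_apply, smul_eq_mul, hℓ, mul_smul]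
    rw [hL k m hm]

/-- Two lines, one of which contains the other, are equal. -/
lemma IsLine.eq_of_le {L L' : Submodule B P} (h : IsLine L) (h' : IsLine L') (hle : L ≤ L') :
    L = L' := by
  refine le_antisymm hle fun m hm => ?_
  obtain ⟨n, v, ℓ, hv, h1, -⟩ := h
  have : m = ∑ k, ℓ k m • v k := by
    conv_lhs => rw [← one_smul B m, ← h1, Finset.sum_smul]
    refine Finset.sum_congr rfl fun k _ => ?_
    rw [h'.apply_smul_comm (ℓ k) (hle (hv k)) hm]
  rw [this]
  exact Submodule.sum_mem _ fun k _ => L.smul_mem _ (hv k)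

lemma IsLine.eq_sum {L : Submodule B P} {n : ℕ} {v : Fin n → P} {ℓ : Fin n → P →ₗ[B] B}
    (h1 : ∑ k, ℓ k (v k) = 1) (hL : ∀ m ∈ L, ∀ k, ℓ k (v k) • m = ℓ k m • v k) {m : P}
    (hm : m ∈ L) : m = ∑ k, ℓ k m • v k := by
  conv_lhs => rw [← one_smul B m, ← h1, Finset.sum_smul]
  exact Finset.sum_congr rfl fun k _ => hL m hm k

/-- A cyclic submodule generated by a vector on which a linear form takes the value `1`. -/
lemma isLine_span_singleton {v : P} (ℓ : P →ₗ[B] B) (h : ℓ v = 1) :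
    IsLine (Submodule.span B {v}) := by
  refine ⟨1, fun _ => v, fun _ => ℓ, fun _ => Submodule.mem_span_singleton_self v, by simpa using h,
    fun m hm _ => ?_⟩
  obtain ⟨c, rfl⟩ := Submodule.mem_span_singleton.mp hm
  simp [h]

/-- The projection onto a line that its local generators define. -/
lemma IsLine.exists_retraction {L : Submodule B P} (h : IsLine L) :
    ∃ π : P →ₗ[B] L, ∀ l : L, π l = l := by
  obtain ⟨n, v, ℓ, hv, h1, hL⟩ := h
  refine ⟨∑ k, (ℓ k).smulRight (⟨v k, hv k⟩ : L), fun l => Subtype.ext ?_⟩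
  simp only [LinearMap.sum_apply, LinearMap.smulRight_apply]
  rw [AddSubmonoidClass.coe_finsetSum]
  exact (IsLine.eq_sum h1 hL l.2).symm

lemma IsLine.finite {L : Submodule B P} (h : IsLine L) : Module.Finite B L := by
  obtain ⟨n, v, ℓ, hv, h1, hL⟩ := h
  rw [Module.Finite.iff_fg, Submodule.fg_def]
  refine ⟨Set.range v, Set.finite_range v, le_antisymm ?_ fun m hm => ?_⟩
  · rw [Submodule.span_le]; rintro _ ⟨k, rfl⟩; exact hv k
  · rw [IsLine.eq_sum h1 hL hm]
    exact Submodule.sum_mem _ fun k _ => Submodule.smul_mem _ _ (Submodule.subset_span ⟨k, rfl⟩)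

/-- A line in a projective module is a subbundle of rank one. It is locally generated by one of the
`v k`. -/
lemma IsLine.isSubbundle [Module.Projective B P] {L : Submodule B P} (h : IsLine L) :
    IsSubbundle 1 L := by
  obtain ⟨π, hπ⟩ := h.exists_retraction
  have hfin := h.finite
  have hproj : Module.Projective B L := Module.Projective.of_split L.subtype π (LinearMap.ext hπ)
  refine ⟨hfin, ?_, fun x => ?_⟩
  · -- `id - π` splits the quotient map.
    have hs : L ≤ LinearMap.ker (LinearMap.id - L.subtype ∘ₗ π) := fun l hl => by
      simp [hπ ⟨l, hl⟩]
    refine Module.Projective.of_split (L.liftQ _ hs) L.mkQ ?_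
    ext p
    simp
  · obtain ⟨n, v, ℓ, hv, h1, hL⟩ := h
    -- Some `b = ℓ k (v k)` is invertible at `x`.
    obtain ⟨k, hk⟩ : ∃ k, ℓ k (v k) ∉ x.asIdeal := by
      by_contra! hcon
      exact x.2.ne_top ((Ideal.eq_top_iff_one _).mpr (h1 ▸ Ideal.sum_mem _ fun k _ => hcon k))
    let S := x.asIdeal.primeCompl
    have hloc := (inferInstance : IsLocalizedModule S (LocalizedModule.mkLinearMap S L))
    let e : LocalizedModule S L := LocalizedModule.mk ⟨v k, hv k⟩ 1
    let f : LocalizedModule S L →ₗ[Localization S] Localization S :=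
      IsLocalizedModule.mapExtendScalars S (LocalizedModule.mkLinearMap S L)
        (Algebra.linearMap B (Localization S)) (Localization S) (ℓ k ∘ₗ L.subtype)
    have hf : ∀ l : L, f (LocalizedModule.mk l 1) = algebraMap B (Localization S) (ℓ k l) := by
      intro l
      exact IsLocalizedModule.map_apply S (LocalizedModule.mkLinearMap S L)
        (Algebra.linearMap B (Localization S)) (ℓ k ∘ₗ L.subtype) l
    have hu : IsUnit (algebraMap B (Localization S) (ℓ k (v k))) :=
      IsLocalization.map_units (Localization S) (⟨_, hk⟩ : S)
    have hgen : ∀ y : LocalizedModule S L, ∃ c : Localization S, c • e = y := by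
      intro y
      induction y using LocalizedModule.induction_on with
      | _ l s =>
      refine ⟨Localization.mk (ℓ k l) (s * ⟨_, hk⟩), ?_⟩
      rw [LocalizedModule.mk_smul_mk, LocalizedModule.mk_eq]
      refine ⟨1, ?_⟩
      simp only [one_smul, mul_one]
      apply Subtype.ext
      simp only [Submonoid.smul_def, Submonoid.coe_mul, Submodule.coe_smul]
      rw [mul_smul, hL l l.2 k]
    unfold Module.rankAtStalk
    have hfe : f e = algebraMap B (Localization S) (ℓ k (v k)) := hf ⟨v k, hv k⟩
    have : Nontrivial (Localization S) := inferInstanceAs (Nontrivial (Localization.AtPrime x.asIdeal))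
    have hequiv : Localization S ≃ₗ[Localization S] LocalizedModule S L := by
      refine LinearEquiv.ofBijective (LinearMap.toSpanSingleton _ _ e) ⟨?_, hgen⟩
      rw [← LinearMap.ker_eq_bot, eq_bot_iff]
      intro c hc
      have : f (c • e) = 0 := by rw [show c • e = 0 from hc, map_zero]
      rw [map_smul, hfe, smul_eq_mul, hu.mul_left_eq_zero] at this
      exact this
    exact hequiv.finrank_eq.symm.trans (Module.finrank_self _)

/-- Near every point, a module of constant rank one is generated by one element, whose annihilator
is trivial there. -/
lemma exists_generator_of_rankAtStalk_eq_one {L : Type*} [AddCommGroup L] [Module B L]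
    [Module.Finite B L] [Module.Projective B L] (x : PrimeSpectrum B)
    (hr : Module.rankAtStalk (R := B) L x = 1) :
    ∃ e : L, (∀ l : L, ∃ s ∉ x.asIdeal, ∃ c : B, s • l = c • e) ∧
      ∀ c : B, c • e = 0 → ∃ s ∉ x.asIdeal, s * c = 0 := by
  let S := x.asIdeal.primeCompl
  have : IsLocalRing (Localization S) :=
    inferInstanceAs (IsLocalRing (Localization.AtPrime x.asIdeal))
  have : Module.Free (Localization S) (LocalizedModule S L) := Module.free_of_flat_of_isLocalRing
  have : Nontrivial (Localization S) := inferInstanceAs (Nontrivial (Localization.AtPrime x.asIdeal))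
  obtain ⟨β⟩ := (finrank_eq_one_iff Unit).mp hr
  obtain ⟨e, t, het⟩ : ∃ (e : L) (t : S), LocalizedModule.mk e t = β () := by
    induction h : β () using LocalizedModule.induction_on with
    | _ e t => exact ⟨e, t, rfl⟩
  have hrep : ∀ y, y = β.repr y () • β () := fun y => by
    conv_lhs => rw [← β.sum_repr y]
    simp
  refine ⟨e, fun l => ?_, fun c hc => ?_⟩
  · have h := hrep (LocalizedModule.mk l 1)
    obtain ⟨a, s, has⟩ : ∃ (a : B) (s : S), Localization.mk a s = β.repr (LocalizedModule.mk l 1) () := by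
      induction h : β.repr (LocalizedModule.mk l 1) () using Localization.induction_on with
      | _ y => exact ⟨y.1, y.2, rfl⟩
    rw [← has, ← het, LocalizedModule.mk_smul_mk, LocalizedModule.mk_eq] at h
    obtain ⟨u, hu⟩ := h
    refine ⟨u * (s * t), (u * (s * t)).2, u * a, ?_⟩
    simp only [one_smul, Submonoid.smul_def, Submonoid.coe_mul, smul_smul] at hu ⊢
    exact hu
  · have h1 : (algebraMap B (Localization S) c) • β () = 0 := by
      rw [← het, algebraMap_smul, LocalizedModule.smul'_mk, hc, LocalizedModule.zero_mk]
    have h2 : algebraMap B (Localization S) c = 0 := by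
      have := congrArg (fun y => β.repr y ()) h1
      simpa only [map_smul, Module.Basis.repr_self, Finsupp.smul_apply, Finsupp.single_eq_same,
        smul_eq_mul, mul_one, map_zero, Finsupp.zero_apply] using this
    obtain ⟨s, hs⟩ := (IsLocalization.map_eq_zero_iff S (Localization S) c).mp h2
    exact ⟨s, s.2, hs⟩

/-- A subbundle of rank one is a line. The rank enters through `f(l) l' = f(l') l`, which holds for
modules that are locally generated by one element and turns a dual basis of the module into the data
of a line. -/
lemma IsSubbundle.isLine [Module.Projective B P] {L : Submodule B P} (h : IsSubbundle 1 L) :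
    IsLine L := by
  have := h.finite
  have := h.projective_quotient
  -- `L` is a direct summand.
  obtain ⟨σ, hσ⟩ := Module.projective_lifting_property L.mkQ LinearMap.id L.mkQ_surjective
  have hmem : ∀ p : P, p - σ (L.mkQ p) ∈ L := fun p => by
    have : L.mkQ (σ (L.mkQ p)) = L.mkQ p := LinearMap.congr_fun hσ _
    rw [← Submodule.Quotient.mk_eq_zero, Submodule.Quotient.mk_sub, sub_eq_zero]
    exact this.symm
  let π : P →ₗ[B] L := LinearMap.codRestrict L (LinearMap.id - σ ∘ₗ L.mkQ) hmem
  have hπ : ∀ l : L, π l = l := fun l => Subtype.ext <| by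
    have : L.mkQ (l : P) = 0 := by simp
    change (l : P) - σ (L.mkQ l) = l
    rw [this, map_zero, sub_zero]
  have hproj : Module.Projective B L := Module.Projective.of_split L.subtype π (LinearMap.ext hπ)
  -- A dual basis `c k`, `y k` of `L`.
  obtain ⟨n, g, hg⟩ := Module.Finite.exists_fin' B L
  obtain ⟨s, hs⟩ := Module.projective_lifting_property g LinearMap.id hg
  let y : Fin n → L := fun k => g (Pi.single k 1)
  let c : Fin n → L →ₗ[B] B := fun k => LinearMap.proj k ∘ₗ s
  have hdual : ∀ l : L, l = ∑ k, c k l • y k := fun l => by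
    conv_lhs => rw [← LinearMap.id_apply (R := B) l, ← hs, LinearMap.comp_apply,
      ← Finset.univ_sum_single (s l), map_sum]
    refine Finset.sum_congr rfl fun k _ => ?_
    rw [← map_smul, ← Pi.single_smul, smul_eq_mul, mul_one]
    rfl
  -- near a point, `l` and `l'` are multiples of one generator
  have hsymm : ∀ (f : L →ₗ[B] B) (l l' : L), f l • l' = f l' • l := by
    intro f l l'
    rw [← sub_eq_zero]
    by_contra hne
    obtain ⟨m, hm, hle⟩ := Ideal.exists_le_maximal
      ((LinearMap.toSpanSingleton B L (f l • l' - f l' • l)).ker) (fun htop => hne <| by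
        have := htop.ge (Submodule.mem_top (x := (1 : B)))
        simpa using this)
    obtain ⟨e, he, -⟩ := exists_generator_of_rankAtStalk_eq_one (L := L) ⟨m, hm.isPrime⟩
      (h.rank_eq _)
    obtain ⟨s, hs, a, ha⟩ := he l
    obtain ⟨s', hs', a', ha'⟩ := he l'
    have key : (s * s') • (f l • l' - f l' • l) = 0 := by
      have e1 := congrArg f ha
      have e2 := congrArg f ha'
      simp only [map_smul, smul_eq_mul] at e1 e2
      have x1 : (s * s') • f l • l' = (s * f l) • s' • l' := by
        simp only [smul_smul]; congr 1; ring
      have x2 : (s * s') • f l' • l = (s' * f l') • s • l := by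
        simp only [smul_smul]; congr 1; ring
      rw [smul_sub, x1, x2, e1, e2, ha, ha', smul_smul, smul_smul, sub_eq_zero]
      congr 1; ring
    rcases hm.isPrime.mem_or_mem (hle (show s * s' ∈ _ from key)) with h | h
    exacts [hs h, hs' h]
  -- the sum acts as the identity on `L`, which is faithful
  have hone : ∑ k, c k (y k) = 1 := by
    have hkill : ∀ l : L, (∑ k, c k (y k) - 1) • l = 0 := fun l => by
      rw [sub_smul, one_smul, Finset.sum_smul, sub_eq_zero]
      conv_rhs => rw [hdual l]
      exact Finset.sum_congr rfl fun k _ => hsymm _ _ _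
    rw [← sub_eq_zero]
    by_contra hne
    obtain ⟨m, hm, hle⟩ := Ideal.exists_le_maximal
      ((LinearMap.toSpanSingleton B B (∑ k, c k (y k) - 1)).ker) (fun htop => hne <| by
        have := htop.ge (Submodule.mem_top (x := (1 : B)))
        simpa using this)
    obtain ⟨e, -, he⟩ := exists_generator_of_rankAtStalk_eq_one (L := L) ⟨m, hm.isPrime⟩
      (h.rank_eq _)
    obtain ⟨s, hs, hs0⟩ := he _ (hkill e)
    exact hs (hle hs0)
  refine ⟨n, fun k => y k, fun k => c k ∘ₗ π, fun k => (y k).2, ?_, fun m hm k => ?_⟩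
  · simpa [hπ] using hone
  · have := congrArg Subtype.val (hsymm (c k) (y k) ⟨m, hm⟩)
    simp only [LinearMap.comp_apply, hπ]
    rw [hπ ⟨m, hm⟩]
    exact this

end Line

section BaseChange

variable {B B' P P' κ : Type*} [CommRing B] [CommRing B'] [AddCommGroup P] [Module B P]
  [AddCommGroup P'] [Module B' P'] {f : B →+* B'} (β : Module.Basis κ B P)
  (β' : Module.Basis κ B' P') (τ : P →ₛₗ[f] P')

include β in
lemma exists_form_comp_eq (hτ : ∀ j, τ (β j) = β' j) (ℓ : P →ₗ[B] B) :
    ∃ ℓ' : P' →ₗ[B'] B', ∀ m, ℓ' (τ m) = f (ℓ m) := by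
  refine ⟨β'.constr B' fun j => f (ℓ (β j)), fun m => ?_⟩
  induction β.mem_span m using Submodule.span_induction with
  | mem x hx =>
    obtain ⟨j, rfl⟩ := hx
    rw [hτ, Module.Basis.constr_basis]
  | zero => simp
  | add x y _ _ hx hy => simp [hx, hy]
  | smul a x _ hx => simp [hx]

include β β' in
/-- The base change of a line is a line. -/
lemma IsLine.span_image (hτ : ∀ j, τ (β j) = β' j) {L : Submodule B P} (h : IsLine L) :
    IsLine (Submodule.span B' (τ '' L)) := by
  obtain ⟨n, v, ℓ, hv, h1, hL⟩ := h
  choose ℓ' hℓ' using fun k => exists_form_comp_eq β β' τ hτ (ℓ k)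
  refine ⟨n, fun k => τ (v k), ℓ', fun k => Submodule.subset_span ⟨_, hv k, rfl⟩, ?_, ?_⟩
  · simp only [hℓ', ← map_sum, h1, map_one]
  · intro m hm k
    induction hm using Submodule.span_induction with
    | mem x hx =>
      obtain ⟨y, hy, rfl⟩ := hx
      rw [hℓ', hℓ', ← map_smulₛₗ, hL y hy k, map_smulₛₗ]
    | zero => simp
    | add x y _ _ hx hy => rw [smul_add, hx, hy, map_add, add_smul]
    | smul a x _ hx => rw [smul_comm, hx, map_smul, smul_smul, smul_eq_mul]

end BaseChange

/-! ### Contractions of twisted endomorphisms -/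

section Twisted

variable {A : Type*} [CommRing A] {M N : Type*} [AddCommGroup M] [Module A M]
  [AddCommGroup N] [Module A N]

/-- The pairing `B ⊗ N → B'`, `b ⊗ n ↦ f(b) c(n)`, attached to an algebra map `f : B → B'` and a
linear form `c : N → B'`. -/
def pairing {B B' : Type*} [CommRing B] [Algebra A B] [CommRing B'] [Algebra A B']
    (f : B →ₐ[A] B') (c : N →ₗ[A] B') : B ⊗[A] N →ₗ[A] B' :=
  LinearMap.mul' A B' ∘ₗ TensorProduct.map f.toLinearMap c

section Pairing

variable {B B' : Type*} [CommRing B] [Algebra A B] [CommRing B'] [Algebra A B']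

@[simp] lemma pairing_tmul (f : B →ₐ[A] B') (c : N →ₗ[A] B') (b : B) (n : N) :
    pairing f c (b ⊗ₜ n) = f b * c n := rfl

lemma pairing_comp {B'' : Type*} [CommRing B''] [Algebra A B''] (f : B →ₐ[A] B')
    (g : B' →ₐ[A] B'') (c : N →ₗ[A] B') (q : B ⊗[A] N) :
    pairing (g.comp f) (g.toLinearMap ∘ₗ c) q = g (pairing f c q) := by
  induction q with
  | zero => simp
  | tmul x n => simp
  | add x y hx hy => simp [hx, hy]

lemma pairing_rTensor {B'' : Type*} [CommRing B''] [Algebra A B''] (f : B →ₐ[A] B')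
    (g : B' →ₐ[A] B'') (c : N →ₗ[A] B'') (q : B ⊗[A] N) :
    pairing g c (f.toLinearMap.rTensor N q) = pairing (g.comp f) c q := by
  induction q with
  | zero => simp
  | tmul x n => simp
  | add x y hx hy => simp [hx, hy]

lemma pairing_add (f : B →ₐ[A] B') (c c' : N →ₗ[A] B') (q : B ⊗[A] N) :
    pairing f (c + c') q = pairing f c q + pairing f c' q := by
  simp [pairing, TensorProduct.map_add_right]

lemma pairing_smul_form (f : B →ₐ[A] B') (c : N →ₗ[A] B') (a : B') (q : B ⊗[A] N) :
    pairing f (a • c) q = a * pairing f c q := by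
  induction q with
  | zero => simp
  | tmul x n => simp; ring
  | add x y hx hy => simp [hx, hy, mul_add]

end Pairing

/-- For `c : N → B`, the endomorphism of `B ⊗ M` that `φ : M → M ⊗ N` and `c` induce. -/
def twistEnd {B : Type*} [CommRing B] [Algebra A B] (φ : M →ₗ[A] M ⊗[A] N) (c : N →ₗ[A] B) :
    B ⊗[A] M →ₗ[B] B ⊗[A] M :=
  LinearMap.liftBaseChange B (c.rTensor M ∘ₗ (TensorProduct.comm A M N).toLinearMap ∘ₗ φ)

/-- The contraction of `(B ⊗ M) ⊗ (B ⊗ N)` with `c : N → B`. -/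
def contract {B : Type*} [CommRing B] [Algebra A B] (c : N →ₗ[A] B) :
    (B ⊗[A] M) ⊗[B] (B ⊗[A] N) →ₗ[B] B ⊗[A] M :=
  (TensorProduct.rid B (B ⊗[A] M)).toLinearMap ∘ₗ
    (LinearMap.liftBaseChange B c).lTensor (B ⊗[A] M)

section Contract

variable {B : Type*} [CommRing B] [Algebra A B]

lemma liftBaseChange_eq_pairing (c : N →ₗ[A] B) (q : B ⊗[A] N) :
    LinearMap.liftBaseChange B c q = pairing (AlgHom.id A B) c q := by
  induction q with
  | zero => simp
  | tmul x n => simp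
  | add x y hx hy => simp [hx, hy]

@[simp] lemma contract_tmul (c : N →ₗ[A] B) (x : B ⊗[A] M) (q : B ⊗[A] N) :
    contract c (x ⊗ₜ[B] q) = pairing (AlgHom.id A B) c q • x := by
  simp [contract, liftBaseChange_eq_pairing]

lemma contract_baseChangeTwisted (φ : M →ₗ[A] M ⊗[A] N) (c : N →ₗ[A] B) (x : B ⊗[A] M) :
    contract c (baseChangeTwisted B φ x) = twistEnd φ c x := by
  have key : ∀ (b : B) (t : M ⊗[A] N),
      contract c (AlgebraTensorModule.distribBaseChange A B M N (b ⊗ₜ t)) =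
        b • c.rTensor M (TensorProduct.comm A M N t) := by
    intro b t
    induction t with
    | zero => simp
    | tmul m n =>
      rw [AlgebraTensorModule.distribBaseChange_tmul]
      simp [TensorProduct.smul_tmul', mul_comm]
    | add x y hx hy => simp only [TensorProduct.tmul_add, map_add, hx, hy, smul_add]
  induction x with
  | zero => simp
  | tmul b m => simpa [baseChangeTwisted, twistEnd] using key b (φ m)
  | add x y hx hy => simp only [map_add, hx, hy]

end Contract

section DualBasis

variable {B : Type*} [CommRing B] [Algebra A B]

variable (A N) in
/-- A finitely generated projective module has a dual basis. -/
lemma exists_dual_basis [Module.Finite A N] [Module.Projective A N] :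
    ∃ (k : ℕ) (e : Fin k → N) (c : Fin k → N →ₗ[A] A), ∀ x, x = ∑ i, c i x • e i := by
  obtain ⟨n, g, hg⟩ := Module.Finite.exists_fin' A N
  obtain ⟨s, hs⟩ := Module.projective_lifting_property g LinearMap.id hg
  refine ⟨n, fun k => g (Pi.single k 1), fun k => LinearMap.proj k ∘ₗ s, fun l => ?_⟩
  conv_lhs => rw [← LinearMap.id_apply (R := A) l, ← hs, LinearMap.comp_apply,
    ← Finset.univ_sum_single (s l), map_sum]
  refine Finset.sum_congr rfl fun k _ => ?_
  rw [← map_smul, ← Pi.single_smul, smul_eq_mul, mul_one]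
  rfl

variable {k : ℕ} {e : Fin k → N} {c : Fin k → N →ₗ[A] A}

lemma eq_sum_pairing_smul (h : ∀ x, x = ∑ i, c i x • e i) (q : B ⊗[A] N) :
    q = ∑ i, pairing (AlgHom.id A B) (Algebra.linearMap A B ∘ₗ c i) q • (1 : B) ⊗ₜ[A] e i := by
  induction q with
  | zero => simp
  | tmul b n =>
    conv_lhs => rw [h n, TensorProduct.tmul_sum]
    refine Finset.sum_congr rfl fun i _ => ?_
    simp [TensorProduct.smul_tmul', Algebra.smul_def, mul_comm]
  | add x y hx hy =>
    conv_lhs => rw [hx, hy]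
    simp only [map_add, add_smul, Finset.sum_add_distrib]

lemma eq_sum_contract_tmul (h : ∀ x, x = ∑ i, c i x • e i) (t : (B ⊗[A] M) ⊗[B] (B ⊗[A] N)) :
    t = ∑ i, contract (Algebra.linearMap A B ∘ₗ c i) t ⊗ₜ[B] ((1 : B) ⊗ₜ[A] e i) := by
  induction t with
  | zero => simp
  | tmul x q =>
    conv_lhs => rw [eq_sum_pairing_smul h q, TensorProduct.tmul_sum]
    refine Finset.sum_congr rfl fun i _ => ?_
    rw [contract_tmul, TensorProduct.smul_tmul]
  | add x y hx hy =>
    conv_lhs => rw [hx, hy]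
    simp only [map_add, TensorProduct.add_tmul, Finset.sum_add_distrib]

/-- Contractions with linear forms over the base detect equality. -/
lemma ext_contract [Module.Finite A N] [Module.Projective A N]
    {t t' : (B ⊗[A] M) ⊗[B] (B ⊗[A] N)}
    (h : ∀ c : N →ₗ[A] A, contract (Algebra.linearMap A B ∘ₗ c) t =
      contract (Algebra.linearMap A B ∘ₗ c) t') : t = t' := by
  obtain ⟨k, e, c, hc⟩ := exists_dual_basis A N
  rw [eq_sum_contract_tmul hc t, eq_sum_contract_tmul hc t']
  exact Finset.sum_congr rfl fun i _ => by rw [h]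

lemma ext_pairing [Module.Finite A N] [Module.Projective A N] {q q' : B ⊗[A] N}
    (h : ∀ c : N →ₗ[A] A, pairing (AlgHom.id A B) (Algebra.linearMap A B ∘ₗ c) q =
      pairing (AlgHom.id A B) (Algebra.linearMap A B ∘ₗ c) q') : q = q' := by
  obtain ⟨k, e, c, hc⟩ := exists_dual_basis A N
  rw [eq_sum_pairing_smul hc q, eq_sum_pairing_smul hc q']
  exact Finset.sum_congr rfl fun i _ => by rw [h]

lemma isInvariant_iff_forall_twistEnd_mem [Module.Finite A N] [Module.Projective A N]
    (φ : M →ₗ[A] M ⊗[A] N) (L : Submodule B (B ⊗[A] M)) :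
    IsInvariant (baseChangeTwisted B φ) L ↔
      ∀ c : N →ₗ[A] A, ∀ l ∈ L, twistEnd φ (Algebra.linearMap A B ∘ₗ c) l ∈ L := by
  constructor
  · intro h c l hl
    obtain ⟨t, ht⟩ := h l hl
    rw [← contract_baseChangeTwisted, ← ht]
    clear ht
    induction t with
    | zero => simp
    | tmul x q => simpa using L.smul_mem _ x.2
    | add x y hx hy => simpa only [map_add] using L.add_mem hx hy
  · intro h l hl
    obtain ⟨k, e, c, hc⟩ := exists_dual_basis A N
    rw [eq_sum_contract_tmul hc (baseChangeTwisted B φ l)]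
    refine Submodule.sum_mem _ fun i _ => ?_
    rw [contract_baseChangeTwisted]
    exact ⟨⟨_, h (c i) l hl⟩ ⊗ₜ ((1 : B) ⊗ₜ e i), by simp⟩

/-- An eigenvector of a Higgs field is a simultaneous eigenvector of its contractions. -/
lemma eigen_iff_forall_twistEnd [Module.Finite A N] [Module.Projective A N]
    (φ : M →ₗ[A] M ⊗[A] N) (θ : B ⊗[A] N) (x : B ⊗[A] M) :
    baseChangeTwisted B φ x = x ⊗ₜ θ ↔ ∀ c : N →ₗ[A] A,
      twistEnd φ (Algebra.linearMap A B ∘ₗ c) x =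
        pairing (AlgHom.id A B) (Algebra.linearMap A B ∘ₗ c) θ • x := by
  constructor
  · intro h c
    rw [← contract_baseChangeTwisted, h, contract_tmul]
  · intro h
    refine ext_contract fun c => ?_
    rw [contract_baseChangeTwisted, h, contract_tmul]

lemma twistEnd_eq_of_eigen {φ : M →ₗ[A] M ⊗[A] N} {θ : B ⊗[A] N} {x : B ⊗[A] M}
    (h : baseChangeTwisted B φ x = x ⊗ₜ θ) (c : N →ₗ[A] B) :
    twistEnd φ c x = pairing (AlgHom.id A B) c θ • x := by
  rw [← contract_baseChangeTwisted, h, contract_tmul]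

lemma mem_ker_subEigen_iff {B P Q : Type*} [CommRing B] [AddCommGroup P] [Module B P]
    [AddCommGroup Q] [Module B Q] (Φ : P →ₗ[B] P ⊗[B] Q) (θ : Q) (x : P) :
    x ∈ LinearMap.ker (subEigen Φ θ) ↔ Φ x = x ⊗ₜ θ := by
  rw [LinearMap.mem_ker, subEigen, LinearMap.sub_apply, sub_eq_zero, eq_comm]
  rfl

end DualBasis

end Twisted

lemma _root_.Matrix.det_mul_eq_zero_of_mulVec_eq_zero {n R : Type*} [Fintype n] [DecidableEq n]
    [CommRing R] {M : Matrix n n R} {v : n → R} (h : M.mulVec v = 0) (j : n) :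
    M.det * v j = 0 := by
  have := congrArg M.adjugate.mulVec h
  rw [Matrix.mulVec_mulVec, Matrix.adjugate_mul, Matrix.mulVec_zero] at this
  simpa [Matrix.smul_mulVec] using congrFun this j

/-! ### The matrix of a Higgs field and the spectral equation -/

section TwistMatrix

variable {A : Type*} [CommRing A] {M N : Type*} [AddCommGroup M] [Module A M]
  [AddCommGroup N] [Module A N] {ι : Type*}

/-- The functional `m ⊗ n ↦ m_k c(n)` on `M ⊗ N`, with `m_k` a coordinate of `m`. -/
def coordForm (b : Module.Basis ι A M) (k : ι) {B : Type*} [CommRing B] [Algebra A B] (c : N →ₗ[A] B) :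
    M ⊗[A] N →ₗ[A] B :=
  (TensorProduct.lid A B).toLinearMap ∘ₗ TensorProduct.map (b.coord k) c

/-- The matrix with entries in `B` obtained from the matrix of `φ : M → M ⊗ N`, which has entries
in `N`, by means of `c : N → B`. -/
def twistMatrix (b : Module.Basis ι A M) (φ : M →ₗ[A] M ⊗[A] N) {B : Type*} [CommRing B]
    [Algebra A B] (c : N →ₗ[A] B) : Matrix ι ι B :=
  Matrix.of fun k j => coordForm b k c (φ (b j))

variable (b : Module.Basis ι A M) (φ : M →ₗ[A] M ⊗[A] N) {B : Type*} [CommRing B] [Algebra A B]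

@[simp] lemma coordForm_tmul (k : ι) (c : N →ₗ[A] B) (m : M) (n : N) :
    coordForm b k c (m ⊗ₜ n) = b.repr m k • c n := rfl

lemma coordForm_add (k : ι) (c c' : N →ₗ[A] B) (t : M ⊗[A] N) :
    coordForm b k (c + c') t = coordForm b k c t + coordForm b k c' t := by
  simp [coordForm, TensorProduct.map_add_right]

lemma coordForm_smul (k : ι) (a : B) (c : N →ₗ[A] B) (t : M ⊗[A] N) :
    coordForm b k (a • c) t = a * coordForm b k c t := by
  induction t with
  | zero => simp
  | tmul m n => simp
  | add x y hx hy => simp only [map_add, hx, hy, mul_add]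

lemma coordForm_comp {B' : Type*} [CommRing B'] [Algebra A B'] (k : ι) (f : B →ₐ[A] B')
    (c : N →ₗ[A] B) (t : M ⊗[A] N) :
    coordForm b k (f.toLinearMap ∘ₗ c) t = f (coordForm b k c t) := by
  induction t with
  | zero => simp
  | tmul m n => simp
  | add x y hx hy => simp only [map_add, hx, hy]

lemma twistMatrix_add (c c' : N →ₗ[A] B) :
    twistMatrix b φ (c + c') = twistMatrix b φ c + twistMatrix b φ c' := by
  ext k j; exact coordForm_add b k c c' _

lemma twistMatrix_smul (a : B) (c : N →ₗ[A] B) :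
    twistMatrix b φ (a • c) = a • twistMatrix b φ c := by
  ext k j; exact coordForm_smul b k a c _

lemma twistMatrix_comp {B' : Type*} [CommRing B'] [Algebra A B'] (f : B →ₐ[A] B')
    (c : N →ₗ[A] B) :
    twistMatrix b φ (f.toLinearMap ∘ₗ c) = (twistMatrix b φ c).map f := by
  ext k j; exact coordForm_comp b k f c _

lemma repr_rTensor_comm (k : ι) (c : N →ₗ[A] B) (t : M ⊗[A] N) :
    (Algebra.TensorProduct.basis B b).repr (c.rTensor M (TensorProduct.comm A M N t)) k =
      coordForm b k c t := by
  induction t with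
  | zero => simp
  | tmul m n => simp [Algebra.smul_def, mul_comm]
  | add x y hx hy => simp only [map_add, Finsupp.add_apply, hx, hy]

variable [Fintype ι]

lemma toMatrix_twistEnd [DecidableEq ι] (c : N →ₗ[A] B) :
    LinearMap.toMatrix (Algebra.TensorProduct.basis B b) (Algebra.TensorProduct.basis B b)
      (twistEnd φ c) = twistMatrix b φ c := by
  ext k j
  rw [LinearMap.toMatrix_apply, Algebra.TensorProduct.basis_apply, twistEnd,
    LinearMap.liftBaseChange_tmul, one_smul]
  exact repr_rTensor_comm b k c _

lemma repr_twistEnd (c : N →ₗ[A] B) (x : B ⊗[A] M) :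
    ⇑((Algebra.TensorProduct.basis B b).repr (twistEnd φ c x)) =
      Matrix.mulVec (twistMatrix b φ c) ((Algebra.TensorProduct.basis B b).repr x) := by
  classical rw [← toMatrix_twistEnd, LinearMap.toMatrix_mulVec_repr]

/-- As `φ ∧ φ = 0`, the matrices that represent contractions of `φ` commute. -/
lemma commute_twistMatrix (hφ : wedgeSquare φ = 0) (c c' : N →ₗ[A] B) :
    Commute (twistMatrix b φ c) (twistMatrix b φ c') := by
  -- the bilinear form `n ⊗ n' ↦ c(n) c'(n')`
  let F (c c' : N →ₗ[A] B) : N ⊗[A] N →ₗ[A] B := LinearMap.mul' A B ∘ₗ TensorProduct.map c c'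
  have key : ∀ (c c' : N →ₗ[A] B) (i : ι) (t : M ⊗[A] N),
      coordForm b i (LinearMap.id : B →ₗ[A] B)
        ((F c c').lTensor M (TensorProduct.assoc A M N N (φ.rTensor N t))) =
        ∑ k, twistMatrix b φ c i k * coordForm b k c' t := by
    intro c c' i t
    induction t with
    | zero => simp
    | tmul m n =>
      have h1 : ∀ s : M ⊗[A] N, coordForm b i (LinearMap.id : B →ₗ[A] B)
          ((F c c').lTensor M (TensorProduct.assoc A M N N (s ⊗ₜ n))) =
          coordForm b i c s * c' n := by
        intro s
        induction s with
        | zero => simp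
        | tmul x y => simp [F]
        | add x y hx hy => simp only [TensorProduct.add_tmul, map_add, hx, hy, add_mul]
      rw [LinearMap.rTensor_tmul, h1]
      conv_lhs => rw [← b.sum_repr m]
      simp only [map_sum, map_smul, Finset.sum_mul]
      refine Finset.sum_congr rfl fun k _ => ?_
      simp [twistMatrix]
    | add x y hx hy => simp only [map_add, hx, hy, mul_add, Finset.sum_add_distrib]
  -- the commutator is alternating, so it factors through the exterior square
  let alt : N [⋀^Fin 2]→ₗ[A] B :=
    { toFun := fun v => c (v 0) * c' (v 1) - c' (v 0) * c (v 1)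
      map_update_add' := by
        intro _ v i x y
        fin_cases i <;> simp [Function.update_of_ne] <;> ring
      map_update_smul' := by
        intro _ v i x y
        fin_cases i <;> simp [Function.update_of_ne, smul_sub]
      map_eq_zero_of_eq' := by
        intro v i j hv hij
        fin_cases i <;> fin_cases j <;> simp_all [mul_comm] }
  have hF : F c c' - F c' c = exteriorPower.alternatingMapLinearEquiv alt ∘ₗ wedge A N := by
    ext x y
    simp [F, wedge, alt]
  have hw : ∀ i j, coordForm b i (LinearMap.id : B →ₗ[A] B)
      ((F c c' - F c' c).lTensor M (TensorProduct.assoc A M N N (φ.rTensor N (φ (b j))))) = 0 := by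
    intro i j
    have := LinearMap.congr_fun hφ (b j)
    simp only [wedgeSquare, LinearMap.comp_apply, LinearEquiv.coe_coe, LinearMap.zero_apply] at this
    rw [hF, LinearMap.lTensor_comp, LinearMap.comp_apply, this, map_zero, map_zero]
  ext i j
  have := hw i j
  rw [LinearMap.lTensor_sub, LinearMap.sub_apply, map_sub, key, key, sub_eq_zero] at this
  exact this

variable [DecidableEq ι]

/-- The characteristic matrix `c(θ) - φ_c`. -/
def charMatrix {B' : Type*} [CommRing B'] [Algebra A B'] (f : B →ₐ[A] B') (θ : B ⊗[A] N)
    (c : N →ₗ[A] B') : Matrix ι ι B' :=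
  Matrix.scalar ι (pairing f c θ) - twistMatrix b φ c

lemma charMatrix_comp {B' B'' : Type*} [CommRing B'] [Algebra A B'] [CommRing B''] [Algebra A B'']
    (f : B →ₐ[A] B') (g : B' →ₐ[A] B'') (θ : B ⊗[A] N) (c : N →ₗ[A] B') :
    charMatrix b φ (g.comp f) θ (g.toLinearMap ∘ₗ c) = (charMatrix b φ f θ c).map g := by
  rw [charMatrix, charMatrix, pairing_comp, twistMatrix_comp]
  ext i j
  by_cases h : i = j <;> simp [h]

lemma charMatrix_add {B' : Type*} [CommRing B'] [Algebra A B'] (f : B →ₐ[A] B') (θ : B ⊗[A] N)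
    (c c' : N →ₗ[A] B') :
    charMatrix b φ f θ (c + c') = charMatrix b φ f θ c + charMatrix b φ f θ c' := by
  rw [charMatrix, charMatrix, charMatrix, pairing_add, twistMatrix_add, map_add]; abel

lemma charMatrix_smul {B' : Type*} [CommRing B'] [Algebra A B'] (f : B →ₐ[A] B') (θ : B ⊗[A] N)
    (a : B') (c : N →ₗ[A] B') :
    charMatrix b φ f θ (a • c) = a • charMatrix b φ f θ c := by
  rw [charMatrix, charMatrix, pairing_smul_form, twistMatrix_smul, smul_sub]
  congr 1
  ext i j
  by_cases h : i = j <;> simp [h]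

lemma commute_charMatrix (hφ : wedgeSquare φ = 0) {B' : Type*} [CommRing B'] [Algebra A B']
    (f : B →ₐ[A] B') (θ : B ⊗[A] N) (c c' : N →ₗ[A] B') :
    Commute (charMatrix b φ f θ c) (charMatrix b φ f θ c') := by
  refine Commute.sub_left (Matrix.scalar_commute _ (fun _ => Commute.all _ _) _) ?_
  exact Commute.sub_right (Matrix.scalar_commute _ (fun _ => Commute.all _ _) _).symm
    (commute_twistMatrix b φ hφ c c')

/-- The characteristic matrices of an eigenvector with eigenvalue `θ` kill it. -/
lemma charMatrix_mulVec_eq_zero [Module.Finite A N] [Module.Projective A N] {θ : B ⊗[A] N}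
    {x : B ⊗[A] M} (hx : baseChangeTwisted B φ x = x ⊗ₜ θ) {B' : Type*} [CommRing B']
    [Algebra A B'] (f : B →ₐ[A] B') (c : N →ₗ[A] B') :
    (charMatrix b φ f θ c).mulVec
      (fun i => f ((Algebra.TensorProduct.basis B b).repr x i)) = 0 := by
  obtain ⟨k, e, d, hd⟩ := exists_dual_basis A N
  have h0 : ∀ c : N →ₗ[A] B, (charMatrix b φ (AlgHom.id A B) θ c).mulVec
      ((Algebra.TensorProduct.basis B b).repr x) = 0 := by
    intro c
    rw [charMatrix, Matrix.sub_mulVec, ← repr_twistEnd, twistEnd_eq_of_eigen hx, sub_eq_zero]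
    ext i
    simp [Matrix.mulVec_diagonal]
  have hc : c = ∑ i, c (e i) • (f.toLinearMap ∘ₗ (Algebra.linearMap A B ∘ₗ d i)) := by
    ext n
    conv_lhs => rw [hd n, map_sum]
    simp [Algebra.smul_def, mul_comm]
  have hsum : ∀ s : Finset (Fin k), (charMatrix b φ f θ
      (∑ i ∈ s, c (e i) • (f.toLinearMap ∘ₗ (Algebra.linearMap A B ∘ₗ d i)))).mulVec
      (fun i => f ((Algebra.TensorProduct.basis B b).repr x i)) = 0 := by
    intro s
    induction s using Finset.cons_induction with
    | empty =>
      have : charMatrix b φ f θ 0 = 0 := by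
        simpa using charMatrix_smul b φ f θ 0 0
      simp [this]
    | cons i s hi ih =>
      rw [Finset.sum_cons, charMatrix_add, charMatrix_smul, Matrix.add_mulVec, ih, add_zero,
        Matrix.smul_mulVec]
      have := charMatrix_comp b φ (AlgHom.id A B) f θ (Algebra.linearMap A B ∘ₗ d i)
      rw [AlgHom.comp_id] at this
      rw [this]
      have h1 := congrArg (fun v : ι → B => fun j => f (v j)) (h0 (Algebra.linearMap A B ∘ₗ d i))
      rw [show ((charMatrix b φ (AlgHom.id A B) θ (Algebra.linearMap A B ∘ₗ d i)).map f).mulVec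
        (fun i => f ((Algebra.TensorProduct.basis B b).repr x i)) = 0 from ?_, smul_zero]
      ext j
      have := congrFun h1 j
      simpa [Matrix.mulVec, dotProduct] using this
  rw [hc]
  exact hsum _

/-- A common null vector of the characteristic matrices is an eigenvector. -/
lemma eigen_of_charMatrix_mulVec_eq_zero [Module.Finite A N] [Module.Projective A N] {θ : B ⊗[A] N}
    {x : B ⊗[A] M} (hx : ∀ c : N →ₗ[A] A,
      (charMatrix b φ (AlgHom.id A B) θ (Algebra.linearMap A B ∘ₗ c)).mulVec
      ((Algebra.TensorProduct.basis B b).repr x) = 0) :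
    baseChangeTwisted B φ x = x ⊗ₜ θ := by
  refine (eigen_iff_forall_twistEnd φ θ x).2 fun c => ?_
  apply (Algebra.TensorProduct.basis B b).repr.injective
  ext i
  have := congrFun (hx c) i
  rw [charMatrix, Matrix.sub_mulVec, ← repr_twistEnd, Pi.sub_apply, Pi.zero_apply,
    sub_eq_zero] at this
  rw [← this]
  simp [Matrix.mulVec_diagonal]

section CharValue

variable [Module.Free A M] [Module.Finite A M]

/-- The left hand side of the spectral equation is the determinant of the characteristic matrix of the universal linear
form, that is the inclusion of `N` into its symmetric algebra. -/
lemma charValue_eq_det (θ : B ⊗[A] N) :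
    charValue B φ θ = (charMatrix b φ (Algebra.TensorProduct.includeLeft : B →ₐ[A] _) θ
      ((Algebra.TensorProduct.includeRight : SymmetricAlgebra A N →ₐ[A] _).toLinearMap ∘ₗ
        SymmetricAlgebra.ι A N)).det := by
  have hp : pairing (Algebra.TensorProduct.includeLeft : B →ₐ[A] B ⊗[A] SymmetricAlgebra A N)
      ((Algebra.TensorProduct.includeRight : SymmetricAlgebra A N →ₐ[A] _).toLinearMap ∘ₗ
        SymmetricAlgebra.ι A N) θ = (SymmetricAlgebra.ι A N).baseChange B θ := by
    induction θ with
    | zero => simp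
    | tmul x n => simp
    | add x y hx hy => simp only [map_add, hx, hy]
  rw [charValue, charMatrix, hp, twistMatrix_comp, Polynomial.eval₂_eq_eval_map,
    ← LinearMap.charpoly_toMatrix (symEnd φ) (Algebra.TensorProduct.basis _ b),
    ← Matrix.charpoly_map, Matrix.eval_charpoly]
  congr 2
  rw [show symEnd φ = twistEnd φ (SymmetricAlgebra.ι A N) from rfl, toMatrix_twistEnd]
  rfl

/-- If `θ` satisfies the spectral equation, all characteristic matrices are singular. -/
lemma det_charMatrix_eq_zero {θ : B ⊗[A] N} (h : charValue B φ θ = 0) {B' : Type*} [CommRing B']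
    [Algebra A B'] (f : B →ₐ[A] B') (c : N →ₗ[A] B') : (charMatrix b φ f θ c).det = 0 := by
  rw [charValue_eq_det b] at h
  let g : B ⊗[A] SymmetricAlgebra A N →ₐ[A] B' :=
    Algebra.TensorProduct.lift f (SymmetricAlgebra.lift c) fun _ _ => Commute.all _ _
  have hf : g.comp Algebra.TensorProduct.includeLeft = f := by
    ext x; simp [g]
  have hc : g.toLinearMap ∘ₗ
      ((Algebra.TensorProduct.includeRight : SymmetricAlgebra A N →ₐ[A] _).toLinearMap ∘ₗ
        SymmetricAlgebra.ι A N) = c := by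
    ext x; simp [g]
  rw [← hf, ← hc, charMatrix_comp, ← AlgHom.mapMatrix_apply, ← AlgHom.map_det, h, map_zero]

variable {k : ℕ} {e : Fin k → N} {c : Fin k → N →ₗ[A] A}

variable (B c) in
/-- The linear form `Σ cᵢ Xᵢ` with indeterminate coefficients. -/
def genericForm : N →ₗ[A] MvPolynomial (Fin k) B :=
  ∑ i, (LinearMap.toSpanSingleton A (MvPolynomial (Fin k) B) (MvPolynomial.X i)) ∘ₗ c i

/-- The characteristic matrix of the linear form with indeterminate coefficients detects the
spectral equation. -/
lemma charValue_eq_zero_iff_det_genericForm (hc : ∀ x, x = ∑ i, c i x • e i) (θ : B ⊗[A] N) :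
    charValue B φ θ = 0 ↔
      (charMatrix b φ (IsScalarTower.toAlgHom A B (MvPolynomial (Fin k) B)) θ
        (genericForm B c)).det = 0 := by
  refine ⟨fun h => det_charMatrix_eq_zero b φ h _ _, fun h => ?_⟩
  let β : MvPolynomial (Fin k) B →ₐ[A] B ⊗[A] SymmetricAlgebra A N :=
    (MvPolynomial.aeval fun i => (1 : B) ⊗ₜ[A] SymmetricAlgebra.ι A N (e i) :
      MvPolynomial (Fin k) B →ₐ[B] B ⊗[A] SymmetricAlgebra A N).restrictScalars A
  have h1 : β.comp (IsScalarTower.toAlgHom A B (MvPolynomial (Fin k) B)) =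
      Algebra.TensorProduct.includeLeft := by
    ext x
    simp [β]
  have h2 : β.toLinearMap ∘ₗ genericForm B c =
      (Algebra.TensorProduct.includeRight : SymmetricAlgebra A N →ₐ[A] _).toLinearMap ∘ₗ
        SymmetricAlgebra.ι A N := by
    ext x
    conv_rhs => rw [LinearMap.comp_apply, hc x]
    simp only [LinearMap.comp_apply, genericForm, LinearMap.sum_apply, map_sum, map_smul,
      LinearMap.toSpanSingleton_apply]
    refine Finset.sum_congr rfl fun i _ => ?_
    simp [β]
  rw [charValue_eq_det b, ← h1, ← h2, charMatrix_comp, ← AlgHom.mapMatrix_apply,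
    ← AlgHom.map_det, h, map_zero]

/-- The eigenvalue of a line satisfies the spectral equation: the determinant kills each eigenvector,
and the coordinates of the vectors on a line generate the unit ideal. -/
lemma charValue_eq_zero_of_isLine [Module.Finite A N] [Module.Projective A N] {θ : B ⊗[A] N}
    {L : Submodule B (B ⊗[A] M)} (hL : IsLine L)
    (h : ∀ l ∈ L, baseChangeTwisted B φ l = l ⊗ₜ θ) : charValue B φ θ = 0 := by
  classical
  let b := Module.Free.chooseBasis A M
  obtain ⟨n, v, ℓ, hv, h1, -⟩ := hL
  set D := charValue B φ θ with hD
  rw [charValue_eq_det b] at hD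
  -- the determinant annihilates the coordinates of the elements of `L`
  have hx : ∀ i j, D * Algebra.TensorProduct.includeLeft (S := A)
      ((Algebra.TensorProduct.basis B b).repr (v i) j) = 0 := by
    intro i j
    have h0 := charMatrix_mulVec_eq_zero b φ (h (v i) (hv i))
      (Algebra.TensorProduct.includeLeft : B →ₐ[A] B ⊗[A] SymmetricAlgebra A N)
      ((Algebra.TensorProduct.includeRight : SymmetricAlgebra A N →ₐ[A] _).toLinearMap ∘ₗ
        SymmetricAlgebra.ι A N)
    rw [hD]
    exact Matrix.det_mul_eq_zero_of_mulVec_eq_zero h0 j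
  have h2 : D * Algebra.TensorProduct.includeLeft (S := A) (1 : B) = 0 := by
    rw [← h1, map_sum, Finset.mul_sum]
    refine Finset.sum_eq_zero fun i _ => ?_
    rw [← (Algebra.TensorProduct.basis B b).sum_repr (v i), map_sum, map_sum, Finset.mul_sum]
    refine Finset.sum_eq_zero fun j _ => ?_
    rw [map_smul, smul_eq_mul, map_mul, ← mul_assoc, hx, zero_mul]
  rwa [map_one, mul_one] at h2

end CharValue

end TwistMatrix

/-- A polynomial over an algebra over an infinite field `K` vanishes if its values at the points with
coordinates in `K` do. `K`-linear functionals of the coefficients reduce this to polynomials over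
`K`. -/
lemma _root_.MvPolynomial.eq_zero_of_forall_eval_algebraMap {K R σ : Type*} [Field K] [Infinite K]
    [CommRing R] [Algebra K R] (P : MvPolynomial σ R)
    (h : ∀ t : σ → K, P.eval (fun i => algebraMap K R (t i)) = 0) : P = 0 := by
  ext m
  rw [MvPolynomial.coeff_zero]
  refine (Module.forall_dual_apply_eq_zero_iff K _).1 fun f => ?_
  let Q : MvPolynomial σ K := ∑ m ∈ P.support, MvPolynomial.monomial m (f (P.coeff m))
  have hQ : Q = 0 := by
    refine MvPolynomial.funext fun t => ?_
    have := congrArg f (h t)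
    rw [MvPolynomial.eval_eq] at this
    rw [map_zero, ← map_zero f, ← this, map_sum, map_sum]
    refine Finset.sum_congr rfl fun m _ => ?_
    rw [MvPolynomial.eval_monomial, Finsupp.prod, mul_comm (P.coeff m)]
    simp only [← map_pow, ← map_prod]
    rw [← Algebra.smul_def, map_smul, smul_eq_mul, mul_comm]
  have := congrArg (MvPolynomial.coeff m) hQ
  rw [MvPolynomial.coeff_zero, MvPolynomial.coeff_sum] at this
  by_cases hm : m ∈ P.support
  · classical simpa [MvPolynomial.coeff_monomial, hm] using this
  · rw [MvPolynomial.notMem_support_iff.1 hm, map_zero]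

/-- Over an algebra over an infinite field, the spectral equation can be tested with linear
forms. -/
lemma charValue_eq_zero_of_forall_det {A : Type*} [CommRing A] {M N : Type*} [AddCommGroup M]
    [Module A M] [AddCommGroup N] [Module A N] [Module.Finite A N] [Module.Projective A N]
    [Module.Free A M] [Module.Finite A M] {ι : Type*} [Fintype ι] [DecidableEq ι]
    (b : Module.Basis ι A M) (φ : M →ₗ[A] M ⊗[A] N) (K : Type*) {R : Type*} [Field K] [Infinite K]
    [CommRing R] [Algebra K R] [Algebra A R] (θ : R ⊗[A] N)
    (h : ∀ c : N →ₗ[A] R, (charMatrix b φ (AlgHom.id A R) θ c).det = 0) : charValue R φ θ = 0 := by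
  obtain ⟨k, e, c, hc⟩ := exists_dual_basis A N
  rw [charValue_eq_zero_iff_det_genericForm b φ hc]
  refine MvPolynomial.eq_zero_of_forall_eval_algebraMap (K := K) _ fun t => ?_
  let ev : MvPolynomial (Fin k) R →ₐ[A] R :=
    (MvPolynomial.aeval fun i => algebraMap K R (t i)).restrictScalars A
  have h1 : ev.comp (IsScalarTower.toAlgHom A R (MvPolynomial (Fin k) R)) = AlgHom.id A R := by
    ext x
    simp [ev]
  have h2 := h (ev.toLinearMap ∘ₗ genericForm R c)
  rw [← h1, charMatrix_comp, ← AlgHom.mapMatrix_apply, ← AlgHom.map_det] at h2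
  simpa [ev, MvPolynomial.aeval_eq_eval] using h2

/-! ### Derivations and the dimension of the spectral cover -/

section RankAtPoint

variable {B P k : Type*} [CommRing B] [AddCommGroup P] [Module B P] [Module.Finite B P] [Field k]
  [Algebra B k]

lemma finrank_tensor_eq_rankAtStalk [Module.Projective B P] :
    Module.finrank k (k ⊗[B] P) =
      Module.rankAtStalk (R := B) P (PrimeSpectrum.comap (algebraMap B k) ⊥) := by
  rw [← Module.rankAtStalk_baseChange, Module.rankAtStalk_eq_finrank_of_free]
  rfl

lemma finrank_hom_eq_rankAtStalk [Module.Projective B P] :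
    Module.finrank k (P →ₗ[B] k) =
      Module.rankAtStalk (R := B) P (PrimeSpectrum.comap (algebraMap B k) ⊥) := by
  rw [(LinearMap.liftBaseChangeEquiv (R := B) (M := P) (N := k) k).finrank_eq,
    ← finrank_tensor_eq_rankAtStalk]
  exact Subspace.dual_finrank_eq

instance : Module.Finite k (P →ₗ[B] k) :=
  Module.Finite.equiv (LinearMap.liftBaseChangeEquiv (R := B) (M := P) (N := k) k).symm

end RankAtPoint

/-- A smooth algebra over an algebraically closed field is reduced: if `s` is nilpotent, `s ⊗ T` is
integral over `B`, and integral closures commute with smooth base change. -/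
lemma isReduced_of_smooth (k B : Type*) [Field k] [IsAlgClosed k] [CommRing B] [Algebra k B]
    [Algebra.Smooth k B] : IsReduced B := by
  refine ⟨fun s hs => ?_⟩
  have hint : IsIntegral B (s ⊗ₜ[k] (Polynomial.X : Polynomial k)) := by
    obtain ⟨m, hm⟩ := hs
    refine ⟨Polynomial.X ^ m, Polynomial.monic_X_pow m, ?_⟩
    simp [Algebra.TensorProduct.tmul_pow, hm]
  obtain ⟨t, ht⟩ := (TensorProduct.toIntegralClosure_bijective_of_smooth
    (R := k) (S := B) (B := Polynomial k)).2 ⟨_, hint⟩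
  have ht := congrArg (fun x => (Polynomial.lcoeff k 1).lTensor B x.1) ht
  have hcoeff : ∀ p : integralClosure k (Polynomial k), p.1.coeff 1 = 0 := by
    intro p
    obtain ⟨z, hz⟩ := (IsAlgClosed.algebraMap_bijective_of_isIntegral
      (k := k) (K := integralClosure k (Polynomial k))).2 p
    rw [← hz]
    exact Polynomial.coeff_C_succ
  have h0 : ∀ t : B ⊗[k] integralClosure k (Polynomial k), (Polynomial.lcoeff k 1).lTensor B
      (TensorProduct.toIntegralClosure k B (Polynomial k) t).1 = 0 := by
    intro t
    induction t with
    | zero => simp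
    | tmul b p => simp [TensorProduct.toIntegralClosure, hcoeff]
    | add x y hx hy => rw [map_add, Subalgebra.coe_add, map_add, hx, hy, add_zero]
  rw [h0] at ht
  simpa using (congrArg (TensorProduct.rid k B) ht).symm

/-- A derivation with values in a field `K` of characteristic zero vanishes on integral elements,
provided that the kernel of `B → K` is killed by localization. -/
lemma derivation_apply_eq_zero_of_isIntegral {A B K : Type*} [CommRing A] [CommRing B] [Field K]
    [CharZero K] [Algebra A B] [Algebra B K] [Algebra A K] [IsScalarTower A B K]
    (hK : ∀ y, algebraMap B K y = 0 → ∃ s, algebraMap B K s ≠ 0 ∧ s * y = 0)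
    (D : Derivation A B K) {x : B} (hx : IsIntegral A x) : D x = 0 := by
  -- replace an equation `q` of `x` by its derivative until `q'(x)` is nonzero in `K`; then
  -- `q'(x) D(x) = 0`
  have key : ∀ (n : ℕ) (q : Polynomial A), (q.map (algebraMap A K)).natDegree = n →
      q.map (algebraMap A K) ≠ 0 → algebraMap B K (Polynomial.aeval x q) = 0 → D x = 0 := by
    intro n
    induction n with
    | zero =>
      intro q hn h0 hq
      rw [← Polynomial.aeval_algebraMap_apply, ← Polynomial.aeval_map_algebraMap K,
        Polynomial.eq_C_of_natDegree_eq_zero hn, Polynomial.aeval_C] at hq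
      rw [Polynomial.eq_C_of_natDegree_eq_zero hn] at h0
      exact absurd hq (by simpa using h0)
    | succ n ih =>
      intro q hn h0 hq
      by_cases hq' : algebraMap B K (Polynomial.aeval x (Polynomial.derivative q)) = 0
      · refine ih (Polynomial.derivative q) ?_ ?_ hq'
        · rw [← Polynomial.derivative_map, Polynomial.natDegree_derivative, hn]; rfl
        · rw [← Polynomial.derivative_map]
          intro h
          have := Polynomial.derivative_eq_zero.1 h
          omega
      · obtain ⟨s, hs, hsq⟩ := hK _ hq
        have h1 := congrArg D hsq
        rw [D.leibniz, map_zero, ← algebraMap_smul K (Polynomial.aeval x q), hq, zero_smul,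
          add_zero, ← algebraMap_smul K s, smul_eq_zero, or_iff_right hs, Derivation.map_aeval,
          ← algebraMap_smul K (Polynomial.aeval x _), smul_eq_zero, or_iff_right hq'] at h1
        exact h1
  obtain ⟨q, hq, hq0⟩ := hx
  refine key _ q rfl (hq.map _).ne_zero ?_
  rw [Polynomial.aeval_def, hq0, map_zero]

/-- The ring `k[ε]`, made into an `A`-algebra by `a ↦ a + ε δ(a)`. -/
def TwistedDual {A k : Type} [CommRing A] [Algebra ℂ A] [Field k] [Algebra ℂ k] [Algebra A k]
    (_δ : Derivation ℂ A k) : Type := DualNumber k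

namespace TwistedDual

variable {A k : Type} [CommRing A] [Algebra ℂ A] [Field k] [Algebra ℂ k] [Algebra A k]
  (δ : Derivation ℂ A k)

instance : CommRing (TwistedDual δ) := inferInstanceAs (CommRing (DualNumber k))

instance : Algebra k (TwistedDual δ) := inferInstanceAs (Algebra k (DualNumber k))

instance : Algebra ℂ (TwistedDual δ) := inferInstanceAs (Algebra ℂ (DualNumber k))

instance : IsScalarTower ℂ k (TwistedDual δ) :=
  inferInstanceAs (IsScalarTower ℂ k (DualNumber k))

instance : Algebra A (TwistedDual δ) :=
  RingHom.toAlgebra (S := TwistedDual δ)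
    { toFun := fun a => (TrivSqZeroExt.inl (algebraMap A k a) + TrivSqZeroExt.inr (δ a) :
        DualNumber k)
      map_one' := by
        change (_ : DualNumber k) = 1
        ext <;> simp
      map_mul' := fun x y => by
        change (_ : DualNumber k) = _ * _
        refine TrivSqZeroExt.ext (by simp) ?_
        rw [TrivSqZeroExt.snd_mul]
        simp [← algebraMap_smul k, mul_comm]
      map_zero' := by
        change (_ : DualNumber k) = 0
        ext <;> simp
      map_add' := fun x y => by
        change (_ : DualNumber k) = _ + _
        ext <;> simp }

/-- The reduction modulo `ε`. -/
def fst : TwistedDual δ →ₐ[A] k where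
  toRingHom := (TrivSqZeroExt.fstHom k k k : DualNumber k →ₐ[k] k).toRingHom
  commutes' a := by
    change TrivSqZeroExt.fst (TrivSqZeroExt.inl (algebraMap A k a) + TrivSqZeroExt.inr (δ a) :
      DualNumber k) = _
    simp

/-- The coefficient of `ε`. -/
def snd : TwistedDual δ →ₗ[k] k := TrivSqZeroExt.sndHom k k

/-- Multiplication by `ε`. -/
def inr : k →ₗ[A] TwistedDual δ where
  toFun x := (TrivSqZeroExt.inr x : DualNumber k)
  map_add' x y := TrivSqZeroExt.inr_add k x y
  map_smul' a x := by
    refine Eq.trans ?_ (Algebra.smul_def (A := TwistedDual δ) a _).symm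
    rw [← algebraMap_smul k a x]
    change (_ : DualNumber k) = (TrivSqZeroExt.inl (algebraMap A k a) + TrivSqZeroExt.inr (δ a)) * _
    refine TrivSqZeroExt.ext (by simp) ?_
    rw [TrivSqZeroExt.snd_mul]
    simp

lemma snd_algebraMap (a : A) : snd δ (algebraMap A (TwistedDual δ) a) = δ a := by
  change TrivSqZeroExt.snd (TrivSqZeroExt.inl (algebraMap A k a) + TrivSqZeroExt.inr (δ a) :
      DualNumber k) = _
  simp

@[simp] lemma snd_inr (x : k) : snd δ (inr δ x) = x := rfl

lemma mul_inr (y : TwistedDual δ) (x : k) : y * inr δ x = inr δ (fst δ y * x) := by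
  change (_ : DualNumber k) = _
  refine TrivSqZeroExt.ext ?_ ?_
  · exact (TrivSqZeroExt.fst_mul (R := k) (M := k) y (TrivSqZeroExt.inr x)).trans (mul_zero _)
  · refine (TrivSqZeroExt.snd_mul (R := k) (M := k) y (TrivSqZeroExt.inr x)).trans ?_
    simp [fst]
    rfl

lemma snd_mul (x y : TwistedDual δ) :
    snd δ (x * y) = fst δ x * snd δ y + fst δ y * snd δ x := by
  refine (TrivSqZeroExt.snd_mul (R := k) (M := k) x y).trans ?_
  rw [op_smul_eq_smul]
  rfl

lemma ext {x y : TwistedDual δ} (h : fst δ x = fst δ y) (h' : snd δ x = snd δ y) : x = y :=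
  TrivSqZeroExt.ext h h'

lemma surjective_fst : Function.Surjective (fst δ) := fun x =>
  ⟨(TrivSqZeroExt.inl x : DualNumber k), rfl⟩

lemma sq_eq_zero_of_fst_eq_zero {x : TwistedDual δ} (h : fst δ x = 0) : x ^ 2 = 0 := by
  refine ext δ ?_ ?_
  · rw [map_pow, h, map_zero]; simp
  · rw [sq, snd_mul, h]; simp

instance [IsScalarTower ℂ A k] : IsScalarTower ℂ A (TwistedDual δ) := .of_algebraMap_eq fun z => by
  refine ext δ ?_ ?_
  · rw [AlgHom.commutes, ← IsScalarTower.algebraMap_apply]; rfl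
  · rw [snd_algebraMap, Derivation.map_algebraMap]; rfl

end TwistedDual

/-! ### Dimension of the smooth locus of the spectral cover -/

section Chart

/-- An `A`-algebra `B` with a section `θ` of `B ⊗ N` that satisfies the spectral equation and is
universal in the sense of an open subscheme of the spectral cover: points of `Spec B` are
determined by the value of `θ`, and they extend to first order thickenings together with `θ`. -/
structure IsSpectralChart {A B M N : Type} [CommRing A] [CommRing B] [Algebra A B] [AddCommGroup M]
    [Module A M] [AddCommGroup N] [Module A N] [Module.Free A M] [Module.Finite A M]
    (φ : M →ₗ[A] M ⊗[A] N) (θ : B ⊗[A] N) : Prop where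
  charValue_eq_zero : charValue B φ θ = 0
  algHom_ext : ∀ (R : Type) [CommRing R] [Algebra A R] (f g : B →ₐ[A] R),
    f.toLinearMap.rTensor N θ = g.toLinearMap.rTensor N θ → f = g
  exists_lift : ∀ (R k : Type) [CommRing R] [Field k] [Algebra A R] [Algebra A k] (π : R →ₐ[A] k),
    Function.Surjective π → (∀ x, π x = 0 → x ^ 2 = 0) → ∀ (ψ : B →ₐ[A] k) (θ' : R ⊗[A] N),
    charValue R φ θ' = 0 → π.toLinearMap.rTensor N θ' = ψ.toLinearMap.rTensor N θ →
    ∃ f : B →ₐ[A] R, f.toLinearMap.rTensor N θ = θ'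

variable {A B k : Type} [CommRing A] [CommRing B] [Field k] [Algebra A B] [Algebra B k]

lemma eq_zero_of_apply_D [Algebra ℂ B] {ℓ : Ω[B⁄ℂ] →ₗ[B] k} (h : ∀ x, ℓ (KaehlerDifferential.D ℂ B x) = 0) :
    ℓ = 0 := by
  apply LinearMap.ext_on (KaehlerDifferential.span_range_derivation ℂ B)
  rintro _ ⟨x, rfl⟩
  simpa using h x

/-- The coefficient of `ε` of a lift of a point over `k[ε]`, regarded as a tangent vector. -/
lemma exists_form_eq_snd [Algebra A k] [Algebra ℂ A] [Algebra ℂ B] [IsScalarTower ℂ A B]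
    [Algebra ℂ k] [IsScalarTower ℂ A k] [IsScalarTower ℂ B k] {δ : Derivation ℂ A k} {f : B →ₐ[A] TwistedDual δ}
    (hf : ∀ x, TwistedDual.fst δ (f x) = algebraMap B k x) :
    ∃ ℓ : Ω[B⁄ℂ] →ₗ[B] k, ∀ x, ℓ (KaehlerDifferential.D ℂ B x) = TwistedDual.snd δ (f x) := by
  let D : Derivation ℂ B k := Derivation.mk'
    ((TwistedDual.snd δ).restrictScalars ℂ ∘ₗ (f.restrictScalars ℂ).toLinearMap) fun x y => by
      simp [TwistedDual.snd_mul, hf, Algebra.smul_def]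
  exact ⟨D.liftKaehlerDifferential, fun x => D.liftKaehlerDifferential_comp_D x⟩

/-- The localization of a reduced ring at a minimal prime is a field. -/
lemma exists_mul_eq_zero_of_mem_minimalPrimes {R : Type*} [CommRing R] [IsReduced R] {p : Ideal R}
    (hp : p ∈ minimalPrimes R) {x : R} (hx : x ∈ p) : ∃ s ∉ p, s * x = 0 := by
  have hpp : p.IsPrime := hp.1.1
  by_contra! h
  -- otherwise, some prime avoids `x` and the complement of `p`
  obtain ⟨q, hq, -, hqS⟩ := Ideal.exists_le_prime_disjoint ⊥
    ((p.primeCompl ⊔ Submonoid.powers x : Submonoid R)) (by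
      rw [Set.disjoint_left]
      rintro y hy hyS
      obtain ⟨s, hs, z, ⟨m, rfl⟩, hsz⟩ := Submonoid.mem_sup.1 hyS
      rw [show y = 0 from hy] at hsz
      rcases Nat.eq_zero_or_pos m with rfl | hm
      · exact hs (by rw [show s = 0 by simpa using hsz]; exact p.zero_mem)
      · refine h s hs (pow_eq_zero_iff hm.ne' |>.1 ?_)
        obtain ⟨m, rfl⟩ := Nat.exists_eq_succ_of_ne_zero hm.ne'
        have hsz : s * x ^ (m + 1) = 0 := hsz
        rw [mul_pow, pow_succ s, mul_assoc, hsz, mul_zero])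
  have hqp : q ≤ p := fun y hy => by
    by_contra hyp
    exact Set.disjoint_left.1 hqS hy (Submonoid.mem_sup_left hyp)
  exact Set.disjoint_left.1 hqS (hp.2 ⟨hq, bot_le⟩ hqp hx)
    (Submonoid.mem_sup_right (Submonoid.mem_powers x))

variable [Algebra A k] [IsScalarTower A B k]

/-- The homomorphism `x ↦ x + ε D(x)`. -/
def derivationHom (D : Derivation A B k) : B →ₐ[A] DualNumber k where
  toFun x := TrivSqZeroExt.inl (algebraMap B k x) + TrivSqZeroExt.inr (D x)
  map_one' := by ext <;> simp
  map_mul' x y := by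
    refine TrivSqZeroExt.ext (by simp) ?_
    rw [TrivSqZeroExt.snd_mul]
    simp [← algebraMap_smul k, mul_comm]
  map_zero' := by ext <;> simp
  map_add' x y := by ext <;> simp
  commutes' a := by
    rw [← IsScalarTower.algebraMap_apply]
    ext <;> simp [TrivSqZeroExt.algebraMap_eq_inl']

@[simp] lemma fst_derivationHom (D : Derivation A B k) (x : B) :
    (derivationHom D x).fst = algebraMap B k x := by
  simp [derivationHom]

@[simp] lemma snd_derivationHom (D : Derivation A B k) (x : B) :
    (derivationHom D x).snd = D x := by
  simp [derivationHom]

lemma pairing_algebraMap_comp {R N : Type} [CommRing R] [Algebra A R] [AddCommGroup N]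
    [Module A N] (g : B →ₐ[A] R) (c : N →ₗ[A] A) (θ : B ⊗[A] N) :
    pairing g (Algebra.linearMap A R ∘ₗ c) θ =
      g (pairing (AlgHom.id A B) (Algebra.linearMap A B ∘ₗ c) θ) := by
  rw [← pairing_comp, AlgHom.comp_id]
  congr 2
  ext x
  simp

variable {M : Type} [AddCommGroup M] [Module A M] [Module.Free A M] [Module.Finite A M]

/-- The contractions of `θ` are integral over `A`, by the spectral equation. -/
lemma isIntegral_pairing {N : Type} [AddCommGroup N] [Module A N] {φ : M →ₗ[A] M ⊗[A] N}
    {θ : B ⊗[A] N} (h : charValue B φ θ = 0) (c : N →ₗ[A] A) :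
    IsIntegral A (pairing (AlgHom.id A B) (Algebra.linearMap A B ∘ₗ c) θ) := by
  classical
  let b := Module.Free.chooseBasis A M
  refine ⟨(twistMatrix b φ c).charpoly, Matrix.charpoly_monic _, ?_⟩
  rw [Polynomial.eval₂_eq_eval_map, ← Matrix.charpoly_map, Matrix.eval_charpoly]
  have := det_charMatrix_eq_zero b φ h (AlgHom.id A B) (Algebra.linearMap A B ∘ₗ c)
  rw [charMatrix, show Algebra.linearMap A B ∘ₗ c = (Algebra.ofId A B).toLinearMap ∘ₗ c from rfl,
    twistMatrix_comp] at this
  exact this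

variable [Algebra ℂ A] [Algebra ℂ B] [IsScalarTower ℂ A B]

variable (A B k) in
/-- Restriction of `k`-valued derivations from `B` to `A`. -/
def restrictDerivation : (Ω[B⁄ℂ] →ₗ[B] k) →ₗ[k] (Ω[A⁄ℂ] →ₗ[A] k) where
  toFun ℓ := ℓ.restrictScalars A ∘ₗ KaehlerDifferential.map ℂ ℂ A B
  map_add' _ _ := rfl
  map_smul' _ _ := rfl

@[simp] lemma restrictDerivation_D (ℓ : Ω[B⁄ℂ] →ₗ[B] k) (a : A) :
    restrictDerivation A B k ℓ (KaehlerDifferential.D ℂ A a) =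
      ℓ (KaehlerDifferential.D ℂ B (algebraMap A B a)) := by
  rw [← KaehlerDifferential.map_D ℂ ℂ A B]; rfl

/-- A tangent vector that is vertical, that is trivial on `A`, is a derivation over `A`. -/
lemma exists_derivation_of_restrictDerivation_eq_zero {ℓ : Ω[B⁄ℂ] →ₗ[B] k}
    (h : restrictDerivation A B k ℓ = 0) :
    ∃ D : Derivation A B k, ∀ x, D x = ℓ (KaehlerDifferential.D ℂ B x) := by
  have h0 : ∀ a : A, ℓ (KaehlerDifferential.D ℂ B (algebraMap A B a)) = 0 := fun a => by
    rw [← restrictDerivation_D, h, LinearMap.zero_apply]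
  refine ⟨Derivation.mk'
    { toFun := fun x => ℓ (KaehlerDifferential.D ℂ B x)
      map_add' := fun x y => by simp
      map_smul' := fun a x => by
        rw [Algebra.smul_def, Derivation.leibniz, map_add, map_smul, map_smul, h0, smul_zero,
          add_zero, RingHom.id_apply, algebraMap_smul] } fun x y => ?_, fun x => rfl⟩
  simp

/-- A smooth open part of the spectral cover has dimension at most `n`: the contractions of `θ`
determine its points and are integral over `A`, so at the generic points there are no nonzero
vertical derivations. -/
lemma finrank_hom_kaehler_le {k : Type} [Field k] [Algebra B k] [Algebra.Smooth ℂ B] [Module.Finite A Ω[A⁄ℂ]]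
    [Module.Projective A Ω[A⁄ℂ]] {n : ℕ}
    (hn : ∀ p, Module.rankAtStalk (R := A) Ω[A⁄ℂ] p = n) {φ : M →ₗ[A] M ⊗[A] Ω[A⁄ℂ]}
    {θ : B ⊗[A] Ω[A⁄ℂ]} (hθ : IsSpectralChart φ θ) :
    Module.finrank k (Ω[B⁄ℂ] →ₗ[B] k) ≤ n := by
  have := isReduced_of_smooth ℂ B
  -- the rank is the same at a minimal prime `η`, where the residue field is a localization
  obtain ⟨η, hη, hle⟩ := Ideal.exists_minimalPrimes_le
    (I := ⊥) (J := (PrimeSpectrum.comap (algebraMap B k) ⊥).asIdeal) bot_le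
  have hp : η.IsPrime := hη.1.1
  let K := η.ResidueField
  have hcomap : PrimeSpectrum.comap (algebraMap B K) ⊥ = ⟨η, hp⟩ := by
    ext x
    simp [K]
  rw [finrank_hom_eq_rankAtStalk, ← Module.rankAtStalk_eq_of_le_of_finite_of_flat (p := ⟨η, hp⟩)
    _ hle, ← hcomap, ← finrank_hom_eq_rankAtStalk, ← hn (PrimeSpectrum.comap (algebraMap A K) ⊥),
    ← finrank_hom_eq_rankAtStalk]
  let : Algebra ℂ K := ((algebraMap B K).comp (algebraMap ℂ B)).toAlgebra
  have : CharZero K := charZero_of_injective_algebraMap (algebraMap ℂ K).injective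
  have hK : ∀ y, algebraMap B K y = 0 → ∃ s, algebraMap B K s ≠ 0 ∧ s * y = 0 := by
    intro y hy
    rw [Ideal.algebraMap_residueField_eq_zero] at hy
    obtain ⟨s, hs, hsy⟩ := exists_mul_eq_zero_of_mem_minimalPrimes hη hy
    exact ⟨s, fun h => hs (Ideal.algebraMap_residueField_eq_zero.1 h), hsy⟩
  refine LinearMap.finrank_le_finrank_of_injective (f := restrictDerivation A B K) ?_
  rw [← LinearMap.ker_eq_bot, LinearMap.ker_eq_bot']
  intro ℓ hℓ
  obtain ⟨D, hD⟩ := exists_derivation_of_restrictDerivation_eq_zero hℓ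
  -- `D` vanishes on the contractions of `θ`, hence altogether
  have hf : derivationHom D = derivationHom 0 := by
    refine hθ.algHom_ext _ _ _ (ext_pairing fun c => ?_)
    rw [pairing_rTensor, pairing_rTensor, AlgHom.id_comp, AlgHom.id_comp,
      pairing_algebraMap_comp (R := DualNumber K) (derivationHom D) c θ,
      pairing_algebraMap_comp (R := DualNumber K) (derivationHom 0) c θ]
    have h0 := derivation_apply_eq_zero_of_isIntegral hK D
      (isIntegral_pairing hθ.charValue_eq_zero c)
    ext <;> simp [h0]
  refine eq_zero_of_apply_D fun x => ?_
  have := congrArg TrivSqZeroExt.snd (DFunLike.congr_fun hf x)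
  simpa [hD] using this

variable [Algebra ℂ k] [IsScalarTower ℂ A k] [IsScalarTower ℂ B k]

/-- If all lifts of `θ` over the thickening `k[ε]` of a point in a nonzero tangent direction `δ`
satisfied the spectral equation, the vertical tangent space and the tangent vectors over `δ` would
make the tangent space of `Spec B` too large. -/
lemma exists_charValue_ne_zero [Algebra.Smooth ℂ B] [Module.Finite A Ω[A⁄ℂ]]
    [Module.Projective A Ω[A⁄ℂ]] {n : ℕ}
    (hn : ∀ p, Module.rankAtStalk (R := A) Ω[A⁄ℂ] p = n) {φ : M →ₗ[A] M ⊗[A] Ω[A⁄ℂ]}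
    {θ : B ⊗[A] Ω[A⁄ℂ]} (hθ : IsSpectralChart φ θ) {δ : Derivation ℂ A k} (hδ : δ ≠ 0) :
    ∃ θ' : TwistedDual δ ⊗[A] Ω[A⁄ℂ], (TwistedDual.fst δ).toLinearMap.rTensor _ θ' =
      (IsScalarTower.toAlgHom A B k).toLinearMap.rTensor _ θ ∧
      charValue (TwistedDual δ) φ θ' ≠ 0 := by
  by_contra! h
  obtain ⟨θ₀, hθ₀⟩ := LinearMap.rTensor_surjective Ω[A⁄ℂ]
    (g := (TwistedDual.fst δ).toLinearMap) (TwistedDual.surjective_fst δ)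
    ((IsScalarTower.toAlgHom A B k).toLinearMap.rTensor _ θ)
  have hinr : ∀ (c : Ω[A⁄ℂ] →ₗ[A] A) (η : k ⊗[A] Ω[A⁄ℂ]), TwistedDual.snd δ
      (pairing (AlgHom.id A _) (Algebra.linearMap A _ ∘ₗ c) ((TwistedDual.inr δ).rTensor _ η)) =
        pairing (AlgHom.id A k) (Algebra.linearMap A k ∘ₗ c) η := by
    intro c η
    induction η with
    | zero => simp
    | tmul x ω =>
      simp only [LinearMap.rTensor_tmul, pairing_tmul, AlgHom.id_apply, LinearMap.comp_apply,
        Algebra.linearMap_apply]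
      rw [mul_comm, TwistedDual.mul_inr, AlgHom.commutes, TwistedDual.snd_inr, mul_comm]
    | add x y hx hy => simp only [map_add, hx, hy]
  -- the lift `θ₀ + ε η` of `θ` gives a tangent vector `ℓ` of `Spec B` over `δ`
  have key : ∀ η : k ⊗[A] Ω[A⁄ℂ], ∃ ℓ : Ω[B⁄ℂ] →ₗ[B] k,
      (∀ a : A, ℓ (KaehlerDifferential.D ℂ B (algebraMap A B a)) = δ a) ∧
      ∀ c : Ω[A⁄ℂ] →ₗ[A] A, ℓ (KaehlerDifferential.D ℂ B
        (pairing (AlgHom.id A B) (Algebra.linearMap A B ∘ₗ c) θ)) =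
        TwistedDual.snd δ (pairing (AlgHom.id A _) (Algebra.linearMap A _ ∘ₗ c) θ₀) +
        pairing (AlgHom.id A k) (Algebra.linearMap A k ∘ₗ c) η := by
    intro η
    set θ' := θ₀ + (TwistedDual.inr δ).rTensor _ η with hθ'
    have h1 : (TwistedDual.fst δ).toLinearMap.rTensor _ θ' =
        (IsScalarTower.toAlgHom A B k).toLinearMap.rTensor _ θ := by
      rw [hθ', map_add, hθ₀, ← LinearMap.rTensor_comp_apply,
        show (TwistedDual.fst δ).toLinearMap ∘ₗ TwistedDual.inr δ = 0 from rfl]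
      simp
    obtain ⟨f, hf⟩ := hθ.exists_lift _ k (TwistedDual.fst δ) (TwistedDual.surjective_fst δ)
      (fun x hx => TwistedDual.sq_eq_zero_of_fst_eq_zero δ hx) _ θ' (h θ' h1) h1
    have hf' : (TwistedDual.fst δ).comp f = IsScalarTower.toAlgHom A B k := by
      refine hθ.algHom_ext _ _ _ ?_
      rw [← h1, ← hf, AlgHom.comp_toLinearMap, LinearMap.rTensor_comp_apply]
    obtain ⟨ℓ, hℓ⟩ := exists_form_eq_snd (f := f) (fun x => DFunLike.congr_fun hf' x)
    refine ⟨ℓ, fun a => ?_, fun c => ?_⟩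
    · rw [hℓ, AlgHom.commutes, TwistedDual.snd_algebraMap]
    · rw [hℓ, ← pairing_algebraMap_comp, ← AlgHom.id_comp f, ← pairing_rTensor, hf, hθ', map_add,
        map_add]
      congr 1
      exact hinr c η
  obtain ⟨m, e, c, hc⟩ := exists_dual_basis A Ω[A⁄ℂ]
  -- the coordinates of the variation of `θ` along a tangent vector, and those of `η`
  let τ : (Ω[B⁄ℂ] →ₗ[B] k) →ₗ[k] Fin m → k :=
    { toFun := fun ℓ i => ℓ (KaehlerDifferential.D ℂ B
        (pairing (AlgHom.id A B) (Algebra.linearMap A B ∘ₗ c i) θ))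
      map_add' := fun _ _ => rfl
      map_smul' := fun _ _ => rfl }
  let σ : k ⊗[A] Ω[A⁄ℂ] →ₗ[k] Fin m → k :=
    LinearMap.pi fun i => LinearMap.liftBaseChange k (Algebra.linearMap A k ∘ₗ c i)
  have hσ : Function.Injective σ := by
    intro q q' hq
    rw [eq_sum_pairing_smul hc q, eq_sum_pairing_smul hc q']
    refine Finset.sum_congr rfl fun i _ => ?_
    rw [← liftBaseChange_eq_pairing, ← liftBaseChange_eq_pairing]
    congr 1
    exact congrFun hq i
  obtain ⟨ℓ₀, hℓ₀, hℓ₀'⟩ := key 0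
  -- the differences `ℓ - ℓ₀` are vertical and realize each variation `η`
  have hle : LinearMap.range σ ≤ (LinearMap.ker (restrictDerivation A B k)).map τ := by
    rintro _ ⟨η, rfl⟩
    obtain ⟨ℓ, hℓ, hℓ'⟩ := key η
    refine ⟨ℓ - ℓ₀, ?_, ?_⟩
    · rw [SetLike.mem_coe, LinearMap.mem_ker]
      refine eq_zero_of_apply_D fun a => ?_
      rw [restrictDerivation_D, LinearMap.sub_apply, hℓ, hℓ₀, sub_self]
    · ext i
      change (ℓ - ℓ₀) _ = LinearMap.liftBaseChange k (Algebra.linearMap A k ∘ₗ c i) η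
      rw [LinearMap.sub_apply, hℓ', hℓ₀', liftBaseChange_eq_pairing]
      simp
  have h1 := Submodule.finrank_mono hle
  rw [LinearMap.finrank_range_of_inj hσ, finrank_tensor_eq_rankAtStalk, hn] at h1
  have h2 := Submodule.finrank_map_le τ (LinearMap.ker (restrictDerivation A B k))
  have h3 := (restrictDerivation A B k).finrank_range_add_finrank_ker
  have h4 := finrank_hom_kaehler_le (k := k) hn hθ
  -- the vertical tangent space has dimension at least `n`, so it is everything; but `ℓ₀` maps to `δ`
  have h5 : LinearMap.range (restrictDerivation A B k) = ⊥ :=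
    Submodule.finrank_eq_zero.1 (by omega)
  refine hδ (Derivation.ext fun a => ?_)
  rw [← hℓ₀, ← restrictDerivation_D, LinearMap.range_eq_bot.1 h5]
  rfl

end Chart

/-! ### Nonvanishing of adjugates at points of the smooth locus -/

section Nonvanishing

open scoped Matrix

lemma map_snd_mul {A k ι : Type} [CommRing A] [Algebra ℂ A] [Field k] [Algebra ℂ k] [Algebra A k]
    [Fintype ι] (δ : Derivation ℂ A k) (X Y : Matrix ι ι (TwistedDual δ)) :
    (X * Y).map (TwistedDual.snd δ) = X.map (TwistedDual.fst δ) * Y.map (TwistedDual.snd δ) +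
      X.map (TwistedDual.snd δ) * Y.map (TwistedDual.fst δ) := by
  ext i j
  simp only [Matrix.map_apply, Matrix.mul_apply, Matrix.add_apply, map_sum, TwistedDual.snd_mul,
    ← Finset.sum_add_distrib]
  exact Finset.sum_congr rfl fun _ _ => by ring

section CharMatrix

variable {A : Type*} [CommRing A] {M N : Type*} [AddCommGroup M] [Module A M]
  [AddCommGroup N] [Module A N] {ι : Type*} [Fintype ι] [DecidableEq ι] (b : Module.Basis ι A M)
  (φ : M →ₗ[A] M ⊗[A] N) {B B' k : Type*} [CommRing B] [Algebra A B] [CommRing B'] [Algebra A B']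

lemma charMatrix_rTensor {B'' : Type*} [CommRing B''] [Algebra A B''] (f : B →ₐ[A] B')
    (g : B' →ₐ[A] B'') (θ : B ⊗[A] N) (c : N →ₗ[A] B'') :
    charMatrix b φ g (f.toLinearMap.rTensor N θ) c = charMatrix b φ (g.comp f) θ c := by
  rw [charMatrix, charMatrix, pairing_rTensor]

variable [Field k] [Infinite k] [Algebra A k] [Module.Free A M] [Module.Finite A M]

/-- At a point of the spectral cover, the characteristic matrices have a common null vector, and so
have their transposes. -/
lemma exists_common_eigenvector (hφ : wedgeSquare φ = 0) {θ : B ⊗[A] N}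
    (hθ : charValue B φ θ = 0) (f : B →ₐ[A] k) :
    (∃ v : ι → k, v ≠ 0 ∧ ∀ c : N →ₗ[A] k, charMatrix b φ f θ c *ᵥ v = 0) ∧
      ∃ u : ι → k, u ≠ 0 ∧ ∀ c : N →ₗ[A] k, u ᵥ* charMatrix b φ f θ c = 0 := by
  let F : (N →ₗ[A] k) →ₗ[k] Matrix ι ι k :=
    { toFun := charMatrix b φ f θ
      map_add' := charMatrix_add b φ f θ
      map_smul' := charMatrix_smul b φ f θ }
  have hunit : ∀ X : Matrix ι ι k, X.det = 0 → ¬ IsUnit (Matrix.toLin' X) := by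
    intro X hX h
    have := (Matrix.isUnit_toLin'_iff).1 h
    rw [Matrix.isUnit_iff_isUnit_det, hX] at this
    exact not_isUnit_zero this
  constructor
  · obtain ⟨v, hv, h⟩ := exists_common_null_vector
      (LinearMap.range ((Matrix.toLin' : Matrix ι ι k ≃ₗ[k] _).toLinearMap ∘ₗ F)) (by
        rintro _ ⟨c, rfl⟩ _ ⟨c', rfl⟩
        have := commute_charMatrix b φ hφ f θ c c'
        simp only [LinearMap.comp_apply, LinearEquiv.coe_coe]
        rw [Module.End.mul_eq_comp, Module.End.mul_eq_comp, ← Matrix.toLin'_mul, ← Matrix.toLin'_mul]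
        exact congrArg _ this) (by
        rintro _ ⟨c, rfl⟩
        exact hunit _ (det_charMatrix_eq_zero b φ hθ f c))
    exact ⟨v, hv, fun c => h _ ⟨c, rfl⟩⟩
  · obtain ⟨v, hv, h⟩ := exists_common_null_vector
      (LinearMap.range ((Matrix.toLin' : Matrix ι ι k ≃ₗ[k] _).toLinearMap ∘ₗ
        (Matrix.transposeLinearEquiv ι ι k k).toLinearMap ∘ₗ F)) (by
        rintro _ ⟨c, rfl⟩ _ ⟨c', rfl⟩
        have := commute_charMatrix b φ hφ f θ c' c
        simp only [LinearMap.comp_apply, LinearEquiv.coe_coe]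
        rw [Module.End.mul_eq_comp, Module.End.mul_eq_comp, ← Matrix.toLin'_mul, ← Matrix.toLin'_mul]
        refine congrArg _ ?_
        change (charMatrix b φ f θ c)ᵀ * (charMatrix b φ f θ c')ᵀ =
          (charMatrix b φ f θ c')ᵀ * (charMatrix b φ f θ c)ᵀ
        rw [← Matrix.transpose_mul, ← Matrix.transpose_mul, this.eq]) (by
        rintro _ ⟨c, rfl⟩
        exact hunit _ ((Matrix.det_transpose _).trans (det_charMatrix_eq_zero b φ hθ f c)))
    refine ⟨v, hv, fun c => ?_⟩
    rw [← Matrix.mulVec_transpose]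
    exact h _ ⟨c, rfl⟩

end CharMatrix

variable {A B k M ι : Type} [CommRing A] [CommRing B] [Field k] [Algebra A B] [Algebra B k]
  [Algebra A k] [IsScalarTower A B k] [AddCommGroup M] [Module A M] [Module.Free A M]
  [Module.Finite A M] [Fintype ι] [DecidableEq ι] (b : Module.Basis ι A M)
  [Algebra ℂ A] [Algebra ℂ k]

/-- The first order condition for a lift of `θ` to satisfy the spectral equation. -/
lemma charValue_twistedDual_eq_zero {N : Type} [AddCommGroup N] [Module A N] [Module.Finite A N]
    [Module.Projective A N] {φ : M →ₗ[A] M ⊗[A] N} {θ : B ⊗[A] N} (hθ : charValue B φ θ = 0)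
    {δ : Derivation ℂ A k} {θ' : TwistedDual δ ⊗[A] N}
    (hθ' : (TwistedDual.fst δ).toLinearMap.rTensor _ θ' =
      (IsScalarTower.toAlgHom A B k).toLinearMap.rTensor _ θ)
    (h : ∀ c : N →ₗ[A] TwistedDual δ, ((charMatrix b φ (IsScalarTower.toAlgHom A B k) θ
        ((TwistedDual.fst δ).toLinearMap ∘ₗ c)).adjugate *
      (charMatrix b φ (AlgHom.id A _) θ' c).map (TwistedDual.snd δ)).trace = 0) :
    charValue (TwistedDual δ) φ θ' = 0 := by
  refine charValue_eq_zero_of_forall_det b φ ℂ θ' fun c => ?_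
  have hM : (charMatrix b φ (AlgHom.id A _) θ' c).map (TwistedDual.fst δ) =
      charMatrix b φ (IsScalarTower.toAlgHom A B k) θ ((TwistedDual.fst δ).toLinearMap ∘ₗ c) := by
    rw [← charMatrix_comp, AlgHom.comp_id, ← AlgHom.id_comp (TwistedDual.fst δ),
      ← charMatrix_rTensor, hθ', charMatrix_rTensor, AlgHom.id_comp, AlgHom.id_comp]
  refine TwistedDual.ext δ ?_ ?_
  · rw [AlgHom.map_det, AlgHom.mapMatrix_apply, hM, det_charMatrix_eq_zero b φ hθ, map_zero]
  · rw [map_zero, ← h c, ← hM]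
    exact snd_det_dualNumber _

variable [IsScalarTower ℂ A k]

/-- A linear condition on tangent vectors has a nonzero solution in dimension at least two, and the
trivial condition has one in dimension at least one. -/
lemma exists_derivation_ne_zero [Module.Finite A Ω[A⁄ℂ]] [Module.Projective A Ω[A⁄ℂ]] {n : ℕ}
    (hn : ∀ p, Module.rankAtStalk (R := A) Ω[A⁄ℂ] p = n) (F : (Ω[A⁄ℂ] →ₗ[A] k) →ₗ[k] k)
    (h : 2 ≤ n ∨ 1 ≤ n ∧ F = 0) :
    ∃ ℓ : Ω[A⁄ℂ] →ₗ[A] k, ℓ.compDer (KaehlerDifferential.D ℂ A) ≠ 0 ∧ F ℓ = 0 := by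
  have hd := finrank_hom_eq_rankAtStalk (B := A) (P := Ω[A⁄ℂ]) (k := k)
  rw [hn] at hd
  have hker : LinearMap.ker F ≠ ⊥ := by
    intro hF
    have h1 := F.finrank_range_add_finrank_ker
    rw [hF, finrank_bot, hd] at h1
    rcases h with h | ⟨h, rfl⟩
    · have := Submodule.finrank_le (LinearMap.range F)
      rw [Module.finrank_self] at this
      omega
    · rw [LinearMap.range_zero, finrank_bot] at h1
      omega
  obtain ⟨ℓ, hℓ, h0⟩ := Submodule.exists_mem_ne_zero_of_ne_bot hker
  exact ⟨ℓ, fun h => h0 (eq_zero_of_apply_D fun x => DFunLike.congr_fun h x), hℓ⟩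

variable [Algebra ℂ B] [IsScalarTower ℂ A B] [IsScalarTower ℂ B k] [Algebra.Smooth ℂ B]
  [Module.Finite A Ω[A⁄ℂ]] [Module.Projective A Ω[A⁄ℂ]] {n : ℕ}

/-- If all adjugates of characteristic matrices vanished at a point, all lifts of `θ` over all
tangent directions would satisfy the spectral equation. -/
lemma exists_adjugate_charMatrix_ne_zero
    (hn : ∀ p, Module.rankAtStalk (R := A) Ω[A⁄ℂ] p = n) (h1 : 1 ≤ n)
    {φ : M →ₗ[A] M ⊗[A] Ω[A⁄ℂ]} {θ : B ⊗[A] Ω[A⁄ℂ]} (hθ : IsSpectralChart φ θ) :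
    ∃ c : Ω[A⁄ℂ] →ₗ[A] k, c ≠ 0 ∧
      (charMatrix b φ (IsScalarTower.toAlgHom A B k) θ c).adjugate ≠ 0 := by
  by_contra! h
  obtain ⟨ℓ, hℓ, -⟩ := exists_derivation_ne_zero (k := k) hn 0 (Or.inr ⟨h1, rfl⟩)
  obtain ⟨θ', hθ', hne⟩ := exists_charValue_ne_zero hn hθ hℓ
  refine hne (charValue_twistedDual_eq_zero b hθ.charValue_eq_zero hθ' fun c => ?_)
  suffices h : (charMatrix b φ (IsScalarTower.toAlgHom A B k) θ
      ((TwistedDual.fst _).toLinearMap ∘ₗ c)).adjugate = 0 by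
    rw [h, Matrix.zero_mul, Matrix.trace_zero]
  by_cases hc : (TwistedDual.fst (ℓ.compDer (KaehlerDifferential.D ℂ A))).toLinearMap ∘ₗ c = 0
  · rcases subsingleton_or_nontrivial ι with hι | hι
    · -- for matrices of size at most one, the adjugate is `1` even at `c = 0`
      have hℓ0 : ℓ ≠ 0 := by
        rintro rfl
        exact hℓ (by ext; simp)
      rw [Matrix.adjugate_subsingleton, ← h ℓ hℓ0, Matrix.adjugate_subsingleton]
    · rw [hc, show charMatrix b φ (IsScalarTower.toAlgHom A B k) θ 0 = 0 by
        simpa using charMatrix_smul b φ (IsScalarTower.toAlgHom A B k) θ 0 0, Matrix.adjugate_zero]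
  · exact h _ hc

/-- In dimension at least two, some adjugate has nonzero trace: otherwise, the equations of the
tangent space of the spectral cover would amount to a single equation `u (δ Φ) v = 0` on the tangent
vectors `δ` of the base, where `v` and `u` are null vectors on both sides. -/
lemma exists_trace_adjugate_charMatrix_ne_zero
    (hn : ∀ p, Module.rankAtStalk (R := A) Ω[A⁄ℂ] p = n) (h2 : 2 ≤ n)
    {φ : M →ₗ[A] M ⊗[A] Ω[A⁄ℂ]} (hφ : wedgeSquare φ = 0) {θ : B ⊗[A] Ω[A⁄ℂ]}
    (hθ : IsSpectralChart φ θ) :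
    ∃ c : Ω[A⁄ℂ] →ₗ[A] k,
      (charMatrix b φ (IsScalarTower.toAlgHom A B k) θ c).adjugate.trace ≠ 0 := by
  by_contra! h
  have : CharZero k := charZero_of_injective_algebraMap (algebraMap ℂ k).injective
  obtain ⟨c₀, -, hc₀⟩ := exists_adjugate_charMatrix_ne_zero (k := k) b hn (by omega) hθ
  obtain ⟨⟨v, hv0, hv⟩, u, hu0, hu⟩ := exists_common_eigenvector b φ hφ hθ.charValue_eq_zero
    (IsScalarTower.toAlgHom A B k)
  set X := charMatrix b φ (IsScalarTower.toAlgHom A B k) θ c₀ with hX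
  obtain ⟨i, j, hij⟩ : ∃ i j, X.adjugate i j ≠ 0 := by
    by_contra! h0
    exact hc₀ (Matrix.ext h0)
  obtain ⟨κ, hκ⟩ := adjugate_eq_smul_vecMulVec hv0 hu0 (hv c₀) (hu c₀)
  have hκ0 : κ ≠ 0 := by
    rintro rfl
    rw [zero_smul] at hκ
    exact hc₀ hκ
  -- the trace of `adj X = κ v uᵀ` vanishes, so `v` lies in the range of `X`
  have huv : u ⬝ᵥ v = 0 := by
    have := h c₀
    rw [← hX, hκ, Matrix.trace_smul, Matrix.trace_vecMulVec, smul_eq_mul, mul_eq_zero,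
      or_iff_right hκ0, dotProduct_comm] at this
    exact this
  obtain ⟨v₂, hv₂⟩ := exists_mulVec_eq_of_adjugate_dotProduct (x := v) hij (by
    rw [show X.adjugate i = (κ * v i) • u by
      ext l; rw [hκ]; simp [Matrix.vecMulVec_apply, mul_assoc], smul_dotProduct, huv, smul_zero])
  obtain ⟨m, e, d, hd⟩ := exists_dual_basis A Ω[A⁄ℂ]
  -- the equation on tangent vectors of the base
  let F : (Ω[A⁄ℂ] →ₗ[A] k) →ₗ[k] k :=
    { toFun := fun ℓ => ∑ l, c₀ (e l) * ∑ p, u p * ∑ q,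
        ℓ (KaehlerDifferential.D ℂ A (twistMatrix b φ (d l) p q)) * v q
      map_add' := fun ℓ ℓ' => by
        simp only [LinearMap.add_apply, add_mul, mul_add, Finset.sum_add_distrib]
      map_smul' := fun a ℓ => by
        simp only [LinearMap.smul_apply, smul_eq_mul, RingHom.id_apply, Finset.mul_sum]
        refine Finset.sum_congr rfl fun _ _ => Finset.sum_congr rfl fun _ _ =>
          Finset.sum_congr rfl fun _ _ => by ring }
  obtain ⟨ℓ, hℓ, hF⟩ := exists_derivation_ne_zero hn F (Or.inl h2)
  set δ := ℓ.compDer (KaehlerDifferential.D ℂ A) with hδ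
  obtain ⟨θ', hθ', hne⟩ := exists_charValue_ne_zero hn hθ hℓ
  refine hne (charValue_twistedDual_eq_zero b hθ.charValue_eq_zero hθ' fun c => ?_)
  -- a lift of `c₀`
  let c₁ : Ω[A⁄ℂ] →ₗ[A] TwistedDual δ :=
    ∑ l, algebraMap k (TwistedDual δ) (c₀ (e l)) • (Algebra.linearMap A (TwistedDual δ) ∘ₗ d l)
  have hfst : ∀ x : k, TwistedDual.fst δ (algebraMap k (TwistedDual δ) x) = x := fun _ => rfl
  have hsnd : ∀ x : k, TwistedDual.snd δ (algebraMap k (TwistedDual δ) x) = 0 := fun _ => rfl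
  have hc₁ : (TwistedDual.fst δ).toLinearMap ∘ₗ c₁ = c₀ := by
    refine LinearMap.ext fun x => ?_
    conv_rhs => rw [hd x, map_sum]
    simp [c₁, hfst, Algebra.smul_def, mul_comm]
  have hfstM : ∀ c : Ω[A⁄ℂ] →ₗ[A] TwistedDual δ,
      (charMatrix b φ (AlgHom.id A _) θ' c).map (TwistedDual.fst δ) =
      charMatrix b φ (IsScalarTower.toAlgHom A B k) θ ((TwistedDual.fst δ).toLinearMap ∘ₗ c) := by
    intro c
    rw [← charMatrix_comp, AlgHom.comp_id, ← AlgHom.id_comp (TwistedDual.fst δ),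
      ← charMatrix_rTensor, hθ', charMatrix_rTensor, AlgHom.id_comp, AlgHom.id_comp]
  set X₁ := (charMatrix b φ (AlgHom.id A _) θ' c₁).map (TwistedDual.snd δ) with hX₁
  set Y := charMatrix b φ (IsScalarTower.toAlgHom A B k) θ ((TwistedDual.fst δ).toLinearMap ∘ₗ c)
    with hY
  set Y₁ := (charMatrix b φ (AlgHom.id A _) θ' c).map (TwistedDual.snd δ) with hY₁
  -- the equation holds for the lift of `c₀`: the variation of `θ` contributes a multiple of `u ⬝ᵥ v`
  have h0 : u ⬝ᵥ X₁ *ᵥ v = 0 := by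
    have hmat : X₁ = Matrix.scalar ι (TwistedDual.snd δ (pairing (AlgHom.id A _) c₁ θ')) -
        ∑ l, c₀ (e l) • (twistMatrix b φ (d l)).map δ := by
      have hs : ∀ s : Finset (Fin m), twistMatrix b φ (∑ l ∈ s, algebraMap k (TwistedDual δ)
          (c₀ (e l)) • (Algebra.linearMap A (TwistedDual δ) ∘ₗ d l)) =
          ∑ l ∈ s, algebraMap k (TwistedDual δ) (c₀ (e l)) •
            (twistMatrix b φ (d l)).map (algebraMap A (TwistedDual δ)) := by
        intro s
        induction s using Finset.cons_induction with
        | empty => simpa using twistMatrix_smul b φ (0 : TwistedDual δ) 0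
        | cons l s hl ih =>
          rw [Finset.sum_cons, Finset.sum_cons, twistMatrix_add, twistMatrix_smul, ih]
          congr 2
          exact twistMatrix_comp b φ (Algebra.ofId A (TwistedDual δ)) (d l)
      rw [hX₁, charMatrix, hs]
      ext p q
      simp only [Matrix.map_apply, Matrix.sub_apply, map_sub, Matrix.sum_apply, Matrix.smul_apply,
        map_sum, smul_eq_mul, TwistedDual.snd_mul, hfst, hsnd, mul_zero, add_zero,
        TwistedDual.snd_algebraMap]
      by_cases hpq : p = q <;> simp [hpq]
    rw [hmat, Matrix.sub_mulVec, dotProduct_sub, sub_eq_zero]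
    have h1 : u ⬝ᵥ (Matrix.scalar ι (TwistedDual.snd δ (pairing (AlgHom.id A _) c₁ θ'))) *ᵥ v =
        TwistedDual.snd δ (pairing (AlgHom.id A _) c₁ θ') * u ⬝ᵥ v := by
      simp [dotProduct, Matrix.mulVec_diagonal, Finset.mul_sum, mul_left_comm]
    rw [h1, huv, mul_zero, Matrix.sum_mulVec, dotProduct_sum, ← hF]
    change ∑ l, c₀ (e l) * ∑ p, u p * ∑ q, δ (twistMatrix b φ (d l) p q) * v q = _
    refine Finset.sum_congr rfl fun l _ => ?_
    rw [Matrix.smul_mulVec, dotProduct_smul, smul_eq_mul]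
    rfl
  -- the general case follows as the characteristic matrices commute: evaluate the coefficient of `ε`
  -- of the commutation relation on `u` and `v₂`, where `X v₂ = v`
  have hcomm : Y * X₁ + Y₁ * X = X * Y₁ + X₁ * Y := by
    have := congrArg (fun Z : Matrix ι ι (TwistedDual δ) => Z.map (TwistedDual.snd δ))
      (commute_charMatrix b φ hφ (AlgHom.id A _) θ' c c₁).eq
    simpa only [map_snd_mul, hfstM, hc₁] using this
  have hγ : X *ᵥ (Y *ᵥ v₂) = 0 := by
    rw [Matrix.mulVec_mulVec, (commute_charMatrix b φ hφ _ θ c₀ _).eq, ← Matrix.mulVec_mulVec,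
      hv₂, hv]
  obtain ⟨γ, hγ⟩ : ∃ γ : k, Y *ᵥ v₂ = γ • v := by
    refine ⟨(Y *ᵥ v₂) i / X.adjugate i j * (κ * u j), ?_⟩
    refine (exists_smul_eq_of_mulVec_eq_zero hij hγ).trans ?_
    rw [mul_smul]
    congr 1
    ext l
    rw [hκ]
    simp only [Matrix.smul_apply, Matrix.vecMulVec_apply, Pi.smul_apply, smul_eq_mul]
    ring
  have hfin : u ⬝ᵥ Y₁ *ᵥ v = 0 := by
    have := congrArg (fun Z : Matrix ι ι k => u ⬝ᵥ Z *ᵥ v₂) hcomm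
    simp only [Matrix.add_mulVec, dotProduct_add, ← Matrix.mulVec_mulVec, hv₂, hγ,
      Matrix.mulVec_smul, dotProduct_smul, h0, smul_zero, add_zero] at this
    rw [Matrix.dotProduct_mulVec u Y, hu, zero_dotProduct, zero_add, Matrix.dotProduct_mulVec u X,
      hu, zero_dotProduct] at this
    exact this
  obtain ⟨κ', hκ'⟩ := adjugate_eq_smul_vecMulVec hv0 hu0 (hv ((TwistedDual.fst δ).toLinearMap ∘ₗ c))
    (hu ((TwistedDual.fst δ).toLinearMap ∘ₗ c))
  rw [hκ', Matrix.smul_mul, Matrix.trace_smul, Matrix.trace_mul_comm, Matrix.mul_vecMulVec,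
    Matrix.trace_vecMulVec, dotProduct_comm, hfin, smul_zero]

end Nonvanishing

/-! ### The eigenline bundle over the smooth locus -/

section Eigenline

open scoped Matrix

/-- The first order variation of the determinant of a characteristic matrix vanishes, since the
characteristic matrices over `B[ε]` are singular, too. -/
lemma trace_adjugate_charMatrix_mul {A M N ι B : Type*} [CommRing A] [AddCommGroup M] [Module A M]
    [AddCommGroup N] [Module A N] [Module.Free A M] [Module.Finite A M] [Fintype ι] [DecidableEq ι]
    (b : Module.Basis ι A M) [CommRing B] [Algebra A B] {φ : M →ₗ[A] M ⊗[A] N} {θ : B ⊗[A] N}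
    (hθ : charValue B φ θ = 0) (c c' : N →ₗ[A] B) :
    ((charMatrix b φ (AlgHom.id A B) θ c).adjugate *
      charMatrix b φ (AlgHom.id A B) θ c').trace = 0 := by
  let ι₀ : B →ₐ[A] DualNumber B := TrivSqZeroExt.inlAlgHom A B B
  have h := snd_det_dualNumber (charMatrix b φ ι₀ θ
    (ι₀.toLinearMap ∘ₗ c + (DualNumber.eps : DualNumber B) • (ι₀.toLinearMap ∘ₗ c')))
  rw [det_charMatrix_eq_zero b φ hθ, TrivSqZeroExt.snd_zero, charMatrix_add, charMatrix_smul] at h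
  rw [show charMatrix b φ ι₀ θ (ι₀.toLinearMap ∘ₗ c) = (charMatrix b φ (AlgHom.id A B) θ c).map ι₀
      from charMatrix_comp b φ (AlgHom.id A B) ι₀ θ c,
    show charMatrix b φ ι₀ θ (ι₀.toLinearMap ∘ₗ c') = (charMatrix b φ (AlgHom.id A B) θ c').map ι₀
      from charMatrix_comp b φ (AlgHom.id A B) ι₀ θ c'] at h
  rw [h]
  congr 3
  · ext i j
    simp only [Matrix.map_apply, Matrix.add_apply, Matrix.smul_apply, smul_eq_mul,
      TrivSqZeroExt.fst_add, TrivSqZeroExt.fst_mul, DualNumber.fst_eps, zero_mul, add_zero]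
    rfl
  · ext i j
    have h1 : ∀ x, TrivSqZeroExt.snd (ι₀ x) = 0 := fun _ => rfl
    have h2 : ∀ x, TrivSqZeroExt.fst (ι₀ x) = x := fun _ => rfl
    simp only [Matrix.map_apply, Matrix.add_apply, Matrix.smul_apply, smul_eq_mul,
      TrivSqZeroExt.snd_add, DualNumber.snd_mul, DualNumber.fst_eps, DualNumber.snd_eps, h1, h2,
      zero_add, zero_mul, one_mul]

/-- Linear forms on a module of rank one are proportional. -/
lemma apply_mul_apply_comm_of_rankAtStalk_eq_one {A N B : Type*} [CommRing A] [AddCommGroup N]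
    [Module A N] [Module.Finite A N] [Module.Projective A N]
    (hn : ∀ p, Module.rankAtStalk (R := A) N p = 1) [CommRing B] [Algebra A B]
    (c c' : N →ₗ[A] B) (x y : N) : c x * c' y = c y * c' x := by
  have htop : IsSubbundle 1 (⊤ : Submodule A N) :=
    ⟨Module.Finite.equiv Submodule.topEquiv.symm, inferInstance, fun p => by
      rw [Module.rankAtStalk_eq_of_equiv Submodule.topEquiv, hn]⟩
  obtain ⟨k, e, d, hd⟩ := exists_dual_basis A N
  have h1 : ∀ x, c x = ∑ i, algebraMap A B (d i x) * c (e i) := fun x => by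
    conv_lhs => rw [hd x, map_sum]
    simp [Algebra.smul_def]
  rw [h1 x, h1 y, Finset.sum_mul, Finset.sum_mul]
  refine Finset.sum_congr rfl fun i _ => ?_
  have h2 := congrArg c' (htop.isLine.apply_smul_comm (d i) (l := x) (l' := y) trivial trivial)
  rw [map_smul, map_smul, Algebra.smul_def, Algebra.smul_def] at h2
  rw [mul_right_comm, h2, mul_right_comm]

variable {A B M : Type} [CommRing A] [CommRing B] [Algebra A B] [AddCommGroup M] [Module A M]
  [Module.Free A M] [Module.Finite A M] [Algebra ℂ A] [Algebra ℂ B] [IsScalarTower ℂ A B]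
  [Algebra.Smooth ℂ B] [Module.Finite A Ω[A⁄ℂ]] [Module.Projective A Ω[A⁄ℂ]] {n : ℕ}

/-- On a smooth open part of the spectral cover, the eigenspaces form a line bundle. -/
theorem isLine_ker_subEigen (hn : ∀ p, Module.rankAtStalk (R := A) Ω[A⁄ℂ] p = n) (h1 : 1 ≤ n)
    {φ : M →ₗ[A] M ⊗[A] Ω[A⁄ℂ]} (hφ : wedgeSquare φ = 0) {θ : B ⊗[A] Ω[A⁄ℂ]}
    (hθ : IsSpectralChart φ θ) : IsLine (LinearMap.ker (subEigen (baseChangeTwisted B φ) θ)) := by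
  classical
  let b := Module.Free.chooseBasis A M
  refine IsLine.of_span_eq_top ?_
  -- `m` is a point near which no eigenvector would generate the eigenspace
  by_contra hne
  obtain ⟨m, hm, hle⟩ := Ideal.exists_le_maximal _ hne
  let : Field (B ⧸ m) := Ideal.Quotient.field m
  set X := charMatrix b φ (AlgHom.id A B) θ
  let π : B →ₐ[A] B ⧸ m := IsScalarTower.toAlgHom A B (B ⧸ m)
  have hX0 : ∀ c, (X c).det = 0 := det_charMatrix_eq_zero b φ hθ.charValue_eq_zero _
  -- the columns of a multiple of an adjugate that consist of eigenvectors
  have key : ∀ (a : B) (c : Ω[A⁄ℂ] →ₗ[A] B), (∀ c', a • (X c' * (X c).adjugate) = 0) →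
      ∀ i j, a * (X c).adjugate i j ∈ m := by
    intro a c h i j
    let v : B ⊗[A] M := (Algebra.TensorProduct.basis B b).repr.symm
      (Finsupp.equivFunOnFinite.symm fun k => a * (X c).adjugate k j)
    have hv : ⇑((Algebra.TensorProduct.basis B b).repr v) = fun k => a * (X c).adjugate k j := by
      simp [v]
    refine hle (Ideal.subset_span ⟨v, ?_, (Algebra.TensorProduct.basis B b).coord i, ?_, ?_⟩)
    · rw [mem_ker_subEigen_iff]
      refine eigen_of_charMatrix_mulVec_eq_zero b φ fun c' => ?_
      rw [hv]
      ext l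
      have := congrFun (congrFun (h (Algebra.linearMap A B ∘ₗ c')) l) j
      simp only [Matrix.smul_apply, Matrix.mul_apply, smul_eq_mul, Matrix.zero_apply,
        Finset.mul_sum] at this
      rw [Pi.zero_apply, ← this]
      exact Finset.sum_congr rfl fun k _ => by simp only [X]; ring
    · rw [Module.Basis.coord_apply, hv]
    · intro x hx
      rw [mem_ker_subEigen_iff] at hx
      have h0 := charMatrix_mulVec_eq_zero b φ hx (AlgHom.id A B) c
      apply (Algebra.TensorProduct.basis B b).repr.injective
      ext k
      have h3 := adjugate_apply_mul_of_mulVec_eq_zero h0 i j k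
      simp only [AlgHom.id_apply] at h3
      rw [map_smul, map_smul, Finsupp.smul_apply, Finsupp.smul_apply, hv, Module.Basis.coord_apply,
        smul_eq_mul, smul_eq_mul, mul_left_comm, h3]
      ring
  -- linear forms with values in the residue field lift
  have hlift : ∀ c : Ω[A⁄ℂ] →ₗ[A] B ⧸ m, ∃ c' : Ω[A⁄ℂ] →ₗ[A] B, π.toLinearMap ∘ₗ c' = c :=
    fun c => Module.projective_lifting_property π.toLinearMap c Ideal.Quotient.mk_surjective
  have hmap : ∀ c : Ω[A⁄ℂ] →ₗ[A] B, (charMatrix b φ π θ (π.toLinearMap ∘ₗ c)).adjugate =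
      (X c).adjugate.map π := by
    intro c
    rw [← AlgHom.mapMatrix_apply, AlgHom.map_adjugate, AlgHom.mapMatrix_apply, ← charMatrix_comp,
      AlgHom.comp_id]
  have hπ : ∀ x, π x = 0 ↔ x ∈ m := fun x => Ideal.Quotient.eq_zero_iff_mem
  rcases h1.eq_or_lt with rfl | h2
  · -- in dimension one, all characteristic matrices are multiples of `X c`, up to the factor `c x`
    obtain ⟨c₀, hc₀, hadj⟩ := exists_adjugate_charMatrix_ne_zero (k := B ⧸ m) b hn le_rfl hθ
    obtain ⟨c, rfl⟩ := hlift c₀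
    obtain ⟨x, hx⟩ : ∃ x, π (c x) ≠ 0 := by
      by_contra! h
      exact hc₀ (LinearMap.ext h)
    change (charMatrix b φ π θ _).adjugate ≠ 0 at hadj
    obtain ⟨i, j, hij⟩ : ∃ i j, π ((X c).adjugate i j) ≠ 0 := by
      by_contra! h
      exact hadj (by rw [hmap]; exact Matrix.ext h)
    have := key (c x) c (fun c' => by
      rw [← Matrix.smul_mul, ← charMatrix_smul,
        show c x • c' = c' x • c from LinearMap.ext fun y => by
          simpa [mul_comm (c' x)] using apply_mul_apply_comm_of_rankAtStalk_eq_one hn c c' x y,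
        charMatrix_smul, Matrix.smul_mul, Matrix.mul_adjugate, hX0, zero_smul, smul_zero]) i j
    rw [← hπ, map_mul, mul_eq_zero] at this
    tauto
  · obtain ⟨c₀, htr⟩ := exists_trace_adjugate_charMatrix_ne_zero (k := B ⧸ m) b hn h2 hφ hθ
    obtain ⟨c, rfl⟩ := hlift c₀
    change (charMatrix b φ π θ _).adjugate.trace ≠ 0 at htr
    have htr' : π (X c).adjugate.trace ≠ 0 := by
      rw [hmap] at htr
      simpa [Matrix.trace] using htr
    obtain ⟨i, hi⟩ : ∃ i, π ((X c).adjugate i i) ≠ 0 := by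
      by_contra! h
      exact htr' (by rw [Matrix.trace, map_sum]; exact Finset.sum_eq_zero fun i _ => h i)
    have := key (X c).adjugate.trace c (fun c' => trace_adjugate_smul_mul_adjugate (hX0 c)
      (commute_charMatrix b φ hφ _ θ c c')
      (trace_adjugate_charMatrix_mul b hθ.charValue_eq_zero c c')) i i
    rw [← hπ, map_mul, mul_eq_zero] at this
    tauto

end Eigenline

/-! ### Gluing morphisms of schemes -/

section GlueHom

open Limits

/-- Morphisms that agree near each point are equal. -/
lemma hom_ext_of_locally {Y Z : Scheme.{0}} {m m' : Y ⟶ Z}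
    (h : ∀ y : Y, ∃ (C : CommRingCat.{0}) (q : Spec C ⟶ Y), IsOpenImmersion q ∧
      y ∈ Set.range q ∧ q ≫ m = q ≫ m') : m = m' := by
  choose C q hq hy hm using h
  let 𝒰 : Y.OpenCover := ⟨⟨Y, fun y => Spec (C y), q⟩, by
    rw [Scheme.presieve₀_mem_precoverage_iff]
    exact ⟨fun y => ⟨y, hy y⟩, hq⟩⟩
  exact 𝒰.hom_ext _ _ hm

/-- A morphism can be given by its restrictions to affine schemes over `Y` (all of them, or only the
open subschemes) if these exist locally, are unique, and are compatible with restriction. -/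
lemma exists_hom_of_locally {Y Z : Scheme.{0}}
    (Q : ∀ {C : CommRingCat.{0}}, (Spec C ⟶ Y) → Prop)
    (hQ : ∀ {C : CommRingCat.{0}} (q : Spec C ⟶ Y), IsOpenImmersion q → Q q)
    (hQ' : ∀ {C D : CommRingCat.{0}} (q : Spec C ⟶ Y) (f : C ⟶ D), Q q →
      IsOpenImmersion (Spec.map f) → Q (Spec.map f ≫ q))
    (P : ∀ {C : CommRingCat.{0}}, (Spec C ⟶ Y) → (Spec C ⟶ Z) → Prop)
    (hP : ∀ y : Y, ∃ (C : CommRingCat.{0}) (q : Spec C ⟶ Y) (m : Spec C ⟶ Z), IsOpenImmersion q ∧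
      y ∈ Set.range q ∧ P q m)
    (hP' : ∀ {C D : CommRingCat.{0}} (q : Spec C ⟶ Y) (m : Spec C ⟶ Z) (f : C ⟶ D), P q m →
      Q (Spec.map f ≫ q) → P (Spec.map f ≫ q) (Spec.map f ≫ m))
    (huniq : ∀ {C : CommRingCat.{0}} (q : Spec C ⟶ Y) (m m' : Spec C ⟶ Z), Q q → P q m → P q m' →
      m = m') :
    ∃ g : Y ⟶ Z, ∀ {C : CommRingCat.{0}} (q : Spec C ⟶ Y) (m : Spec C ⟶ Z), Q q → P q m →
      q ≫ g = m := by
  choose C q m hq hy hm using hP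
  let 𝒰 : Y.OpenCover := ⟨⟨Y, fun y => Spec (C y), q⟩, by
    rw [Scheme.presieve₀_mem_precoverage_iff]
    exact ⟨fun y => ⟨y, hy y⟩, hq⟩⟩
  have key : ∀ {D : CommRingCat.{0}} (q' : Spec D ⟶ Y) (m' : Spec D ⟶ Z), Q q' → P q' m' → ∀ y,
      pullback.fst (q y) q' ≫ m y = pullback.snd (q y) q' ≫ m' := by
    intro D q' m' hq' hm' y
    have := hq y
    refine hom_ext_of_locally fun x => ?_
    obtain ⟨E, i, hi, hx, -⟩ := Scheme.exists_affine_mem_range_and_range_subset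
      (TopologicalSpace.Opens.mem_top x)
    refine ⟨E, i, hi, hx, ?_⟩
    obtain ⟨f, hf⟩ := Spec.map_surjective (i ≫ pullback.fst (q y) q')
    obtain ⟨f', hf'⟩ := Spec.map_surjective (i ≫ pullback.snd (q y) q')
    have ho : IsOpenImmersion (Spec.map f') := by rw [hf']; infer_instance
    have he : Spec.map f ≫ q y = Spec.map f' ≫ q' := by
      rw [hf, hf', Category.assoc, Category.assoc, pullback.condition]
    have hQf := hQ' q' f' hq' ho
    rw [← Category.assoc, ← Category.assoc, ← hf, ← hf']
    refine huniq _ _ _ hQf ?_ (hP' q' m' f' hm' hQf)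
    rw [← he] at hQf ⊢
    exact hP' (q y) (m y) f (hm y) hQf
  have hc : ∀ y y', pullback.fst (q y) (q y') ≫ m y = pullback.snd (q y) (q y') ≫ m y' :=
    fun y y' => key (q y') (m y') (hQ _ (hq y')) (hm y') y
  refine ⟨𝒰.glueMorphisms m hc, fun {D} q' m' hq' hm' => ?_⟩
  refine Scheme.Cover.hom_ext (𝒰.pullback₁ q') _ _ fun y => ?_
  have h1 : q y ≫ 𝒰.glueMorphisms m hc = m y := 𝒰.ι_glueMorphisms m hc y
  have h2 := key q' m' hq' hm' y
  rw [← h1, ← Category.assoc, pullback.condition, Category.assoc] at h2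
  have := hq y
  change pullback.fst q' (q y) ≫ q' ≫ _ = pullback.fst q' (q y) ≫ m'
  rw [← pullbackSymmetry_hom_comp_snd, Category.assoc, Category.assoc, h2]

lemma exists_nhd {Y : Scheme.{0}} {U : Y.Opens} {y : Y} (hy : y ∈ U) :
    ∃ (C : CommRingCat.{0}) (q : Spec C ⟶ Y), IsOpenImmersion q ∧ y ∈ Set.range q ∧
      Set.range q ⊆ U := by
  obtain ⟨C, q, hq, h1, h2⟩ := Scheme.exists_affine_mem_range_and_range_subset hy
  exact ⟨C, q, hq, h1, h2⟩

/-- Every point of an affine scheme is the image of a point with values in a field. -/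
lemma exists_fieldPoint {B : CommRingCat.{0}} (p : Spec B) :
    ∃ (K : Type) (_ : Field K) (κ : B ⟶ .of K), ∀ x, Spec.map κ x = p := by
  have := p.isPrime
  refine ⟨p.asIdeal.ResidueField, inferInstance,
    CommRingCat.ofHom (algebraMap B p.asIdeal.ResidueField), fun x => ?_⟩
  have hx : x = (⊥ : PrimeSpectrum p.asIdeal.ResidueField) :=
    Subsingleton.elim (α := PrimeSpectrum p.asIdeal.ResidueField) _ _
  rw [hx]
  refine PrimeSpectrum.ext ?_
  change RingHom.ker (algebraMap B p.asIdeal.ResidueField) = _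
  exact Ideal.ker_algebraMap_residueField _

instance (K : Type) [Field K] : Subsingleton (Spec (.of K)) :=
  inferInstanceAs (Subsingleton (PrimeSpectrum K))

instance (K : Type) [Field K] : Nonempty (Spec (.of K)) :=
  inferInstanceAs (Nonempty (PrimeSpectrum K))

/-- A morphism from the spectrum of a field that meets an open subscheme factors through it. -/
lemma exists_fieldPoint_lift {Y U : Scheme.{0}} (ι : U ⟶ Y) [IsOpenImmersion ι] {K : Type} [Field K]
    (y : Spec (.of K) ⟶ Y) (x : Spec (.of K)) (hx : y x ∈ Set.range ι) :
    ∃ y' : Spec (.of K) ⟶ U, y' ≫ ι = y := by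
  have h : Set.range y ⊆ Set.range ι := by
    rintro _ ⟨x', rfl⟩
    rwa [Subsingleton.elim x' x]
  exact ⟨IsOpenImmersion.lift ι y h, IsOpenImmersion.lift_fac ι y h⟩

lemma exists_Spec_lift {Y : Scheme.{0}} {R B : CommRingCat.{0}} (ι : Spec R ⟶ Y)
    [IsOpenImmersion ι] (y : Spec B ⟶ Y) (h : Set.range y ⊆ Set.range ι) :
    ∃ f : R ⟶ B, Spec.map f ≫ ι = y := by
  obtain ⟨f, hf⟩ := Spec.map_surjective (IsOpenImmersion.lift ι y h)
  exact ⟨f, by rw [hf, IsOpenImmersion.lift_fac]⟩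

/-- The localization of `B` at the powers of `b`. -/
abbrev away {B : CommRingCat.{0}} (b : B) : CommRingCat.{0} := .of (Localization.Away b)

/-- The localization map. -/
abbrev toAway {B : CommRingCat.{0}} (b : B) : B ⟶ away b :=
  CommRingCat.ofHom (algebraMap B (Localization.Away b))

instance {B : CommRingCat.{0}} (b : B) : IsOpenImmersion (Spec.map (toAway b)) :=
  AlgebraicGeometry.IsOpenImmersion.of_isLocalization b

instance {B : CommRingCat.{0}} (b : B) : Epi (toAway b) :=
  inferInstanceAs (Epi (CommRingCat.ofHom (algebraMap B (Localization (Submonoid.powers b)))))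

lemma range_Spec_toAway {B : CommRingCat.{0}} (b : B) :
    Set.range (Spec.map (toAway b)) = (PrimeSpectrum.basicOpen b : Set (PrimeSpectrum B)) :=
  PrimeSpectrum.localization_away_comap_range (Localization.Away b) b

lemma exists_away_lift {B C : CommRingCat.{0}} {b : B} {f : B ⟶ C} (h : IsUnit (f b)) :
    ∃ f' : away b ⟶ C, toAway b ≫ f' = f :=
  ⟨CommRingCat.ofHom (IsLocalization.Away.lift b (g := f.hom) h), by
    ext x
    exact IsLocalization.Away.lift_eq b h x⟩

/-- Each neighbourhood of a point contains a basic one. -/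
lemma exists_away_of_isOpenImmersion {B C : CommRingCat.{0}} (q : B ⟶ C)
    [IsOpenImmersion (Spec.map q)] {p : Spec B} (hp : p ∈ Set.range (Spec.map q)) :
    ∃ b : B, b ∉ p.asIdeal ∧ ∃ f : C ⟶ away b, q ≫ f = toAway b := by
  obtain ⟨_, ⟨_, ⟨b, rfl⟩, rfl⟩, hpb, hle⟩ := PrimeSpectrum.isBasis_basic_opens.exists_subset_of_mem_open
    (a := p) hp (Spec.map q).isOpenEmbedding.isOpen_range
  obtain ⟨f, hf⟩ := exists_Spec_lift (Spec.map q) (Spec.map (toAway b))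
    ((range_Spec_toAway b).le.trans hle)
  exact ⟨b, hpb, f, Spec.map_injective (by rw [Spec.map_comp, hf])⟩

end GlueHom

/-! ### Functors of points over a scheme -/

section PointFunctor

/-- The open immersion `Spec Γ(Y, U) ⟶ Y` of an affine open subset `U`. -/
def chart {Y : Scheme.{0}} (U : Y.affineOpens) : Spec Γ(Y, U.1) ⟶ Y := IsAffineOpen.fromSpec U.2

instance {Y : Scheme.{0}} (U : Y.affineOpens) : IsOpenImmersion (chart U) :=
  IsAffineOpen.isOpenImmersion_fromSpec U.2

lemma range_chart {Y : Scheme.{0}} (U : Y.affineOpens) : Set.range (chart U) = U.1 :=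
  IsAffineOpen.range_fromSpec U.2

/-- A family of affine open subsets of `X`, indexed by a preordered type, that covers `X` and such
that intersections of members are covered by smaller members. -/
structure AffineBasis (X : Scheme.{0}) (I : Type) [Preorder I] where
  opens : I → X.affineOpens
  mono : ∀ {i j}, i ≤ j → (opens i).1 ≤ (opens j).1
  exists_mem : ∀ x : X, ∃ i, x ∈ (opens i).1
  directed : ∀ i j (x : X), x ∈ (opens i).1 → x ∈ (opens j).1 → ∃ k ≤ i, k ≤ j ∧ x ∈ (opens k).1

namespace AffineBasis

variable {X : Scheme.{0}} {I : Type} [Preorder I] (𝔅 : AffineBasis X I)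

/-- The functions on a member. -/
abbrev ring (i : I) : CommRingCat.{0} := Γ(X, (𝔅.opens i).1)

/-- Restriction of functions. -/
def res {i j : I} (h : j ≤ i) : 𝔅.ring i ⟶ 𝔅.ring j :=
  X.presheaf.map (homOfLE (𝔅.mono h)).op

/-- The point of `X` given by an algebra over the functions on a member. -/
def pt (i : I) {B : CommRingCat.{0}} (α : 𝔅.ring i ⟶ B) : Spec B ⟶ X :=
  Spec.map α ≫ chart (𝔅.opens i)

lemma map_pt (i : I) {B C : CommRingCat.{0}} (α : 𝔅.ring i ⟶ B) (q : B ⟶ C) :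
    Spec.map q ≫ 𝔅.pt i α = 𝔅.pt i (α ≫ q) := by
  rw [pt, pt, Spec.map_comp, Category.assoc]

lemma pt_res {i j : I} (h : j ≤ i) {B : CommRingCat.{0}} (α : 𝔅.ring j ⟶ B) :
    𝔅.pt i (𝔅.res h ≫ α) = 𝔅.pt j α := by
  rw [pt, pt, Spec.map_comp, Category.assoc]
  congr 1
  exact IsAffineOpen.map_fromSpec (𝔅.opens i).2 (𝔅.opens j).2 _

lemma res_res {i j k : I} (h : j ≤ i) (h' : k ≤ j) :
    𝔅.res h ≫ 𝔅.res h' = 𝔅.res (h'.trans h) := by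
  rw [res, res, res, ← Functor.map_comp]
  rfl

lemma res_refl (i : I) : 𝔅.res (le_refl i) = 𝟙 _ :=
  X.presheaf.map_id _

lemma pt_injective {i : I} {B : CommRingCat.{0}} {α α' : 𝔅.ring i ⟶ B}
    (h : 𝔅.pt i α = 𝔅.pt i α') : α = α' := by
  rw [pt, pt, cancel_mono] at h
  exact Spec.map_injective h

lemma exists_pt_eq {i : I} {B : CommRingCat.{0}} (y : Spec B ⟶ X)
    (h : Set.range y ⊆ ((𝔅.opens i).1 : Set X)) : ∃ α : 𝔅.ring i ⟶ B, 𝔅.pt i α = y :=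
  exists_Spec_lift _ y (by rwa [range_chart])

lemma range_pt {i : I} {B : CommRingCat.{0}} (α : 𝔅.ring i ⟶ B) (x : Spec B) :
    𝔅.pt i α x ∈ (𝔅.opens i).1 := by
  rw [← SetLike.mem_coe, ← range_chart]
  exact ⟨Spec.map α x, rfl⟩

end AffineBasis

/-- A functor of points over `X`, that is a Zariski sheaf on the category of affine schemes over `X`,
given only on the points `Spec B ⟶ X` that factor through a member of a basis of affine open
subsets. -/
structure PointFunctor {X : Scheme.{0}} {I : Type} [Preorder I] (𝔅 : AffineBasis X I) where
  obj : ∀ (i : I) {B : CommRingCat.{0}}, (𝔅.ring i ⟶ B) → Type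
  map : ∀ {i j : I} (h : j ≤ i) {B C : CommRingCat.{0}} {α : 𝔅.ring i ⟶ B} {β : 𝔅.ring j ⟶ C}
    (q : B ⟶ C), α ≫ q = 𝔅.res h ≫ β → obj i α → obj j β
  map_id : ∀ {i : I} {B : CommRingCat.{0}} {α : 𝔅.ring i ⟶ B} (hq : α ≫ 𝟙 B = 𝔅.res le_rfl ≫ α)
    (s : obj i α), map le_rfl (𝟙 B) hq s = s
  map_map : ∀ {i j k : I} (h : j ≤ i) (h' : k ≤ j) {B C D : CommRingCat.{0}} {α : 𝔅.ring i ⟶ B}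
    {β : 𝔅.ring j ⟶ C} {γ : 𝔅.ring k ⟶ D} (q : B ⟶ C) (q' : C ⟶ D) (hq : α ≫ q = 𝔅.res h ≫ β)
    (hq' : β ≫ q' = 𝔅.res h' ≫ γ) (hqq : α ≫ q ≫ q' = 𝔅.res (h'.trans h) ≫ γ) (s : obj i α),
    map h' q' hq' (map h q hq s) = map (h'.trans h) (q ≫ q') hqq s
  map_bijective : ∀ {i j : I} (h : j ≤ i) {B : CommRingCat.{0}} {α : 𝔅.ring i ⟶ B}
    {β : 𝔅.ring j ⟶ B} (hq : α ≫ 𝟙 B = 𝔅.res h ≫ β), Function.Bijective (map h (𝟙 B) hq)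
  eq_of_locally : ∀ {i : I} {B : CommRingCat.{0}} {α : 𝔅.ring i ⟶ B} (s t : obj i α),
    (∀ p : PrimeSpectrum B, ∃ b ∉ p.asIdeal, ∃ (β : 𝔅.ring i ⟶ away b)
      (hq : α ≫ toAway b = 𝔅.res le_rfl ≫ β),
      map le_rfl (toAway b) hq s = map le_rfl (toAway b) hq t) → s = t
  exists_glue : ∀ {i : I} {B : CommRingCat.{0}} (α : 𝔅.ring i ⟶ B) (ι : Type) (b : ι → B),
    Ideal.span (Set.range b) = ⊤ → ∀ (s : ∀ k, obj i (α ≫ toAway (b k))),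
    (∀ (k l : ι) {C : CommRingCat.{0}} (f : away (b k) ⟶ C) (f' : away (b l) ⟶ C)
      (γ : 𝔅.ring i ⟶ C) (hf : (α ≫ toAway (b k)) ≫ f = 𝔅.res le_rfl ≫ γ)
      (hf' : (α ≫ toAway (b l)) ≫ f' = 𝔅.res le_rfl ≫ γ), toAway (b k) ≫ f = toAway (b l) ≫ f' →
      map le_rfl f hf (s k) = map le_rfl f' hf' (s l)) →
    ∃ t : obj i α, ∀ (k : ι) (hq : α ≫ toAway (b k) = 𝔅.res le_rfl ≫ α ≫ toAway (b k)),
      map le_rfl (toAway (b k)) hq t = s k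

namespace PointFunctor

variable {X : Scheme.{0}} {I : Type} [Preorder I] {𝔅 : AffineBasis X I} (F : PointFunctor 𝔅)

lemma map_congr {i j : I} (h : j ≤ i) {B C : CommRingCat.{0}} {α : 𝔅.ring i ⟶ B}
    {β : 𝔅.ring j ⟶ C} {q q' : B ⟶ C} (e : q = q') (hq : α ≫ q = 𝔅.res h ≫ β)
    (hq' : α ≫ q' = 𝔅.res h ≫ β) (s : F.obj i α) : F.map h q hq s = F.map h q' hq' s := by
  subst e; rfl

/-- Two elements are equal if they are so in the neighbourhood of each point with values in a
field. -/
lemma eq_of_fieldPoint {i : I} {B : CommRingCat.{0}} {α : 𝔅.ring i ⟶ B} (s t : F.obj i α)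
    (h : ∀ (K : Type) [Field K] (κ : B ⟶ .of K), ∃ (C : CommRingCat.{0}) (q : B ⟶ C)
      (κ' : C ⟶ .of K) (β : 𝔅.ring i ⟶ C) (hq : α ≫ q = 𝔅.res le_rfl ≫ β),
      IsOpenImmersion (Spec.map q) ∧ q ≫ κ' = κ ∧
      F.map le_rfl q hq s = F.map le_rfl q hq t) : s = t := by
  refine F.eq_of_locally s t fun p => ?_
  obtain ⟨K, hK, κ, hκ⟩ := exists_fieldPoint p
  obtain ⟨C, q, κ', β, hq, ho, hκ', e⟩ := h K κ
  have x : Spec (.of K) := Classical.arbitrary _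
  obtain ⟨b, hb, f, hf⟩ := exists_away_of_isOpenImmersion q (p := p)
    ⟨Spec.map κ' x, by rw [← hκ x, ← hκ', Spec.map_comp]; rfl⟩
  have h1 : β ≫ f = 𝔅.res le_rfl ≫ β ≫ f := by rw [𝔅.res_refl, Category.id_comp]
  have h2 : α ≫ toAway b = 𝔅.res le_rfl ≫ β ≫ f := by
    rw [← hf, ← Category.assoc, hq, Category.assoc]
  have h3 : α ≫ q ≫ f = 𝔅.res le_rfl ≫ β ≫ f := by rw [hf, h2]
  refine ⟨b, hb, β ≫ f, h2, ?_⟩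
  have := congrArg (F.map le_rfl f h1) e
  rw [F.map_map le_rfl le_rfl q f hq h1 h3, F.map_map le_rfl le_rfl q f hq h1 h3] at this
  rwa [F.map_congr le_rfl hf h3 h2, F.map_congr le_rfl hf h3 h2] at this

/-- Affine charts of a functor of points: over each member `i` of the basis, a family of affine
schemes `Spec (R i a)` that are open subfunctors of `F` and cover it. -/
structure Charts where
  A : I → Type
  R : ∀ i, A i → CommRingCat.{0}
  str : ∀ i a, 𝔅.ring i ⟶ R i a
  u : ∀ i a, F.obj i (str i a)
  hom_ext : ∀ (i : I) (a : A i) {B : CommRingCat.{0}} (α : 𝔅.ring i ⟶ B) (f f' : R i a ⟶ B)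
    (hf : str i a ≫ f = 𝔅.res le_rfl ≫ α) (hf' : str i a ≫ f' = 𝔅.res le_rfl ≫ α),
    F.map le_rfl f hf (u i a) = F.map le_rfl f' hf' (u i a) → f = f'
  exists_fieldPoint : ∀ (i : I) (K : Type) [Field K] (α : 𝔅.ring i ⟶ .of K) (s : F.obj i α),
    ∃ (a : A i) (f : R i a ⟶ .of K) (hf : str i a ≫ f = 𝔅.res le_rfl ≫ α),
      F.map le_rfl f hf (u i a) = s
  exists_nhd : ∀ (i : I) (a : A i) {B : CommRingCat.{0}} (α : 𝔅.ring i ⟶ B) (s : F.obj i α)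
    (K : Type) [Field K] (κ : B ⟶ .of K) (α' : 𝔅.ring i ⟶ .of K)
    (hκ : α ≫ κ = 𝔅.res le_rfl ≫ α') (f : R i a ⟶ .of K)
    (hf : str i a ≫ f = 𝔅.res le_rfl ≫ α'),
    F.map le_rfl f hf (u i a) = F.map le_rfl κ hκ s →
    ∃ b : B, κ b ≠ 0 ∧ ∃ (β : 𝔅.ring i ⟶ away b) (hq : α ≫ toAway b = 𝔅.res le_rfl ≫ β)
      (f' : R i a ⟶ away b) (hf' : str i a ≫ f' = 𝔅.res le_rfl ≫ β),
      F.map le_rfl f' hf' (u i a) = F.map le_rfl (toAway b) hq s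

variable {F} (𝓒 : F.Charts)

namespace Charts

/-- The basic open subsets of the charts. -/
structure Index where
  i : I
  a : 𝓒.A i
  g : 𝓒.R i a

variable {𝓒}

/-- The functions on a basic open subset of a chart. -/
abbrev Index.ring (c : 𝓒.Index) : CommRingCat.{0} := away c.g

/-- The projection of a basic open subset of a chart to `X`. -/
def Index.str (c : 𝓒.Index) : 𝔅.ring c.i ⟶ c.ring := 𝓒.str c.i c.a ≫ toAway c.g

/-- The universal element over a basic open subset of a chart. -/
def Index.elt (c : 𝓒.Index) : F.obj c.i c.str :=
  F.map le_rfl (toAway c.g) (by rw [𝔅.res_refl, Category.id_comp]; rfl) (𝓒.u c.i c.a)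

/-- `f` is a factorization of `q^* s` through the basic open subset `c` of a chart. -/
def IsFac (c : 𝓒.Index) {i : I} (h : c.i ≤ i) {B C : CommRingCat.{0}} {α : 𝔅.ring i ⟶ B}
    (s : F.obj i α) (q : B ⟶ C) (f : c.ring ⟶ C) : Prop :=
  ∃ (β : 𝔅.ring c.i ⟶ C) (hβ : α ≫ q = 𝔅.res h ≫ β) (hf : c.str ≫ f = 𝔅.res le_rfl ≫ β),
    F.map h q hβ s = F.map le_rfl f hf c.elt

section IsFac

variable {c c' : 𝓒.Index} {i j : I} {h : c.i ≤ i} {B C D : CommRingCat.{0}}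
  {α : 𝔅.ring i ⟶ B} {s : F.obj i α} {q : B ⟶ C} {f : c.ring ⟶ C}

lemma IsFac.str_comp (hs : IsFac c h s q f) : α ≫ q = 𝔅.res h ≫ c.str ≫ f := by
  obtain ⟨β, hβ, hf, -⟩ := hs
  rw [hf, 𝔅.res_refl, Category.id_comp, ← hβ]

lemma IsFac.pt_eq (hs : IsFac c h s q f) :
    Spec.map q ≫ 𝔅.pt i α = Spec.map f ≫ 𝔅.pt c.i c.str := by
  rw [𝔅.map_pt, hs.str_comp, 𝔅.pt_res, 𝔅.map_pt]

lemma isFac_iff (hβ : α ≫ q = 𝔅.res h ≫ c.str ≫ f)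
    (hf : c.str ≫ f = 𝔅.res le_rfl ≫ c.str ≫ f) :
    IsFac c h s q f ↔ F.map h q hβ s = F.map le_rfl f hf c.elt := by
  refine ⟨?_, fun e => ⟨_, hβ, hf, e⟩⟩
  rintro ⟨β, hβ', hf', e⟩
  have : β = c.str ≫ f := by rw [hf', 𝔅.res_refl, Category.id_comp]
  subst this
  exact e

lemma IsFac.comp (hs : IsFac c h s q f) (q' : C ⟶ D) : IsFac c h s (q ≫ q') (f ≫ q') := by
  obtain ⟨β, hβ, hf, e⟩ := hs
  have h1 : α ≫ q ≫ q' = 𝔅.res h ≫ β ≫ q' := by rw [← Category.assoc, hβ, Category.assoc]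
  have h2 : c.str ≫ f ≫ q' = 𝔅.res le_rfl ≫ β ≫ q' := by
    rw [← Category.assoc, hf, Category.assoc]
  have h3 : β ≫ q' = 𝔅.res le_rfl ≫ β ≫ q' := by rw [𝔅.res_refl, Category.id_comp]
  refine ⟨β ≫ q', h1, h2, ?_⟩
  rw [← F.map_map h le_rfl q q' hβ h3 h1, ← F.map_map le_rfl le_rfl f q' hf h3 h2, e]

/-- A factorization of a restriction of `s` is one of `s`. -/
lemma isFac_map_iff {f : c.ring ⟶ D} (hc : c.i ≤ j) (hj : j ≤ i) {β : 𝔅.ring j ⟶ C}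
    (hq : α ≫ q = 𝔅.res hj ≫ β) (q' : C ⟶ D) :
    IsFac c hc (F.map hj q hq s) q' f ↔ IsFac c (hc.trans hj) s (q ≫ q') f := by
  have key : ∀ {γ : 𝔅.ring c.i ⟶ D}, α ≫ q ≫ q' = 𝔅.res (hc.trans hj) ≫ γ ↔
      β ≫ q' = 𝔅.res hc ≫ γ := by
    intro γ
    rw [← Category.assoc, hq, Category.assoc, ← 𝔅.res_res hj hc, Category.assoc]
    refine ⟨fun h => 𝔅.pt_injective ?_, fun h => by rw [h]⟩
    rw [← 𝔅.pt_res hj, h, 𝔅.pt_res]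
  constructor
  · rintro ⟨γ, hγ, hf, e⟩
    refine ⟨γ, key.2 hγ, hf, ?_⟩
    rw [← e, F.map_map]
  · rintro ⟨γ, hγ, hf, e⟩
    refine ⟨γ, key.1 hγ, hf, ?_⟩
    rw [← e, F.map_map]

/-- The universal element factors through its own chart. -/
lemma isFac_elt (c : 𝓒.Index) (q : c.ring ⟶ C) : IsFac c le_rfl c.elt q q := by
  have h1 : c.str ≫ q = 𝔅.res le_rfl ≫ c.str ≫ q := by rw [𝔅.res_refl, Category.id_comp]
  exact ⟨_, h1, h1, rfl⟩

lemma IsFac.unique {f' : c.ring ⟶ C} {h' : c.i ≤ i} (hs : IsFac c h s q f)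
    (hs' : IsFac c h' s q f') : f = f' := by
  obtain ⟨β, hβ, hf, e⟩ := hs
  obtain ⟨β', hβ', hf', e'⟩ := hs'
  have : β = β' := by
    refine 𝔅.pt_injective ?_
    rw [← 𝔅.pt_res h, ← hβ, hβ', 𝔅.pt_res]
  subst this
  rw [e] at e'
  rw [← cancel_epi (toAway c.g)]
  have h1 : 𝓒.str c.i c.a ≫ toAway c.g ≫ f = 𝔅.res le_rfl ≫ β := by
    rw [← hf, Index.str, Category.assoc]
  have h2 : 𝓒.str c.i c.a ≫ toAway c.g ≫ f' = 𝔅.res le_rfl ≫ β := by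
    rw [← hf', Index.str, Category.assoc]
  refine 𝓒.hom_ext c.i c.a β _ _ h1 h2 ?_
  rw [Index.elt, F.map_map _ _ _ _ _ _ h1, F.map_map _ _ _ _ _ _ h2] at e'
  exact e'

variable {f' : c'.ring ⟶ C} {h' : c'.i ≤ i} {hc : c.i ≤ c'.i}

/-- If `s` is the restriction of the universal element of `c'` along `f'`, a factorization of the
latter through `c` is one of `s`; the two lemmas after this one are the other implications between
these three factorizations. -/
lemma IsFac.of_elt (hs : IsFac c' h' s q f') (hf : IsFac c hc c'.elt f' f) :
    IsFac c (hc.trans h') s q f := by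
  obtain ⟨β', hβ', hf', e'⟩ := hs
  obtain ⟨β, hβ, hf, e⟩ := hf
  have h0 : β' = c'.str ≫ f' := by rw [hf', 𝔅.res_refl, Category.id_comp]
  have h1 : β' ≫ 𝟙 C = 𝔅.res hc ≫ β := by rw [h0, Category.comp_id, hβ]
  have h2 : α ≫ q = 𝔅.res (hc.trans h') ≫ β := by
    rw [hβ', ← Category.comp_id β', h1, ← Category.assoc, 𝔅.res_res]
  refine ⟨β, h2, hf, ?_⟩
  have := congrArg (F.map hc (𝟙 C) h1) e'
  rw [F.map_map h' hc q (𝟙 C) hβ' h1 (by rw [Category.comp_id, h2]),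
    F.map_map le_rfl hc f' (𝟙 C) hf' h1 (by rw [Category.comp_id, hβ])] at this
  rw [← e, F.map_congr _ (Category.comp_id f').symm hβ (by rw [Category.comp_id, hβ]), ← this]
  exact F.map_congr _ (Category.comp_id q).symm _ _ _

lemma IsFac.elt_of (hs : IsFac c' h' s q f') (hf : IsFac c h s q f) (hc : c.i ≤ c'.i) :
    IsFac c hc c'.elt f' f := by
  obtain ⟨β', hβ', hf', e'⟩ := hs
  obtain ⟨β, hβ, hf, e⟩ := hf
  have h0 : β' = c'.str ≫ f' := by rw [hf', 𝔅.res_refl, Category.id_comp]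
  have h1 : β' ≫ 𝟙 C = 𝔅.res hc ≫ β := by
    refine 𝔅.pt_injective ?_
    rw [Category.comp_id, 𝔅.pt_res, ← 𝔅.pt_res h', ← hβ', hβ, 𝔅.pt_res]
  have h2 : c'.str ≫ f' = 𝔅.res hc ≫ β := by rw [← h1, h0, Category.comp_id]
  refine ⟨β, h2, hf, ?_⟩
  have := congrArg (F.map hc (𝟙 C) h1) e'
  rw [F.map_map h' hc q (𝟙 C) hβ' h1 (by rw [Category.comp_id, hβ]),
    F.map_map le_rfl hc f' (𝟙 C) hf' h1 (by rw [Category.comp_id, h2])] at this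
  rw [← e, F.map_congr _ (Category.comp_id f').symm h2 (by rw [Category.comp_id, h2]), ← this]
  exact F.map_congr _ (Category.comp_id q) _ _ _

lemma IsFac.of_isFac_elt (hs : IsFac c h s q f) (hf : IsFac c hc c'.elt f' f) (h' : c'.i ≤ i) :
    IsFac c' h' s q f' := by
  have hα := hs.str_comp
  have h0 := hf.str_comp
  have h1 : α ≫ q = 𝔅.res h' ≫ c'.str ≫ f' := by
    rw [hα, h0, ← Category.assoc (𝔅.res h'), 𝔅.res_res]
  have h2 : c'.str ≫ f' = 𝔅.res le_rfl ≫ c'.str ≫ f' := by rw [𝔅.res_refl, Category.id_comp]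
  have h3 : (c'.str ≫ f') ≫ 𝟙 C = 𝔅.res hc ≫ c.str ≫ f := by rw [Category.comp_id, h0]
  have h4 : c.str ≫ f = 𝔅.res le_rfl ≫ c.str ≫ f := by rw [𝔅.res_refl, Category.id_comp]
  rw [isFac_iff h1 h2]
  rw [isFac_iff hα h4] at hs
  rw [isFac_iff h0 h4] at hf
  refine (F.map_bijective hc h3).1 ?_
  rw [F.map_map h' hc q (𝟙 C) h1 h3 (by rw [Category.comp_id, hα]),
    F.map_map le_rfl hc f' (𝟙 C) h2 h3 (by rw [Category.comp_id, h0]),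
    F.map_congr _ (Category.comp_id q) _ hα, F.map_congr _ (Category.comp_id f') _ h0, hs, hf]

end IsFac

/-- The order on basic open subsets of charts given by inclusion, as subfunctors of `F`. -/
instance : Preorder 𝓒.Index where
  le c c' := ∃ (h : c.i ≤ c'.i) (t : c'.ring ⟶ c.ring), IsFac c h c'.elt t (𝟙 _)
  le_refl c := ⟨le_rfl, 𝟙 _, isFac_elt c _⟩
  le_trans := by
    rintro c c' c'' ⟨h, t, ht⟩ ⟨h', t', ht'⟩
    refine ⟨h.trans h', t' ≫ t, (ht'.comp t).of_elt (hc := h) ?_⟩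
    rwa [Category.id_comp]

lemma Index.i_le {c c' : 𝓒.Index} (h : c ≤ c') : c.i ≤ c'.i := h.choose

/-- The transition maps. -/
def Index.trans {c c' : 𝓒.Index} (h : c ≤ c') : c'.ring ⟶ c.ring := h.choose_spec.choose

lemma Index.isFac_trans {c c' : 𝓒.Index} (h : c ≤ c') {C : CommRingCat.{0}} (q : c.ring ⟶ C) :
    IsFac c (Index.i_le h) c'.elt (Index.trans h ≫ q) q := by
  have := (h.choose_spec.choose_spec).comp q
  rwa [Category.id_comp] at this

/-- A factorization through a smaller basic open subset gives one through a larger one. -/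
lemma IsFac.trans {c c' : 𝓒.Index} {i : I} {h : c.i ≤ i} {B C : CommRingCat.{0}}
    {α : 𝔅.ring i ⟶ B} {s : F.obj i α} {q : B ⟶ C} {f : c.ring ⟶ C} (hs : IsFac c h s q f)
    (hc : c ≤ c') (h' : c'.i ≤ i) : IsFac c' h' s q (Index.trans hc ≫ f) :=
  hs.of_isFac_elt (Index.isFac_trans hc f) h'

lemma Index.eq_trans {c c' : 𝓒.Index} {h : c.i ≤ c'.i} {t : c'.ring ⟶ c.ring}
    (ht : IsFac c h c'.elt t (𝟙 _)) (hc : c ≤ c') : t = Index.trans hc := by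
  have := (ht.trans hc le_rfl).unique (isFac_elt c' t)
  rw [← this, Category.comp_id]

lemma Index.trans_refl (c : 𝓒.Index) : Index.trans (le_refl c) = 𝟙 _ :=
  (Index.eq_trans (isFac_elt c (𝟙 _)) _).symm

lemma Index.trans_trans {c c' c'' : 𝓒.Index} (h : c ≤ c') (h' : c' ≤ c'') :
    Index.trans (h.trans h') = Index.trans h' ≫ Index.trans h := by
  have h1 := Index.isFac_trans h (𝟙 _)
  rw [Category.comp_id] at h1
  exact (Index.eq_trans ((Index.isFac_trans h' (Index.trans h)).of_elt h1) _).symm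

instance {c c' : 𝓒.Index} (h : c ≤ c') : Epi (Index.trans h) where
  left_cancellation f f' e := by
    have h1 := Index.isFac_trans h f
    rw [e] at h1
    exact h1.unique (Index.isFac_trans h f')

/-- A factorization at a point with values in a field extends to a neighbourhood. -/
lemma exists_nhd_isFac (c : 𝓒.Index) {i : I} (h : c.i ≤ i) {B : CommRingCat.{0}}
    {α : 𝔅.ring i ⟶ B} (s : F.obj i α) {K : Type} [Field K] (κ : B ⟶ .of K)
    {f₀ : c.ring ⟶ .of K} (hs : IsFac c h s κ f₀) :
    ∃ (C : CommRingCat.{0}) (q : B ⟶ C) (κ' : C ⟶ .of K) (f : c.ring ⟶ C),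
      IsOpenImmersion (Spec.map q) ∧ q ≫ κ' = κ ∧ IsFac c h s q f := by
  have x : Spec (.of K) := Classical.arbitrary _
  -- shrink `Spec B` so that it maps to the given member of the basis
  have hx : (Spec.map κ x : Spec B) ∈ (𝔅.pt i α) ⁻¹ᵁ (𝔅.opens c.i).1 := by
    change (Spec.map κ ≫ 𝔅.pt i α) x ∈ (𝔅.opens c.i).1
    rw [𝔅.map_pt, hs.str_comp, 𝔅.pt_res]
    exact 𝔅.range_pt _ x
  obtain ⟨C₁, q₁, ho₁, hx₁, hle⟩ := Higgs.exists_nhd hx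
  obtain ⟨q₁, rfl⟩ := Spec.map_surjective q₁
  obtain ⟨α₁, hα₁⟩ := 𝔅.exists_pt_eq (i := c.i) (𝔅.pt i (α ≫ q₁)) (by
    rw [← 𝔅.map_pt]
    rintro _ ⟨y, rfl⟩
    exact hle ⟨y, rfl⟩)
  have h₁ : α ≫ q₁ = 𝔅.res h ≫ α₁ := 𝔅.pt_injective (by rw [𝔅.pt_res, hα₁])
  obtain ⟨κ₁, hκ₁⟩ := exists_fieldPoint_lift (Spec.map q₁) (Spec.map κ) x hx₁
  obtain ⟨κ₁, rfl⟩ := Spec.map_surjective κ₁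
  rw [← Spec.map_comp] at hκ₁
  replace hκ₁ := Spec.map_injective hκ₁
  -- shrink further to the open locus where the chart is defined
  have hs₁ : IsFac c le_rfl (F.map h q₁ h₁ s) κ₁ f₀ := by
    rw [isFac_map_iff, hκ₁]; exact hs
  have hβ := hs₁.str_comp
  have hf := isFac_elt c f₀
  rw [𝔅.res_refl, Category.id_comp] at hβ
  have h2 : α₁ ≫ κ₁ = 𝔅.res le_rfl ≫ c.str ≫ f₀ := by rw [𝔅.res_refl, Category.id_comp, hβ]
  have h3 : c.str ≫ f₀ = 𝔅.res le_rfl ≫ c.str ≫ f₀ := by rw [𝔅.res_refl, Category.id_comp]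
  have h4 : 𝓒.str c.i c.a ≫ toAway c.g ≫ f₀ = 𝔅.res le_rfl ≫ c.str ≫ f₀ := by
    rw [← h3, Index.str, Category.assoc]
  rw [isFac_iff h2 h3, Index.elt, F.map_map _ _ _ _ _ _ h4] at hs₁
  obtain ⟨b, hb, β₂, h5, f₂, h6, e₂⟩ := 𝓒.exists_nhd c.i c.a α₁ (F.map h q₁ h₁ s) K κ₁
    (c.str ≫ f₀) h2 (toAway c.g ≫ f₀) h4 hs₁.symm
  obtain ⟨κ₂, hκ₂⟩ := exists_away_lift (f := κ₁) (b := b) (isUnit_iff_ne_zero.2 hb)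
  have e : f₂ ≫ κ₂ = toAway c.g ≫ f₀ := by
    have h7 : 𝓒.str c.i c.a ≫ f₂ ≫ κ₂ = 𝔅.res le_rfl ≫ c.str ≫ f₀ := by
      rw [← h2, ← hκ₂, ← Category.assoc, h6, ← h5, Category.assoc]
    have h8 : β₂ ≫ κ₂ = 𝔅.res le_rfl ≫ c.str ≫ f₀ := by
      rw [← h7, ← Category.assoc, h6, 𝔅.res_refl, Category.id_comp]
    refine 𝓒.hom_ext c.i c.a _ _ _ h7 h4 ?_
    rw [← hs₁, ← F.map_map le_rfl le_rfl f₂ κ₂ h6 h8 h7, e₂,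
      F.map_map le_rfl le_rfl _ κ₂ h5 h8 (by rw [hκ₂, h2])]
    exact F.map_congr _ hκ₂ _ _ _
  -- and to the locus where `g` does not vanish
  have hg : κ₂ (f₂ c.g) ≠ 0 := by
    have h1 : κ₂ (f₂ c.g) = f₀ (toAway c.g c.g) := congrArg (fun t => t c.g) e
    rw [h1]
    exact ((IsLocalization.Away.algebraMap_isUnit (S := Localization.Away c.g) c.g).map f₀.hom).ne_zero
  obtain ⟨κ₃, hκ₃⟩ := exists_away_lift (f := κ₂) (b := f₂ c.g) (isUnit_iff_ne_zero.2 hg)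
  obtain ⟨f₃, hf₃⟩ := exists_away_lift (b := c.g) (f := f₂ ≫ toAway (f₂ c.g))
    (IsLocalization.Away.algebraMap_isUnit (S := Localization.Away (f₂ c.g)) (f₂ c.g))
  refine ⟨_, q₁ ≫ toAway b ≫ toAway (f₂ c.g), κ₃, f₃, ?_, ?_, ?_⟩
  · rw [Spec.map_comp, Spec.map_comp]
    infer_instance
  · rw [Category.assoc, Category.assoc, hκ₃, hκ₂, hκ₁]
  · rw [← isFac_map_iff le_rfl h h₁]
    have h7 : c.str ≫ f₃ = 𝔅.res le_rfl ≫ β₂ ≫ toAway (f₂ c.g) := by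
      rw [Index.str, Category.assoc, hf₃, ← Category.assoc, h6, Category.assoc]
    have h8 : β₂ ≫ toAway (f₂ c.g) = 𝔅.res le_rfl ≫ β₂ ≫ toAway (f₂ c.g) := by
      rw [𝔅.res_refl, Category.id_comp]
    have h9 : α₁ ≫ toAway b ≫ toAway (f₂ c.g) = 𝔅.res le_rfl ≫ β₂ ≫ toAway (f₂ c.g) := by
      rw [← Category.assoc, h5, Category.assoc]
    refine ⟨_, h9, h7, ?_⟩
    have h10 : 𝓒.str c.i c.a ≫ toAway c.g ≫ f₃ = 𝔅.res le_rfl ≫ β₂ ≫ toAway (f₂ c.g) := by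
      rw [← h7, Index.str, Category.assoc]
    rw [Index.elt, F.map_map _ _ _ _ _ h7 h10, ← F.map_map le_rfl le_rfl _ _ h5 h8 h9, ← e₂,
      F.map_map le_rfl le_rfl f₂ _ h6 h8 (by rw [← hf₃, h10])]
    exact F.map_congr _ hf₃.symm _ _ _

end Charts
end PointFunctor
end PointFunctor

/-! ### The diagram of the charts -/

section PointFunctor
namespace PointFunctor
namespace Charts

variable {X : Scheme.{0}} {I : Type} [Preorder I] {𝔅 : AffineBasis X I} {F : PointFunctor 𝔅}
  {𝓒 : F.Charts}

/-- A factorization through a basic open subset gives one through any other basic open subset of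
the same chart that contains the point. -/
lemma IsFac.basic {k : I} {a : 𝓒.A k} {g g' : 𝓒.R k a} {i : I} {h : k ≤ i} {B C : CommRingCat.{0}}
    {α : 𝔅.ring i ⟶ B} {s : F.obj i α} {q : B ⟶ C} {f : away g ⟶ C}
    (hs : IsFac (⟨k, a, g⟩ : 𝓒.Index) h s q f) {f' : away g' ⟶ C}
    (e : toAway g' ≫ f' = toAway g ≫ f) : IsFac (⟨k, a, g'⟩ : 𝓒.Index) h s q f' := by
  obtain ⟨β, hβ, hf, e'⟩ := hs
  have h1 : 𝓒.str k a ≫ toAway g ≫ f = 𝔅.res le_rfl ≫ β := by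
    rw [← hf, Index.str, Category.assoc]
  have h2 : 𝓒.str k a ≫ toAway g' ≫ f' = 𝔅.res le_rfl ≫ β := by rw [e, h1]
  have h3 : (⟨k, a, g'⟩ : 𝓒.Index).str ≫ f' = 𝔅.res le_rfl ≫ β := by
    rw [← h2, Index.str, Category.assoc]
  refine ⟨β, hβ, h3, ?_⟩
  rw [e', Index.elt, Index.elt, F.map_map _ _ _ _ _ _ h1, F.map_map _ _ _ _ _ _ h2]
  exact F.map_congr _ e.symm _ _ _

/-- Over a field, each element factors through a chart. -/
lemma exists_isFac {i k : I} (h : k ≤ i) {B : CommRingCat.{0}} {α : 𝔅.ring i ⟶ B}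
    (s : F.obj i α) {K : Type} [Field K] (κ : B ⟶ .of K)
    (hk : ∀ x : Spec (.of K), 𝔅.pt i (α ≫ κ) x ∈ (𝔅.opens k).1) :
    ∃ (a : 𝓒.A k) (f : away (1 : 𝓒.R k a) ⟶ .of K),
      IsFac (⟨k, a, 1⟩ : 𝓒.Index) h s κ f := by
  obtain ⟨β, hβ⟩ := 𝔅.exists_pt_eq (i := k) (𝔅.pt i (α ≫ κ)) (by rintro _ ⟨x, rfl⟩; exact hk x)
  have h1 : α ≫ κ = 𝔅.res h ≫ β := 𝔅.pt_injective (by rw [𝔅.pt_res, hβ])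
  obtain ⟨a, f, hf, e⟩ := 𝓒.exists_fieldPoint k K β (F.map h κ h1 s)
  obtain ⟨f', rfl⟩ := exists_away_lift (b := (1 : 𝓒.R k a)) (f := f) (by simp)
  have h2 : (⟨k, a, 1⟩ : 𝓒.Index).str ≫ f' = 𝔅.res le_rfl ≫ β := by
    rw [← hf, Index.str, Category.assoc]
  refine ⟨a, f', β, h1, h2, ?_⟩
  rw [← e, Index.elt, F.map_map _ _ _ _ _ _ hf]

lemma Index.basic_le {k : I} {a : 𝓒.A k} {g g' : 𝓒.R k a} (h : g ∣ g') :
    (⟨k, a, g'⟩ : 𝓒.Index) ≤ ⟨k, a, g⟩ := by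
  obtain ⟨t, ht⟩ := exists_away_lift (f := toAway g') (b := g)
    (isUnit_of_dvd_unit (map_dvd _ h)
      (IsLocalization.Away.algebraMap_isUnit (S := Localization.Away g') g'))
  refine ⟨le_rfl, t, IsFac.basic (isFac_elt ⟨k, a, g⟩ t) ?_⟩
  rw [ht, Category.comp_id]

/-- A chart contains a neighbourhood of each of its field valued points in any other chart over a
smaller member of the basis. -/
lemma exists_basic_le {c₀ c : 𝓒.Index} (hk : c₀.i ≤ c.i) {i : I} {hi : c₀.i ≤ i}
    {hc : c.i ≤ i} {B : CommRingCat.{0}} {α : 𝔅.ring i ⟶ B} {s : F.obj i α} {K : Type} [Field K]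
    {κ : B ⟶ .of K} {f : c₀.ring ⟶ .of K} {f₁ : c.ring ⟶ .of K}
    (hf : IsFac c₀ hi s κ f) (hf₁ : IsFac c hc s κ f₁) :
    ∃ g : 𝓒.R c₀.i c₀.a, f (toAway c₀.g g) ≠ 0 ∧ (⟨c₀.i, c₀.a, g⟩ : 𝓒.Index) ≤ c := by
  -- the universal element of the small chart, regarded over the larger member
  have h1 : (𝔅.res hk ≫ c₀.str) ≫ 𝟙 _ = 𝔅.res hk ≫ c₀.str := Category.comp_id _
  obtain ⟨u, hu⟩ := (F.map_bijective hk h1).2 c₀.elt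
  have hu' : ∀ {C : CommRingCat.{0}} (q : c₀.ring ⟶ C), IsFac c₀ hk u q q := by
    intro C q
    have := (isFac_map_iff (s := u) (f := q) le_rfl hk h1 q).1 (by rw [hu]; exact isFac_elt c₀ q)
    rwa [Category.id_comp] at this
  have h2 : IsFac c le_rfl u f f₁ := (hu' f).of_isFac_elt (hf₁.elt_of hf hk) le_rfl
  obtain ⟨C, q, κ', f', ho, hq, hf'⟩ := Charts.exists_nhd_isFac c le_rfl u f h2
  have x : Spec (.of K) := Classical.arbitrary _
  have : IsOpenImmersion (Spec.map (toAway c₀.g ≫ q)) := by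
    rw [Spec.map_comp]; infer_instance
  obtain ⟨g, hg, j, hj⟩ := exists_away_of_isOpenImmersion (toAway c₀.g ≫ q)
    (p := Spec.map (toAway c₀.g ≫ f) x)
    ⟨Spec.map κ' x, by rw [← hq, ← Category.assoc, Spec.map_comp _ κ']; rfl⟩
  have h3 : IsFac (⟨c₀.i, c₀.a, g⟩ : 𝓒.Index) hk u (q ≫ j) (𝟙 _) :=
    IsFac.basic (g := c₀.g) (hu' (q ≫ j)) (by rw [← hj, Category.comp_id, Category.assoc])
  refine ⟨g, fun h => hg ?_, hk, f' ≫ j, (hf'.comp j).elt_of h3 hk⟩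
  change f (toAway c₀.g g) ∈ x.asIdeal
  rw [h]
  exact Ideal.zero_mem _

/-- Two charts through which an element factors at a point with values in a field contain a common
smaller one. -/
lemma exists_le_le {i : I} {B : CommRingCat.{0}} {α : 𝔅.ring i ⟶ B} {s : F.obj i α} {K : Type}
    [Field K] {κ : B ⟶ .of K} {c₁ c₂ : 𝓒.Index} {h₁ : c₁.i ≤ i} {h₂ : c₂.i ≤ i}
    {f₁ : c₁.ring ⟶ .of K} {f₂ : c₂.ring ⟶ .of K} (hf₁ : IsFac c₁ h₁ s κ f₁)
    (hf₂ : IsFac c₂ h₂ s κ f₂) (j : I) (hj : ∀ x : Spec (.of K), 𝔅.pt i (α ≫ κ) x ∈ (𝔅.opens j).1) :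
    ∃ c ≤ c₁, c ≤ c₂ ∧ c.i ≤ j ∧ ∃ (h : c.i ≤ i) (f : c.ring ⟶ .of K), IsFac c h s κ f := by
  have x : Spec (.of K) := Classical.arbitrary _
  have hx₁ : 𝔅.pt i (α ≫ κ) x ∈ (𝔅.opens c₁.i).1 := by
    rw [hf₁.str_comp, 𝔅.pt_res]; exact 𝔅.range_pt _ x
  have hx₂ : 𝔅.pt i (α ≫ κ) x ∈ (𝔅.opens c₂.i).1 := by
    rw [hf₂.str_comp, 𝔅.pt_res]; exact 𝔅.range_pt _ x
  obtain ⟨k', hk₁, hk₂, hx'⟩ := 𝔅.directed c₁.i c₂.i _ hx₁ hx₂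
  obtain ⟨k, hk', hkj, hx⟩ := 𝔅.directed k' j _ hx' (hj x)
  replace hk₁ := hk'.trans hk₁
  replace hk₂ := hk'.trans hk₂
  obtain ⟨a, f, hf⟩ := exists_isFac (𝓒 := 𝓒) (hk₁.trans h₁) s κ fun y => by
    rwa [Subsingleton.elim y x]
  obtain ⟨g₁, hg₁, hle₁⟩ := exists_basic_le hk₁ hf hf₁
  obtain ⟨g₂, hg₂, hle₂⟩ := exists_basic_le hk₂ hf hf₂
  obtain ⟨f', hf'⟩ := exists_away_lift (b := g₁ * g₂) (f := toAway 1 ≫ f) (by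
    change IsUnit (f (toAway 1 (g₁ * g₂)))
    rw [map_mul, map_mul]
    exact isUnit_iff_ne_zero.2 (mul_ne_zero hg₁ hg₂))
  exact ⟨⟨k, a, g₁ * g₂⟩, (Index.basic_le (dvd_mul_right _ _)).trans hle₁,
    (Index.basic_le (dvd_mul_left _ _)).trans hle₂, hkj, hk₁.trans h₁, f', hf.basic hf'⟩

/-- The transition maps are monomorphisms, and locally open immersions as the charts are open. -/
instance isOpenImmersion_trans {c c' : 𝓒.Index} (h : c ≤ c') :
    IsOpenImmersion (Spec.map (Index.trans h)) := by
  have key : ∀ x : Spec c.ring, ∃ (U : Scheme) (i : U ⟶ Spec c.ring) (_ : IsOpenImmersion i),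
      x ∈ i.opensRange ∧ IsOpenImmersion (i ≫ Spec.map (Index.trans h)) := by
    intro x
    obtain ⟨K, hK, κ, hκ⟩ := Higgs.exists_fieldPoint x
    obtain ⟨C, q, κ', f, ho, hq, hf⟩ := exists_nhd_isFac c (Index.i_le h) c'.elt
      (Index.trans h ≫ κ) (Index.isFac_trans h κ)
    have : Mono (Spec.map (Index.trans h)) :=
      inferInstanceAs (Mono (Scheme.Spec.map (Index.trans h).op))
    have h1 : Index.trans h ≫ f = q := (hf.trans h le_rfl).unique (isFac_elt c' q)
    have h2 : f ≫ κ' = κ := by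
      rw [← cancel_epi (Index.trans h), ← Category.assoc, h1, hq]
    have h3 : IsOpenImmersion (Spec.map f ≫ Spec.map (Index.trans h)) := by
      rwa [← Spec.map_comp, h1]
    have y : Spec (.of K) := Classical.arbitrary _
    refine ⟨Spec C, Spec.map f, ?_, ⟨Spec.map κ' y, ?_⟩, h3⟩
    · exact MorphismProperty.of_postcomp (W := @IsOpenImmersion) (W' := .monomorphisms Scheme)
        (Spec.map f) (Spec.map (Index.trans h)) (.infer_property _) h3
    · rw [← hκ y, ← h2, Spec.map_comp]; rfl
  have : Mono (Spec.map (Index.trans h)) :=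
    inferInstanceAs (Mono (Scheme.Spec.map (Index.trans h).op))
  exact IsOpenImmersion.of_forall_source_exists _ (Scheme.Hom.injective _) key

variable (𝓒)

/-- The diagram of the basic open subsets of the charts. -/
def diagram : 𝓒.Index ⥤ Scheme.{0} where
  obj c := Spec c.ring
  map h := Spec.map (Index.trans (leOfHom h))
  map_id c := by rw [Index.trans_refl, Spec.map_id]
  map_comp h h' := by
    rw [← Spec.map_comp, ← Index.trans_trans]

instance {c c' : 𝓒.Index} (h : c ⟶ c') : IsOpenImmersion (𝓒.diagram.map h) :=
  isOpenImmersion_trans (leOfHom h)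

/-- Two charts that meet inside a third one contain, near each common point, a common smaller one.
Hence the colimit of the diagram is a gluing along open subschemes. -/
instance : (𝓒.diagram ⋙ Scheme.forget).IsLocallyDirected where
  cond {c₁ c₂ c} h₁ h₂ x₁ x₂ e := by
    change Spec.map (Index.trans (leOfHom h₁)) x₁ = Spec.map (Index.trans (leOfHom h₂)) x₂ at e
    obtain ⟨K, hK, κ, hκ⟩ := Higgs.exists_fieldPoint (Spec.map (Index.trans (leOfHom h₁)) x₁)
    have y : Spec (.of K) := Classical.arbitrary _
    obtain ⟨κ₁, hκ₁⟩ := exists_fieldPoint_lift (Spec.map (Index.trans (leOfHom h₁)))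
      (Spec.map κ) y ⟨x₁, (hκ y).symm⟩
    obtain ⟨κ₂, hκ₂⟩ := exists_fieldPoint_lift (Spec.map (Index.trans (leOfHom h₂)))
      (Spec.map κ) y ⟨x₂, by rw [hκ y, e]⟩
    obtain ⟨κ₁, rfl⟩ := Spec.map_surjective κ₁
    obtain ⟨κ₂, rfl⟩ := Spec.map_surjective κ₂
    rw [← Spec.map_comp] at hκ₁ hκ₂
    replace hκ₁ := Spec.map_injective hκ₁
    replace hκ₂ := Spec.map_injective hκ₂
    have hf₁ := Index.isFac_trans (leOfHom h₁) κ₁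
    have hf₂ := Index.isFac_trans (leOfHom h₂) κ₂
    rw [hκ₁] at hf₁
    rw [hκ₂] at hf₂
    obtain ⟨c', hc₁, hc₂, -, h, f, hf⟩ := exists_le_le hf₁ hf₂ c.i fun x => 𝔅.range_pt _ x
    refine ⟨c', homOfLE hc₁, homOfLE hc₂, Spec.map f y, ?_, ?_⟩
    · apply (Spec.map (Index.trans (leOfHom h₁))).isOpenEmbedding.injective
      change Spec.map _ (Spec.map (Index.trans hc₁) (Spec.map f y)) = _
      rw [← Scheme.Hom.comp_apply, ← Scheme.Hom.comp_apply, ← Spec.map_comp, ← Spec.map_comp,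
        Category.assoc, (hf.trans hc₁ (Index.i_le (leOfHom h₁))).unique hf₁, hκ₁, hκ y]
    · apply (Spec.map (Index.trans (leOfHom h₂))).isOpenEmbedding.injective
      change Spec.map _ (Spec.map (Index.trans hc₂) (Spec.map f y)) = _
      rw [← Scheme.Hom.comp_apply, ← Scheme.Hom.comp_apply, ← Spec.map_comp, ← Spec.map_comp,
        Category.assoc, (hf.trans hc₂ (Index.i_le (leOfHom h₂))).unique hf₂, hκ₂, hκ y, e]

end Charts
end PointFunctor
end PointFunctor

/-! ### The scheme glued from charts -/

section PointFunctor
namespace PointFunctor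
namespace Charts

variable {X : Scheme.{0}} {I : Type} [Preorder I] {𝔅 : AffineBasis X I} {F : PointFunctor 𝔅}
  (𝓒 : F.Charts)

open Limits

/-- The scheme glued from the charts. -/
def glued : Scheme.{0} := colimit 𝓒.diagram

/-- The open immersion of a basic open subset of a chart. -/
def ι (c : 𝓒.Index) : Spec c.ring ⟶ 𝓒.glued := colimit.ι 𝓒.diagram c

instance (c : 𝓒.Index) : IsOpenImmersion (𝓒.ι c) :=
  inferInstanceAs (IsOpenImmersion (colimit.ι 𝓒.diagram c))

lemma trans_ι {c c' : 𝓒.Index} (h : c ≤ c') : Spec.map (Index.trans h) ≫ 𝓒.ι c' = 𝓒.ι c :=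
  colimit.w 𝓒.diagram (homOfLE h)

lemma exists_ι_eq (z : 𝓒.glued) : ∃ c x, 𝓒.ι c x = z :=
  Scheme.IsLocallyDirected.ι_jointly_surjective 𝓒.diagram z

/-- Points of two charts that are equal in the glued scheme come from a common smaller chart. -/
lemma exists_of_ι_eq_ι {c c' : 𝓒.Index} {x : Spec c.ring} {x' : Spec c'.ring}
    (h : 𝓒.ι c x = 𝓒.ι c' x') : ∃ (c'' : 𝓒.Index) (hc : c'' ≤ c) (_ : c'' ≤ c'),
      x ∈ Set.range (Spec.map (Index.trans hc)) := by
  obtain ⟨k, f, f', y, hy, -⟩ := (Scheme.IsLocallyDirected.ι_eq_ι_iff 𝓒.diagram).1 h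
  exact ⟨k, leOfHom f, leOfHom f', y, hy⟩

/-- The projection to `X`. -/
def proj : 𝓒.glued ⟶ X :=
  colimit.desc 𝓒.diagram
    { pt := X
      ι :=
        { app := fun c => 𝔅.pt c.i c.str
          naturality := fun c c' h => by
            change Spec.map (Index.trans (leOfHom h)) ≫ 𝔅.pt c'.i c'.str = 𝔅.pt c.i c.str ≫ 𝟙 X
            rw [Category.comp_id]
            simpa using (Index.isFac_trans (leOfHom h) (𝟙 _)).pt_eq } }

lemma ι_proj (c : 𝓒.Index) : 𝓒.ι c ≫ 𝓒.proj = 𝔅.pt c.i c.str :=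
  colimit.ι_desc _ c

variable {𝓒} {i : I} {B C : CommRingCat.{0}} {α : 𝔅.ring i ⟶ B} {s s' : F.obj i α} {q : B ⟶ C}
  {c c' : 𝓒.Index} {hc : c.i ≤ i} {hc' : c'.i ≤ i} {f : c.ring ⟶ C} {f' : c'.ring ⟶ C}

lemma exists_nhd_isFac_comp {K : Type} [Field K] (κ : C ⟶ .of K)
    {f₀ : c.ring ⟶ .of K} (hs : IsFac c hc s (q ≫ κ) f₀) :
    ∃ (D : CommRingCat.{0}) (q' : C ⟶ D) (κ' : D ⟶ .of K) (f : c.ring ⟶ D),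
      IsOpenImmersion (Spec.map q') ∧ q' ≫ κ' = κ ∧ IsFac c hc s (q ≫ q') f := by
  have hq : α ≫ q = 𝔅.res le_rfl ≫ α ≫ q := by rw [𝔅.res_refl, Category.id_comp]
  rw [← isFac_map_iff hc le_rfl hq] at hs
  obtain ⟨D, q', κ', f, h1, h2, h3⟩ := Charts.exists_nhd_isFac c hc _ κ hs
  exact ⟨D, q', κ', f, h1, h2, (isFac_map_iff hc le_rfl hq q').1 h3⟩

lemma IsFac.map_eq (hs : IsFac c hc s q f) (hs' : IsFac c hc s' q f)
    {β : 𝔅.ring i ⟶ C} (hq : α ≫ q = 𝔅.res le_rfl ≫ β) :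
    F.map le_rfl q hq s = F.map le_rfl q hq s' := by
  have h0 := hs.str_comp
  have h1 : c.str ≫ f = 𝔅.res le_rfl ≫ c.str ≫ f := by rw [𝔅.res_refl, Category.id_comp]
  rw [isFac_iff h0 h1] at hs hs'
  have h2 : β ≫ 𝟙 C = 𝔅.res hc ≫ c.str ≫ f := by
    rw [← h0, hq, Category.comp_id, 𝔅.res_refl, Category.id_comp]
  refine (F.map_bijective hc h2).1 ?_
  have h3 : α ≫ q ≫ 𝟙 C = 𝔅.res hc ≫ c.str ≫ f := by rw [Category.comp_id, h0]
  rw [F.map_map _ _ _ _ hq h2 h3, F.map_map _ _ _ _ hq h2 h3,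
    F.map_congr _ (Category.comp_id q) _ h0, F.map_congr _ (Category.comp_id q) _ h0, hs, hs']

lemma IsFac.eq {f : c.ring ⟶ B} (hs : IsFac c hc s (𝟙 B) f) (hs' : IsFac c hc s' (𝟙 B) f) :
    s = s' := by
  have h : α ≫ 𝟙 B = 𝔅.res le_rfl ≫ α := by rw [𝔅.res_refl, Category.id_comp, Category.comp_id]
  have := hs.map_eq hs' h
  rwa [F.map_id, F.map_id] at this

/-- Being a factorization is local, as `F` is separated. -/
lemma isFac_of_locally (h : Spec.map q ≫ 𝔅.pt i α = Spec.map f ≫ 𝔅.pt c.i c.str)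
    (hs : ∀ (K : Type) [Field K] (κ : C ⟶ .of K), ∃ (D : CommRingCat.{0}) (q' : C ⟶ D)
      (κ' : D ⟶ .of K), IsOpenImmersion (Spec.map q') ∧ q' ≫ κ' = κ ∧
      IsFac c hc s (q ≫ q') (f ≫ q')) : IsFac c hc s q f := by
  have h0 : α ≫ q = 𝔅.res hc ≫ c.str ≫ f := by
    rw [𝔅.map_pt, 𝔅.map_pt] at h
    exact 𝔅.pt_injective (by rw [𝔅.pt_res, h])
  have h1 : c.str ≫ f = 𝔅.res le_rfl ≫ c.str ≫ f := by rw [𝔅.res_refl, Category.id_comp]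
  rw [isFac_iff h0 h1]
  refine F.eq_of_fieldPoint _ _ fun K _ κ => ?_
  obtain ⟨D, q', κ', ho, hκ', hs⟩ := hs K κ
  have h2 : (c.str ≫ f) ≫ q' = 𝔅.res le_rfl ≫ c.str ≫ f ≫ q' := by
    rw [𝔅.res_refl, Category.id_comp, Category.assoc]
  refine ⟨D, q', κ', c.str ≫ f ≫ q', h2, ho, hκ', ?_⟩
  have h3 := hs.str_comp
  have h4 : c.str ≫ f ≫ q' = 𝔅.res le_rfl ≫ c.str ≫ f ≫ q' := by rw [𝔅.res_refl, Category.id_comp]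
  rw [isFac_iff h3 h4] at hs
  rw [F.map_map _ _ _ _ h0 h2 h3, F.map_map _ _ _ _ h1 h2 h4, hs]

/-- Factorizations of the same element through two charts become equal in the glued scheme. -/
lemma IsFac.ι_eq_ι (hs : IsFac c hc s q f) (hs' : IsFac c' hc' s q f') :
    Spec.map f ≫ 𝓒.ι c = Spec.map f' ≫ 𝓒.ι c' := by
  refine hom_ext_of_locally fun y => ?_
  obtain ⟨K, hK, κ, hκ⟩ := Higgs.exists_fieldPoint y
  obtain ⟨c'', h, h', -, hc'', f₀, hf₀⟩ := exists_le_le (hs.comp κ) (hs'.comp κ) c.i fun x => by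
    rw [(hs.comp κ).str_comp, 𝔅.pt_res]; exact 𝔅.range_pt _ x
  obtain ⟨D, q', κ', g, ho, hκ', hg⟩ := exists_nhd_isFac_comp κ hf₀
  have x : Spec (.of K) := Classical.arbitrary _
  refine ⟨D, Spec.map q', ho, ⟨Spec.map κ' x, ?_⟩, ?_⟩
  · rw [← hκ x, ← hκ', Spec.map_comp]; rfl
  · rw [← Category.assoc, ← Category.assoc, ← Spec.map_comp, ← Spec.map_comp,
      ← (hg.trans h hc).unique (hs.comp q'), ← (hg.trans h' hc').unique (hs'.comp q'),
      Spec.map_comp, Spec.map_comp, Category.assoc, Category.assoc, 𝓒.trans_ι, 𝓒.trans_ι]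

/-- Morphisms to two charts that are equal in the glued scheme define the same element. -/
lemma IsFac.of_ι_eq_ι (hs : IsFac c hc s q f) (h : Spec.map f ≫ 𝓒.ι c = Spec.map f' ≫ 𝓒.ι c')
    (hc' : c'.i ≤ i) : IsFac c' hc' s q f' := by
  refine isFac_of_locally ?_ fun K _ κ => ?_
  · rw [hs.pt_eq, ← 𝓒.ι_proj, ← 𝓒.ι_proj, ← Category.assoc, h, Category.assoc]
  have y : Spec (.of K) := Classical.arbitrary _
  obtain ⟨c'', h1, h2, hy⟩ := 𝓒.exists_of_ι_eq_ι
    (x := Spec.map f (Spec.map κ y)) (x' := Spec.map f' (Spec.map κ y))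
    (congrArg (fun t => t (Spec.map κ y)) h)
  obtain ⟨D, q', ho, hy', hle⟩ := Higgs.exists_nhd
    (U := Spec.map f ⁻¹ᵁ (Spec.map (Index.trans h1)).opensRange) (y := Spec.map κ y) hy
  obtain ⟨q', rfl⟩ := Spec.map_surjective q'
  obtain ⟨κ', hκ'⟩ := exists_fieldPoint_lift (Spec.map q') (Spec.map κ) y hy'
  obtain ⟨κ', rfl⟩ := Spec.map_surjective κ'
  obtain ⟨g, hg⟩ := exists_Spec_lift (Spec.map (Index.trans h1)) (Spec.map q' ≫ Spec.map f) (by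
    rintro _ ⟨z, rfl⟩
    exact hle ⟨z, rfl⟩)
  rw [← Spec.map_comp, ← Spec.map_comp] at hg
  replace hg := Spec.map_injective hg
  have hg' : Index.trans h2 ≫ g = f' ≫ q' := by
    refine Spec.map_injective ?_
    rw [← cancel_mono (𝓒.ι c'), Spec.map_comp, Category.assoc, 𝓒.trans_ι, ← 𝓒.trans_ι h1,
      ← Category.assoc, ← Spec.map_comp, hg, Spec.map_comp, Category.assoc, h, Spec.map_comp,
      Category.assoc]
  refine ⟨D, q', κ', ho, Spec.map_injective (by rw [Spec.map_comp, hκ']), ?_⟩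
  rw [← hg']
  have h3 := Index.isFac_trans h1 g
  rw [hg] at h3
  exact ((hs.comp q').of_elt h3).trans h2 hc'

/-- `s` is the element defined by the morphism `h` to the glued scheme. -/
def IsElt (s : F.obj i α) (h : Spec B ⟶ 𝓒.glued) : Prop :=
  ∀ {C : CommRingCat.{0}} (q : B ⟶ C) (c : 𝓒.Index) (hc : c.i ≤ i) (f : c.ring ⟶ C),
    Spec.map q ≫ h = Spec.map f ≫ 𝓒.ι c → IsFac c hc s q f

/-- Morphisms to the glued scheme factor locally through the charts. -/
lemma exists_factorization (h : Spec B ⟶ 𝓒.glued) (hh : h ≫ 𝓒.proj = 𝔅.pt i α) {K : Type}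
    [Field K] (κ : B ⟶ .of K) :
    ∃ (c : 𝓒.Index) (_ : c.i ≤ i) (D : CommRingCat.{0}) (q : B ⟶ D) (κ' : D ⟶ .of K)
      (f : c.ring ⟶ D), IsOpenImmersion (Spec.map q) ∧ q ≫ κ' = κ ∧
      Spec.map q ≫ h = Spec.map f ≫ 𝓒.ι c := by
  have y : Spec (.of K) := Classical.arbitrary _
  obtain ⟨c, x, hx⟩ := 𝓒.exists_ι_eq (h (Spec.map κ y))
  obtain ⟨κ₁, hκ₁⟩ := exists_fieldPoint_lift (𝓒.ι c) (Spec.map κ ≫ h) y ⟨x, hx⟩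
  obtain ⟨κ₁, rfl⟩ := Spec.map_surjective κ₁
  obtain ⟨c', h1, -, hi, _, f₀, hf₀⟩ := exists_le_le (isFac_elt c κ₁) (isFac_elt c κ₁) i fun z => by
    rw [← 𝔅.map_pt, ← 𝓒.ι_proj, ← Category.assoc, hκ₁, Category.assoc, hh, 𝔅.map_pt]
    exact 𝔅.range_pt _ z
  have hf₁ := (hf₀.trans h1 le_rfl).unique (isFac_elt c κ₁)
  have hy : h (Spec.map κ y) ∈ (𝓒.ι c').opensRange := by
    refine ⟨Spec.map f₀ y, ?_⟩
    change (Spec.map f₀ ≫ 𝓒.ι c') y = (Spec.map κ ≫ h) y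
    rw [← hκ₁, ← hf₁, Spec.map_comp, Category.assoc, 𝓒.trans_ι]
  obtain ⟨D, q, ho, hy', hle⟩ := Higgs.exists_nhd
    (U := h ⁻¹ᵁ (𝓒.ι c').opensRange) (y := Spec.map κ y) hy
  obtain ⟨q, rfl⟩ := Spec.map_surjective q
  obtain ⟨κ', hκ'⟩ := exists_fieldPoint_lift (Spec.map q) (Spec.map κ) y hy'
  obtain ⟨κ', rfl⟩ := Spec.map_surjective κ'
  obtain ⟨f, hf⟩ := exists_Spec_lift (𝓒.ι c') (Spec.map q ≫ h) (by
    rintro _ ⟨z, rfl⟩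
    exact hle ⟨z, rfl⟩)
  exact ⟨c', hi, D, q, κ', f, ho, Spec.map_injective (by rw [Spec.map_comp, hκ']), hf.symm⟩

/-- A morphism to the glued scheme defines at most one element. -/
lemma IsElt.eq {h : Spec B ⟶ 𝓒.glued} (hh : h ≫ 𝓒.proj = 𝔅.pt i α) (hs : IsElt s h)
    (hs' : IsElt s' h) : s = s' := by
  refine F.eq_of_fieldPoint _ _ fun K _ κ => ?_
  obtain ⟨c, hc, D, q, κ', f, ho, hκ', hf⟩ := exists_factorization h hh κ
  have hq : α ≫ q = 𝔅.res le_rfl ≫ α ≫ q := by rw [𝔅.res_refl, Category.id_comp]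
  exact ⟨D, q, κ', α ≫ q, hq, ho, hκ', (hs q c hc f hf).map_eq (hs' q c hc f hf) hq⟩

/-- A morphism to the glued scheme is determined by the element that it defines. -/
lemma IsElt.hom_eq {h h' : Spec B ⟶ 𝓒.glued} (hh : h ≫ 𝓒.proj = 𝔅.pt i α)
    (hh' : h' ≫ 𝓒.proj = 𝔅.pt i α) (hs : IsElt s h) (hs' : IsElt s h') : h = h' := by
  refine hom_ext_of_locally fun y => ?_
  obtain ⟨K, hK, κ, hκ⟩ := Higgs.exists_fieldPoint y
  obtain ⟨c, hc, D, q, κ₁, f, ho, hκ₁, hf⟩ := exists_factorization h hh κ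
  obtain ⟨c', hc', D', q', κ₂, f', ho', hκ₂, hf'⟩ := exists_factorization (Spec.map q ≫ h')
    (by rw [Category.assoc, hh', 𝔅.map_pt]) κ₁
  have x : Spec (.of K) := Classical.arbitrary _
  refine ⟨D', Spec.map (q ≫ q'), ?_, ⟨Spec.map κ₂ x, ?_⟩, ?_⟩
  · rw [Spec.map_comp]; infer_instance
  · rw [← hκ x, ← hκ₁, ← hκ₂, ← Category.assoc, Spec.map_comp _ κ₂]; rfl
  · rw [← Category.assoc, ← Spec.map_comp] at hf'
    have h1 := (hs q c hc f hf).comp q'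
    have h2 := hs' (q ≫ q') c' hc' f' hf'
    rw [hf', ← h1.ι_eq_ι h2, Spec.map_comp, Category.assoc, hf, Spec.map_comp, Category.assoc]

lemma IsElt.map {h : Spec B ⟶ 𝓒.glued} (hs : IsElt s h) {j : I} (hj : j ≤ i)
    {β : 𝔅.ring j ⟶ C} (hq : α ≫ q = 𝔅.res hj ≫ β) :
    IsElt (F.map hj q hq s) (Spec.map q ≫ h) := by
  intro D q' c hc f hf
  rw [isFac_map_iff]
  refine hs _ c _ f ?_
  rw [Spec.map_comp, Category.assoc, hf]

variable (α) in
/-- A morphism to the glued scheme defines an element: pull back the universal elements of the charts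
locally, and glue. -/
lemma exists_isElt (h : Spec B ⟶ 𝓒.glued) (hh : h ≫ 𝓒.proj = 𝔅.pt i α) :
    ∃ s : F.obj i α, IsElt s h := by
  -- near `p`, the morphism `h` factors through the chart `c p` by means of `f p`
  have key : ∀ p : Spec B, ∃ (b : B) (c : 𝓒.Index) (hc : c.i ≤ i) (f : c.ring ⟶ away b),
      b ∉ p.asIdeal ∧ Spec.map (toAway b) ≫ h = Spec.map f ≫ 𝓒.ι c := by
    intro p
    obtain ⟨K, hK, κ, hκ⟩ := Higgs.exists_fieldPoint p
    obtain ⟨c, hc, D, q, κ', f, ho, hκ', hf⟩ := exists_factorization h hh κ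
    have x : Spec (.of K) := Classical.arbitrary _
    obtain ⟨b, hb, g, hg⟩ := exists_away_of_isOpenImmersion q (p := p)
      ⟨Spec.map κ' x, by rw [← hκ x, ← hκ', Spec.map_comp]; rfl⟩
    exact ⟨b, c, hc, f ≫ g, hb, by rw [← hg, Spec.map_comp, Category.assoc, hf, Spec.map_comp,
      Category.assoc]⟩
  choose b c hc f hb hf using key
  have hspan : Ideal.span (Set.range b) = ⊤ := by
    by_contra hne
    obtain ⟨m, hm, hle⟩ := Ideal.exists_le_maximal _ hne
    exact hb ⟨m, hm.isPrime⟩ (hle (Ideal.subset_span ⟨_, rfl⟩))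
  -- the pullback of the universal element, regarded over the member `i` of the basis
  have hs : ∀ p, ∃ s : F.obj i (α ≫ toAway (b p)), IsFac (c p) (hc p) s (𝟙 _) (f p) := by
    intro p
    have h1 : (c p).str ≫ f p = 𝔅.res le_rfl ≫ (c p).str ≫ f p := by
      rw [𝔅.res_refl, Category.id_comp]
    have h2 : (α ≫ toAway (b p)) ≫ 𝟙 _ = 𝔅.res (hc p) ≫ (c p).str ≫ f p := by
      refine 𝔅.pt_injective ?_
      rw [Category.comp_id, 𝔅.pt_res, ← 𝔅.map_pt, ← 𝔅.map_pt, ← hh, ← 𝓒.ι_proj, ← Category.assoc,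
        hf, Category.assoc]
    obtain ⟨s, hs⟩ := (F.map_bijective (hc p) h2).2 (F.map le_rfl (f p) h1 (c p).elt)
    exact ⟨s, _, h2, h1, hs⟩
  choose s hs using hs
  obtain ⟨t, ht⟩ := F.exists_glue α _ b hspan s fun k l C g g' γ hg hg' e => by
    have h1 := (hs k).comp g
    have h2 := (hs l).comp g'
    rw [Category.id_comp] at h1 h2
    have h3 : IsFac (c k) (hc k) (s l) g' (f k ≫ g) := h2.of_ι_eq_ι (by
      rw [Spec.map_comp, Category.assoc, ← hf, ← Category.assoc, ← Spec.map_comp, ← e,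
        Spec.map_comp, Spec.map_comp, Category.assoc, Category.assoc, hf]) (hc k)
    rw [← Category.comp_id g, ← isFac_map_iff (hc k) le_rfl hg] at h1
    rw [← Category.comp_id g', ← isFac_map_iff (hc k) le_rfl hg'] at h3
    exact h1.eq h3
  have ht' : ∀ p, IsFac (c p) (hc p) t (toAway (b p)) (f p) := by
    intro p
    have hq : α ≫ toAway (b p) = 𝔅.res le_rfl ≫ α ≫ toAway (b p) := by
      rw [𝔅.res_refl, Category.id_comp]
    have := hs p
    rw [← ht p hq, isFac_map_iff, Category.comp_id] at this
    exact this
  -- an arbitrary factorization of `h` is compared with one of the chosen ones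
  refine ⟨t, fun {C} q c' hc' f' hf' => isFac_of_locally ?_ fun K _ κ => ?_⟩
  · rw [← 𝓒.ι_proj, ← Category.assoc, ← hf', Category.assoc, hh]
  have x : Spec (.of K) := Classical.arbitrary _
  set p := Spec.map (q ≫ κ) x with hp
  have hbp : κ (q (b p)) ≠ 0 := fun h0 => hb p (by
    change (q ≫ κ) (b p) ∈ x.asIdeal
    rw [CommRingCat.comp_apply, h0]
    exact Ideal.zero_mem _)
  obtain ⟨κ', hκ'⟩ := exists_away_lift (f := κ) (b := q (b p)) (isUnit_iff_ne_zero.2 hbp)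
  obtain ⟨g, hg⟩ := exists_away_lift (f := q ≫ toAway (q (b p))) (b := b p)
    (IsLocalization.Away.algebraMap_isUnit (S := Localization.Away (q (b p))) (q (b p)))
  refine ⟨_, toAway (q (b p)), κ', inferInstance, hκ', ?_⟩
  have h1 := (ht' p).comp g
  rw [hg] at h1
  refine h1.of_ι_eq_ι ?_ hc'
  rw [Spec.map_comp, Category.assoc, ← hf, ← Category.assoc, ← Spec.map_comp, hg, Spec.map_comp,
    Spec.map_comp, Category.assoc, Category.assoc, hf']

variable (𝓒) in
/-- Each element is defined by a morphism to the glued scheme: it factors locally through charts, and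
the factorizations glue. -/
lemma exists_hom (s : F.obj i α) :
    ∃ h : Spec B ⟶ 𝓒.glued, h ≫ 𝓒.proj = 𝔅.pt i α ∧ IsElt s h := by
  have hloc : ∀ {C : CommRingCat.{0}} (q : B ⟶ C) (K : Type) [Field K] (κ : C ⟶ .of K),
      ∃ (D : CommRingCat.{0}) (q' : C ⟶ D) (κ' : D ⟶ .of K) (c : 𝓒.Index) (hc : c.i ≤ i)
        (f : c.ring ⟶ D), IsOpenImmersion (Spec.map q') ∧ q' ≫ κ' = κ ∧
        IsFac c hc s (q ≫ q') f := by
    intro C q K _ κ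
    obtain ⟨a, f, hf⟩ := exists_isFac (𝓒 := 𝓒) le_rfl s (q ≫ κ) fun x => 𝔅.range_pt _ x
    obtain ⟨D, q', κ', f', h1, h2, h3⟩ := exists_nhd_isFac_comp κ hf
    exact ⟨D, q', κ', _, _, f', h1, h2, h3⟩
  obtain ⟨h, hh⟩ := exists_hom_of_locally (Y := Spec B) (Z := 𝓒.glued) (fun _ => True)
    (fun _ _ => trivial) (fun _ _ _ _ => trivial)
    (fun {C} q m => ∃ (q₀ : B ⟶ C) (c : 𝓒.Index) (hc : c.i ≤ i) (f : c.ring ⟶ C),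
      Spec.map q₀ = q ∧ IsFac c hc s q₀ f ∧ m = Spec.map f ≫ 𝓒.ι c)
    (fun y => by
      obtain ⟨K, hK, κ, hκ⟩ := Higgs.exists_fieldPoint y
      obtain ⟨D, q, κ', c, hc, f, ho, hκ', hf⟩ := hloc (𝟙 B) K κ
      have x : Spec (.of K) := Classical.arbitrary _
      rw [Category.id_comp] at hf
      refine ⟨D, Spec.map q, Spec.map f ≫ 𝓒.ι c, ho, ⟨Spec.map κ' x, ?_⟩, q, c, hc, f, rfl, hf,
        rfl⟩
      rw [← hκ x, ← hκ', Spec.map_comp]; rfl)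
    (by
      rintro C D q m g ⟨q, c, hc, f, rfl, hf, rfl⟩ -
      exact ⟨q ≫ g, c, hc, f ≫ g, Spec.map_comp _ _, hf.comp g, by
        rw [Spec.map_comp, Category.assoc]⟩)
    (by
      rintro C q m m' - ⟨q, c, hc, f, rfl, hf, rfl⟩ ⟨q', c', hc', f', e, hf', rfl⟩
      rw [Spec.map_injective e] at hf'
      exact hf.ι_eq_ι hf')
  -- on every factorization, `h` is the corresponding morphism to the chart
  have hh' : ∀ {C : CommRingCat.{0}} (q : B ⟶ C) (c : 𝓒.Index) (hc : c.i ≤ i) (f : c.ring ⟶ C),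
      IsFac c hc s q f → Spec.map q ≫ h = Spec.map f ≫ 𝓒.ι c :=
    fun q c hc f hf => hh _ _ trivial ⟨q, c, hc, f, rfl, hf, rfl⟩
  refine ⟨h, hom_ext_of_locally fun y => ?_, fun {C} q c hc f hf => ?_⟩
  · obtain ⟨K, hK, κ, hκ⟩ := Higgs.exists_fieldPoint y
    obtain ⟨D, q, κ', c, hc, f, ho, hκ', hf⟩ := hloc (𝟙 B) K κ
    have x : Spec (.of K) := Classical.arbitrary _
    rw [Category.id_comp] at hf
    refine ⟨D, Spec.map q, ho, ⟨Spec.map κ' x, ?_⟩, ?_⟩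
    · rw [← hκ x, ← hκ', Spec.map_comp]; rfl
    · rw [← Category.assoc, hh' q c hc f hf, Category.assoc, 𝓒.ι_proj, hf.pt_eq]
  · have hpt : Spec.map q ≫ h ≫ 𝓒.proj = Spec.map q ≫ 𝔅.pt i α := by
      refine hom_ext_of_locally fun y => ?_
      obtain ⟨K, hK, κ, hκ⟩ := Higgs.exists_fieldPoint y
      obtain ⟨D, q', κ', c', hc', f', ho, hκ', hf'⟩ := hloc q K κ
      have x : Spec (.of K) := Classical.arbitrary _
      refine ⟨D, Spec.map q', ho, ⟨Spec.map κ' x, ?_⟩, ?_⟩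
      · rw [← hκ x, ← hκ', Spec.map_comp]; rfl
      · rw [← Category.assoc, ← Category.assoc, ← Spec.map_comp, hh' _ _ _ _ hf', Category.assoc,
          𝓒.ι_proj, ← hf'.pt_eq, Spec.map_comp, Category.assoc]
    refine isFac_of_locally ?_ fun K _ κ => ?_
    · rw [← 𝓒.ι_proj, ← hpt, ← Category.assoc, hf, Category.assoc]
    obtain ⟨D, q', κ', c', hc', f', ho, hκ', hf'⟩ := hloc q K κ
    refine ⟨D, q', κ', ho, hκ', hf'.of_ι_eq_ι ?_ hc⟩
    rw [← hh' _ _ _ _ hf', Spec.map_comp, Category.assoc, hf, Spec.map_comp, Category.assoc]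

variable (𝓒)

/-- The element of `F` defined by a morphism to the glued scheme. -/
def toElt (i : I) {B : CommRingCat.{0}} (α : 𝔅.ring i ⟶ B) (h : Spec B ⟶ 𝓒.glued)
    (hh : h ≫ 𝓒.proj = 𝔅.pt i α) : F.obj i α :=
  (exists_isElt α h hh).choose

lemma isElt_toElt (h : Spec B ⟶ 𝓒.glued) (hh : h ≫ 𝓒.proj = 𝔅.pt i α) :
    IsElt (𝓒.toElt i α h hh) h :=
  (exists_isElt α h hh).choose_spec

lemma toElt_map {j : I} (hj : j ≤ i) {β : 𝔅.ring j ⟶ C} (hq : α ≫ q = 𝔅.res hj ≫ β)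
    (h : Spec B ⟶ 𝓒.glued) (hh : h ≫ 𝓒.proj = 𝔅.pt i α)
    (hh' : (Spec.map q ≫ h) ≫ 𝓒.proj = 𝔅.pt j β) :
    𝓒.toElt j β (Spec.map q ≫ h) hh' = F.map hj q hq (𝓒.toElt i α h hh) :=
  IsElt.eq hh' (𝓒.isElt_toElt _ hh') (IsElt.map (𝓒.isElt_toElt h hh) hj hq)

/-- The glued scheme represents `F`. -/
lemma existsUnique_toElt_eq (s : F.obj i α) :
    ∃! h : Spec B ⟶ 𝓒.glued, ∃ hh : h ≫ 𝓒.proj = 𝔅.pt i α, 𝓒.toElt i α h hh = s := by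
  obtain ⟨h, hh, hs⟩ := 𝓒.exists_hom s
  refine ⟨h, ⟨hh, IsElt.eq hh (𝓒.isElt_toElt h hh) hs⟩, ?_⟩
  rintro h' ⟨hh', rfl⟩
  exact IsElt.hom_eq hh' hh (𝓒.isElt_toElt h' hh') hs

end Charts
end PointFunctor
end PointFunctor

/-! ### Frames of a locally free sheaf -/

section Frames

variable {X : Scheme.{0}} (E : X.Modules) {U V W : X.Opens}

lemma resRing_resRing (h : V ≤ U) (h' : W ≤ V) (a : Γ(X, U)) :
    resRing h' (resRing h a) = resRing (h'.trans h) a := by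
  change (X.presheaf.map _ ≫ X.presheaf.map _) a = _
  rw [← Functor.map_comp]
  rfl

lemma resRing_refl (a : Γ(X, U)) : resRing (le_refl U) a = a := by
  change X.presheaf.map (𝟙 _) a = a
  rw [X.presheaf.map_id]; rfl

lemma resMod_resMod (h : V ≤ U) (h' : W ≤ V) (s : Γ(E, U)) :
    resMod E h' (resMod E h s) = resMod E (h'.trans h) s := by
  change (E.presheaf.map _ ≫ E.presheaf.map _) s = _
  rw [← Functor.map_comp]
  rfl

lemma resMod_refl (s : Γ(E, U)) : resMod E (le_refl U) s = s := by
  change E.presheaf.map (𝟙 _) s = s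
  rw [E.presheaf.map_id]; rfl

lemma resMod_smul (h : V ≤ U) (a : Γ(X, U)) (s : Γ(E, U)) :
    resMod E h (a • s) = resRing h a • resMod E h s := map_smulₛₗ _ _ _

lemma eq_of_resMod_eq {ι : Type} (D : ι → X.Opens) (hD : ∀ k, D k ≤ U) (hU : U ≤ iSup D)
    {s t : Γ(E, U)} (h : ∀ k, resMod E (hD k) s = resMod E (hD k) t) : s = t :=
  TopCat.Sheaf.eq_of_locally_eq' ⟨E.presheaf, E.isSheaf⟩ D U (fun k => homOfLE (hD k)) hU s t h

lemma exists_resMod_eq {ι : Type} (D : ι → X.Opens) (hD : ∀ k, D k ≤ U) (hU : U ≤ iSup D)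
    (s : ∀ k, Γ(E, D k)) (h : ∀ k l, resMod E (inf_le_left : D k ⊓ D l ≤ D k) (s k) =
      resMod E (inf_le_right : D k ⊓ D l ≤ D l) (s l)) :
    ∃ t : Γ(E, U), ∀ k, resMod E (hD k) t = s k := by
  obtain ⟨t, ht, -⟩ := TopCat.Sheaf.existsUnique_gluing' ⟨E.presheaf, E.isSheaf⟩ D U
    (fun k => homOfLE (hD k)) hU s (fun k l => h k l)
  exact ⟨t, ht⟩

lemma eq_of_resRing_eq {ι : Type} (D : ι → X.Opens) (hD : ∀ k, D k ≤ U) (hU : U ≤ iSup D)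
    {s t : Γ(X, U)} (h : ∀ k, resRing (hD k) s = resRing (hD k) t) : s = t :=
  TopCat.Sheaf.eq_of_locally_eq' X.sheaf D U (fun k => homOfLE (hD k)) hU s t h

lemma exists_resRing_eq {ι : Type} (D : ι → X.Opens) (hD : ∀ k, D k ≤ U) (hU : U ≤ iSup D)
    (s : ∀ k, Γ(X, D k)) (h : ∀ k l, resRing (inf_le_left : D k ⊓ D l ≤ D k) (s k) =
      resRing (inf_le_right : D k ⊓ D l ≤ D l) (s l)) :
    ∃ t : Γ(X, U), ∀ k, resRing (hD k) t = s k := by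
  obtain ⟨t, ht, -⟩ := TopCat.Sheaf.existsUnique_gluing' X.sheaf D U
    (fun k => homOfLE (hD k)) hU s (fun k l => h k l)
  exact ⟨t, ht⟩

/-- A frame over `W`: it induces an isomorphism `𝒪^ι ≅ E` of sheaves over `W`. -/
def IsFrame {ι : Type} [Fintype ι] (W : X.Opens) (e : ι → Γ(E, W)) : Prop :=
  ∀ (V : X.Opens) (h : V ≤ W),
    Function.Bijective fun c : ι → Γ(X, V) => ∑ i, c i • resMod E h (e i)

variable {E} {ι : Type} [Fintype ι]

lemma IsFrame.res {e : ι → Γ(E, W)} (he : IsFrame E W e) (h : V ≤ W) :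
    IsFrame E V fun i => resMod E h (e i) := by
  intro V' h'
  simp_rw [resMod_resMod]
  exact he V' (h'.trans h)

/-- The basis of the module of sections given by a frame. -/
def IsFrame.basis {e : ι → Γ(E, W)} (he : IsFrame E W e) : Module.Basis ι Γ(X, W) Γ(E, W) :=
  Module.Basis.ofEquivFun (LinearEquiv.ofBijective (Fintype.linearCombination Γ(X, W) e) (by
    have := he W le_rfl
    simp_rw [resMod_refl] at this
    exact this)).symm

lemma IsFrame.basis_apply {e : ι → Γ(E, W)} (he : IsFrame E W e) (i : ι) : he.basis i = e i := by
  classical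
  rw [IsFrame.basis, Module.Basis.coe_ofEquivFun]
  change Fintype.linearCombination Γ(X, W) e (Pi.single i 1) = _
  rw [Fintype.linearCombination_apply_single, one_smul]

section Localization

variable (hV : IsAffineOpen V) {D : X.Opens} (g : Γ(X, V)) (hDV : D ≤ V) (hD : D = X.basicOpen g)

include hD in
lemma isUnit_resRing : IsUnit (resRing hDV g) := by
  subst hD
  exact RingedSpace.isUnit_res_basicOpen _ g

include hV hD in
lemma exists_pow_mul_eq_zero (a : Γ(X, V)) (ha : resRing hDV a = 0) : ∃ n : ℕ, g ^ n * a = 0 := by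
  subst hD
  have := hV.isLocalization_basicOpen g
  have h0 : algebraMap Γ(X, V) Γ(X, X.basicOpen g) a = 0 := ha
  obtain ⟨⟨_, n, rfl⟩, hn⟩ := (IsLocalization.map_eq_zero_iff (Submonoid.powers g) _ a).1 h0
  exact ⟨n, hn⟩

include hV hD in
lemma exists_pow_mul_eq_resRing (c : Γ(X, D)) :
    ∃ (n : ℕ) (a : Γ(X, V)), resRing hDV a = resRing hDV g ^ n * c := by
  subst hD
  have := hV.isLocalization_basicOpen g
  obtain ⟨⟨a, ⟨_, n, rfl⟩⟩, hn⟩ := IsLocalization.surj (Submonoid.powers g) c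
  refine ⟨n, a, ?_⟩
  rw [← map_pow, mul_comm]
  exact hn.symm

include hV hD in
lemma exists_pow_mul_eq_resRing_pi (c : ι → Γ(X, D)) :
    ∃ (n : ℕ) (a : ι → Γ(X, V)), ∀ i, resRing hDV (a i) = resRing hDV g ^ n * c i := by
  choose n a ha using fun i => exists_pow_mul_eq_resRing hV g hDV hD (c i)
  refine ⟨∑ i, n i, fun i => g ^ (∑ i, n i - n i) * a i, fun i => ?_⟩
  rw [map_mul, ha, map_pow, ← mul_assoc, ← pow_add,
    Nat.sub_add_cancel (Finset.single_le_sum (fun _ _ => Nat.zero_le _) (Finset.mem_univ i))]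

include hV hD in
lemma IsFrame.exists_pow_smul_eq_zero {e : ι → Γ(E, V)} (he : IsFrame E V e) (s : Γ(E, V))
    (hs : resMod E hDV s = 0) : ∃ n : ℕ, g ^ n • s = 0 := by
  have h0 : ∀ i, resRing hDV (he.basis.repr s i) = 0 := by
    refine congrFun ((he D hDV).1 ?_ : (fun i => resRing hDV (he.basis.repr s i)) = 0)
    rw [← he.basis.sum_repr s, map_sum] at hs
    simp_rw [resMod_smul, he.basis_apply] at hs
    simpa using hs
  choose n hn using fun i => exists_pow_mul_eq_zero hV g hDV hD _ (h0 i)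
  refine ⟨∑ i, n i, he.basis.ext_elem fun i => ?_⟩
  rw [map_smul, map_zero, Finsupp.smul_apply, smul_eq_mul,
    ← Nat.sub_add_cancel (Finset.single_le_sum (fun _ _ => Nat.zero_le _) (Finset.mem_univ i) :
      n i ≤ ∑ i, n i), pow_add, mul_assoc, hn, mul_zero]
  rfl

include hV hD in
lemma IsFrame.exists_resMod_eq_pow_smul {e : ι → Γ(E, V)} (he : IsFrame E V e) (t : Γ(E, D)) :
    ∃ (n : ℕ) (s : Γ(E, V)), resMod E hDV s = resRing hDV g ^ n • t := by
  obtain ⟨c, rfl⟩ := (he D hDV).2 t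
  obtain ⟨n, a, ha⟩ := exists_pow_mul_eq_resRing_pi hV g hDV hD c
  refine ⟨n, ∑ i, a i • e i, ?_⟩
  rw [map_sum, Finset.smul_sum]
  simp_rw [resMod_smul, ha, mul_smul]

end Localization

/-- The sheaf has frames locally. -/
def LocallyFramed (E : X.Modules) (ι : Type) [Fintype ι] : Prop :=
  ∀ x : X, ∃ U : X.Opens, x ∈ U ∧ ∃ e : ι → Γ(E, U), IsFrame E U e

lemma LocallyFramed.exists_cover (hE : LocallyFramed E ι) (hU : IsAffineOpen U) :
    ∃ (κ : Type) (_ : Fintype κ) (h : κ → Γ(X, U)), U ≤ ⨆ k, X.basicOpen (h k) ∧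
      ∀ k, ∃ e : ι → Γ(E, X.basicOpen (h k)), IsFrame E _ e := by
  have key : ∀ x : U, ∃ f : Γ(X, U), x.1 ∈ X.basicOpen f ∧
      ∃ e : ι → Γ(E, X.basicOpen f), IsFrame E _ e := by
    intro x
    obtain ⟨W, hW, e, he⟩ := hE x
    obtain ⟨f, hf, hx⟩ := hU.exists_basicOpen_le ⟨x.1, hW⟩ x.2
    exact ⟨f, hx, _, he.res hf⟩
  choose f hf hf' using key
  obtain ⟨t, ht⟩ := hU.isCompact.elim_finite_subcover
    (fun x : U => (X.basicOpen (f x) : Set X)) (fun x => (X.basicOpen (f x)).2)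
    fun x hx => Set.mem_iUnion.2 ⟨⟨x, hx⟩, hf _⟩
  refine ⟨t, inferInstance, fun k => f k.1, fun x hx => ?_, fun k => hf' k.1⟩
  obtain ⟨k, hk, hx⟩ := Set.mem_iUnion₂.1 (ht hx)
  exact TopologicalSpace.Opens.mem_iSup.2 ⟨⟨k, hk⟩, hx⟩

lemma inf_eq_basicOpen_resRing (h : V ≤ U) (g : Γ(X, U)) :
    X.basicOpen g ⊓ V = X.basicOpen (resRing h g) := by
  rw [inf_comm]
  exact (Scheme.basicOpen_res X g (homOfLE h).op).symm

/-- A section that vanishes where `g ≠ 0` is killed by a power of `g`. -/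
lemma LocallyFramed.exists_pow_smul_eq_zero (hE : LocallyFramed E ι) (hU : IsAffineOpen U)
    (g : Γ(X, U)) (s : Γ(E, U)) (hs : resMod E (X.basicOpen_le g) s = 0) :
    ∃ n : ℕ, g ^ n • s = 0 := by
  obtain ⟨κ, _, h, hc, he⟩ := hE.exists_cover hU
  choose e he using he
  have hle := fun k => X.basicOpen_le (h k)
  have := fun k => (he k).exists_pow_smul_eq_zero (hU.basicOpen (h k)) (resRing (hle k) g)
    inf_le_right (inf_eq_basicOpen_resRing (hle k) g) (resMod E (hle k) s) (by
      rw [resMod_resMod, ← resMod_resMod E (X.basicOpen_le g) inf_le_left, hs, map_zero])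
  choose n hn using this
  refine ⟨∑ k, n k, eq_of_resMod_eq E _ hle hc fun k => ?_⟩
  rw [resMod_smul, map_zero, map_pow,
    ← Nat.sub_add_cancel (Finset.single_le_sum (fun _ _ => Nat.zero_le _) (Finset.mem_univ k) :
      n k ≤ ∑ i, n i), pow_add, mul_smul, hn, smul_zero]

/-- A section over the locus where `g ≠ 0` extends after multiplication by a power of `g`. -/
lemma LocallyFramed.exists_resMod_eq_pow_smul (hE : LocallyFramed E ι) (hU : IsAffineOpen U)
    (g : Γ(X, U)) (t : Γ(E, X.basicOpen g)) :
    ∃ (n : ℕ) (s : Γ(E, U)),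
      resMod E (X.basicOpen_le g) s = resRing (X.basicOpen_le g) g ^ n • t := by
  obtain ⟨κ, _, h, hc, he⟩ := hE.exists_cover hU
  choose e he using he
  have hle := fun k => X.basicOpen_le (h k)
  have hg := X.basicOpen_le g
  have h1 := fun k => (he k).exists_resMod_eq_pow_smul (hU.basicOpen (h k)) (resRing (hle k) g)
    inf_le_right (inf_eq_basicOpen_resRing (hle k) g) (resMod E inf_le_left t)
  choose n s hs using h1
  have hsum : ∀ k, n k ≤ ∑ i, n i := fun k =>
    Finset.single_le_sum (fun _ _ => Nat.zero_le _) (Finset.mem_univ k)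
  -- the extensions over the members of the cover, with a uniform exponent
  obtain ⟨s', hs'⟩ : ∃ s' : ∀ k, Γ(E, X.basicOpen (h k)), ∀ k, resMod E inf_le_right (s' k) =
      resRing (inf_le_left.trans hg : X.basicOpen g ⊓ X.basicOpen (h k) ≤ U) g ^ (∑ i, n i) •
        resMod E inf_le_left t := by
    refine ⟨fun k => resRing (hle k) g ^ (∑ i, n i - n k) • s k, fun k => ?_⟩
    rw [resMod_smul, hs, map_pow, resRing_resRing, smul_smul, ← pow_add,
      Nat.sub_add_cancel (hsum k)]
  have h2 := fun k l => ((he k).res (inf_le_left : _ ⊓ X.basicOpen (h l) ≤ _)).exists_pow_smul_eq_zero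
    (by rw [← Scheme.basicOpen_mul]; exact hU.basicOpen _)
    (resRing (inf_le_left.trans (hle k)) g)
    inf_le_right (inf_eq_basicOpen_resRing (inf_le_left.trans (hle k)) g)
    (resMod E inf_le_left (s' k) - resMod E inf_le_right (s' l)) (by
      have hk : X.basicOpen g ⊓ (X.basicOpen (h k) ⊓ X.basicOpen (h l)) ≤
        X.basicOpen g ⊓ X.basicOpen (h k) := inf_le_inf le_rfl inf_le_left
      have hl : X.basicOpen g ⊓ (X.basicOpen (h k) ⊓ X.basicOpen (h l)) ≤
        X.basicOpen g ⊓ X.basicOpen (h l) := inf_le_inf le_rfl inf_le_right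
      rw [map_sub, resMod_resMod, resMod_resMod, ← resMod_resMod E inf_le_right hk,
        ← resMod_resMod E inf_le_right hl, hs', hs', resMod_smul, resMod_smul, map_pow, map_pow,
        resRing_resRing, resRing_resRing, resMod_resMod, resMod_resMod, sub_self])
  choose m hm using h2
  have hsum' : ∀ k l, m k l ≤ ∑ k, ∑ l, m k l := fun k l =>
    (Finset.single_le_sum (fun _ _ => Nat.zero_le _) (Finset.mem_univ l)).trans
      (Finset.single_le_sum (f := fun k => ∑ l, m k l) (fun _ _ => Nat.zero_le _)
        (Finset.mem_univ k))
  obtain ⟨s₀, hs₀⟩ := exists_resMod_eq E _ hle hc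
    (fun k => resRing (hle k) g ^ (∑ k, ∑ l, m k l) • s' k) (fun k l => by
      rw [← sub_eq_zero, resMod_smul, resMod_smul, map_pow, map_pow, resRing_resRing,
        resRing_resRing, ← smul_sub, ← Nat.sub_add_cancel (hsum' k l), pow_add, mul_smul, hm,
        smul_zero])
  refine ⟨∑ k, ∑ l, m k l + ∑ k, n k, s₀, ?_⟩
  refine eq_of_resMod_eq E (fun k => X.basicOpen g ⊓ X.basicOpen (h k)) (fun k => inf_le_left)
    (fun x hx => ?_) fun k => ?_
  · obtain ⟨k, hk⟩ := TopologicalSpace.Opens.mem_iSup.1 (hc (hg hx))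
    exact TopologicalSpace.Opens.mem_iSup.2 ⟨k, hx, hk⟩
  · rw [resMod_resMod, ← resMod_resMod E (hle k) inf_le_right, hs₀, resMod_smul, hs', resMod_smul,
      smul_smul, map_pow, map_pow, resRing_resRing, resRing_resRing, ← pow_add]

/-- A basis of the module of sections over an affine open subset is a frame. -/
theorem LocallyFramed.isFrame_basis (hE : LocallyFramed E ι) (hU : IsAffineOpen U) {κ : Type}
    [Fintype κ] (b : Module.Basis κ Γ(X, U) Γ(E, U)) : IsFrame E U b := by
  have key : ∀ g : Γ(X, U), Function.Bijective fun c : κ → Γ(X, X.basicOpen g) =>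
      ∑ i, c i • resMod E (X.basicOpen_le g) (b i) := by
    intro g
    have hu := isUnit_resRing g (X.basicOpen_le g) rfl
    constructor
    · intro c c' hcc
      obtain ⟨n, a, ha⟩ := exists_pow_mul_eq_resRing_pi hU g (X.basicOpen_le g) rfl (c - c')
      obtain ⟨m, hm⟩ := hE.exists_pow_smul_eq_zero hU g (∑ i, a i • b i) (by
        rw [map_sum]
        simp_rw [resMod_smul, ha, mul_smul]
        rw [← Finset.smul_sum]
        simp_rw [Pi.sub_apply, sub_smul]
        rw [Finset.sum_sub_distrib, sub_eq_zero.2 hcc, smul_zero])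
      ext i
      have h1 : g ^ m * a i = 0 := by
        simp_rw [Finset.smul_sum, smul_smul] at hm
        exact Fintype.linearIndependent_iff.1 b.linearIndependent _ hm i
      have h2 := congrArg (resRing (X.basicOpen_le g)) h1
      rw [map_mul, map_pow, map_zero, ha, ← mul_assoc, ← pow_add,
        (hu.pow _).mul_right_eq_zero, Pi.sub_apply, sub_eq_zero] at h2
      exact h2
    · intro t
      obtain ⟨n, s, hs⟩ := hE.exists_resMod_eq_pow_smul hU g t
      refine ⟨fun i => ((hu.pow n).unit⁻¹ : Γ(X, X.basicOpen g)ˣ) *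
        resRing (X.basicOpen_le g) (b.repr s i), ?_⟩
      simp_rw [mul_smul, ← resMod_smul]
      rw [← Finset.smul_sum, ← map_sum, b.sum_repr, hs, smul_smul, IsUnit.val_inv_mul, one_smul]
  intro V h
  -- `V` is covered by basic open subsets of `U`, whose intersections are basic open subsets
  let J := {g : Γ(X, U) // X.basicOpen g ≤ V}
  have hc : V ≤ ⨆ g : J, X.basicOpen g.1 := by
    intro x hx
    obtain ⟨f, hf, hxf⟩ := hU.exists_basicOpen_le ⟨x, hx⟩ (h hx)
    exact TopologicalSpace.Opens.mem_iSup.2 ⟨⟨f, hf⟩, hxf⟩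
  have hr : ∀ (V' : X.Opens) (h' : V' ≤ V) (c : κ → Γ(X, V)),
      resMod E h' (∑ i, c i • resMod E h (b i)) =
        ∑ i, resRing h' (c i) • resMod E (h'.trans h) (b i) := by
    intro V' h' c
    rw [map_sum]
    simp_rw [resMod_smul, resMod_resMod]
  constructor
  · intro c c' hcc
    ext i
    refine eq_of_resRing_eq _ (fun g : J => g.2) hc fun g => ?_
    have := congrArg (resMod E g.2) hcc
    simp only [hr] at this
    exact congrFun ((key g.1).1 this) i
  · intro t
    choose c hc' using fun g : J => (key g.1).2 (resMod E g.2 t)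
    have h1 : ∀ g g' : J, ∀ i, resRing (inf_le_left : X.basicOpen g.1 ⊓ X.basicOpen g'.1 ≤ _)
        (c g i) = resRing (inf_le_right : X.basicOpen g.1 ⊓ X.basicOpen g'.1 ≤ _) (c g' i) := by
      intro g g'
      have h2 := key (g.1 * g'.1)
      have h3 : ∀ (D : X.Opens) (_ : D = X.basicOpen (g.1 * g'.1)) (hD : D ≤ U),
          Function.Injective fun c : κ → Γ(X, D) => ∑ i, c i • resMod E hD (b i) := by
        rintro D rfl hD
        exact h2.1
      refine congrFun (h3 _ (Scheme.basicOpen_mul ..).symm (inf_le_left.trans (X.basicOpen_le _)) ?_)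
      have h4 := congrArg (resMod E (inf_le_left : X.basicOpen g.1 ⊓ X.basicOpen g'.1 ≤ _)) (hc' g)
      have h5 := congrArg (resMod E (inf_le_right : X.basicOpen g.1 ⊓ X.basicOpen g'.1 ≤ _)) (hc' g')
      simp only [map_sum, resMod_smul, resMod_resMod] at h4 h5
      exact h4.trans h5.symm
    choose a ha using fun i => exists_resRing_eq _ (fun g : J => g.2) hc (fun g => c g i)
      fun g g' => h1 g g' i
    refine ⟨a, eq_of_resMod_eq E _ (fun g : J => g.2) hc fun g => ?_⟩
    simp only [hr, ha]
    exact hc' g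

end Frames

/-! ### Base change of twisted endomorphisms -/

section Transport

variable {A A' : Type} [CommRing A] [CommRing A'] {σ : A →+* A'} {M N M' N' : Type}
  [AddCommGroup M] [Module A M] [AddCommGroup N] [Module A N] [AddCommGroup M'] [Module A' M']
  [AddCommGroup N'] [Module A' N'] (ρ : M →ₛₗ[σ] M') (ν : N →ₛₗ[σ] N')
  {B B' : Type} [CommRing B] [CommRing B'] [Algebra A B] [Algebra A' B']

/-- The map `B ⊗ M → B' ⊗ M'`, linear over a ring map `f : B → B'`, that `f` and a map `M → M'`
linear over `σ : A → A'` induce. -/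
def baseMap (f : B →+* B') (g : B →ₛₗ[σ] B') (hg : ∀ x, g x = f x) :
    B ⊗[A] M →ₛₗ[f] B' ⊗[A'] M' where
  toFun := TensorProduct.map g ρ
  map_add' := map_add _
  map_smul' b x := by
    induction x with
    | zero => simp
    | tmul y m =>
      simp only [TensorProduct.smul_tmul', smul_eq_mul, TensorProduct.map_tmul, hg, map_mul]
    | add x y hx hy => simp only [smul_add, map_add, hx, hy]

variable (f : B →+* B') (g : B →ₛₗ[σ] B') (hg : ∀ x, g x = f x)

@[simp] lemma baseMap_tmul (b : B) (m : M) :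
    baseMap ρ f g hg (b ⊗ₜ m) = f b ⊗ₜ ρ m := by
  rw [← hg]; rfl

include hg in
lemma apply_algebraMap (a : A) : f (algebraMap A B a) = algebraMap A' B' (σ a) := by
  rw [← hg, Algebra.algebraMap_eq_smul_one, map_smulₛₗ, hg, map_one,
    Algebra.algebraMap_eq_smul_one]

section Basis

variable {ι : Type} (b : Module.Basis ι A M) (b' : Module.Basis ι A' M') (hb : ∀ j, ρ (b j) = b' j)

include hb in
lemma repr_transport (m : M) (j : ι) : b'.repr (ρ m) j = σ (b.repr m j) := by
  classical
  induction b.mem_span m using Submodule.span_induction with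
  | mem x hx =>
    obtain ⟨i, rfl⟩ := hx
    rw [hb, b'.repr_self, b.repr_self, Finsupp.single_apply, Finsupp.single_apply]
    split <;> simp
  | zero => simp
  | add x y _ _ hx hy => simp [hx, hy]
  | smul a x _ hx => simp [map_smulₛₗ, hx]

include hb in
lemma baseMap_basis (j : ι) : baseMap ρ f g hg (Algebra.TensorProduct.basis B b j) =
    Algebra.TensorProduct.basis B' b' j := by
  simp [Algebra.TensorProduct.basis_apply, hb]

include hb in
lemma repr_baseMap (x : B ⊗[A] M) (j : ι) :
    (Algebra.TensorProduct.basis B' b').repr (baseMap ρ f g hg x) j =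
      f ((Algebra.TensorProduct.basis B b).repr x j) :=
  repr_transport (baseMap ρ f g hg) _ _ (baseMap_basis ρ f g hg b b' hb) x j

variable {φ : M →ₗ[A] M ⊗[A] N} {φ' : M' →ₗ[A'] M' ⊗[A'] N'}
  (hφ : ∀ m, φ' (ρ m) = TensorProduct.map ρ ν (φ m))
  {C C' : Type} [CommRing C] [CommRing C'] [Algebra A C] [Algebra A' C'] (h : C →+* C')
  (hσ : ∀ a, h (algebraMap A C a) = algebraMap A' C' (σ a))
  {c : N →ₗ[A] C} {c' : N' →ₗ[A'] C'} (hc : ∀ x, c' (ν x) = h (c x))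

include hb hσ hc in
lemma coordForm_transport (k : ι) (t : M ⊗[A] N) :
    coordForm b' k c' (TensorProduct.map ρ ν t) = h (coordForm b k c t) := by
  induction t with
  | zero => simp
  | tmul m n =>
    rw [TensorProduct.map_tmul, coordForm_tmul, coordForm_tmul, hc, Algebra.smul_def,
      Algebra.smul_def, map_mul, hσ, repr_transport ρ b b' hb]
  | add x y hx hy => simp only [map_add, hx, hy]

include hb hσ hc hφ in
lemma twistMatrix_transport : twistMatrix b' φ' c' = (twistMatrix b φ c).map h := by
  ext k j
  change coordForm b' k c' (φ' (b' j)) = h (coordForm b k c (φ (b j)))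
  rw [← hb, hφ, coordForm_transport ρ ν b b' hb h hσ hc]

variable (i : B →ₐ[A] C) (i' : B' →ₐ[A'] C') (hi : ∀ x, i' (f x) = h (i x))

include hc hi in
lemma pairing_transport (θ : B ⊗[A] N) :
    pairing i' c' (baseMap ν f g hg θ) = h (pairing i c θ) := by
  induction θ with
  | zero => simp
  | tmul x n => rw [baseMap_tmul, pairing_tmul, pairing_tmul, map_mul, hi, hc]
  | add x y hx hy => simp only [map_add, hx, hy]

include hb hσ hc hφ hi in
lemma charMatrix_transport [Fintype ι] [DecidableEq ι] (θ : B ⊗[A] N) :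
    charMatrix b' φ' i' (baseMap ν f g hg θ) c' = (charMatrix b φ i θ c).map h := by
  rw [charMatrix, charMatrix, twistMatrix_transport ρ ν b b' hb hφ h hσ hc,
    pairing_transport ν f g hg h hc i i' hi]
  ext k j
  by_cases hkj : k = j <;> simp [hkj]

end Basis

/-- The pair of `φ'` and its module is obtained from `φ` by base change along `σ : A → A'`. The
condition on the twisting modules is phrased with dual bases. -/
structure IsTransport (φ : M →ₗ[A] M ⊗[A] N) (φ' : M' →ₗ[A'] M' ⊗[A'] N') : Prop where
  basis : ∃ (n : ℕ) (b : Module.Basis (Fin n) A M) (b' : Module.Basis (Fin n) A' M'),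
    ∀ j, ρ (b j) = b' j
  dual : ∃ (k : ℕ) (e : Fin k → N) (c : Fin k → N →ₗ[A] A) (c' : Fin k → N' →ₗ[A'] A'),
    (∀ x, x = ∑ i, c i x • e i) ∧ (∀ x, x = ∑ i, c' i x • ν (e i)) ∧
      ∀ i x, c' i (ν x) = σ (c i x)
  comm : ∀ m, φ' (ρ m) = TensorProduct.map ρ ν (φ m)

variable {ρ ν} {φ : M →ₗ[A] M ⊗[A] N} {φ' : M' →ₗ[A'] M' ⊗[A'] N'} (H : IsTransport ρ ν φ φ')

lemma genericForm_apply {k : ℕ} (c : Fin k → N →ₗ[A] A) (x : N) :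
    genericForm B c x = ∑ i, c i x • MvPolynomial.X i := by
  simp [genericForm]

include H in
/-- The spectral equation is compatible with base change. -/
lemma IsTransport.charValue_eq_zero [Module.Free A M] [Module.Finite A M] [Module.Free A' M']
    [Module.Finite A' M'] {θ : B ⊗[A] N} :
    (charValue B φ θ = 0 → charValue B' φ' (baseMap ν f g hg θ) = 0) ∧
    (Function.Injective f → charValue B' φ' (baseMap ν f g hg θ) = 0 → charValue B φ θ = 0) := by
  obtain ⟨n, b, b', hb⟩ := H.basis
  obtain ⟨k, e, c, c', hc, hc', hcc⟩ := H.dual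
  have key := charMatrix_transport ρ ν f g hg b b' hb H.comm (MvPolynomial.map f)
    (c := genericForm B c) (c' := genericForm B' c')
    (fun a => by
      rw [MvPolynomial.algebraMap_apply, MvPolynomial.map_C, MvPolynomial.algebraMap_apply,
        apply_algebraMap f g hg])
    (fun x => by
      simp only [genericForm_apply, map_sum, hcc, Algebra.smul_def, map_mul, MvPolynomial.map_X,
        MvPolynomial.algebraMap_apply, MvPolynomial.map_C, apply_algebraMap f g hg])
    (IsScalarTower.toAlgHom A B (MvPolynomial (Fin k) B))
    (IsScalarTower.toAlgHom A' B' (MvPolynomial (Fin k) B'))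
    (fun x => by simp [MvPolynomial.algebraMap_eq]) θ
  rw [charValue_eq_zero_iff_det_genericForm b φ hc, charValue_eq_zero_iff_det_genericForm b' φ' hc',
    key]
  have h1 : ∀ Z : Matrix (Fin n) (Fin n) (MvPolynomial (Fin k) B),
    (Z.map (MvPolynomial.map f)).det = MvPolynomial.map f Z.det := fun Z =>
      ((MvPolynomial.map f).map_det Z).symm
  rw [h1]
  exact ⟨fun h => by rw [h, map_zero], fun hf h =>
    MvPolynomial.map_injective f hf (by rw [h, map_zero])⟩

include H in
lemma IsTransport.bijective (hf : Function.Bijective f) :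
    Function.Bijective (baseMap ν f g hg) := by
  obtain ⟨k, e, c, c', hc, hc', hcc⟩ := H.dual
  have hp := fun i q => pairing_transport ν f g hg f
    (c := Algebra.linearMap A B ∘ₗ c i) (c' := Algebra.linearMap A' B' ∘ₗ c' i)
    (fun x => by simp [hcc, apply_algebraMap f g hg]) (AlgHom.id A B) (AlgHom.id A' B')
    (fun _ => rfl) q
  constructor
  · intro q q' h
    rw [eq_sum_pairing_smul hc q, eq_sum_pairing_smul hc q']
    refine Finset.sum_congr rfl fun i _ => ?_
    congr 1
    exact hf.1 (by rw [← hp, h, hp])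
  · intro q
    choose x hx using fun i => hf.2
      (pairing (AlgHom.id A' B') (Algebra.linearMap A' B' ∘ₗ c' i) q)
    refine ⟨∑ i, x i • (1 : B) ⊗ₜ e i, ?_⟩
    conv_rhs => rw [eq_sum_pairing_smul hc' q]
    simp [map_smulₛₗ, hx]

/-- Invariant submodules are those stable under the contractions with a dual basis. -/
lemma isInvariant_iff_of_dual_basis {k : ℕ} {e : Fin k → N} {c : Fin k → N →ₗ[A] A}
    (hc : ∀ x, x = ∑ i, c i x • e i) (L : Submodule B (B ⊗[A] M)) :
    IsInvariant (baseChangeTwisted B φ) L ↔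
      ∀ i, ∀ l ∈ L, twistEnd φ (Algebra.linearMap A B ∘ₗ c i) l ∈ L := by
  constructor
  · intro h i l hl
    obtain ⟨t, ht⟩ := h l hl
    rw [← contract_baseChangeTwisted, ← ht]
    clear ht
    induction t with
    | zero => simp
    | tmul x q => simpa using L.smul_mem _ x.2
    | add x y hx hy => simpa only [map_add] using L.add_mem hx hy
  · intro h l hl
    rw [eq_sum_contract_tmul hc (baseChangeTwisted B φ l)]
    refine Submodule.sum_mem _ fun i _ => ?_
    rw [contract_baseChangeTwisted]
    exact ⟨⟨_, h i l hl⟩ ⊗ₜ ((1 : B) ⊗ₜ e i), by simp⟩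

/-- The contractions of `φ` and `φ'` correspond. -/
lemma twistEnd_transport (hφ : ∀ m, φ' (ρ m) = TensorProduct.map ρ ν (φ m)) {c : N →ₗ[A] B}
    {c' : N' →ₗ[A'] B'} (hc : ∀ x, c' (ν x) = f (c x)) (x : B ⊗[A] M) :
    twistEnd φ' c' (baseMap ρ f g hg x) = baseMap ρ f g hg (twistEnd φ c x) := by
  have key : ∀ t : M ⊗[A] N, c'.rTensor M' (TensorProduct.comm A' M' N' (TensorProduct.map ρ ν t)) =
      baseMap ρ f g hg (c.rTensor M (TensorProduct.comm A M N t)) := by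
    intro t
    induction t with
    | zero => simp
    | tmul m n => simp [hc]
    | add x y hx hy => simp only [map_add, hx, hy]
  induction x with
  | zero => simp
  | tmul b m => simp [twistEnd, hφ, key, map_smulₛₗ]
  | add x y hx hy => simp only [map_add, hx, hy]

/-- Base change of eigenvectors. -/
lemma eigen_transport [Module.Finite A' N'] [Module.Projective A' N'] (H : IsTransport ρ ν φ φ')
    {θ : B ⊗[A] N} {x : B ⊗[A] M} (h : baseChangeTwisted B φ x = x ⊗ₜ θ) :
    baseChangeTwisted B' φ' (baseMap ρ f g hg x) = baseMap ρ f g hg x ⊗ₜ baseMap ν f g hg θ := by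
  obtain ⟨k, e, c, c', hc, hc', hcc⟩ := H.dual
  rw [eq_sum_contract_tmul hc' (baseChangeTwisted B' φ' _), eq_sum_contract_tmul hc' (_ ⊗ₜ _)]
  refine Finset.sum_congr rfl fun i _ => ?_
  have hcf : ∀ x, (Algebra.linearMap A' B' ∘ₗ c' i) (ν x) =
      f ((Algebra.linearMap A B ∘ₗ c i) x) := fun x => by simp [hcc, apply_algebraMap f g hg]
  rw [contract_baseChangeTwisted, contract_tmul, twistEnd_transport f g hg H.comm hcf,
    twistEnd_eq_of_eigen h, map_smulₛₗ,
    pairing_transport ν f g hg f hcf (AlgHom.id A B) (AlgHom.id A' B') (fun _ => rfl)]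

include H in
/-- Higgs subbundles of rank one are compatible with base change. -/
lemma IsTransport.span_image {L : Submodule B (B ⊗[A] M)} (hL : IsLine L)
    (hi : IsInvariant (baseChangeTwisted B φ) L) :
    IsLine (Submodule.span B' (baseMap ρ f g hg '' L)) ∧
      IsInvariant (baseChangeTwisted B' φ') (Submodule.span B' (baseMap ρ f g hg '' L)) := by
  obtain ⟨n, b, b', hb⟩ := H.basis
  obtain ⟨k, e, c, c', hc, hc', hcc⟩ := H.dual
  refine ⟨hL.span_image _ _ _ (baseMap_basis ρ f g hg b b' hb), ?_⟩
  rw [isInvariant_iff_of_dual_basis hc'] 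
  rw [isInvariant_iff_of_dual_basis hc] at hi
  intro i l hl
  induction hl using Submodule.span_induction with
  | mem x hx =>
    obtain ⟨l, hl, rfl⟩ := hx
    rw [twistEnd_transport f g hg H.comm (c := Algebra.linearMap A B ∘ₗ c i)
      (fun x => by simp [hcc, apply_algebraMap f g hg])]
    exact Submodule.subset_span ⟨_, hi i l hl, rfl⟩
  | zero => simp
  | add x y _ _ hx hy => rw [map_add]; exact add_mem hx hy
  | smul a x _ hx => rw [map_smul]; exact Submodule.smul_mem _ _ hx

end Transport

/-! ### Gluing line subbundles -/

/-- The ring map `f : B → B'` is a localization away from `b`. -/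
structure IsAway {B B' : Type} [CommRing B] [CommRing B'] (f : B →+* B') (b : B) : Prop where
  isUnit : IsUnit (f b)
  exists_pow_mul_eq_zero : ∀ x, f x = 0 → ∃ n : ℕ, b ^ n * x = 0
  exists_eq_pow_mul : ∀ y, ∃ (n : ℕ) (x : B), f x = f b ^ n * y

lemma isAway_algebraMap {B : Type} [CommRing B] (b : B) :
    IsAway (algebraMap B (Localization.Away b)) b where
  isUnit := IsLocalization.Away.algebraMap_isUnit b
  exists_pow_mul_eq_zero x hx := by
    obtain ⟨⟨_, n, rfl⟩, hn⟩ := (IsLocalization.map_eq_zero_iff (Submonoid.powers b) _ x).1 hx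
    exact ⟨n, hn⟩
  exists_eq_pow_mul y := by
    obtain ⟨⟨x, ⟨_, n, rfl⟩⟩, hn⟩ := IsLocalization.surj (Submonoid.powers b) y
    exact ⟨n, x, by rw [← map_pow, mul_comm]; exact hn.symm⟩

section Away

variable {B B' P P' κ : Type} [CommRing B] [CommRing B'] [AddCommGroup P] [Module B P]
  [AddCommGroup P'] [Module B' P'] {f : B →+* B'} (β : Module.Basis κ B P)
  (β' : Module.Basis κ B' P') (τ : P →ₛₗ[f] P') (hτ : ∀ j, τ (β j) = β' j) {b : B}
  (hf : IsAway f b)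

include hf

lemma IsAway.exists_pow_smul_mem_image {L : Submodule B P} {y : P'}
    (hy : y ∈ Submodule.span B' (τ '' L)) : ∃ (n : ℕ), ∃ l ∈ L, τ l = f b ^ n • y := by
  induction hy using Submodule.span_induction with
  | mem x hx => obtain ⟨l, hl, rfl⟩ := hx; exact ⟨0, l, hl, by simp⟩
  | zero => exact ⟨0, 0, L.zero_mem, by simp⟩
  | add x y _ _ hx hy =>
    obtain ⟨n, l, hl, e⟩ := hx
    obtain ⟨n', l', hl', e'⟩ := hy
    refine ⟨n + n', b ^ n' • l + b ^ n • l', add_mem (L.smul_mem _ hl) (L.smul_mem _ hl'), ?_⟩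
    rw [map_add, map_smulₛₗ, map_smulₛₗ, e, e', smul_add, map_pow, map_pow, smul_smul, smul_smul,
      ← pow_add, ← pow_add, add_comm n']
  | smul a x _ hx =>
    obtain ⟨n, l, hl, e⟩ := hx
    obtain ⟨m, c, hc⟩ := hf.exists_eq_pow_mul a
    refine ⟨m + n, c • l, L.smul_mem _ hl, ?_⟩
    rw [map_smulₛₗ, hc, e, smul_smul, smul_smul]
    congr 1; ring

include hτ

lemma IsAway.exists_pow_smul_eq_zero [Finite κ] {x : P} (hx : τ x = 0) : ∃ n : ℕ, b ^ n • x = 0 := by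
  have := Fintype.ofFinite κ
  choose n hn using fun j => hf.exists_pow_mul_eq_zero (β.repr x j) (by
    rw [← repr_transport τ β β' hτ, hx]; simp)
  refine ⟨∑ j, n j, β.ext_elem fun j => ?_⟩
  rw [map_smul, map_zero, Finsupp.smul_apply, smul_eq_mul,
    ← Nat.sub_add_cancel (Finset.single_le_sum (fun _ _ => Nat.zero_le _) (Finset.mem_univ j) :
      n j ≤ ∑ j, n j), pow_add, mul_assoc, hn, mul_zero]
  rfl

lemma IsAway.exists_eq_pow_smul [Finite κ] (y : P') : ∃ (n : ℕ) (x : P), τ x = f b ^ n • y := by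
  have := Fintype.ofFinite κ
  choose n x hx using fun j => hf.exists_eq_pow_mul (β'.repr y j)
  refine ⟨∑ j, n j, ∑ j, (b ^ (∑ j, n j - n j) * x j) • β j, ?_⟩
  conv_rhs => rw [← β'.sum_repr y, Finset.smul_sum]
  rw [map_sum]
  refine Finset.sum_congr rfl fun j _ => ?_
  rw [map_smulₛₗ, hτ, map_mul, hx, map_pow, ← mul_assoc, ← pow_add,
    Nat.sub_add_cancel (Finset.single_le_sum (fun _ _ => Nat.zero_le _) (Finset.mem_univ j)),
    smul_smul]

lemma IsAway.exists_pow_smul_mem [Finite κ] {L : Submodule B P} {x : P}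
    (hx : τ x ∈ Submodule.span B' (τ '' L)) : ∃ n : ℕ, b ^ n • x ∈ L := by
  obtain ⟨n, l, hl, e⟩ := hf.exists_pow_smul_mem_image τ hx
  obtain ⟨m, hm⟩ := hf.exists_pow_smul_eq_zero β β' τ hτ (x := b ^ n • x - l) (by
    rw [map_sub, map_smulₛₗ, e, map_pow, sub_self])
  refine ⟨m + n, ?_⟩
  rw [pow_add, mul_smul]
  rw [smul_sub, sub_eq_zero] at hm
  rw [hm]
  exact L.smul_mem _ hl

lemma IsAway.exists_form [Finite κ] (ℓ' : P' →ₗ[B'] B') :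
    ∃ (n : ℕ) (ℓ : P →ₗ[B] B), ∀ m, f (ℓ m) = f b ^ n * ℓ' (τ m) := by
  have := Fintype.ofFinite κ
  choose n x hx using fun j => hf.exists_eq_pow_mul (ℓ' (β' j))
  refine ⟨∑ j, n j, β.constr B fun j => b ^ (∑ j, n j - n j) * x j, fun m => ?_⟩
  induction β.mem_span m using Submodule.span_induction with
  | mem y hy =>
    obtain ⟨j, rfl⟩ := hy
    rw [Module.Basis.constr_basis, hτ, map_mul, hx, map_pow, ← mul_assoc, ← pow_add,
      Nat.sub_add_cancel (Finset.single_le_sum (fun _ _ => Nat.zero_le _) (Finset.mem_univ j))]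
  | zero => simp
  | add x y _ _ hx hy => simp only [map_add, hx, hy, mul_add]
  | smul a x _ hx =>
    rw [map_smul, smul_eq_mul, map_mul, hx, map_smulₛₗ, map_smul, smul_eq_mul]
    ring

end Away

section Glue

variable {B P κ ι : Type} [CommRing B] [AddCommGroup P] [Module B P] (β : Module.Basis κ B P)
  [Finite κ] {B' P' : ι → Type} [∀ k, CommRing (B' k)] [∀ k, AddCommGroup (P' k)]
  [∀ k, Module (B' k) (P' k)] {f : ∀ k, B →+* B' k} (β' : ∀ k, Module.Basis κ (B' k) (P' k))
  (τ : ∀ k, P →ₛₗ[f k] P' k) (hτ : ∀ k j, τ k (β j) = β' k j) {b : ι → B}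
  (hb : Ideal.span (Set.range b) = ⊤) (hf : ∀ k, IsAway (f k) (b k))

include hb hτ hf

lemma le_of_span_image_eq {L L' : Submodule B P}
    (h : ∀ k, Submodule.span (B' k) (τ k '' L) ≤ Submodule.span (B' k) (τ k '' L')) : L ≤ L' := by
  intro x hx
  refine Submodule.mem_of_span_eq_top_of_smul_pow_mem L' _ hb x ?_
  rintro ⟨_, k, rfl⟩
  exact (hf k).exists_pow_smul_mem β (β' k) (τ k) (hτ k)
    (h k (Submodule.subset_span ⟨x, hx, rfl⟩))

/-- Line subbundles glue: if `L k` is one over the localization at `b k`, compatibly, then the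
elements of `P` that lie in each `L k` form a line subbundle. -/
lemma IsLine.glue {L : ∀ k, Submodule (B' k) (P' k)} (hL : ∀ k, IsLine (L k))
    (hc : ∀ k j x, τ k x ∈ L k → ∃ n : ℕ, f j (b k) ^ n • τ j x ∈ L j) :
    IsLine (⨅ k, (L k).comap (τ k)) ∧
      ∀ k, Submodule.span (B' k) (τ k '' (⨅ k, (L k).comap (τ k) : Submodule B P)) = L k := by
  obtain ⟨t, ht, ht'⟩ := (Ideal.span_eq_top_iff_finite (Set.range b)).1 hb
  choose g hg using fun x : t => ht x.2
  -- elements of `L k` extend after multiplication by a power of `b k`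
  have h1 : ∀ k x, τ k x ∈ L k → ∃ n : ℕ, b k ^ n • x ∈ (⨅ k, (L k).comap (τ k) : Submodule B P) := by
    intro k x hx
    choose n hn using fun i : t => hc k (g i) x hx
    refine ⟨∑ i, n i, ?_⟩
    rw [Submodule.mem_iInf]
    intro j
    refine Submodule.mem_of_span_eq_top_of_smul_pow_mem _ _ ht' _ ?_
    rintro ⟨r', hr⟩
    obtain ⟨r, rfl⟩ : ∃ r : t, r.1 = r' := ⟨⟨r', hr⟩, rfl⟩
    have h2 : τ (g r) (b k ^ (∑ i, n i) • x) ∈ L (g r) := by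
      rw [map_smulₛₗ, map_pow, ← Nat.sub_add_cancel (Finset.single_le_sum
        (fun _ _ => Nat.zero_le _) (Finset.mem_univ r) : n r ≤ ∑ i, n i), pow_add, mul_smul]
      exact (L (g r)).smul_mem _ (hn r)
    obtain ⟨m, hm⟩ := hc (g r) j _ h2
    refine ⟨m, ?_⟩
    rw [Submodule.mem_comap, map_smulₛₗ, map_pow, ← hg r]
    exact hm
  have h2 : ∀ k, ∀ y ∈ L k, ∃ (n : ℕ), ∃ l ∈ (⨅ k, (L k).comap (τ k) : Submodule B P),
      τ k l = f k (b k) ^ n • y := by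
    intro k y hy
    obtain ⟨n, x, hx⟩ := (hf k).exists_eq_pow_smul β (β' k) (τ k) (hτ k) y
    obtain ⟨m, hm⟩ := h1 k x (by rw [hx]; exact (L k).smul_mem _ hy)
    exact ⟨m + n, _, hm, by rw [map_smulₛₗ, hx, smul_smul, map_pow, pow_add]⟩
  refine ⟨IsLine.of_span_eq_top ?_, fun k => le_antisymm ?_ fun y hy => ?_⟩
  · -- any form and any element of the intersection qualify, as they do so locally
    have h3 : ∀ l ∈ (⨅ k, (L k).comap (τ k) : Submodule B P), ∀ ℓ : P →ₗ[B] B,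
        ∀ m ∈ (⨅ k, (L k).comap (τ k) : Submodule B P), ℓ l • m = ℓ m • l := by
      intro l hl ℓ m hm
      rw [← sub_eq_zero, ← Submodule.mem_bot (R := B)]
      refine Submodule.mem_of_span_eq_top_of_smul_pow_mem _ _ hb _ ?_
      rintro ⟨_, k, rfl⟩
      obtain ⟨ℓ', hℓ'⟩ := exists_form_comp_eq β (β' k) (τ k) (hτ k) ℓ
      refine (hf k).exists_pow_smul_eq_zero β (β' k) (τ k) (hτ k) ?_
      rw [map_sub, map_smulₛₗ, map_smulₛₗ, ← hℓ', ← hℓ', sub_eq_zero]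
      exact (hL k).apply_smul_comm ℓ' (Submodule.mem_iInf _ |>.1 hl k) (Submodule.mem_iInf _ |>.1 hm k)
    refine (Ideal.eq_top_iff_one _).2 (Submodule.mem_of_span_eq_top_of_smul_pow_mem _ _ hb _ ?_)
    rintro ⟨_, k, rfl⟩
    obtain ⟨n, v, ℓ, hv, hs, -⟩ := hL k
    choose e w hw hwe using fun a => h2 k (v a) (hv a)
    choose e' ℓ' hℓ' using fun a => (hf k).exists_form β (β' k) (τ k) (hτ k) (ℓ a)
    obtain ⟨m, hm⟩ := (hf k).exists_pow_mul_eq_zero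
      (∑ a, b k ^ (∑ a, (e a + e' a) - (e a + e' a)) * ℓ' a (w a) - b k ^ (∑ a, (e a + e' a))) (by
        rw [map_sub, map_sum, map_pow, sub_eq_zero]
        conv_rhs => rw [← mul_one (f k (b k) ^ _), ← hs, Finset.mul_sum]
        refine Finset.sum_congr rfl fun a _ => ?_
        rw [map_mul, hℓ', hwe, map_smul, smul_eq_mul, map_pow, ← mul_assoc, ← mul_assoc, mul_assoc
          (_ ^ _), ← pow_add, ← pow_add, add_comm (e' a), Nat.sub_add_cancel
          (Finset.single_le_sum (f := fun a => e a + e' a) (fun _ _ => Nat.zero_le _)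
            (Finset.mem_univ a))])
    refine ⟨m + ∑ a, (e a + e' a), ?_⟩
    rw [mul_sub, sub_eq_zero, ← pow_add] at hm
    rw [smul_eq_mul, mul_one, ← hm]
    refine Ideal.mul_mem_left _ _ (Ideal.sum_mem _ fun a _ => Ideal.mul_mem_left _ _
      (Ideal.subset_span ⟨w a, hw a, ℓ' a, rfl, fun m hm => h3 _ (hw a) _ _ hm⟩))
  · rw [Submodule.span_le]
    rintro _ ⟨x, hx, rfl⟩
    exact Submodule.mem_iInf _ |>.1 hx k
  · obtain ⟨n, l, hl, e⟩ := h2 k y hy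
    refine (Submodule.smul_mem_iff_of_isUnit _ ((hf k).isUnit.pow n)).1 ?_
    rw [← e]
    exact Submodule.subset_span ⟨l, hl, rfl⟩

end Glue

/-! ### Differential forms on a smooth scheme -/

section Smooth

variable {X : Scheme.{0}} [X.Over SpecC]

/-- The structure map of an affine open subset is given by the structure of a complex algebra on its
functions. -/
lemma chart_over (U : X.affineOpens) :
    chart U ≫ (X ↘ SpecC) = Spec.map (CommRingCat.ofHom (algebraMap ℂ Γ(X, U.1))) := by
  have h1 : X ↘ SpecC = X.toSpecΓ ≫ Spec.map ((Scheme.ΓSpecIso (.of ℂ)).inv ≫ (X ↘ SpecC).appTop) := by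
    rw [Spec.map_comp, ← Category.assoc, ← Scheme.toSpecΓ_naturality, Category.assoc,
      toSpecΓ_SpecMap_ΓSpecIso_inv]
    simp
  have h2 : chart U ≫ X.toSpecΓ = Spec.map (X.presheaf.map (homOfLE le_top).op) :=
    IsAffineOpen.fromSpec_toSpecΓ U.2
  rw [h1, ← Category.assoc, h2, ← Spec.map_comp, Category.assoc]
  rfl

lemma smooth_sections [Smooth (X ↘ SpecC)] (U : X.affineOpens) : Algebra.Smooth ℂ Γ(X, U.1) := by
  have h : Smooth (chart U ≫ (X ↘ SpecC)) := inferInstance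
  rw [chart_over, HasRingHomProperty.Spec_iff (P := @Smooth)] at h
  exact RingHom.smooth_algebraMap.1 h

lemma rankAtStalk_forms {n : ℕ} [SmoothOfRelativeDimension n (X ↘ SpecC)] (U : X.affineOpens)
    (p : PrimeSpectrum Γ(X, U.1)) :
    Module.rankAtStalk (R := Γ(X, U.1)) Ω[Γ(X, U.1)⁄ℂ] p = n := by
  have h : SmoothOfRelativeDimension n (chart U ≫ (X ↘ SpecC)) := by
    have : SmoothOfRelativeDimension (0 + n) (chart U ≫ (X ↘ SpecC)) := inferInstance
    rwa [Nat.zero_add] at this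
  rw [chart_over, HasRingHomProperty.Spec_iff (P := @SmoothOfRelativeDimension n)] at h
  obtain ⟨s, hs, h⟩ := h
  have := SmoothOfRelativeDimension.smooth n (X ↘ SpecC)
  have := smooth_sections U
  obtain ⟨t, ht, hp⟩ : ∃ t ∈ s, t ∉ p.asIdeal := by
    by_contra! hp
    exact p.2.ne_top (top_le_iff.1 (hs ▸ Ideal.span_le.2 hp))
  obtain ⟨p', rfl⟩ : p ∈ Set.range
      (PrimeSpectrum.comap (algebraMap Γ(X, U.1) (Localization.Away t))) := by
    rw [PrimeSpectrum.localization_away_comap_range _ t]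
    exact hp
  have : Nontrivial (Localization.Away t) := p'.nontrivial
  have hst : Algebra.IsStandardSmoothOfRelativeDimension n ℂ (Localization.Away t) := by
    rw [← RingHom.isStandardSmoothOfRelativeDimension_algebraMap]
    exact h t ht
  have := Algebra.IsStandardSmoothOfRelativeDimension.isStandardSmooth n (R := ℂ)
    (S := Localization.Away t)
  have hb := KaehlerDifferential.isBaseChange_of_formallyEtale ℂ Γ(X, U.1) (Localization.Away t)
  have hr := Module.rankAtStalk_isBaseChange hb p'
  rw [← hr, Module.rankAtStalk_eq_finrank_of_free]
  simp [Module.finrank, Algebra.IsStandardSmoothOfRelativeDimension.rank_kaehlerDifferential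
    (R := ℂ) (S := Localization.Away t) n]
end Smooth

section Restriction

variable {X : Scheme.{0}} [X.Over SpecC] {U V : X.affineOpens}

lemma etale_resRing {X : Scheme.{0}} {U V : X.affineOpens} (h : V.1 ≤ U.1) : (resRing h).Etale :=
  (Etale.etale_appLE (𝟙 X) U.2 V.2 h)

/-- Restriction of forms is a base change: it maps some generators with dual basis to such. -/
lemma resForm_dual [Smooth (X ↘ SpecC)] (h : V.1 ≤ U.1) :
    ∃ (k : ℕ) (e : Fin k → Ω[Γ(X, U.1)⁄ℂ]) (c : Fin k → Ω[Γ(X, U.1)⁄ℂ] →ₗ[Γ(X, U.1)] Γ(X, U.1))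
      (c' : Fin k → Ω[Γ(X, V.1)⁄ℂ] →ₗ[Γ(X, V.1)] Γ(X, V.1)),
    (∀ x, x = ∑ i, c i x • e i) ∧ (∀ x, x = ∑ i, c' i x • resForm h (e i)) ∧
      ∀ i x, c' i (resForm h x) = resRing h (c i x) := by
  have := smooth_sections U
  algebraize [resRing h]
  have : Algebra.Etale Γ(X, U.1) Γ(X, V.1) := etale_resRing h
  have : IsScalarTower ℂ Γ(X, U.1) Γ(X, V.1) :=
    IsScalarTower.of_algebraMap_eq fun c => (resRing_algebraMap h c).symm
  have hb := KaehlerDifferential.isBaseChange_of_formallyEtale ℂ Γ(X, U.1) Γ(X, V.1)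
  obtain ⟨k, e, c, hc⟩ := exists_dual_basis Γ(X, U.1) Ω[Γ(X, U.1)⁄ℂ]
  have hl := fun i x => hb.lift_eq (Algebra.linearMap Γ(X, U.1) Γ(X, V.1) ∘ₗ c i) x
  refine ⟨k, e, c, fun i => hb.lift (Algebra.linearMap Γ(X, U.1) Γ(X, V.1) ∘ₗ c i), hc, ?_, hl⟩
  intro x
  induction x using hb.inductionOn with
  | zero => simp
  | tmul x =>
    have h1 : ∀ i, hb.lift (Algebra.linearMap Γ(X, U.1) Γ(X, V.1) ∘ₗ c i)
      (KaehlerDifferential.map ℂ ℂ Γ(X, U.1) Γ(X, V.1) x) = resRing h (c i x) := fun i => hl i x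
    simp_rw [h1]
    conv_lhs => rw [hc x, map_sum]
    refine Finset.sum_congr rfl fun i _ => ?_
    exact map_smulₛₗ (resForm h) _ _
  | smul a x hx =>
    conv_lhs => rw [hx, Finset.smul_sum]
    simp_rw [map_smul, smul_eq_mul, mul_smul]
  | add x y hx hy =>
    conv_lhs => rw [hx, hy]
    simp_rw [map_add, add_smul]
    rw [Finset.sum_add_distrib]

end Restriction

/-! ### Trivializing open subsets -/

namespace HiggsBundle

variable {X : Scheme.{0}} [X.Over SpecC] {r : ℕ} (𝓔 : HiggsBundle X r)

lemma locallyFramed : LocallyFramed 𝓔.E (Fin r) := 𝓔.locallyFree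

lemma isTrivializing_of_isFrame {ι : Type} [Fintype ι] {U : X.affineOpens} {e : ι → Γ(𝓔.E, U.1)}
    (he : IsFrame 𝓔.E U.1 e) : 𝓔.IsTrivializing U :=
  ⟨Module.Free.of_basis he.basis, Module.Finite.of_basis he.basis⟩

variable {𝓔}

lemma IsTrivializing.exists_basis {U : X.affineOpens} (hU : 𝓔.IsTrivializing U) :
    ∃ (n : ℕ) (b : Module.Basis (Fin n) Γ(X, U.1) Γ(𝓔.E, U.1)), IsFrame 𝓔.E U.1 b := by
  have := hU.1
  have := hU.2
  let b := Module.Free.chooseBasis Γ(X, U.1) Γ(𝓔.E, U.1)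
  exact ⟨_, b.reindex (Fintype.equivFin _), 𝓔.locallyFramed.isFrame_basis U.2 _⟩

lemma IsTrivializing.of_le {U V : X.affineOpens} (hU : 𝓔.IsTrivializing U) (h : V.1 ≤ U.1) :
    𝓔.IsTrivializing V := by
  obtain ⟨n, b, hb⟩ := hU.exists_basis
  exact 𝓔.isTrivializing_of_isFrame (hb.res h)

/-- The Higgs field over a smaller open subset is obtained by base change. -/
lemma IsTrivializing.isTransport [Smooth (X ↘ SpecC)] {U V : X.affineOpens} (hU : 𝓔.IsTrivializing U) (h : V.1 ≤ U.1) :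
    IsTransport (resMod 𝓔.E h) (resForm h) (𝓔.φ U) (𝓔.φ V) where
  basis := by
    obtain ⟨n, b, hb⟩ := hU.exists_basis
    exact ⟨n, b, (hb.res h).basis, fun j => ((hb.res h).basis_apply j).symm⟩
  dual := resForm_dual h
  comm := 𝓔.φ_res U V h

variable (𝓔)

/-- The trivializing affine open subsets form a basis of the topology. -/
def trivBasis : AffineBasis X {U : X.affineOpens // 𝓔.IsTrivializing U} where
  opens i := i.1
  mono h := h
  exists_mem x := by
    obtain ⟨W, hx, e, he⟩ := 𝓔.locallyFramed x
    obtain ⟨_, ⟨V, hV, rfl⟩, hxV, hVW⟩ :=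
      X.isBasis_affineOpens.exists_subset_of_mem_open hx W.2
    exact ⟨⟨⟨V, hV⟩, 𝓔.isTrivializing_of_isFrame (he.res hVW)⟩, hxV⟩
  directed i j x hi hj := by
    obtain ⟨_, ⟨V, hV, rfl⟩, hxV, hVW⟩ :=
      X.isBasis_affineOpens.exists_subset_of_mem_open (⟨hi, hj⟩ : x ∈ i.1.1 ⊓ j.1.1)
        (i.1.1 ⊓ j.1.1).2
    exact ⟨⟨⟨V, hV⟩, i.2.of_le (hVW.trans inf_le_left)⟩, hVW.trans inf_le_left,
      hVW.trans inf_le_right, hxV⟩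

end HiggsBundle

/-! ### Algebras that represent eigenvalues and eigenlines -/

section Representing

variable {A : Type} [CommRing A] {M N : Type} [AddCommGroup M] [Module A M] [AddCommGroup N]
  [Module A N] (φ : M →ₗ[A] M ⊗[A] N)

lemma rTensor_eq_baseMap {B C : Type} [CommRing B] [CommRing C] [Algebra A B] [Algebra A C]
    (f : B →ₐ[A] C) (θ : B ⊗[A] N) : f.toLinearMap.rTensor N θ =
      baseMap (σ := RingHom.id A) LinearMap.id f.toRingHom f.toLinearMap (fun _ => rfl) θ := rfl

lemma map_id_id (t : M ⊗[A] N) :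
    TensorProduct.map (LinearMap.id : M →ₗ[A] M) (LinearMap.id : N →ₗ[A] N) t = t := by
  rw [TensorProduct.map_id, LinearMap.id_apply]

/-- The spectral equation is the equation of an affine scheme over `Spec A`. -/
lemma exists_spectralAlgebra [Module.Free A M] [Module.Finite A M] [Module.Finite A N]
    [Module.Projective A N] :
    ∃ (R : Type) (_ : CommRing R) (_ : Algebra A R) (u : R ⊗[A] N), charValue R φ u = 0 ∧
      ∀ (B : Type) [CommRing B] [Algebra A B] (θ : B ⊗[A] N), charValue B φ θ = 0 →
        ∃! f : R →ₐ[A] B, f.toLinearMap.rTensor N u = θ := by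
  classical
  obtain ⟨k, e, c, hc⟩ := exists_dual_basis A N
  let b := Module.Free.chooseBasis A M
  -- the coordinates `xᵢ` of a section, and the relations that they satisfy
  let P := MvPolynomial (Fin k) A
  let Z : P ⊗[A] N := ∑ i, MvPolynomial.X i ⊗ₜ e i
  let D := (charMatrix b φ (IsScalarTower.toAlgHom A P (MvPolynomial (Fin k) P)) Z
    (genericForm P c)).det
  let I : Ideal P := Ideal.span (Set.range (fun i : Fin k => (MvPolynomial.X i : P) -
    ∑ j, c i (e j) • MvPolynomial.X j) ∪ Set.range fun d => D.coeff d)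
  have hD : ∀ (B : Type) [CommRing B] [Algebra A B] (f : P →ₐ[A] B) (θ : B ⊗[A] N),
      f.toLinearMap.rTensor N Z = θ → (charValue B φ θ = 0 ↔ ∀ d, f (D.coeff d) = 0) := by
    rintro B _ _ f θ rfl
    rw [charValue_eq_zero_iff_det_genericForm b φ hc, rTensor_eq_baseMap]
    have hσ : ∀ a : A, MvPolynomial.map f.toRingHom (algebraMap A (MvPolynomial (Fin k) P) a) =
        algebraMap A (MvPolynomial (Fin k) B) a := fun a => by
      rw [MvPolynomial.algebraMap_apply, MvPolynomial.map_C, MvPolynomial.algebraMap_apply]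
      exact congrArg MvPolynomial.C (f.commutes a)
    have := charMatrix_transport (σ := RingHom.id A) LinearMap.id LinearMap.id f.toRingHom
      f.toLinearMap (fun _ => rfl) b b (fun _ => rfl) (φ := φ) (φ' := φ)
      (fun m => (map_id_id _).symm)
      (MvPolynomial.map f.toRingHom) hσ (c := genericForm P c) (c' := genericForm B c)
      (fun x => by
        simp only [LinearMap.id_apply, genericForm_apply, map_sum, Algebra.smul_def, map_mul,
          MvPolynomial.map_X, hσ])
      (IsScalarTower.toAlgHom A P (MvPolynomial (Fin k) P))
      (IsScalarTower.toAlgHom A B (MvPolynomial (Fin k) B))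
      (fun x => by simp [MvPolynomial.algebraMap_eq]) Z
    rw [this]
    have h1 : ∀ Z : Matrix (Module.Free.ChooseBasisIndex A M) (Module.Free.ChooseBasisIndex A M)
      (MvPolynomial (Fin k) P),
      (Z.map (MvPolynomial.map f.toRingHom)).det = MvPolynomial.map f.toRingHom Z.det := fun Z =>
        ((MvPolynomial.map f.toRingHom).map_det Z).symm
    rw [h1, MvPolynomial.ext_iff]
    refine forall_congr' fun d => ?_
    rw [MvPolynomial.coeff_map, MvPolynomial.coeff_zero]
    rfl
  have hx : ∀ (B : Type) [CommRing B] [Algebra A B] (f : P →ₐ[A] B) (i : Fin k),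
      pairing (AlgHom.id A B) (Algebra.linearMap A B ∘ₗ c i) (f.toLinearMap.rTensor N Z) =
        f (∑ j, c i (e j) • MvPolynomial.X j) := by
    intro B _ _ f i
    simp only [Z, map_sum, LinearMap.rTensor_tmul, pairing_tmul, map_smul]
    refine Finset.sum_congr rfl fun j _ => ?_
    simp [Algebra.smul_def, mul_comm]
  refine ⟨P ⧸ I, inferInstance, inferInstance, (Ideal.Quotient.mkₐ A I).toLinearMap.rTensor N Z,
    (hD _ _ _ rfl).2 fun d => ?_, fun B _ _ θ hθ => ?_⟩
  · exact Ideal.Quotient.eq_zero_iff_mem.2 (Ideal.subset_span (Or.inr ⟨d, rfl⟩))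
  let x := fun i => pairing (AlgHom.id A B) (Algebra.linearMap A B ∘ₗ c i) θ
  have hf : (MvPolynomial.aeval x : P →ₐ[A] B).toLinearMap.rTensor N Z = θ := by
    conv_rhs => rw [eq_sum_pairing_smul hc θ]
    simp [Z, TensorProduct.smul_tmul', x]
  have hI : ∀ p ∈ I, (MvPolynomial.aeval x : P →ₐ[A] B) p = 0 := by
    intro p hp
    refine (Ideal.span_le (I := RingHom.ker (MvPolynomial.aeval x : P →ₐ[A] B))).2 ?_ hp
    rintro _ (⟨i, rfl⟩ | ⟨d, rfl⟩)
    · change MvPolynomial.aeval x (_ - _) = _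
      rw [map_sub, ← hx, hf, MvPolynomial.aeval_X, sub_self]
    · exact (hD B _ _ hf).1 hθ d
  refine ⟨Ideal.Quotient.liftₐ I _ hI, ?_, fun f hf' => ?_⟩
  · change LinearMap.rTensor N _ (LinearMap.rTensor N _ Z) = θ
    rw [← LinearMap.rTensor_comp_apply]
    exact hf
  · refine Ideal.Quotient.algHom_ext A (MvPolynomial.algHom_ext fun i => ?_)
    have h1 : (f.comp (Ideal.Quotient.mkₐ A I)).toLinearMap.rTensor N Z = θ := by
      rw [← hf', ← LinearMap.rTensor_comp_apply]
      rfl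
    have h2 := hx B (f.comp (Ideal.Quotient.mkₐ A I)) i
    rw [h1] at h2
    have h3 : Ideal.Quotient.mkₐ A I (∑ j, c i (e j) • MvPolynomial.X j) =
        Ideal.Quotient.mkₐ A I (MvPolynomial.X i) := by
      symm
      exact Ideal.Quotient.eq.2 (Ideal.subset_span (Or.inl ⟨i, rfl⟩))
    change f (Ideal.Quotient.mkₐ A I (MvPolynomial.X i)) = MvPolynomial.aeval x (MvPolynomial.X i)
    rw [← h3, MvPolynomial.aeval_X]
    exact h2.symm

section Lines

variable {n : ℕ} (b : Module.Basis (Fin n) A M)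

/-- The vector with given coordinates. -/
def vec (B : Type) [CommRing B] [Algebra A B] (v : Fin n → B) : B ⊗[A] M :=
  (Algebra.TensorProduct.basis B b).equivFun.symm v

variable {B : Type} [CommRing B] [Algebra A B]

@[simp] lemma repr_vec (v : Fin n → B) (j : Fin n) :
    (Algebra.TensorProduct.basis B b).repr (vec b B v) j = v j := by
  rw [← Module.Basis.equivFun_apply, vec, LinearEquiv.apply_symm_apply]

lemma vec_repr (x : B ⊗[A] M) :
    vec b B (fun j => (Algebra.TensorProduct.basis B b).repr x j) = x :=
  (Algebra.TensorProduct.basis B b).equivFun.symm_apply_apply x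

lemma isLine_span_vec {v : Fin n → B} {i : Fin n} (hv : v i = 1) :
    IsLine (Submodule.span B {vec b B v}) :=
  isLine_span_singleton ((Algebra.TensorProduct.basis B b).coord i) (by
    rw [Module.Basis.coord_apply, repr_vec, hv])

lemma IsLine.eq_span_vec {L : Submodule B (B ⊗[A] M)} (hL : IsLine L) {v : Fin n → B} {i : Fin n}
    (hv : v i = 1) (hm : vec b B v ∈ L) : L = Submodule.span B {vec b B v} :=
  ((isLine_span_vec b hv).eq_of_le hL (by simpa using hm)).symm

lemma eq_of_span_vec_eq {v w : Fin n → B} {i : Fin n} (hv : v i = 1) (hw : w i = 1)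
    (h : Submodule.span B {vec b B v} = Submodule.span B {vec b B w}) : v = w := by
  have h1 : vec b B v ∈ Submodule.span B {vec b B w} := h ▸ Submodule.mem_span_singleton_self _
  obtain ⟨a, ha⟩ := Submodule.mem_span_singleton.1 h1
  have h2 : ∀ j, a * w j = v j := fun j => by
    rw [← repr_vec b v j, ← ha, map_smul, Finsupp.smul_apply, repr_vec, smul_eq_mul]
  have h3 := h2 i
  rw [hv, hw, mul_one] at h3
  funext j
  rw [← h2, h3, one_mul]

/-- Equations for the invariance of a line, with respect to a vector whose `i`-th coordinate is
`1`. -/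
lemma isInvariant_span_vec_iff {k : ℕ} {e : Fin k → N} {c : Fin k → N →ₗ[A] A}
    (hc : ∀ x, x = ∑ i, c i x • e i) {v : Fin n → B} {i : Fin n} (hv : v i = 1) :
    IsInvariant (baseChangeTwisted B φ) (Submodule.span B {vec b B v}) ↔
      ∀ a j, (twistMatrix b φ (Algebra.linearMap A B ∘ₗ c a)).mulVec v j =
        (twistMatrix b φ (Algebra.linearMap A B ∘ₗ c a)).mulVec v i * v j := by
  have hr : ∀ a j, (Algebra.TensorProduct.basis B b).repr
      (twistEnd φ (Algebra.linearMap A B ∘ₗ c a) (vec b B v)) j =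
      (twistMatrix b φ (Algebra.linearMap A B ∘ₗ c a)).mulVec v j := by
    intro a j
    rw [repr_twistEnd]
    congr 1
    funext j
    exact repr_vec b v j
  rw [isInvariant_iff_of_dual_basis hc]
  refine forall_congr' fun a => ⟨fun h j => ?_, fun h l hl => ?_⟩
  · obtain ⟨t, ht⟩ := Submodule.mem_span_singleton.1 (h _ (Submodule.mem_span_singleton_self _))
    have h2 : ∀ j, (twistMatrix b φ (Algebra.linearMap A B ∘ₗ c a)).mulVec v j = t * v j := by
      intro j
      rw [← hr, ← ht, map_smul, Finsupp.smul_apply, repr_vec, smul_eq_mul]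
    rw [h2 i, h2 j, hv, mul_one]
  · obtain ⟨t, rfl⟩ := Submodule.mem_span_singleton.1 hl
    rw [map_smul]
    refine Submodule.smul_mem _ _ (Submodule.mem_span_singleton.2
      ⟨(twistMatrix b φ (Algebra.linearMap A B ∘ₗ c a)).mulVec v i, ?_⟩)
    refine (Algebra.TensorProduct.basis B b).ext_elem fun j => ?_
    rw [hr, map_smul, Finsupp.smul_apply, repr_vec, smul_eq_mul]
    exact (h j).symm

/-- The invariant lines on which the `i`-th coordinate does not vanish are the points of an affine
scheme over `Spec A`. -/
lemma exists_lineAlgebra [Module.Finite A N] [Module.Projective A N] (i : Fin n) :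
    ∃ (R : Type) (_ : CommRing R) (_ : Algebra A R) (w : Fin n → R), w i = 1 ∧
      IsInvariant (baseChangeTwisted R φ) (Submodule.span R {vec b R w}) ∧
      ∀ (B : Type) [CommRing B] [Algebra A B] (v : Fin n → B), v i = 1 →
        IsInvariant (baseChangeTwisted B φ) (Submodule.span B {vec b B v}) →
        ∃! f : R →ₐ[A] B, ∀ j, f (w j) = v j := by
  obtain ⟨k, e, c, hc⟩ := exists_dual_basis A N
  -- the coordinates of a vector on the line, normalized at `i`, with the equations for invariance
  let P := MvPolynomial (Fin n) A
  let T := fun a => (twistMatrix b φ (Algebra.linearMap A P ∘ₗ c a)).mulVec MvPolynomial.X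
  let I : Ideal P := Ideal.span ({MvPolynomial.X i - 1} ∪
    Set.range fun t : Fin k × Fin n => T t.1 t.2 - T t.1 i * MvPolynomial.X t.2)
  have hT : ∀ (B : Type) [CommRing B] [Algebra A B] (f : P →ₐ[A] B) (a : Fin k) (j : Fin n),
      (twistMatrix b φ (Algebra.linearMap A B ∘ₗ c a)).mulVec (fun j => f (MvPolynomial.X j)) j =
        f (T a j) := by
    intro B _ _ f a j
    have h1 : Algebra.linearMap A B ∘ₗ c a = f.toLinearMap ∘ₗ Algebra.linearMap A P ∘ₗ c a := by
      ext x
      simp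
    rw [h1, twistMatrix_comp]
    simp [T, Matrix.mulVec, dotProduct]
  have h1 : Ideal.Quotient.mkₐ A I (MvPolynomial.X i) = 1 := by
    rw [← map_one (Ideal.Quotient.mkₐ A I)]
    exact Ideal.Quotient.eq.2 (Ideal.subset_span (Or.inl rfl))
  refine ⟨P ⧸ I, inferInstance, inferInstance,
    fun j => Ideal.Quotient.mkₐ A I (MvPolynomial.X j), h1, ?_, fun B _ _ v hv hi => ?_⟩
  · rw [isInvariant_span_vec_iff φ b hc h1]
    intro a j
    rw [hT, hT, ← map_mul]
    exact Ideal.Quotient.eq.2 (Ideal.subset_span (Or.inr ⟨(a, j), rfl⟩))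
  rw [isInvariant_span_vec_iff φ b hc hv] at hi
  have hX : (fun j => (MvPolynomial.aeval v : P →ₐ[A] B) (MvPolynomial.X j)) = v := by
    funext j
    exact MvPolynomial.aeval_X v j
  have hI : ∀ p ∈ I, (MvPolynomial.aeval v : P →ₐ[A] B) p = 0 := by
    intro p hp
    refine (Ideal.span_le (I := RingHom.ker (MvPolynomial.aeval v : P →ₐ[A] B))).2 ?_ hp
    rintro _ (rfl | ⟨⟨a, j⟩, rfl⟩)
    · change MvPolynomial.aeval v (_ - _) = _
      rw [map_sub, MvPolynomial.aeval_X, hv, map_one, sub_self]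
    · change MvPolynomial.aeval v (_ - _) = _
      rw [map_sub, map_mul, ← hT, ← hT, hX, MvPolynomial.aeval_X, hi, sub_self]
  refine ⟨Ideal.Quotient.liftₐ I _ hI, fun j => ?_, fun f hf => ?_⟩
  · change MvPolynomial.aeval v (MvPolynomial.X j) = _
    exact MvPolynomial.aeval_X v j
  · refine Ideal.Quotient.algHom_ext A (MvPolynomial.algHom_ext fun j => ?_)
    exact (hf j).trans (MvPolynomial.aeval_X v j).symm

end Lines

end Representing

/-! ### The functor of eigenvalues -/

section BaseMap

variable {A A' A'' : Type} [CommRing A] [CommRing A'] [CommRing A''] {σ : A →+* A'} {σ' : A' →+* A''}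
  {σ'' : A →+* A''} {M M' M'' : Type} [AddCommGroup M] [Module A M] [AddCommGroup M'] [Module A' M']
  [AddCommGroup M''] [Module A'' M''] {B B' B'' : Type} [CommRing B] [CommRing B'] [CommRing B'']
  [Algebra A B] [Algebra A' B'] [Algebra A'' B'']

lemma baseMap_baseMap {ρ : M →ₛₗ[σ] M'} {ρ' : M' →ₛₗ[σ'] M''} {ρ'' : M →ₛₗ[σ''] M''}
    (hρ : ∀ m, ρ' (ρ m) = ρ'' m) {f : B →+* B'} {g : B →ₛₗ[σ] B'} (hg : ∀ x, g x = f x)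
    {f' : B' →+* B''} {g' : B' →ₛₗ[σ'] B''} (hg' : ∀ x, g' x = f' x)
    {f'' : B →+* B''} {g'' : B →ₛₗ[σ''] B''} (hg'' : ∀ x, g'' x = f'' x)
    (hf : ∀ x, f' (f x) = f'' x) (x : B ⊗[A] M) :
    baseMap ρ' f' g' hg' (baseMap ρ f g hg x) = baseMap ρ'' f'' g'' hg'' x := by
  induction x with
  | zero => simp
  | tmul b m => rw [baseMap_tmul, baseMap_tmul, baseMap_tmul, hρ, hf]
  | add x y hx hy => rw [map_add, map_add, map_add, hx, hy]

lemma baseMap_eq_self {σ : A →+* A} {ρ : M →ₛₗ[σ] M} (hρ : ∀ m, ρ m = m) {f : B →+* B}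
    {g : B →ₛₗ[σ] B} (hg : ∀ x, g x = f x) (hf : ∀ x, f x = x) (x : B ⊗[A] M) :
    baseMap ρ f g hg x = x := by
  induction x with
  | zero => simp
  | tmul b m => rw [baseMap_tmul, hρ, hf]
  | add x y hx hy => rw [map_add, hx, hy]

end BaseMap

section Forms

variable {X : Scheme.{0}} [X.Over SpecC] {U V W : X.Opens}

lemma resForm_D (h : V ≤ U) (a : Γ(X, U)) :
    resForm h (KaehlerDifferential.D ℂ Γ(X, U) a) = KaehlerDifferential.D ℂ Γ(X, V) (resRing h a) := by
  let : Algebra Γ(X, U) Γ(X, V) := (resRing h).toAlgebra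
  have : IsScalarTower ℂ Γ(X, U) Γ(X, V) :=
    IsScalarTower.of_algebraMap_eq fun c => (resRing_algebraMap h c).symm
  exact KaehlerDifferential.map_D ℂ ℂ Γ(X, U) Γ(X, V) a

lemma resForm_resForm (h : V ≤ U) (h' : W ≤ V) (s : Ω[Γ(X, U)⁄ℂ]) :
    resForm h' (resForm h s) = resForm (h'.trans h) s := by
  have hs : s ∈ Submodule.span Γ(X, U) (Set.range (KaehlerDifferential.D ℂ Γ(X, U))) := by
    rw [KaehlerDifferential.span_range_derivation]; trivial
  induction hs using Submodule.span_induction with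
  | mem x hx =>
    obtain ⟨a, rfl⟩ := hx
    rw [resForm_D, resForm_D, resForm_D, resRing_resRing]
  | zero => simp
  | add x y _ _ hx hy => rw [map_add, map_add, map_add, hx, hy]
  | smul a x _ hx => rw [map_smulₛₗ, map_smulₛₗ, map_smulₛₗ, hx, resRing_resRing]

lemma resForm_refl (s : Ω[Γ(X, U)⁄ℂ]) : resForm (le_refl U) s = s := by
  have hs : s ∈ Submodule.span Γ(X, U) (Set.range (KaehlerDifferential.D ℂ Γ(X, U))) := by
    rw [KaehlerDifferential.span_range_derivation]; trivial
  induction hs using Submodule.span_induction with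
  | mem x hx =>
    obtain ⟨a, rfl⟩ := hx
    rw [resForm_D, resRing_refl]
  | zero => simp
  | add x y _ _ hx hy => rw [map_add, hx, hy]
  | smul a x _ hx => rw [map_smulₛₗ, hx, resRing_refl]

end Forms

lemma exists_notMem_of_span_eq_top {B ι : Type} [CommRing B] {b : ι → B}
    (hb : Ideal.span (Set.range b) = ⊤) (p : PrimeSpectrum B) : ∃ k, b k ∉ p.asIdeal := by
  by_contra! h
  refine p.2.ne_top (top_le_iff.1 (hb ▸ Ideal.span_le.2 ?_))
  rintro _ ⟨k, rfl⟩
  exact h k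

/-- Ring maps into localizations glue. -/
lemma exists_hom_of_away {R B : CommRingCat.{0}} {ι : Type} (b : ι → B)
    (hb : Ideal.span (Set.range b) = ⊤) (m : ∀ k, R ⟶ away (b k))
    (hm : ∀ (k l : ι) {C : CommRingCat.{0}} (f : away (b k) ⟶ C) (f' : away (b l) ⟶ C),
      toAway (b k) ≫ f = toAway (b l) ≫ f' → m k ≫ f = m l ≫ f') :
    ∃ f : R ⟶ B, ∀ k, f ≫ toAway (b k) = m k := by
  -- the restrictions of the required morphism that factor through one of the localizations
  let P {C : CommRingCat.{0}} (q : Spec C ⟶ Spec B) (t : Spec C ⟶ Spec R) : Prop :=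
    ∃ (k : ι) (f : away (b k) ⟶ C), q = Spec.map (toAway (b k) ≫ f) ∧ t = Spec.map (m k ≫ f)
  have hP : ∀ k, P (Spec.map (toAway (b k))) (Spec.map (m k)) := fun k =>
    ⟨k, 𝟙 _, by rw [Category.comp_id], by rw [Category.comp_id]⟩
  have hloc : ∀ y : Spec B, ∃ (C : CommRingCat.{0}) (q : Spec C ⟶ Spec B) (t : Spec C ⟶ Spec R),
      IsOpenImmersion q ∧ y ∈ Set.range q ∧ P q t := by
    intro y
    obtain ⟨k, hk⟩ := exists_notMem_of_span_eq_top hb y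
    refine ⟨_, Spec.map (toAway (b k)), Spec.map (m k), inferInstance, ?_, hP k⟩
    rw [range_Spec_toAway]
    exact hk
  obtain ⟨g, hg⟩ := exists_hom_of_locally (Y := Spec B) (Z := Spec R) (fun _ => True)
    (fun _ _ => trivial) (fun _ _ _ _ => trivial) P hloc
    (by
      rintro C D q t f ⟨k, f', rfl, rfl⟩ -
      exact ⟨k, f' ≫ f, by rw [← Spec.map_comp, Category.assoc],
        by rw [← Spec.map_comp, Category.assoc]⟩)
    (by
      rintro C q t t' - ⟨k, f, hq, rfl⟩ ⟨l, f', hq', rfl⟩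
      rw [hm k l f f' (Spec.map_injective (hq.symm.trans hq'))])
  obtain ⟨f, rfl⟩ := Spec.map_surjective g
  refine ⟨f, fun k => Spec.map_injective ?_⟩
  rw [Spec.map_comp]
  exact hg _ _ trivial (hP k)

lemma eq_zero_of_forall_prime {B : Type} [CommRing B] {x : B}
    (h : ∀ p : PrimeSpectrum B, ∃ c ∉ p.asIdeal, c * x = 0) : x = 0 := by
  by_contra hx
  let J : Ideal B := LinearMap.ker (LinearMap.toSpanSingleton B B x)
  have hJ : J ≠ ⊤ := fun hJ => hx (by
    have : (1 : B) ∈ J := hJ ▸ Submodule.mem_top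
    simpa [J] using this)
  obtain ⟨m, hm, hle⟩ := Ideal.exists_le_maximal J hJ
  obtain ⟨c, hc, hcx⟩ := h ⟨m, hm.isPrime⟩
  exact hc (hle (by simpa [J] using hcx))

/-- Ring maps that agree locally are equal. -/
lemma hom_ext_of_away {R B : CommRingCat.{0}} {f f' : R ⟶ B}
    (h : ∀ p : PrimeSpectrum B, ∃ b ∉ p.asIdeal, f ≫ toAway b = f' ≫ toAway b) : f = f' := by
  ext x
  rw [← sub_eq_zero]
  refine eq_zero_of_forall_prime fun p => ?_
  obtain ⟨b, hb, e⟩ := h p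
  obtain ⟨n, hn⟩ := (isAway_algebraMap b).exists_pow_mul_eq_zero (f x - f' x) (by
    rw [map_sub, sub_eq_zero]
    exact congrArg (fun t => t x) e)
  exact ⟨b ^ n, fun hbn => hb (p.2.mem_of_pow_mem n hbn), hn⟩

lemma exists_eq_toAlgebra {A R : Type} [CommRing A] [CommRing R] (h : Algebra A R) :
    ∃ f : A →+* R, h = f.toAlgebra :=
  ⟨algebraMap A R, Algebra.algebra_ext _ _ fun _ => rfl⟩

namespace HiggsBundle

variable {X : Scheme.{0}} [X.Over SpecC] {r : ℕ} (𝓔 : HiggsBundle X r)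

section Maps

variable {U V : X.affineOpens} (hVU : V.1 ≤ U.1) {B B' : Type} [CommRing B] [CommRing B']
  [Algebra Γ(X, U.1) B] [Algebra Γ(X, V.1) B'] (f : B →+* B')
  (hf : f.comp (algebraMap Γ(X, U.1) B) = (algebraMap Γ(X, V.1) B').comp (resRing hVU))

/-- Pullback of forms along `Spec B' → Spec B`. -/
def formMap : Forms U B →ₛₗ[f] Forms V B' :=
  baseMap (resForm hVU) f (semilinear hVU f hf) fun _ => rfl

/-- Pullback of sections of `E` along `Spec B' → Spec B`. -/
def fibMap : 𝓔.Fib U B →ₛₗ[f] 𝓔.Fib V B' :=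
  baseMap (resMod 𝓔.E hVU) f (semilinear hVU f hf) fun _ => rfl

lemma formMap_tmul (b : B) (m : Ω[Γ(X, U.1)⁄ℂ]) :
    formMap hVU f hf (b ⊗ₜ m) = f b ⊗ₜ resForm hVU m := rfl

end Maps

variable {𝓔} in
lemma rTensor_eq_formMap {U : X.affineOpens} {B B' : Type} [CommRing B] [CommRing B']
    [Algebra Γ(X, U.1) B] [Algebra Γ(X, U.1) B'] (f : B →ₐ[Γ(X, U.1)] B')
    (hf : f.toRingHom.comp (algebraMap Γ(X, U.1) B) =
      (algebraMap Γ(X, U.1) B').comp (resRing le_rfl)) (x : B ⊗[Γ(X, U.1)] Ω[Γ(X, U.1)⁄ℂ]) :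
    f.toLinearMap.rTensor _ x = formMap (le_refl U.1) f.toRingHom hf x := by
  induction x with
  | zero => rw [map_zero, map_zero]
  | tmul b m =>
    rw [LinearMap.rTensor_tmul, formMap_tmul, resForm_refl]
    rfl
  | add x y hx hy => rw [map_add, map_add, hx, hy]

/-- The algebra structure of a point. -/
@[reducible] def alg {i : {U : X.affineOpens // 𝓔.IsTrivializing U}} {B : CommRingCat.{0}}
    (α : 𝓔.trivBasis.ring i ⟶ B) : Algebra Γ(X, i.1.1) B := α.hom.toAlgebra

/-- The sections of `y^* Ω¹` that satisfy the spectral equation. -/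
def Eig {i : {U : X.affineOpens // 𝓔.IsTrivializing U}} {B : CommRingCat.{0}}
    (α : 𝓔.trivBasis.ring i ⟶ B) : Type :=
  letI := 𝓔.alg α
  {θ : Forms i.1 B // 𝓔.SpectralEquation i.2 B θ}

variable [Smooth (X ↘ SpecC)] {i j k : {U : X.affineOpens // 𝓔.IsTrivializing U}}
  {B C D : CommRingCat.{0}} {α : 𝓔.trivBasis.ring i ⟶ B} {β : 𝓔.trivBasis.ring j ⟶ C}
  {γ : 𝓔.trivBasis.ring k ⟶ D}

variable {𝓔} in
/-- Pullback of solutions of the spectral equation. -/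
def Eig.map (h : j ≤ i) (q : B ⟶ C) (hq : α ≫ q = 𝓔.trivBasis.res h ≫ β) (s : 𝓔.Eig α) :
    𝓔.Eig β :=
  letI := 𝓔.alg α
  letI := 𝓔.alg β
  ⟨formMap (U := i.1) (V := j.1) h q.hom (congrArg CommRingCat.Hom.hom hq) s.1, by
    have := i.2.1; have := i.2.2; have := j.2.1; have := j.2.2
    exact ((i.2.isTransport h).charValue_eq_zero _ _ _).1 s.2⟩

variable {𝓔} in
lemma Eig.map_map (h : j ≤ i) (h' : k ≤ j) (q : B ⟶ C) (q' : C ⟶ D)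
    (hq : α ≫ q = 𝓔.trivBasis.res h ≫ β) (hq' : β ≫ q' = 𝓔.trivBasis.res h' ≫ γ)
    (hqq : α ≫ q ≫ q' = 𝓔.trivBasis.res (h'.trans h) ≫ γ) (s : 𝓔.Eig α) :
    Eig.map h' q' hq' (Eig.map h q hq s) = Eig.map (h'.trans h) (q ≫ q') hqq s := by
  let := 𝓔.alg α
  let := 𝓔.alg β
  let := 𝓔.alg γ
  exact Subtype.ext (baseMap_baseMap (resForm_resForm _ _) _ _ _ (fun _ => rfl) _)

variable {𝓔} in
lemma Eig.map_id (hq : α ≫ 𝟙 B = 𝓔.trivBasis.res le_rfl ≫ α) (s : 𝓔.Eig α) :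
    Eig.map le_rfl (𝟙 B) hq s = s := by
  let := 𝓔.alg α
  exact Subtype.ext (baseMap_eq_self resForm_refl _ (fun _ => rfl) _)

variable {𝓔} in
lemma Eig.map_bijective (h : j ≤ i) {β : 𝓔.trivBasis.ring j ⟶ B}
    (hq : α ≫ 𝟙 B = 𝓔.trivBasis.res h ≫ β) :
    Function.Bijective (Eig.map h (𝟙 B) hq : 𝓔.Eig α → 𝓔.Eig β) := by
  let := 𝓔.alg α
  let := 𝓔.alg β
  have := i.2.1; have := i.2.2; have := j.2.1; have := j.2.2
  have hb := (i.2.isTransport h).bijective (𝟙 B : B ⟶ B).hom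
    (semilinear (U := i.1) (V := j.1) h (𝟙 B : B ⟶ B).hom (congrArg CommRingCat.Hom.hom hq))
    (fun _ => rfl) Function.bijective_id
  refine ⟨fun s t hst => Subtype.ext (hb.1 (congrArg Subtype.val hst)), fun t => ?_⟩
  obtain ⟨θ, hθ⟩ := hb.2 t.1
  refine ⟨⟨θ, ?_⟩, Subtype.ext hθ⟩
  refine ((i.2.isTransport h).charValue_eq_zero (𝟙 B : B ⟶ B).hom
    (semilinear (U := i.1) (V := j.1) h (𝟙 B : B ⟶ B).hom (congrArg CommRingCat.Hom.hom hq))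
    (fun _ => rfl)).2 Function.injective_id (?_ : charValue B (𝓔.φ j.1) (baseMap _ _ _ _ θ) = 0)
  rw [hθ]
  exact t.2

variable (i) in
/-- Over a member of the basis, the functor of solutions of the spectral equation is represented by
an affine scheme. -/
lemma exists_representing : ∃ (R : CommRingCat.{0}) (str : 𝓔.trivBasis.ring i ⟶ R) (u : 𝓔.Eig str),
    ∀ {B : CommRingCat.{0}} {α : 𝓔.trivBasis.ring i ⟶ B} (s : 𝓔.Eig α),
      ∃ (f : R ⟶ B) (hf : str ≫ f = 𝓔.trivBasis.res le_rfl ≫ α), Eig.map le_rfl f hf u = s ∧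
      ∀ (f' : R ⟶ B) (hf' : str ≫ f' = 𝓔.trivBasis.res le_rfl ≫ α), Eig.map le_rfl f' hf' u = s →
        f' = f := by
  have := i.2.1; have := i.2.2
  have := smooth_sections i.1
  obtain ⟨R, _, inst, u, hu, hR⟩ := exists_spectralAlgebra (𝓔.φ i.1)
  obtain ⟨str, rfl⟩ := exists_eq_toAlgebra inst
  let u' : 𝓔.Eig (CommRingCat.ofHom str : 𝓔.trivBasis.ring i ⟶ .of R) := ⟨u, hu⟩
  refine ⟨.of R, CommRingCat.ofHom str, u', fun {B α} s => ?_⟩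
  let := 𝓔.alg α
  let := str.toAlgebra
  have key : ∀ (f : R →ₐ[Γ(X, i.1.1)] B)
      (hf : CommRingCat.ofHom str ≫ CommRingCat.ofHom f.toRingHom = 𝓔.trivBasis.res le_rfl ≫ α),
      f.toLinearMap.rTensor _ u = s.1 ↔
        Eig.map le_rfl (CommRingCat.ofHom f.toRingHom) hf u' = s := by
    intro f hf
    have := rTensor_eq_formMap f (congrArg CommRingCat.Hom.hom hf)
    exact ⟨fun e => Subtype.ext ((this u).symm.trans e),
      fun e => (this u).trans (congrArg Subtype.val e)⟩
  obtain ⟨f, hf, hf'⟩ := hR B s.1 s.2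
  have hα : CommRingCat.ofHom str ≫ CommRingCat.ofHom f.toRingHom =
      𝓔.trivBasis.res le_rfl ≫ α := by
    rw [AffineBasis.res_refl, Category.id_comp]
    ext a
    exact f.commutes a
  refine ⟨CommRingCat.ofHom f.toRingHom, hα, (key f hα).1 hf, fun f₁ hf₁ h1 => ?_⟩
  let f₂ : R →ₐ[Γ(X, i.1.1)] B := ⟨f₁.hom, fun a => by
    rw [AffineBasis.res_refl, Category.id_comp] at hf₁
    exact congrArg (fun t => t.hom a) hf₁⟩
  have := hf' f₂ ((key f₂ hf₁).2 h1)
  ext x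
  exact congrArg (fun t => t x) this

/-- The functor of solutions of the spectral equation. -/
def eigFunctor : PointFunctor 𝓔.trivBasis where
  obj _ _ α := 𝓔.Eig α
  map h _ _ _ _ q hq := Eig.map h q hq
  map_id := Eig.map_id
  map_map h h' _ _ _ _ _ _ q q' hq hq' hqq s := Eig.map_map h h' q q' hq hq' hqq s
  map_bijective h _ _ _ hq := Eig.map_bijective h hq
  eq_of_locally {i B α} s t h := by
    obtain ⟨R, str, u, hu⟩ := 𝓔.exists_representing i
    obtain ⟨f, hf, hfs, -⟩ := hu s
    obtain ⟨f', hf', hft, -⟩ := hu t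
    suffices hff : f = f' by
      subst hff
      rw [← hfs, ← hft]
    refine hom_ext_of_away fun p => ?_
    obtain ⟨b, hb, β, hq, e⟩ := h p
    have h1 : str ≫ f ≫ toAway b = 𝓔.trivBasis.res le_rfl ≫ β := by
      rw [← hq, ← Category.assoc, hf, AffineBasis.res_refl, Category.id_comp]
    have h2 : str ≫ f' ≫ toAway b = 𝓔.trivBasis.res le_rfl ≫ β := by
      rw [← hq, ← Category.assoc, hf', AffineBasis.res_refl, Category.id_comp]
    obtain ⟨g₀, -, -, huniq⟩ := hu (Eig.map le_rfl (toAway b) hq s)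
    refine ⟨b, hb, ?_⟩
    rw [huniq _ h1 (by rw [← hfs, Eig.map_map]), huniq _ h2 (by rw [e, ← hft, Eig.map_map])]
  exists_glue {i B} α ι b hb s hs := by
    obtain ⟨R, str, u, hu⟩ := 𝓔.exists_representing i
    choose m hm hms hmu using fun k => hu (s k)
    obtain ⟨f, hf⟩ := exists_hom_of_away b hb m fun k l C g g' hg => by
      have h1 : (α ≫ toAway (b k)) ≫ g = 𝓔.trivBasis.res (le_refl i) ≫ α ≫ toAway (b k) ≫ g := by
        rw [AffineBasis.res_refl, Category.id_comp, Category.assoc]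
      have h2 : (α ≫ toAway (b l)) ≫ g' = 𝓔.trivBasis.res (le_refl i) ≫ α ≫ toAway (b k) ≫ g := by
        rw [AffineBasis.res_refl, Category.id_comp, Category.assoc, hg]
      have h3 : str ≫ m k ≫ g = 𝓔.trivBasis.res (le_refl i) ≫ α ≫ toAway (b k) ≫ g := by
        rw [← Category.assoc, hm, Category.assoc, h1, AffineBasis.res_refl, Category.id_comp]
      have h4 : str ≫ m l ≫ g' = 𝓔.trivBasis.res (le_refl i) ≫ α ≫ toAway (b k) ≫ g := by
        rw [← Category.assoc, hm, Category.assoc, h2, AffineBasis.res_refl, Category.id_comp]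
      obtain ⟨g₀, -, -, huniq⟩ := hu (Eig.map le_rfl g h1 (s k))
      rw [huniq (m k ≫ g) h3 (by rw [← hms k, Eig.map_map]),
        huniq (m l ≫ g') h4 (by rw [hs k l g g' _ h1 h2 hg, ← hms l, Eig.map_map])]
    have hfα : str ≫ f = α := by
      refine hom_ext_of_away fun p => ?_
      obtain ⟨k, hk⟩ := exists_notMem_of_span_eq_top hb p
      exact ⟨b k, hk, by rw [Category.assoc, hf, hm, AffineBasis.res_refl, Category.id_comp]⟩
    refine ⟨Eig.map le_rfl f (by rw [AffineBasis.res_refl, Category.id_comp, hfα]) u,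
      fun k hq => ?_⟩
    rw [Eig.map_map _ _ _ _ _ _ (by rw [hf, hm]), ← hms k]
    simp only [hf]

/-- Over each member of the basis, the functor of solutions of the spectral equation has a single
affine chart. -/
lemma nonempty_charts_eigFunctor : Nonempty (PointFunctor.Charts 𝓔.eigFunctor) := by
  choose R str u f hf hfs huniq using fun i => 𝓔.exists_representing i
  refine ⟨⟨fun _ => Unit, fun i _ => R i, fun i _ => str i, fun i _ => u i,
    fun i _ B α g g' hg hg' e => ?_, fun i K _ α s => ⟨(), f i s, hf i s, hfs i s⟩,
    fun i _ B α s K _ κ α' hκ g hg e => ?_⟩⟩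
  · exact (huniq i (Eig.map le_rfl g' hg' (u i)) g hg e).trans
      (huniq i (Eig.map le_rfl g' hg' (u i)) g' hg' rfl).symm
  · have h1 : α ≫ toAway (1 : B) = 𝓔.trivBasis.res le_rfl ≫ α ≫ toAway (1 : B) := by
      rw [AffineBasis.res_refl, Category.id_comp]
    obtain ⟨s, rfl⟩ : ∃ s' : 𝓔.Eig α, s' = s := ⟨s, rfl⟩
    have h2 : str i ≫ f i s ≫ toAway (1 : B) = 𝓔.trivBasis.res le_rfl ≫ α ≫ toAway (1 : B) := by
      rw [← Category.assoc, hf, Category.assoc, h1, AffineBasis.res_refl, Category.id_comp]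
    refine ⟨1, by simp, α ≫ toAway 1, h1, f i s ≫ toAway 1, h2, ?_⟩
    change Eig.map le_rfl (f i s ≫ toAway 1) h2 (u i) = Eig.map le_rfl (toAway 1) h1 s
    have h3 := Eig.map_map le_rfl le_rfl (f i s) (toAway 1) (hf i s) h1 h2 (u i)
    rw [hfs] at h3
    exact h3.symm

end HiggsBundle

/-! ### The functor of eigenlines -/

lemma span_image_span {B B' P P' : Type} [CommRing B] [CommRing B'] [AddCommGroup P] [Module B P]
    [AddCommGroup P'] [Module B' P'] {f : B →+* B'} (τ : P →ₛₗ[f] P') (s : Set P) :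
    Submodule.span B' (τ '' Submodule.span B s) = Submodule.span B' (τ '' s) := by
  refine le_antisymm (Submodule.span_le.2 ?_)
    (Submodule.span_mono (Set.image_mono Submodule.subset_span))
  rintro _ ⟨x, hx, rfl⟩
  change τ x ∈ Submodule.span B' (τ '' s)
  induction hx using Submodule.span_induction with
  | mem x hx => exact Submodule.subset_span ⟨x, hx, rfl⟩
  | zero => simp
  | add x y _ _ hx hy => rw [map_add]; exact add_mem hx hy
  | smul a x _ hx => rw [map_smulₛₗ]; exact Submodule.smul_mem _ _ hx

lemma IsTransport.exists_form {A A' : Type} [CommRing A] [CommRing A'] {σ : A →+* A'}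
    {M N M' N' : Type} [AddCommGroup M] [Module A M] [AddCommGroup N] [Module A N] [AddCommGroup M']
    [Module A' M'] [AddCommGroup N'] [Module A' N'] {ρ : M →ₛₗ[σ] M'} {ν : N →ₛₗ[σ] N'}
    {φ : M →ₗ[A] M ⊗[A] N} {φ' : M' →ₗ[A'] M' ⊗[A'] N'} (H : IsTransport ρ ν φ φ')
    (c : N →ₗ[A] A) : ∃ c' : N' →ₗ[A'] A', ∀ x, c' (ν x) = σ (c x) := by
  obtain ⟨k, e, d, d', hd, hd', hdd⟩ := H.dual
  refine ⟨∑ i, σ (c (e i)) • d' i, fun x => ?_⟩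
  conv_rhs => rw [hd x]
  simp [hdd, mul_comm]

lemma IsAway.one {B : Type} [CommRing B] (f : B →+* B) (hf : ∀ x, f x = x) : IsAway f 1 where
  isUnit := by rw [map_one]; exact isUnit_one
  exists_pow_mul_eq_zero x hx := ⟨0, by rw [← hf x, hx, mul_zero]⟩
  exists_eq_pow_mul y := ⟨0, y, by rw [hf, pow_zero, one_mul]⟩

namespace HiggsBundle

variable {X : Scheme.{0}} [X.Over SpecC] {r : ℕ} {𝓔 : HiggsBundle X r}

lemma IsTrivializing.exists_basis_res {U : X.affineOpens} (hU : 𝓔.IsTrivializing U) :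
    ∃ (n : ℕ) (b : Module.Basis (Fin n) Γ(X, U.1) Γ(𝓔.E, U.1)), ∀ (V : X.affineOpens)
      (h : V.1 ≤ U.1), ∃ b' : Module.Basis (Fin n) Γ(X, V.1) Γ(𝓔.E, V.1),
        ∀ j, resMod 𝓔.E h (b j) = b' j := by
  obtain ⟨n, b, hb⟩ := hU.exists_basis
  exact ⟨n, b, fun V h => ⟨(hb.res h).basis, fun j => ((hb.res h).basis_apply j).symm⟩⟩

variable {i j k : {U : X.affineOpens // 𝓔.IsTrivializing U}}
  {B C D : CommRingCat.{0}} {α : 𝓔.trivBasis.ring i ⟶ B} {β : 𝓔.trivBasis.ring j ⟶ C}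
  {γ : 𝓔.trivBasis.ring k ⟶ D}

variable (𝓔) in
/-- The sections of `y^* E`. -/
abbrev FibAt (α : 𝓔.trivBasis.ring i ⟶ B) : Type :=
  letI := 𝓔.alg α
  𝓔.Fib i.1 B

/-- Pullback of sections of `y^* E`. -/
def fibHom (h : j ≤ i) (q : B ⟶ C) (hq : α ≫ q = 𝓔.trivBasis.res h ≫ β) :
    𝓔.FibAt α →ₛₗ[q.hom] 𝓔.FibAt β :=
  letI := 𝓔.alg α
  letI := 𝓔.alg β
  𝓔.fibMap (U := i.1) (V := j.1) h q.hom (congrArg CommRingCat.Hom.hom hq)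

lemma fibHom_fibHom (h : j ≤ i) (h' : k ≤ j) (q : B ⟶ C) (q' : C ⟶ D)
    (hq : α ≫ q = 𝓔.trivBasis.res h ≫ β) (hq' : β ≫ q' = 𝓔.trivBasis.res h' ≫ γ)
    (hqq : α ≫ q ≫ q' = 𝓔.trivBasis.res (h'.trans h) ≫ γ) (x : 𝓔.FibAt α) :
    fibHom h' q' hq' (fibHom h q hq x) = fibHom (h'.trans h) (q ≫ q') hqq x := by
  let := 𝓔.alg α
  let := 𝓔.alg β
  let := 𝓔.alg γ
  exact baseMap_baseMap (resMod_resMod _ _ _) (fun _ => rfl) (fun _ => rfl) (fun _ => rfl) (fun _ => rfl) _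

lemma fibHom_congr (h : j ≤ i) {q q' : B ⟶ C} (e : q = q') (hq : α ≫ q = 𝓔.trivBasis.res h ≫ β)
    (hq' : α ≫ q' = 𝓔.trivBasis.res h ≫ β) (x : 𝓔.FibAt α) :
    fibHom h q hq x = fibHom h q' hq' x := by
  subst e; rfl

lemma fibHom_id (hq : α ≫ 𝟙 B = 𝓔.trivBasis.res le_rfl ≫ α) (x : 𝓔.FibAt α) :
    fibHom le_rfl (𝟙 B) hq x = x := by
  let := 𝓔.alg α
  exact baseMap_eq_self (resMod_refl _) (fun _ => rfl) (fun _ => rfl) _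

variable (i) in
/-- Bases of `y^* E`, compatible with pullback. -/
lemma exists_basis_fibHom : ∃ n : ℕ, ∀ {B : CommRingCat.{0}} (α : 𝓔.trivBasis.ring i ⟶ B),
    ∃ b : Module.Basis (Fin n) B (𝓔.FibAt α), ∀ (j : {U : X.affineOpens // 𝓔.IsTrivializing U})
      {C : CommRingCat.{0}} (β : 𝓔.trivBasis.ring j ⟶ C) (h : j ≤ i) (q : B ⟶ C)
      (hq : α ≫ q = 𝓔.trivBasis.res h ≫ β), ∃ b' : Module.Basis (Fin n) C (𝓔.FibAt β),
        ∀ l, fibHom h q hq (b l) = b' l := by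
  obtain ⟨n, b, hb⟩ := i.2.exists_basis_res
  refine ⟨n, fun {B} α => ?_⟩
  let := 𝓔.alg α
  refine ⟨Algebra.TensorProduct.basis B b, fun j C β h q hq => ?_⟩
  let := 𝓔.alg β
  obtain ⟨b', hb'⟩ := hb j.1 h
  exact ⟨Algebra.TensorProduct.basis C b', baseMap_basis _ _ _ (fun _ => rfl) _ _ hb'⟩

/-- Invariance under the Higgs field. -/
def IsInv (α : 𝓔.trivBasis.ring i ⟶ B) (L : Submodule B (𝓔.FibAt α)) : Prop :=
  letI := 𝓔.alg α
  IsInvariant (𝓔.pullbackφ i.1 B) L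

variable (𝓔) in
/-- The rank one Higgs subbundles of `y^* E`. -/
def Line (α : 𝓔.trivBasis.ring i ⟶ B) : Type :=
  {L : Submodule B (𝓔.FibAt α) // IsLine L ∧ IsInv α L}

variable [Smooth (X ↘ SpecC)]

/-- Pullback of rank one Higgs subbundles. -/
def Line.map (h : j ≤ i) (q : B ⟶ C) (hq : α ≫ q = 𝓔.trivBasis.res h ≫ β) (s : 𝓔.Line α) :
    𝓔.Line β :=
  ⟨Submodule.span C (fibHom h q hq '' s.1), by
    let := 𝓔.alg α
    let := 𝓔.alg β
    exact (i.2.isTransport h).span_image _ _ (fun _ => rfl) s.2.1 s.2.2⟩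

lemma Line.map_map (h : j ≤ i) (h' : k ≤ j) (q : B ⟶ C) (q' : C ⟶ D)
    (hq : α ≫ q = 𝓔.trivBasis.res h ≫ β) (hq' : β ≫ q' = 𝓔.trivBasis.res h' ≫ γ)
    (hqq : α ≫ q ≫ q' = 𝓔.trivBasis.res (h'.trans h) ≫ γ) (s : 𝓔.Line α) :
    Line.map h' q' hq' (Line.map h q hq s) = Line.map (h'.trans h) (q ≫ q') hqq s := by
  refine Subtype.ext ((span_image_span _ _).trans ?_)
  rw [Set.image_image]
  simp_rw [fibHom_fibHom h h' q q' hq hq' hqq]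
  rfl

lemma Line.map_id (hq : α ≫ 𝟙 B = 𝓔.trivBasis.res le_rfl ≫ α) (s : 𝓔.Line α) :
    Line.map le_rfl (𝟙 B) hq s = s := by
  refine Subtype.ext (?_ : Submodule.span B (fibHom le_rfl (𝟙 B) hq '' s.1) = s.1)
  simp_rw [fibHom_id hq]
  rw [Set.image_id', Submodule.span_eq]

section Glue

variable {ι : Type} {b : ι → B} (hb : Ideal.span (Set.range b) = ⊤)
  {j : ι → {U : X.affineOpens // 𝓔.IsTrivializing U}} {C : ι → CommRingCat.{0}}
  {β : ∀ k, 𝓔.trivBasis.ring (j k) ⟶ C k} (h : ∀ k, j k ≤ i) (q : ∀ k, B ⟶ C k)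
  (hq : ∀ k, α ≫ q k = 𝓔.trivBasis.res (h k) ≫ β k) (hf : ∀ k, IsAway (q k).hom (b k))

include hb hf

/-- Line subbundles that agree locally are equal. -/
lemma Line.eq_of_map_eq {s t : 𝓔.Line α}
    (hst : ∀ k, Line.map (h k) (q k) (hq k) s = Line.map (h k) (q k) (hq k) t) : s = t := by
  obtain ⟨n, hn⟩ := exists_basis_fibHom i
  obtain ⟨e, he⟩ := hn α
  choose e' he' using fun k => he (j k) (β k) (h k) (q k) (hq k)
  have key := fun k => congrArg Subtype.val (hst k)
  exact Subtype.ext (le_antisymm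
    (le_of_span_image_eq e e' (fun k => fibHom (h k) (q k) (hq k)) he' hb hf fun k => (key k).le)
    (le_of_span_image_eq e e' (fun k => fibHom (h k) (q k) (hq k)) he' hb hf fun k => (key k).ge))

/-- Rank one Higgs subbundles glue. Invariance is tested by contraction with linear forms on `Ω¹`,
which restrict to the members of the cover. -/
lemma Line.exists_map_eq (s : ∀ k, 𝓔.Line (β k))
    (hs : ∀ k l x, fibHom (h k) (q k) (hq k) x ∈ (s k).1 → ∃ n : ℕ,
      (q l).hom (b k) ^ n • fibHom (h l) (q l) (hq l) x ∈ (s l).1) :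
    ∃ t : 𝓔.Line α, ∀ k, Line.map (h k) (q k) (hq k) t = s k := by
  obtain ⟨n, hn⟩ := exists_basis_fibHom i
  obtain ⟨e, he⟩ := hn α
  choose e' he' using fun k => he (j k) (β k) (h k) (q k) (hq k)
  obtain ⟨hL, hL'⟩ := IsLine.glue e e' (fun k => fibHom (h k) (q k) (hq k)) he' hb hf
    (fun k => (s k).2.1) hs
  refine ⟨⟨_, hL, ?_⟩, fun k => Subtype.ext (hL' k)⟩
  let := 𝓔.alg α
  have := smooth_sections i.1
  refine (isInvariant_iff_forall_twistEnd_mem (B := B) (𝓔.φ i.1) _).2 fun c l hl => ?_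
  rw [Submodule.mem_iInf] at hl ⊢
  intro k
  let := 𝓔.alg (β k)
  have := smooth_sections (j k).1
  obtain ⟨c', hc'⟩ := (i.2.isTransport (h k)).exists_form c
  have h1 := (isInvariant_iff_forall_twistEnd_mem (B := C k) (𝓔.φ (j k).1) _).1 (s k).2.2 c' _ (hl k)
  rw [Submodule.mem_comap]
  have h2 := twistEnd_transport (q k).hom (semilinear (U := i.1) (V := (j k).1) (h k) (q k).hom
    (congrArg CommRingCat.Hom.hom (hq k))) (fun _ => rfl) (i.2.isTransport (h k)).comm
    (c := Algebra.linearMap _ B ∘ₗ c) (c' := Algebra.linearMap _ (C k) ∘ₗ c')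
    (fun x => by
      rw [LinearMap.comp_apply, LinearMap.comp_apply, hc', Algebra.linearMap_apply,
        Algebra.linearMap_apply]
      exact (apply_algebraMap (q k).hom (semilinear (U := i.1) (V := (j k).1) (h k) (q k).hom
        (congrArg CommRingCat.Hom.hom (hq k))) (fun _ => rfl) _).symm) l
  exact h2 ▸ h1

end Glue

/-- Rank one Higgs subbundles over a point do not depend on the trivializing open subset. -/
lemma Line.map_bijective (h : j ≤ i) {β : 𝓔.trivBasis.ring j ⟶ B}
    (hq : α ≫ 𝟙 B = 𝓔.trivBasis.res h ≫ β) :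
    Function.Bijective (Line.map h (𝟙 B) hq : 𝓔.Line α → 𝓔.Line β) := by
  have h1 : Ideal.span (Set.range fun _ : Unit => (1 : B)) = ⊤ := by simp
  refine ⟨fun s t hst => ?_, fun s => ?_⟩
  · exact Line.eq_of_map_eq h1 (fun _ => h) (fun _ => 𝟙 B) (fun _ => hq)
      (fun _ => IsAway.one _ fun _ => rfl) fun _ => hst
  · obtain ⟨t, ht⟩ := Line.exists_map_eq h1 (fun _ => h) (fun _ => 𝟙 B) (fun _ => hq)
      (fun _ => IsAway.one _ fun _ => rfl) (fun _ => s) fun _ _ x hx => ⟨0, by simpa using hx⟩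
    exact ⟨t, ht ()⟩

variable (𝓔) in
/-- The functor of rank one Higgs subbundles. -/
def lineFunctor : PointFunctor 𝓔.trivBasis where
  obj _ _ α := 𝓔.Line α
  map h _ _ _ _ q hq := Line.map h q hq
  map_id := Line.map_id
  map_map h h' _ _ _ _ _ _ q q' hq hq' hqq s := Line.map_map h h' q q' hq hq' hqq s
  map_bijective h _ _ _ hq := Line.map_bijective h hq
  eq_of_locally {i B α} s t h := by
    choose b hb β hq e using h
    have h1 : Ideal.span (Set.range b) = ⊤ := by
      by_contra hne
      obtain ⟨m, hm, hle⟩ := Ideal.exists_le_maximal _ hne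
      exact hb ⟨m, hm.isPrime⟩ (hle (Ideal.subset_span ⟨_, rfl⟩))
    exact Line.eq_of_map_eq h1 (fun _ => le_rfl) (fun p => toAway (b p)) hq
      (fun p => isAway_algebraMap (b p)) e
  exists_glue {i B} α ι b hb s hs := by
    have hq : ∀ k, α ≫ toAway (b k) = 𝓔.trivBasis.res (le_refl i) ≫ α ≫ toAway (b k) := fun k => by
      rw [AffineBasis.res_refl, Category.id_comp]
    suffices hs' : ∀ k l x, fibHom le_rfl (toAway (b k)) (hq k) x ∈ (s k).1 → ∃ n : ℕ,
        (toAway (b l)).hom (b k) ^ n • fibHom le_rfl (toAway (b l)) (hq l) x ∈ (s l).1 by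
      obtain ⟨t, ht⟩ := Line.exists_map_eq hb (fun _ => le_refl i) (fun k => toAway (b k)) hq
        (fun k => isAway_algebraMap (b k)) s hs'
      exact ⟨t, fun k _ => ht k⟩
    intro k l x hx
    -- compare the restrictions over the locus where `b k` and `b l` are invertible
    let c : away (b l) := toAway (b l) (b k)
    obtain ⟨f, hf⟩ := exists_away_lift (f := toAway (b l) ≫ toAway c) (b := b k)
      (isAway_algebraMap c).isUnit
    have h1 : (α ≫ toAway (b k)) ≫ f = 𝓔.trivBasis.res (le_refl i) ≫ α ≫ toAway (b k) ≫ f := by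
      rw [AffineBasis.res_refl, Category.id_comp, Category.assoc]
    have h2 : (α ≫ toAway (b l)) ≫ toAway c =
        𝓔.trivBasis.res (le_refl i) ≫ α ≫ toAway (b k) ≫ f := by
      rw [AffineBasis.res_refl, Category.id_comp, Category.assoc, hf]
    have h3 := congrArg Subtype.val (hs k l f (toAway c) _ h1 h2 hf)
    have h4 : α ≫ toAway (b k) ≫ f = 𝓔.trivBasis.res (le_refl i) ≫ α ≫ toAway (b k) ≫ f := by
      rw [AffineBasis.res_refl, Category.id_comp]
    have h5 : fibHom le_rfl f h1 (fibHom le_rfl (toAway (b k)) (hq k) x) =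
        fibHom le_rfl (toAway c) h2 (fibHom le_rfl (toAway (b l)) (hq l) x) := by
      rw [fibHom_fibHom _ _ _ _ _ _ h4, fibHom_fibHom _ _ _ _ _ _ (by rw [← hf]; exact h4)]
      exact fibHom_congr le_rfl hf _ _ x
    have h6 : fibHom le_rfl (toAway c) h2 (fibHom le_rfl (toAway (b l)) (hq l) x) ∈
        Submodule.span (away c) (fibHom le_rfl (toAway c) h2 '' (s l).1) := by
      rw [← h5]
      exact h3.le (Submodule.subset_span ⟨_, hx, rfl⟩)
    obtain ⟨n, hn⟩ := exists_basis_fibHom i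
    obtain ⟨e, he⟩ := hn (α ≫ toAway (b l))
    obtain ⟨e', he'⟩ := he _ _ _ _ h2
    exact (isAway_algebraMap c).exists_pow_smul_mem e e' (fibHom le_rfl (toAway c) h2) he' h6

end HiggsBundle

namespace HiggsBundle

variable {X : Scheme.{0}} [X.Over SpecC] {r : ℕ} {𝓔 : HiggsBundle X r}

section Basis

variable {i : {U : X.affineOpens // 𝓔.IsTrivializing U}} {B C : CommRingCat.{0}} {n : ℕ}
  (b : Module.Basis (Fin n) Γ(X, i.1.1) Γ(𝓔.E, i.1.1))

/-- The basis of `y^* E` given by a basis of `E`. -/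
def fibBasis (α : 𝓔.trivBasis.ring i ⟶ B) : Module.Basis (Fin n) B (𝓔.FibAt α) :=
  letI := 𝓔.alg α
  Algebra.TensorProduct.basis B b

lemma repr_fibHom {α : 𝓔.trivBasis.ring i ⟶ B} {β : 𝓔.trivBasis.ring i ⟶ C} (q : B ⟶ C)
    (hq : α ≫ q = 𝓔.trivBasis.res le_rfl ≫ β) (x : 𝓔.FibAt α) (l : Fin n) :
    (fibBasis b β).repr (fibHom le_rfl q hq x) l = q.hom ((fibBasis b α).repr x l) := by
  let := 𝓔.alg α
  let := 𝓔.alg β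
  exact repr_baseMap (resMod 𝓔.E (le_refl i.1.1)) q.hom _ (fun _ => rfl) b b
    (fun j => resMod_refl _ (b j)) x l

variable [Smooth (X ↘ SpecC)]

/-- The rank one Higgs subbundles on which the coordinate `a` does not vanish are represented by an
affine scheme. -/
lemma exists_lineChart (a : Fin n) : ∃ (R : CommRingCat.{0}) (str : 𝓔.trivBasis.ring i ⟶ R)
    (u : 𝓔.Line str), (∃ x ∈ u.1, (fibBasis b str).repr x a = 1) ∧
    (∀ {B : CommRingCat.{0}} (α : 𝓔.trivBasis.ring i ⟶ B) (f f' : R ⟶ B)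
      (hf : str ≫ f = 𝓔.trivBasis.res le_rfl ≫ α) (hf' : str ≫ f' = 𝓔.trivBasis.res le_rfl ≫ α),
      Line.map le_rfl f hf u = Line.map le_rfl f' hf' u → f = f') ∧
    ∀ {B : CommRingCat.{0}} {α : 𝓔.trivBasis.ring i ⟶ B} (s : 𝓔.Line α),
      (∃ x ∈ s.1, (fibBasis b α).repr x a = 1) →
        ∃ (f : R ⟶ B) (hf : str ≫ f = 𝓔.trivBasis.res le_rfl ≫ α), Line.map le_rfl f hf u = s := by
  have := smooth_sections i.1
  -- a line on which the coordinate `a` does not vanish has a unique generator with coordinate `1`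
  obtain ⟨R, _, inst, w, hw, hinv, hR⟩ := exists_lineAlgebra (𝓔.φ i.1) b a
  obtain ⟨S, rfl⟩ : ∃ S : 𝓔.trivBasis.ring i ⟶ .of R, inst = 𝓔.alg S := by
    obtain ⟨str, rfl⟩ := exists_eq_toAlgebra inst
    exact ⟨CommRingCat.ofHom str, rfl⟩
  let := 𝓔.alg S
  let L : Submodule R (R ⊗[Γ(X, i.1.1)] Γ(𝓔.E, i.1.1)) := Submodule.span R {vec b R w}
  let u : 𝓔.Line S := ⟨L, isLine_span_vec b hw, hinv⟩
  have hmap : ∀ {B : CommRingCat.{0}} {α : 𝓔.trivBasis.ring i ⟶ B} (f : CommRingCat.of R ⟶ B)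
      (hf : S ≫ f = 𝓔.trivBasis.res le_rfl ≫ α), (Line.map le_rfl f hf u).1 =
        letI := 𝓔.alg α
        Submodule.span B {vec b B fun j => f.hom (w j)} := by
    intro B α f hf
    let := 𝓔.alg α
    refine (span_image_span (fibHom le_rfl f hf) {(vec b R w : 𝓔.FibAt S)}).trans ?_
    rw [Set.image_singleton]
    congr 2
    refine (fibBasis b α).ext_elem fun l => ?_
    rw [repr_fibHom]
    exact (congrArg f.hom (repr_vec b w l)).trans (repr_vec b (fun j => f.hom (w j)) l).symm
  refine ⟨.of R, S, u, ⟨vec b R w, (Submodule.mem_span_singleton_self _ : _ ∈ L), (repr_vec b w a).trans hw⟩,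
    fun {B} α f f' hf hf' e => ?_, fun {B α} s hs => ?_⟩
  · let := 𝓔.alg α
    have h1 := hmap f hf
    have h2 := hmap f' hf'
    have hfw : f.hom (w a) = 1 := by rw [hw, map_one]
    have hfw' : f'.hom (w a) = 1 := by rw [hw, map_one]
    have h3 : Submodule.span B {vec b B fun j => f.hom (w j)} =
        Submodule.span B {vec b B fun j => f'.hom (w j)} :=
      h1.symm.trans ((congrArg Subtype.val e).trans h2)
    have h4 := eq_of_span_vec_eq b hfw hfw' h3
    have h5 : IsInvariant (baseChangeTwisted B (𝓔.φ i.1))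
        (Submodule.span B {vec b B fun j => f.hom (w j)}) := h1 ▸ (Line.map le_rfl f hf u).2.2
    rw [AffineBasis.res_refl, Category.id_comp] at hf hf'
    let F : R →ₐ[Γ(X, i.1.1)] B := ⟨f.hom, fun c => congrArg (fun t => t.hom c) hf⟩
    let F' : R →ₐ[Γ(X, i.1.1)] B := ⟨f'.hom, fun c => congrArg (fun t => t.hom c) hf'⟩
    have h6 : F = F' := (hR B _ hfw h5).unique (fun _ => rfl) fun j => (congrFun h4 j).symm
    ext x
    exact congrArg (fun t => t x) h6
  · let := 𝓔.alg α
    obtain ⟨x, hx, hxa⟩ := hs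
    have hxv : vec b B (fun j => (Algebra.TensorProduct.basis B b).repr x j) ∈ s.1 :=
      (vec_repr b x).symm ▸ hx
    have h1 : s.1 = Submodule.span B {vec b B fun j => (Algebra.TensorProduct.basis B b).repr x j} :=
      s.2.1.eq_span_vec b (i := a) hxa hxv
    obtain ⟨f, hf, -⟩ := hR B (fun j => (Algebra.TensorProduct.basis B b).repr x j) hxa
      (h1 ▸ s.2.2)
    have hS : S ≫ CommRingCat.ofHom f.toRingHom = 𝓔.trivBasis.res le_rfl ≫ α := by
      rw [AffineBasis.res_refl, Category.id_comp]
      ext c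
      exact f.commutes c
    refine ⟨CommRingCat.ofHom f.toRingHom, hS, Subtype.ext ?_⟩
    rw [hmap, h1]
    congr 3
    funext j
    exact hf j

end Basis

variable [Smooth (X ↘ SpecC)]

/-- Charts of the functor of rank one Higgs subbundles: over each member of the basis, the loci where
the coordinates do not vanish on the line. -/
lemma nonempty_charts_lineFunctor : Nonempty (PointFunctor.Charts 𝓔.lineFunctor) := by
  choose n b hb using fun i : {U : X.affineOpens // 𝓔.IsTrivializing U} => i.2.exists_basis_res
  choose R str u hu hext hlift using fun i a => exists_lineChart (i := i) (b i) a
  refine ⟨⟨fun i => Fin (n i), R, str, u, fun i a B α f f' hf hf' e => hext i a α f f' hf hf' e,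
    fun i K _ α s => ?_, fun i a B α s K _ κ α' hκ f hf e => ?_⟩⟩
  · -- a nonzero vector on the line, normalized at a nonzero coordinate
    obtain ⟨m, v, ℓ, hv, h1, -⟩ := s.2.1
    obtain ⟨k, hk⟩ : ∃ k, v k ≠ 0 := by
      by_contra! h
      simp [h] at h1
    obtain ⟨a, ha⟩ : ∃ a, (fibBasis (b i) α).repr (v k) a ≠ 0 := by
      by_contra! h
      exact hk ((fibBasis (b i) α).ext_elem fun a => by rw [h, map_zero]; rfl)
    have h2 : (fibBasis (b i) α).repr
        (((fibBasis (b i) α).repr (v k) a)⁻¹ • v k) a = 1 := by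
      rw [map_smul, Finsupp.smul_apply, smul_eq_mul]
      exact inv_mul_cancel₀ ha
    obtain ⟨f, hf, e⟩ := hlift i a s ⟨_, s.1.smul_mem _ (hv k), h2⟩
    exact ⟨a, f, hf, e⟩
  · obtain ⟨w, hw, hwa⟩ := hu i a
    -- some section of the line has a nonzero coordinate `a` at the given point
    obtain ⟨x, hx, hxa⟩ : ∃ x ∈ s.1, κ ((fibBasis (b i) α).repr x a) ≠ 0 := by
      by_contra! h
      have h1 : fibHom le_rfl f hf w ∈ (Line.map le_rfl κ hκ s).1 :=
        (congrArg Subtype.val e).le (Submodule.subset_span ⟨w, hw, rfl⟩)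
      have h2 : ∀ y ∈ (Line.map le_rfl κ hκ s).1, (fibBasis (b i) α').repr y a = 0 := by
        intro y hy
        induction hy using Submodule.span_induction with
        | mem y hy => obtain ⟨x, hx, rfl⟩ := hy; rw [repr_fibHom]; exact h x hx
        | zero => simp
        | add y z _ _ hy hz => rw [map_add, Finsupp.add_apply, hy, hz, add_zero]
        | smul c y _ hy => rw [map_smul, Finsupp.smul_apply, hy, smul_zero]
      have h3 := h2 _ h1
      rw [repr_fibHom, hwa, map_one] at h3
      exact one_ne_zero h3
    refine ⟨_, hxa, ?_⟩
    set c := (fibBasis (b i) α).repr x a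
    have hq : α ≫ toAway c = 𝓔.trivBasis.res (le_refl i) ≫ α ≫ toAway c := by
      rw [AffineBasis.res_refl, Category.id_comp]
    obtain ⟨d, hd⟩ := (isAway_algebraMap c).isUnit.exists_left_inv
    have h1 : (fibBasis (b i) (α ≫ toAway c)).repr (d • fibHom le_rfl (toAway c) hq x) a = 1 := by
      rw [map_smul, Finsupp.smul_apply, repr_fibHom]
      exact hd
    obtain ⟨f', hf', e'⟩ := hlift i a (Line.map le_rfl (toAway c) hq s)
      ⟨_, Submodule.smul_mem _ _ (Submodule.subset_span ⟨x, hx, rfl⟩), h1⟩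
    exact ⟨_, hq, f', hf', e'⟩

end HiggsBundle

/-! ### Existence of the Higgs Grassmannian and of the spectral cover -/

namespace HiggsBundle

variable {X : Scheme.{0}} [X.Over SpecC] {r : ℕ} {𝓔 : HiggsBundle X r}

section OfAlg

variable {i : {U : X.affineOpens // 𝓔.IsTrivializing U}} {B : Type} [CommRing B]

lemma exists_eq_alg (inst : Algebra Γ(X, i.1.1) B) :
    ∃ α : 𝓔.trivBasis.ring i ⟶ .of B, inst = 𝓔.alg α := by
  obtain ⟨f, rfl⟩ := exists_eq_toAlgebra inst
  exact ⟨CommRingCat.ofHom f, rfl⟩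

/-- A construction for all algebras over the functions on a member of the basis, given for those
that come from a ring map. -/
def ofAlg {motive : Algebra Γ(X, i.1.1) B → Type}
    (h : ∀ α : 𝓔.trivBasis.ring i ⟶ .of B, motive (𝓔.alg α)) (inst : Algebra Γ(X, i.1.1) B) :
    motive inst :=
  (exists_eq_alg inst).choose_spec ▸ h (exists_eq_alg inst).choose

/-- The value of `ofAlg` is computed by means of the choice of a ring map, which is unique. -/
lemma ofAlg_alg {motive : Algebra Γ(X, i.1.1) B → Type}
    (h : ∀ α : 𝓔.trivBasis.ring i ⟶ .of B, motive (𝓔.alg α)) (α : 𝓔.trivBasis.ring i ⟶ .of B) :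
    ofAlg h (𝓔.alg α) = h α := by
  have key : ∀ (β : 𝓔.trivBasis.ring i ⟶ .of B) (e : 𝓔.alg α = 𝓔.alg β), e ▸ h β = h α := by
    intro β e
    have : α = β := by
      ext x
      exact congrArg (fun a : Algebra Γ(X, i.1.1) B => a.algebraMap x) e
    subst this
    rfl
  exact key _ (exists_eq_alg (𝓔.alg α)).choose_spec

end OfAlg

variable [Smooth (X ↘ SpecC)]

/-- The scheme glued from the charts of the functor of rank one Higgs subbundles. -/
lemma nonempty_higgsGrassmannian : Nonempty (HiggsGrassmannian 𝓔 1) := by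
  obtain ⟨𝓒⟩ := nonempty_charts_lineFunctor (𝓔 := 𝓔)
  let T (i : {U : X.affineOpens // 𝓔.IsTrivializing U}) (B : Type) [CommRing B]
      (h : Spec (.of B) ⟶ 𝓒.glued) (inst : Algebra Γ(X, i.1.1) B) : Type :=
    h ≫ 𝓒.proj = pt i.1 B → Submodule B (𝓔.Fib i.1 B)
  let sub (i : {U : X.affineOpens // 𝓔.IsTrivializing U}) (B : Type) [CommRing B]
      (h : Spec (.of B) ⟶ 𝓒.glued) (inst : Algebra Γ(X, i.1.1) B) : T i B h inst :=
    ofAlg (motive := T i B h) (fun α hh => (𝓒.toElt i α h hh).1) inst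
  have hsub : ∀ i (B : Type) [CommRing B] (h : Spec (.of B) ⟶ 𝓒.glued)
      (α : 𝓔.trivBasis.ring i ⟶ .of B) (hh : h ≫ 𝓒.proj = 𝓔.trivBasis.pt i α),
      sub i B h (𝓔.alg α) hh = (𝓒.toElt i α h hh).1 := by
    intro i B _ h α hh
    exact congrFun (ofAlg_alg (motive := T i B h) (fun α hh => (𝓒.toElt i α h hh).1) α) hh
  refine ⟨⟨𝓒.glued, 𝓒.proj, fun U hU B _ inst h hh => sub ⟨U, hU⟩ B h inst hh, ?_, ?_, ?_⟩⟩
  · intro U hU B _ inst h hh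
    obtain ⟨α, rfl⟩ := exists_eq_alg (i := ⟨U, hU⟩) inst
    have := hU.1
    have e : sub ⟨U, hU⟩ B h (𝓔.alg α) hh = _ := hsub ⟨U, hU⟩ B h α hh
    rw [e]
    exact ⟨(𝓒.toElt ⟨U, hU⟩ α h hh).2.1.isSubbundle, (𝓒.toElt ⟨U, hU⟩ α h hh).2.2⟩
  · intro U V hU hV hVU B B' _ _ inst inst' f hf h hh hh'
    obtain ⟨α, rfl⟩ := exists_eq_alg (i := ⟨U, hU⟩) inst
    obtain ⟨β, rfl⟩ := exists_eq_alg (i := ⟨V, hV⟩) inst'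
    have e : sub ⟨U, hU⟩ B h (𝓔.alg α) hh = _ := hsub ⟨U, hU⟩ B h α hh
    have e' : sub ⟨V, hV⟩ B' (Spec.map (CommRingCat.ofHom f) ≫ h) (𝓔.alg β) hh' = _ :=
      hsub ⟨V, hV⟩ B' _ β hh'
    rw [e, e']
    exact congrArg Subtype.val (𝓒.toElt_map (i := ⟨U, hU⟩) (j := ⟨V, hV⟩) hVU
      (q := CommRingCat.ofHom f) (CommRingCat.hom_ext hf) h hh hh')
  · intro U hU B _ inst L hL
    obtain ⟨α, rfl⟩ := exists_eq_alg (i := ⟨U, hU⟩) inst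
    have := hU.1
    obtain ⟨h, ⟨hh, e⟩, huniq⟩ := 𝓒.existsUnique_toElt_eq (i := ⟨U, hU⟩) (α := α)
      (⟨L, hL.1.isLine, hL.2⟩ : 𝓔.Line α)
    refine ⟨h, ⟨hh, (hsub _ _ _ _ hh).trans (congrArg Subtype.val e)⟩, ?_⟩
    rintro h' ⟨hh', e'⟩
    exact huniq h' ⟨hh', Subtype.ext ((hsub _ _ _ _ hh').symm.trans e')⟩

/-- The scheme glued from the charts of the functor of solutions of the spectral equation. -/
lemma nonempty_spectralCover : Nonempty (SpectralCover 𝓔) := by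
  obtain ⟨𝓒⟩ := nonempty_charts_eigFunctor 𝓔
  let T (i : {U : X.affineOpens // 𝓔.IsTrivializing U}) (B : Type) [CommRing B]
      (h : Spec (.of B) ⟶ 𝓒.glued) (inst : Algebra Γ(X, i.1.1) B) : Type :=
    h ≫ 𝓒.proj = pt i.1 B → Forms i.1 B
  let eig (i : {U : X.affineOpens // 𝓔.IsTrivializing U}) (B : Type) [CommRing B]
      (h : Spec (.of B) ⟶ 𝓒.glued) (inst : Algebra Γ(X, i.1.1) B) : T i B h inst :=
    ofAlg (motive := T i B h) (fun α hh => (𝓒.toElt i α h hh).1) inst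
  have heig : ∀ i (B : Type) [CommRing B] (h : Spec (.of B) ⟶ 𝓒.glued)
      (α : 𝓔.trivBasis.ring i ⟶ .of B) (hh : h ≫ 𝓒.proj = 𝓔.trivBasis.pt i α),
      eig i B h (𝓔.alg α) hh = (𝓒.toElt i α h hh).1 := by
    intro i B _ h α hh
    exact congrFun (ofAlg_alg (motive := T i B h) (fun α hh => (𝓒.toElt i α h hh).1) α) hh
  refine ⟨⟨𝓒.glued, 𝓒.proj, fun U hU B _ inst h hh => eig ⟨U, hU⟩ B h inst hh, ?_, ?_, ?_⟩⟩
  · intro U hU B _ inst h hh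
    obtain ⟨α, rfl⟩ := exists_eq_alg (i := ⟨U, hU⟩) inst
    have e : eig ⟨U, hU⟩ B h (𝓔.alg α) hh = _ := heig ⟨U, hU⟩ B h α hh
    rw [e]
    exact (𝓒.toElt ⟨U, hU⟩ α h hh).2
  · intro U V hU hV hVU B B' _ _ inst inst' f hf h hh hh'
    obtain ⟨α, rfl⟩ := exists_eq_alg (i := ⟨U, hU⟩) inst
    obtain ⟨β, rfl⟩ := exists_eq_alg (i := ⟨V, hV⟩) inst'
    have e : eig ⟨U, hU⟩ B h (𝓔.alg α) hh = _ := heig ⟨U, hU⟩ B h α hh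
    have e' : eig ⟨V, hV⟩ B' (Spec.map (CommRingCat.ofHom f) ≫ h) (𝓔.alg β) hh' = _ :=
      heig ⟨V, hV⟩ B' _ β hh'
    rw [e, e']
    exact congrArg Subtype.val (𝓒.toElt_map (i := ⟨U, hU⟩) (j := ⟨V, hV⟩) hVU
      (q := CommRingCat.ofHom f) (CommRingCat.hom_ext hf) h hh hh')
  · intro U hU B _ inst θ hθ
    obtain ⟨α, rfl⟩ := exists_eq_alg (i := ⟨U, hU⟩) inst
    obtain ⟨h, ⟨hh, e⟩, huniq⟩ := 𝓒.existsUnique_toElt_eq (i := ⟨U, hU⟩) (α := α)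
      (⟨θ, hθ⟩ : 𝓔.Eig α)
    refine ⟨h, ⟨hh, (heig _ _ _ _ hh).trans (congrArg Subtype.val e)⟩, ?_⟩
    rintro h' ⟨hh', e'⟩
    exact huniq h' ⟨hh', Subtype.ext ((heig _ _ _ _ hh').symm.trans e')⟩

end HiggsBundle

/-! ### The eigenvalue of an eigenline -/

section Eigenvalue

variable {B P Q : Type} [CommRing B] [AddCommGroup P] [Module B P] [AddCommGroup Q] [Module B Q]
  {Φ : P →ₗ[B] P ⊗[B] Q} {L : Submodule B P}

/-- The contraction of `P ⊗ Q` with a linear form on `P`. -/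
def leftContract (ℓ : P →ₗ[B] B) : P ⊗[B] Q →ₗ[B] Q :=
  (TensorProduct.lid B Q).toLinearMap ∘ₗ ℓ.rTensor Q

@[simp] lemma leftContract_tmul (ℓ : P →ₗ[B] B) (x : P) (q : Q) :
    leftContract ℓ (x ⊗ₜ[B] q) = ℓ x • q := by
  simp [leftContract]

/-- A Higgs field acts on an invariant line as multiplication by an eigenvalue. -/
lemma IsLine.exists_eigenvalue (hL : IsLine L) (hi : IsInvariant Φ L) :
    ∃ θ : Q, ∀ l ∈ L, Φ l = l ⊗ₜ θ := by
  obtain ⟨n, v, ℓ, hv, h1, hL'⟩ := id hL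
  -- on `L ⊗ Q`, contraction with `ℓ` is determined by the values of `ℓ` on `L`
  have key : ∀ (f : P →ₗ[B] B) (l : P), l ∈ L → ∀ t : L ⊗[B] Q,
      l ⊗ₜ[B] leftContract f (L.subtype.rTensor Q t) = f l • L.subtype.rTensor Q t := by
    intro f l hl t
    induction t with
    | zero => simp
    | tmul m q =>
      simp only [LinearMap.rTensor_tmul, Submodule.subtype_apply, leftContract_tmul]
      rw [← TensorProduct.smul_tmul, hL.apply_smul_comm f m.2 hl, TensorProduct.smul_tmul']
    | add x y hx hy => simp only [map_add, TensorProduct.tmul_add, smul_add, hx, hy]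
  refine ⟨∑ k, leftContract (ℓ k) (Φ (v k)), fun l hl => ?_⟩
  rw [TensorProduct.tmul_sum]
  conv_lhs => rw [IsLine.eq_sum h1 hL' hl, map_sum]
  refine Finset.sum_congr rfl fun k _ => ?_
  obtain ⟨t, ht⟩ := hi _ (hv k)
  rw [map_smul, ← ht, key _ l hl]

/-- The eigenvalue of a line is unique: the values of linear forms on the line generate the unit
ideal. -/
lemma IsLine.eigenvalue_unique (hL : IsLine L) {θ θ' : Q}
    (h : ∀ l ∈ L, l ⊗ₜ[B] θ = l ⊗ₜ θ') : θ = θ' := by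
  obtain ⟨n, v, ℓ, hv, h1, -⟩ := hL
  have h2 : ∀ k, ℓ k (v k) • θ = ℓ k (v k) • θ' := fun k => by
    rw [← leftContract_tmul, h _ (hv k), leftContract_tmul]
  rw [← one_smul B θ, ← one_smul B θ', ← h1, Finset.sum_smul, Finset.sum_smul]
  exact Finset.sum_congr rfl fun k _ => h2 k

lemma isInvariant_of_eigen {θ : Q} (h : ∀ l ∈ L, Φ l = l ⊗ₜ θ) : IsInvariant Φ L :=
  fun l hl => ⟨⟨l, hl⟩ ⊗ₜ θ, by rw [h l hl]; rfl⟩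

end Eigenvalue

/-- A solution of the spectral equation over a field is the eigenvalue of an eigenvector. -/
lemma exists_eigenvector {A M N K : Type} [CommRing A] [AddCommGroup M] [Module A M]
    [AddCommGroup N] [Module A N] [Module.Finite A N] [Module.Projective A N] [Field K] [Infinite K]
    [Algebra A K] [Module.Free A M] [Module.Finite A M] {n : ℕ} (b : Module.Basis (Fin n) A M)
    {φ : M →ₗ[A] M ⊗[A] N} (hφ : wedgeSquare φ = 0) {θ : K ⊗[A] N} (hθ : charValue K φ θ = 0) :
    ∃ x : K ⊗[A] M, (∃ a, (Algebra.TensorProduct.basis K b).repr x a = 1) ∧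
      baseChangeTwisted K φ x = x ⊗ₜ θ := by
  obtain ⟨⟨v, hv, h⟩, -⟩ := exists_common_eigenvector b φ hφ hθ (AlgHom.id A K)
  obtain ⟨a, ha⟩ := Function.ne_iff.1 hv
  have h1 : baseChangeTwisted K φ (vec b K v) = vec b K v ⊗ₜ θ := by
    refine eigen_of_charMatrix_mulVec_eq_zero b φ fun c => ?_
    rw [show ((Algebra.TensorProduct.basis K b).repr (vec b K v) : Fin n → K) = v from
      funext fun j => repr_vec b v j]
    exact h _
  refine ⟨(v a)⁻¹ • vec b K v, ⟨a, ?_⟩, ?_⟩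
  · rw [map_smul, Finsupp.smul_apply, repr_vec, smul_eq_mul, inv_mul_cancel₀ ha]
  · rw [map_smul, h1, TensorProduct.smul_tmul']

namespace AffineBasis

variable {X : Scheme.{0}} {I : Type} [Preorder I] (𝔅 : AffineBasis X I)

/-- Each scheme over `X` is covered by affine open subschemes that map to members of the basis. -/
lemma exists_pt_mem {Y : Scheme.{0}} (y : Y ⟶ X) (z : Y) :
    ∃ (i : I) (C : CommRingCat.{0}) (α : 𝔅.ring i ⟶ C) (q : Spec C ⟶ Y), IsOpenImmersion q ∧
      z ∈ Set.range q ∧ q ≫ y = 𝔅.pt i α := by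
  obtain ⟨i, hi⟩ := 𝔅.exists_mem (y z)
  obtain ⟨C, q, hq, hz, hle⟩ := exists_nhd (U := y ⁻¹ᵁ (𝔅.opens i).1) hi
  obtain ⟨α, hα⟩ := 𝔅.exists_pt_eq (i := i) (q ≫ y) (by
    rintro _ ⟨x, rfl⟩
    exact hle ⟨x, rfl⟩)
  exact ⟨i, C, α, q, hq, hz, hα.symm⟩

/-- Locally, a point that factors through two members of the basis factors through a smaller
one. -/
lemma exists_refinement {i j : I} {B : CommRingCat.{0}} {α : 𝔅.ring i ⟶ B} {β : 𝔅.ring j ⟶ B}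
    (e : 𝔅.pt i α = 𝔅.pt j β) (z : Spec B) :
    ∃ (k : I) (hi : k ≤ i) (hj : k ≤ j) (C : CommRingCat.{0}) (q : B ⟶ C) (γ : 𝔅.ring k ⟶ C),
      IsOpenImmersion (Spec.map q) ∧ z ∈ Set.range (Spec.map q) ∧ α ≫ q = 𝔅.res hi ≫ γ ∧
      β ≫ q = 𝔅.res hj ≫ γ := by
  obtain ⟨k, hi, hj, hk⟩ := 𝔅.directed i j (𝔅.pt i α z) (𝔅.range_pt α z) (by
    rw [e]; exact 𝔅.range_pt β z)
  obtain ⟨C, q, hq, hz, hle⟩ := exists_nhd (U := 𝔅.pt i α ⁻¹ᵁ (𝔅.opens k).1) hk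
  obtain ⟨q, rfl⟩ := Spec.map_surjective q
  obtain ⟨γ, hγ⟩ := 𝔅.exists_pt_eq (i := k) (Spec.map q ≫ 𝔅.pt i α) (by
    rintro _ ⟨x, rfl⟩
    exact hle ⟨x, rfl⟩)
  refine ⟨k, hi, hj, C, q, γ, hq, hz, 𝔅.pt_injective ?_, 𝔅.pt_injective ?_⟩
  · rw [𝔅.pt_res, hγ, 𝔅.map_pt]
  · rw [𝔅.pt_res, hγ, e, 𝔅.map_pt]

end AffineBasis

namespace HiggsBundle

variable {X : Scheme.{0}} [X.Over SpecC] {r : ℕ} {𝓔 : HiggsBundle X r}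
  {i j : {U : X.affineOpens // 𝓔.IsTrivializing U}} {B C : CommRingCat.{0}}
  {α : 𝓔.trivBasis.ring i ⟶ B} {β : 𝓔.trivBasis.ring j ⟶ C}

/-- `x` is zero or an eigenvector of the Higgs field with eigenvalue `t`. -/
def IsEigen (x : 𝓔.FibAt α) (t : 𝓔.Eig α) : Prop :=
  letI := 𝓔.alg α
  𝓔.pullbackφ i.1 B x = x ⊗ₜ[B] t.1

/-- The Higgs field acts on the line `s` as multiplication by `t`. -/
def Line.HasEigenvalue (s : 𝓔.Line α) (t : 𝓔.Eig α) : Prop :=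
  ∀ l ∈ s.1, IsEigen l t

lemma Line.HasEigenvalue.unique {s : 𝓔.Line α} {t t' : 𝓔.Eig α} (h : s.HasEigenvalue t)
    (h' : s.HasEigenvalue t') : t = t' := by
  let := 𝓔.alg α
  exact Subtype.ext (s.2.1.eigenvalue_unique fun l hl => (h l hl).symm.trans (h' l hl))

variable [Smooth (X ↘ SpecC)]

/-- Every rank one Higgs subbundle has an eigenvalue, and it satisfies the spectral equation. -/
lemma Line.exists_hasEigenvalue (s : 𝓔.Line α) : ∃ t : 𝓔.Eig α, s.HasEigenvalue t := by
  let := 𝓔.alg α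
  have := i.2.1; have := i.2.2
  have := smooth_sections i.1
  obtain ⟨θ, hθ⟩ := s.2.1.exists_eigenvalue s.2.2
  exact ⟨⟨θ, charValue_eq_zero_of_isLine (B := B) (𝓔.φ i.1) s.2.1 hθ⟩, hθ⟩

lemma IsEigen.map {x : 𝓔.FibAt α} {t : 𝓔.Eig α} (hx : IsEigen x t) (h : j ≤ i) (q : B ⟶ C)
    (hq : α ≫ q = 𝓔.trivBasis.res h ≫ β) : IsEigen (fibHom h q hq x) (Eig.map h q hq t) := by
  let := 𝓔.alg α
  let := 𝓔.alg β
  have := smooth_sections j.1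
  exact eigen_transport q.hom _ (fun _ => rfl) (i.2.isTransport h) hx

lemma Line.HasEigenvalue.map {s : 𝓔.Line α} {t : 𝓔.Eig α} (hs : s.HasEigenvalue t) (h : j ≤ i)
    (q : B ⟶ C) (hq : α ≫ q = 𝓔.trivBasis.res h ≫ β) :
    (Line.map h q hq s).HasEigenvalue (Eig.map h q hq t) := by
  let := 𝓔.alg β
  intro l hl
  induction hl using Submodule.span_induction with
  | mem y hy => obtain ⟨x, hx, rfl⟩ := hy; exact (hs x hx).map h q hq
  | zero => simp [IsEigen]
  | add y z _ _ hy hz =>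
    change 𝓔.pullbackφ j.1 C (y + z) = _
    rw [map_add, TensorProduct.add_tmul]
    exact congrArg₂ (· + ·) hy hz
  | smul c y _ hy =>
    change 𝓔.pullbackφ j.1 C (c • y) = _
    rw [map_smul, ← TensorProduct.smul_tmul']
    exact congrArg (c • ·) hy

/-- At a point with values in a field, a solution of the spectral equation is the eigenvalue of a
line. -/
lemma exists_line_hasEigenvalue {K : Type} [Field K] {α : 𝓔.trivBasis.ring i ⟶ .of K}
    (t : 𝓔.Eig α) : ∃ s : 𝓔.Line α, s.HasEigenvalue t := by
  let := 𝓔.alg α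
  have := i.2.1; have := i.2.2
  have := smooth_sections i.1
  let : Algebra ℂ K := (α.hom.comp (algebraMap ℂ Γ(X, i.1.1))).toAlgebra
  have : CharZero K := charZero_of_injective_algebraMap (algebraMap ℂ K).injective
  obtain ⟨n, b, -⟩ := i.2.exists_basis
  obtain ⟨x, ⟨a, ha⟩, hx⟩ := exists_eigenvector b (𝓔.φ_wedge i.1) t.2
  have h : ∀ l ∈ Submodule.span K {x}, 𝓔.pullbackφ i.1 K l = l ⊗ₜ t.1 := by
    intro l hl
    obtain ⟨c, rfl⟩ := Submodule.mem_span_singleton.1 hl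
    exact (map_smul _ c x).trans ((congrArg (c • ·) hx).trans (TensorProduct.smul_tmul' c x _))
  exact ⟨⟨Submodule.span K {x}, isLine_span_singleton ((Algebra.TensorProduct.basis K b).coord a) ha,
    isInvariant_of_eigen h⟩, h⟩

end HiggsBundle

/-! ### Points of the Higgs Grassmannian and of the spectral cover -/

variable {X : Scheme.{0}} [X.Over SpecC] {r : ℕ} {𝓔 : HiggsBundle X r}
  {i j : {U : X.affineOpens // 𝓔.IsTrivializing U}} {B C : CommRingCat.{0}}
  {α : 𝓔.trivBasis.ring i ⟶ B} {β : 𝓔.trivBasis.ring j ⟶ C}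

namespace HiggsGrassmannian

variable (H : HiggsGrassmannian 𝓔 1)

variable (α) in
/-- The rank one Higgs subbundle that corresponds to a morphism to the Higgs Grassmannian. -/
def line (h : Spec B ⟶ H.carrier) (hh : h ≫ H.ρ = 𝓔.trivBasis.pt i α) : 𝓔.Line α :=
  letI := 𝓔.alg α
  ⟨H.sub i.1 i.2 B h hh, by
    have := i.2.1
    exact (H.isHiggsSubbundle_sub i.1 i.2 B h hh).1.isLine,
    (H.isHiggsSubbundle_sub i.1 i.2 B h hh).2⟩

lemma exists_line_eq (s : 𝓔.Line α) :
    ∃ (h : Spec B ⟶ H.carrier) (hh : h ≫ H.ρ = 𝓔.trivBasis.pt i α), H.line α h hh = s := by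
  let := 𝓔.alg α
  have := i.2.1
  obtain ⟨h, ⟨hh, e⟩, -⟩ := H.existsUnique_sub_eq i.1 i.2 B s.1 ⟨s.2.1.isSubbundle, s.2.2⟩
  exact ⟨h, hh, Subtype.ext e⟩

lemma hom_ext {h h' : Spec B ⟶ H.carrier} (hh : h ≫ H.ρ = 𝓔.trivBasis.pt i α)
    (hh' : h' ≫ H.ρ = 𝓔.trivBasis.pt i α) (e : H.line α h hh = H.line α h' hh') : h = h' := by
  let := 𝓔.alg α
  exact (H.existsUnique_sub_eq i.1 i.2 B _ (H.isHiggsSubbundle_sub i.1 i.2 B h' hh')).unique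
    ⟨hh, congrArg Subtype.val e⟩ ⟨hh', rfl⟩

variable [Smooth (X ↘ SpecC)]

lemma line_map (hij : j ≤ i) (q : B ⟶ C) (hq : α ≫ q = 𝓔.trivBasis.res hij ≫ β)
    (h : Spec B ⟶ H.carrier) (hh : h ≫ H.ρ = 𝓔.trivBasis.pt i α)
    (hh' : (Spec.map q ≫ h) ≫ H.ρ = 𝓔.trivBasis.pt j β) :
    H.line β (Spec.map q ≫ h) hh' = HiggsBundle.Line.map hij q hq (H.line α h hh) := by
  let := 𝓔.alg α
  let := 𝓔.alg β
  exact Subtype.ext (H.sub_natural i.1 j.1 i.2 j.2 hij B C q.hom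
    (congrArg CommRingCat.Hom.hom hq) h hh hh')

end HiggsGrassmannian

namespace SpectralCover

variable (S : SpectralCover 𝓔)

variable (α) in
/-- The section of `Ω¹` that corresponds to a morphism to the spectral cover. -/
def val (h : Spec B ⟶ S.carrier) (hh : h ≫ S.p = 𝓔.trivBasis.pt i α) : 𝓔.Eig α :=
  letI := 𝓔.alg α
  ⟨S.eig i.1 i.2 B h hh, S.spectralEquation_eig i.1 i.2 B h hh⟩

lemma exists_val_eq (t : 𝓔.Eig α) :
    ∃ (h : Spec B ⟶ S.carrier) (hh : h ≫ S.p = 𝓔.trivBasis.pt i α), S.val α h hh = t := by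
  let := 𝓔.alg α
  obtain ⟨h, ⟨hh, e⟩, -⟩ := S.existsUnique_eig_eq i.1 i.2 B t.1 t.2
  exact ⟨h, hh, Subtype.ext e⟩

lemma hom_ext {h h' : Spec B ⟶ S.carrier} (hh : h ≫ S.p = 𝓔.trivBasis.pt i α)
    (hh' : h' ≫ S.p = 𝓔.trivBasis.pt i α) (e : S.val α h hh = S.val α h' hh') : h = h' := by
  let := 𝓔.alg α
  exact (S.existsUnique_eig_eq i.1 i.2 B _ (S.spectralEquation_eig i.1 i.2 B h' hh')).unique
    ⟨hh, congrArg Subtype.val e⟩ ⟨hh', rfl⟩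

variable [Smooth (X ↘ SpecC)]

lemma val_map (hij : j ≤ i) (q : B ⟶ C) (hq : α ≫ q = 𝓔.trivBasis.res hij ≫ β)
    (h : Spec B ⟶ S.carrier) (hh : h ≫ S.p = 𝓔.trivBasis.pt i α)
    (hh' : (Spec.map q ≫ h) ≫ S.p = 𝓔.trivBasis.pt j β) :
    S.val β (Spec.map q ≫ h) hh' = HiggsBundle.Eig.map hij q hq (S.val α h hh) := by
  let := 𝓔.alg α
  let := 𝓔.alg β
  exact Subtype.ext (S.eig_natural i.1 j.1 i.2 j.2 hij B C q.hom
    (congrArg CommRingCat.Hom.hom hq) h hh hh')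

end SpectralCover

namespace HiggsBundle

lemma map_comp_eq_pt {Y : Scheme.{0}} {y : Y ⟶ X} {q : Spec B ⟶ Y}
    (hq : q ≫ y = 𝓔.trivBasis.pt i α) {f : B ⟶ C} (h : j ≤ i)
    (e : α ≫ f = 𝓔.trivBasis.res h ≫ β) : (Spec.map f ≫ q) ≫ y = 𝓔.trivBasis.pt j β := by
  rw [Category.assoc, hq, AffineBasis.map_pt, e, AffineBasis.pt_res]

variable [Smooth (X ↘ SpecC)] (H : HiggsGrassmannian 𝓔 1) (S : SpectralCover 𝓔)

/-! ### The map that sends an eigenline to its eigenvalue -/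

/-- Restriction of points that correspond to a line and to its eigenvalue. -/
lemma hasEigenvalue_map {h : Spec B ⟶ H.carrier} {hh : h ≫ H.ρ = 𝓔.trivBasis.pt i α}
    {t : Spec B ⟶ S.carrier} {ht : t ≫ S.p = 𝓔.trivBasis.pt i α}
    (e : (H.line α h hh).HasEigenvalue (S.val α t ht)) (hij : j ≤ i) (q : B ⟶ C)
    (hq : α ≫ q = 𝓔.trivBasis.res hij ≫ β) :
    (H.line β (Spec.map q ≫ h) (map_comp_eq_pt hh hij hq)).HasEigenvalue
      (S.val β (Spec.map q ≫ t) (map_comp_eq_pt ht hij hq)) := by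
  rw [H.line_map hij q hq, S.val_map hij q hq]
  exact e.map hij q hq

/-- The morphism from the Higgs Grassmannian to the spectral cover that sends an eigenline to its
eigenvalue. -/
lemma exists_hom_spectralCover : ∃ (g : H.carrier ⟶ S.carrier) (hg : g ≫ S.p = H.ρ),
    ∀ (i : {U : X.affineOpens // 𝓔.IsTrivializing U}) {B : CommRingCat.{0}}
      (α : 𝓔.trivBasis.ring i ⟶ B) (h : Spec B ⟶ H.carrier) (hh : h ≫ H.ρ = 𝓔.trivBasis.pt i α),
      (H.line α h hh).HasEigenvalue (S.val α (h ≫ g) (by rw [Category.assoc, hg, hh])) := by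
  -- `t` corresponds to the eigenvalue of the line that corresponds to `h`
  let P {B : CommRingCat.{0}} (h : Spec B ⟶ H.carrier) (t : Spec B ⟶ S.carrier) : Prop :=
    ∃ (i : {U : X.affineOpens // 𝓔.IsTrivializing U}) (α : 𝓔.trivBasis.ring i ⟶ B)
      (hh : h ≫ H.ρ = 𝓔.trivBasis.pt i α) (ht : t ≫ S.p = 𝓔.trivBasis.pt i α),
      (H.line α h hh).HasEigenvalue (S.val α t ht)
  have hP : ∀ {i} {B : CommRingCat.{0}} (α : 𝓔.trivBasis.ring i ⟶ B) (h : Spec B ⟶ H.carrier)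
      (hh : h ≫ H.ρ = 𝓔.trivBasis.pt i α), ∃ (t : Spec B ⟶ S.carrier)
        (ht : t ≫ S.p = 𝓔.trivBasis.pt i α), (H.line α h hh).HasEigenvalue (S.val α t ht) := by
    intro i B α h hh
    obtain ⟨s, hs⟩ := (H.line α h hh).exists_hasEigenvalue
    obtain ⟨t, ht, rfl⟩ := S.exists_val_eq s
    exact ⟨t, ht, hs⟩
  obtain ⟨g, hg⟩ := exists_hom_of_locally (Y := H.carrier) (Z := S.carrier) (fun _ => True)
    (fun _ _ => trivial) (fun _ _ _ _ => trivial) P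
    (fun z => by
      obtain ⟨i, C, α, q, hq, hz, hh⟩ := 𝓔.trivBasis.exists_pt_mem H.ρ z
      obtain ⟨t, ht, e⟩ := hP α q hh
      exact ⟨C, q, t, hq, hz, i, α, hh, ht, e⟩)
    (by
      rintro C D q m f ⟨i, α, hh, ht, e⟩ -
      have h1 : α ≫ f = 𝓔.trivBasis.res le_rfl ≫ α ≫ f := by
        rw [AffineBasis.res_refl, Category.id_comp]
      exact ⟨i, α ≫ f, _, _, hasEigenvalue_map H S e le_rfl f h1⟩)
    (by
      rintro B h t t' - ⟨i, α, hh, ht, e⟩ ⟨j, β, hh', ht', e'⟩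
      -- the eigenvalues are defined over different members of the basis: compare them over a third one
      refine hom_ext_of_locally fun z => ?_
      obtain ⟨k, hi, hj, C, q, γ, hq, hz, h1, h2⟩ :=
        𝓔.trivBasis.exists_refinement (hh.symm.trans hh') z
      refine ⟨C, Spec.map q, hq, hz, S.hom_ext (map_comp_eq_pt ht hi h1)
        (map_comp_eq_pt ht' hj h2) ?_⟩
      exact (hasEigenvalue_map H S e hi q h1).unique (hasEigenvalue_map H S e' hj q h2))
  have hg' : g ≫ S.p = H.ρ := by
    refine hom_ext_of_locally fun z => ?_
    obtain ⟨i, C, α, q, hq, hz, hh⟩ := 𝓔.trivBasis.exists_pt_mem H.ρ z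
    obtain ⟨t, ht, e⟩ := hP α q hh
    refine ⟨C, q, hq, hz, ?_⟩
    rw [← Category.assoc, hg q t trivial ⟨i, α, hh, ht, e⟩, ht, hh]
  refine ⟨g, hg', fun i B α h hh => ?_⟩
  obtain ⟨t, ht, e⟩ := hP α h hh
  have h1 := hg h t trivial ⟨i, α, hh, ht, e⟩
  subst h1
  exact e

variable {H S}

/-- Each point of the spectral cover, regarded as a point with values in a field, is the eigenvalue of
an eigenline. -/
lemma surjective_of_hasEigenvalue {g : H.carrier ⟶ S.carrier} (hg : g ≫ S.p = H.ρ)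
    (h : ∀ (i : {U : X.affineOpens // 𝓔.IsTrivializing U}) {B : CommRingCat.{0}}
      (α : 𝓔.trivBasis.ring i ⟶ B) (h : Spec B ⟶ H.carrier) (hh : h ≫ H.ρ = 𝓔.trivBasis.pt i α),
      (H.line α h hh).HasEigenvalue (S.val α (h ≫ g) (by rw [Category.assoc, hg, hh]))) :
    Surjective g := by
  refine ⟨fun z => ?_⟩
  obtain ⟨i, C, α, q, -, ⟨p, rfl⟩, hq⟩ := 𝓔.trivBasis.exists_pt_mem S.p z
  obtain ⟨K, _, κ, hκ⟩ := exists_fieldPoint p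
  have h1 : α ≫ κ = 𝓔.trivBasis.res le_rfl ≫ α ≫ κ := by
    rw [AffineBasis.res_refl, Category.id_comp]
  obtain ⟨s, hs⟩ := exists_line_hasEigenvalue (S.val (α ≫ κ) _ (map_comp_eq_pt hq le_rfl h1))
  obtain ⟨m, hm, rfl⟩ := H.exists_line_eq s
  have h2 := S.hom_ext (by rw [Category.assoc, hg, hm]) _ ((h i _ m hm).unique hs)
  let x : Spec (.of K) := Classical.arbitrary _
  refine ⟨m x, ?_⟩
  rw [← hκ x]
  exact congrArg (fun f => f x) h2

/-! ### The eigenline over the smooth locus -/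

/-- An open subscheme of the spectral cover is a spectral chart. -/
lemma isSpectralChart_val (σ : Spec B ⟶ S.carrier) [IsOpenImmersion σ]
    (hσ : σ ≫ S.p = 𝓔.trivBasis.pt i α) :
    letI := 𝓔.alg α
    haveI := i.2.1; haveI := i.2.2
    IsSpectralChart (𝓔.φ i.1) (S.val α σ hσ).1 := by
  let := 𝓔.alg α
  have := i.2.1; have := i.2.2
  -- the points of `Spec B`, regarded as points of the spectral cover, correspond to the pullbacks of
  -- the universal eigenvalue
  have key : ∀ {R : CommRingCat.{0}} {γ : 𝓔.trivBasis.ring i ⟶ R} (q : B ⟶ R)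
      (hq : α ≫ q = 𝓔.trivBasis.res le_rfl ≫ γ),
      letI := 𝓔.alg γ
      ∀ f : B →ₐ[Γ(X, i.1.1)] R, f.toRingHom = q.hom →
        f.toLinearMap.rTensor _ (S.val α σ hσ).1 =
          (S.val γ (Spec.map q ≫ σ) (map_comp_eq_pt hσ le_rfl hq)).1 := by
    intro R γ q hq
    let := 𝓔.alg γ
    rintro f hf
    obtain rfl : q = CommRingCat.ofHom f.toRingHom := CommRingCat.hom_ext hf.symm
    rw [S.val_map le_rfl _ hq σ hσ]
    exact rTensor_eq_formMap f (congrArg CommRingCat.Hom.hom hq) _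
  have hom : ∀ {R : CommRingCat.{0}} {γ : 𝓔.trivBasis.ring i ⟶ R},
      letI := 𝓔.alg γ
      ∀ f : B →ₐ[Γ(X, i.1.1)] R, α ≫ CommRingCat.ofHom f.toRingHom = 𝓔.trivBasis.res le_rfl ≫ γ := by
    intro R γ
    let := 𝓔.alg γ
    intro f
    rw [AffineBasis.res_refl, Category.id_comp]
    ext c
    exact f.commutes c
  refine ⟨(S.val α σ hσ).2, fun R _ inst f f' e => ?_, fun R K _ _ inst inst' π hπ hnil ψ θ hθ e => ?_⟩
  · obtain ⟨γ, rfl⟩ := exists_eq_alg (𝓔 := 𝓔) inst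
    let := 𝓔.alg γ
    rw [key (γ := γ) (CommRingCat.ofHom f.toRingHom) (hom (γ := γ) f) f rfl,
      key (γ := γ) (CommRingCat.ofHom f'.toRingHom) (hom (γ := γ) f') f' rfl] at e
    have h1 := S.hom_ext _ _ (Subtype.ext e)
    rw [cancel_mono] at h1
    have h2 := Spec.map_injective h1
    ext x
    exact congrArg (fun t => t x) h2
  · obtain ⟨γ, rfl⟩ := exists_eq_alg (𝓔 := 𝓔) inst
    obtain ⟨κ, rfl⟩ := exists_eq_alg (𝓔 := 𝓔) inst'
    let := 𝓔.alg γ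
    let := 𝓔.alg κ
    obtain ⟨t, ht, e'⟩ := S.exists_val_eq (⟨θ, hθ⟩ : 𝓔.Eig γ)
    have hπγ : γ ≫ CommRingCat.ofHom π.toRingHom = 𝓔.trivBasis.res le_rfl ≫ κ := by
      rw [AffineBasis.res_refl, Category.id_comp]
      ext c
      exact π.commutes c
    -- the point with values in `K` of the thickening lies in the open subscheme
    have h1 : Spec.map (CommRingCat.ofHom π.toRingHom) ≫ t =
        Spec.map (CommRingCat.ofHom ψ.toRingHom) ≫ σ := by
      refine S.hom_ext (map_comp_eq_pt ht le_rfl hπγ)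
        (map_comp_eq_pt hσ le_rfl (hom (γ := κ) ψ)) (Subtype.ext ?_)
      rw [← key (γ := κ) (CommRingCat.ofHom ψ.toRingHom) (hom (γ := κ) ψ) ψ rfl, ← e, S.val_map le_rfl _ hπγ t ht, e']
      exact (rTensor_eq_formMap π (congrArg CommRingCat.Hom.hom hπγ) θ).symm
    -- hence so does the thickening, which has the same underlying space
    have h2 : Set.range t ⊆ Set.range σ := by
      rintro _ ⟨x, rfl⟩
      obtain ⟨y, rfl⟩ : x ∈ Set.range (PrimeSpectrum.comap π.toRingHom) := by
        rw [range_comap_of_surjective _ _ hπ]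
        exact fun c hc => x.2.mem_of_pow_mem 2 (by rw [hnil c hc]; exact zero_mem _)
      exact ⟨Spec.map (CommRingCat.ofHom ψ.toRingHom) y, (congrArg (fun f => f y) h1).symm⟩
    obtain ⟨f, hf⟩ := exists_Spec_lift σ t h2
    have h3 : α ≫ f = γ := 𝓔.trivBasis.pt_injective (by
      rw [← AffineBasis.map_pt, ← hσ, ← Category.assoc, hf, ht])
    let F : B →ₐ[Γ(X, i.1.1)] R := ⟨f.hom, fun c => congrArg (fun t => t.hom c) h3⟩
    refine ⟨F, ?_⟩
    rw [key (γ := γ) f (by rw [h3, AffineBasis.res_refl, Category.id_comp]) F rfl]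
    simp only [hf]
    exact congrArg Subtype.val e'

/-- Over a smooth affine open subscheme of the spectral cover, the kernel of `Ψ` is a line
subbundle. -/
lemma isLine_kerΨ {n : ℕ} [SmoothOfRelativeDimension n (X ↘ SpecC)] (hn : 1 ≤ n)
    (σ : Spec B ⟶ S.carrier) [IsOpenImmersion σ] (hσ : σ ≫ S.p = 𝓔.trivBasis.pt i α)
    (hs : Smooth (σ ≫ S.p ≫ X ↘ SpecC)) :
    letI := 𝓔.alg α
    IsLine (𝓔.kerΨ i.1 B (S.val α σ hσ).1) := by
  let := 𝓔.alg α
  have := i.2.1; have := i.2.2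
  let : Algebra ℂ B := (α.hom.comp (algebraMap ℂ Γ(X, i.1.1))).toAlgebra
  have : IsScalarTower ℂ Γ(X, i.1.1) B := IsScalarTower.of_algebraMap_eq fun _ => rfl
  have h1 : σ ≫ S.p ≫ X ↘ SpecC = Spec.map (CommRingCat.ofHom (algebraMap ℂ B)) := by
    rw [← Category.assoc, hσ, AffineBasis.pt, Category.assoc]
    exact (congrArg (Spec.map α ≫ ·) (chart_over i.1)).trans (Spec.map_comp _ _).symm
  rw [h1, HasRingHomProperty.Spec_iff (P := @Smooth)] at hs
  have : Algebra.Smooth ℂ B := RingHom.smooth_algebraMap.1 hs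
  have := smooth_sections i.1
  exact isLine_ker_subEigen (rankAtStalk_forms i.1) hn (𝓔.φ_wedge i.1) (isSpectralChart_val σ hσ)

end HiggsBundle

namespace HiggsBundle

variable {X : Scheme.{0}} [X.Over SpecC] {r : ℕ} {𝓔 : HiggsBundle X r}
  {n : ℕ} [SmoothOfRelativeDimension n (X ↘ SpecC)] [Smooth (X ↘ SpecC)]
  {H : HiggsGrassmannian 𝓔 1} {S : SpectralCover 𝓔}

section Eigenline

variable {i : {U : X.affineOpens // 𝓔.IsTrivializing U}} {B : CommRingCat.{0}}
  {α : 𝓔.trivBasis.ring i ⟶ B} (hn : 1 ≤ n) (σ : Spec B ⟶ S.carrier) [IsOpenImmersion σ]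
  (hσ : σ ≫ S.p = 𝓔.trivBasis.pt i α) (hs : Smooth (σ ≫ S.p ≫ X ↘ SpecC))

/-- The line of all eigenvectors over an open subscheme of the smooth locus. -/
def eigenline : 𝓔.Line α :=
  letI := 𝓔.alg α
  ⟨𝓔.kerΨ i.1 B (S.val α σ hσ).1, isLine_kerΨ hn σ hσ hs,
    isInvariant_of_eigen fun _ hl => (mem_ker_subEigen_iff _ _ _).1 hl⟩

lemma hasEigenvalue_eigenline : (eigenline hn σ hσ hs).HasEigenvalue (S.val α σ hσ) :=
  fun _ hl => (mem_ker_subEigen_iff _ _ _).1 hl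

include hn hs in
/-- Over a smooth open subscheme, the universal eigenvalue has only one eigenline: the line of all
eigenvectors contains any other. -/
lemma Line.HasEigenvalue.eq {s : 𝓔.Line α} (h : s.HasEigenvalue (S.val α σ hσ)) :
    s = eigenline hn σ hσ hs :=
  Subtype.ext (s.2.1.eq_of_le (eigenline hn σ hσ hs).2.1
    fun l hl => (mem_ker_subEigen_iff _ _ _).2 (h l hl))

end Eigenline

/-- Over a smooth open subscheme `W` of the spectral cover, the lines of all eigenvectors define a
morphism to the Higgs Grassmannian. -/
lemma exists_hom_higgsGrassmannian (hn : 1 ≤ n) (H : HiggsGrassmannian 𝓔 1) {W : S.carrier.Opens}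
    (hW : Smooth (W.ι ≫ S.p ≫ X ↘ SpecC)) :
    ∃ (f : W.toScheme ⟶ H.carrier) (hf : f ≫ H.ρ = W.ι ≫ S.p),
      ∀ (i : {U : X.affineOpens // 𝓔.IsTrivializing U}) {B : CommRingCat.{0}}
        (α : 𝓔.trivBasis.ring i ⟶ B) (q : Spec B ⟶ W.toScheme), IsOpenImmersion q →
        ∀ hq : (q ≫ W.ι) ≫ S.p = 𝓔.trivBasis.pt i α,
        (H.line α (q ≫ f) (by rw [Category.assoc, hf, ← hq, Category.assoc])).HasEigenvalue
          (S.val α (q ≫ W.ι) hq) := by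
  have hs : ∀ {B : CommRingCat.{0}} (q : Spec B ⟶ W.toScheme), IsOpenImmersion q →
      Smooth ((q ≫ W.ι) ≫ S.p ≫ X ↘ SpecC) := by
    intro B q _
    rw [Category.assoc]
    infer_instance
  -- `t` corresponds to an eigenline for the eigenvalue at `q`
  let P {B : CommRingCat.{0}} (q : Spec B ⟶ W.toScheme) (t : Spec B ⟶ H.carrier) : Prop :=
    ∃ (i : {U : X.affineOpens // 𝓔.IsTrivializing U}) (α : 𝓔.trivBasis.ring i ⟶ B)
      (hh : t ≫ H.ρ = 𝓔.trivBasis.pt i α) (ht : (q ≫ W.ι) ≫ S.p = 𝓔.trivBasis.pt i α),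
      (H.line α t hh).HasEigenvalue (S.val α (q ≫ W.ι) ht)
  have hP : ∀ {i} {B : CommRingCat.{0}} (α : 𝓔.trivBasis.ring i ⟶ B) (q : Spec B ⟶ W.toScheme),
      IsOpenImmersion q → ∀ hq : (q ≫ W.ι) ≫ S.p = 𝓔.trivBasis.pt i α, ∃ (t : Spec B ⟶ H.carrier)
        (hh : t ≫ H.ρ = 𝓔.trivBasis.pt i α),
        (H.line α t hh).HasEigenvalue (S.val α (q ≫ W.ι) hq) := by
    intro i B α q _ hq
    obtain ⟨t, ht, e⟩ := H.exists_line_eq (eigenline hn (q ≫ W.ι) hq (hs q inferInstance))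
    exact ⟨t, ht, e ▸ hasEigenvalue_eigenline hn (q ≫ W.ι) hq (hs q inferInstance)⟩
  obtain ⟨f, hf⟩ := exists_hom_of_locally (Y := W.toScheme) (Z := H.carrier)
    (fun q => IsOpenImmersion q) (fun _ hq => hq) (fun q f _ _ => inferInstance) P
    (fun z => by
      obtain ⟨i, C, α, q, hq, hz, hh⟩ := 𝓔.trivBasis.exists_pt_mem (W.ι ≫ S.p) z
      rw [← Category.assoc] at hh
      obtain ⟨t, ht, e⟩ := hP α q hq hh
      exact ⟨C, q, t, hq, hz, i, α, ht, hh, e⟩)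
    (by
      rintro C D q m f ⟨i, α, hh, ht, e⟩ -
      have h1 : α ≫ f = 𝓔.trivBasis.res le_rfl ≫ α ≫ f := by
        rw [AffineBasis.res_refl, Category.id_comp]
      have := hasEigenvalue_map H S e le_rfl f h1
      simp only [← Category.assoc] at this
      exact ⟨i, α ≫ f, _, _, this⟩)
    (by
      rintro B q t t' hq ⟨i, α, hh, ht, e⟩ ⟨j, β, hh', ht', e'⟩
      -- compare the eigenlines over a smaller member of the basis, where they are unique
      refine hom_ext_of_locally fun z => ?_
      obtain ⟨k, hi, hj, C, p, γ, hp, hz, h1, h2⟩ :=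
        𝓔.trivBasis.exists_refinement (ht.symm.trans ht') z
      refine ⟨C, Spec.map p, hp, hz, H.hom_ext (map_comp_eq_pt hh hi h1)
        (map_comp_eq_pt hh' hj h2) ?_⟩
      have h3 : Smooth ((Spec.map p ≫ q ≫ W.ι) ≫ S.p ≫ X ↘ SpecC) := by
        rw [← Category.assoc (Spec.map p)]
        exact hs _ inferInstance
      exact ((hasEigenvalue_map H S e hi p h1).eq hn _ _ h3).trans
        ((hasEigenvalue_map H S e' hj p h2).eq hn _ _ h3).symm)
  have hf' : f ≫ H.ρ = W.ι ≫ S.p := by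
    refine hom_ext_of_locally fun z => ?_
    obtain ⟨i, C, α, q, hq, hz, hh⟩ := 𝓔.trivBasis.exists_pt_mem (W.ι ≫ S.p) z
    rw [← Category.assoc] at hh
    obtain ⟨t, ht, e⟩ := hP α q hq hh
    refine ⟨C, q, hq, hz, ?_⟩
    rw [← Category.assoc, hf q t hq ⟨i, α, ht, hh, e⟩, ht, ← hh, Category.assoc]
  refine ⟨f, hf', fun i B α q hq hh => ?_⟩
  obtain ⟨t, ht, e⟩ := hP α q hq hh
  have h1 := hf q t hq ⟨i, α, ht, hh, e⟩
  subst h1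
  exact e

end HiggsBundle

end Higgs

end

theorem mainTheorem7 {X : Scheme.{0}} [X.Over Higgs.SpecC] {n r : ℕ}
    [SmoothOfRelativeDimension n (X ↘ Higgs.SpecC)] (𝓔 : Higgs.HiggsBundle X r) :
    Nonempty (Higgs.HiggsGrassmannian 𝓔 1) ∧ Nonempty (Higgs.SpectralCover 𝓔) ∧
    ∀ (H : Higgs.HiggsGrassmannian 𝓔 1) (S : Higgs.SpectralCover 𝓔),
      ∃ (g : H.carrier ⟶ S.carrier) (hg : g ≫ S.p = H.ρ),
        Surjective g ∧
        (∀ (U : X.affineOpens) (hU : 𝓔.IsTrivializing U) (B : Type) [CommRing B]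
          [Algebra Γ(X, U.1) B] (h : Spec (.of B) ⟶ H.carrier) (hh : h ≫ H.ρ = Higgs.pt U B),
          ∀ l ∈ H.sub U hU B h hh,
            𝓔.pullbackφ U B l =
              l ⊗ₜ[B] S.eig U hU B (h ≫ g) (by rw [Category.assoc, hg, hh])) ∧
        (1 ≤ n → ∀ W : S.carrier.Opens, Smooth (W.ι ≫ S.p ≫ X ↘ Higgs.SpecC) →
          ∃ (f : W.toScheme ⟶ H.carrier) (hf : f ≫ H.ρ = W.ι ≫ S.p),
            f ≫ g = W.ι ∧
            ∀ (U : X.affineOpens) (hU : 𝓔.IsTrivializing U) (B : Type) [CommRing B]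
              [Algebra Γ(X, U.1) B] (s : Spec (.of B) ⟶ W.toScheme) [IsOpenImmersion s]
              (hs : (s ≫ W.ι) ≫ S.p = Higgs.pt U B),
              Higgs.IsSubbundle 1 (𝓔.kerΨ U B (S.eig U hU B (s ≫ W.ι) hs)) ∧
              H.sub U hU B (s ≫ f) (by rw [Category.assoc, hf, ← hs, Category.assoc]) =
                𝓔.kerΨ U B (S.eig U hU B (s ≫ W.ι) hs)) := by
  have := SmoothOfRelativeDimension.smooth n (X ↘ Higgs.SpecC)
  refine ⟨Higgs.HiggsBundle.nonempty_higgsGrassmannian,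
    Higgs.HiggsBundle.nonempty_spectralCover, fun H S => ?_⟩
  obtain ⟨g, hg, hgH⟩ := Higgs.HiggsBundle.exists_hom_spectralCover H S
  refine ⟨g, hg, Higgs.HiggsBundle.surjective_of_hasEigenvalue hg hgH, ?_, ?_⟩
  · intro U hU B _ inst h hh
    obtain ⟨α, rfl⟩ := Higgs.HiggsBundle.exists_eq_alg (𝓔 := 𝓔) (i := ⟨U, hU⟩) inst
    exact hgH ⟨U, hU⟩ α h hh
  · intro hn W hW
    obtain ⟨f, hf, hfW⟩ := Higgs.HiggsBundle.exists_hom_higgsGrassmannian hn H hW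
    refine ⟨f, hf, ?_, ?_⟩
    · refine Higgs.hom_ext_of_locally fun z => ?_
      obtain ⟨i, C, α, q, hq, hz, hh⟩ := 𝓔.trivBasis.exists_pt_mem (W.ι ≫ S.p) z
      rw [← Category.assoc] at hh
      have hh' : (q ≫ f) ≫ H.ρ = 𝓔.trivBasis.pt i α := by
        rw [Category.assoc, hf, ← hh, Category.assoc]
      refine ⟨C, q, hq, hz, ?_⟩
      rw [← Category.assoc]
      -- both morphisms correspond to the eigenvalue of the line given by `q ≫ f`
      exact S.hom_ext _ hh ((hgH i α (q ≫ f) hh').unique (hfW i α q hq hh))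
    · intro U hU B _ inst s _ hs
      obtain ⟨α, rfl⟩ := Higgs.HiggsBundle.exists_eq_alg (𝓔 := 𝓔) (i := ⟨U, hU⟩) inst
      have hsm : Smooth ((s ≫ W.ι) ≫ S.p ≫ X ↘ Higgs.SpecC) := by
        rw [Category.assoc]
        infer_instance
      have := hU.1
      exact ⟨(Higgs.HiggsBundle.isLine_kerΨ (i := ⟨U, hU⟩) hn (s ≫ W.ι) hs hsm).isSubbundle,
        congrArg Subtype.val ((hfW ⟨U, hU⟩ α s inferInstance hs).eq hn (s ≫ W.ι) hs hsm)⟩
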